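/- Let $\alpha\in\mathbb R$, $\alpha\neq 0$, and let $T=\sum_a t_aT_a$ be a unit vector of $\mathbb R^5$ acting by Clifford multiplication on the five-dimensional spinors $\mathbb C^4$, so $T^2=-\mathbb 1$. **Conventions.** For $B=\mathrm{diag}(B_1,\dots,B_n)$ let $M_B=\mathbb R^{n+2}$ be the Cahen–Wallach space with metric $2dx^+dx^--\sum_iB_i(x^i)^2(dx^-)^2+\sum_i(dx^i)^2$ and null frame $e_+=\partial_+$, $e_-=\partial_-+\frac12\sum_iB_i(x^i)^2\partial_+$, $e_i=\partial_i$. Spinors are complex, $\Gamma_a\Gamma_b+\Gamma_b\Gamma_a=-2g_{ab}$, $\sigma_\pm=-\frac12\Gamma_\mp\Gamma_\pm$, $S_\pm=\sigma_\pm S$ (so $S_-=\ker\Gamma_+$), $\xi_1=\sigma_-\xi$, $\xi_2=\sigma_+\xi$. For endomorphisms $c,d$ commuting with $\Gamma_\pm$ let $D$ be the connection $$D_+=\nabla_+,\quad D_-\xi=\nabla_-\xi+c\,\xi_1+d\,\xi_2,\quad D_i\xi=\nabla_i\xi-\tfrac12\Gamma_+(c\Gamma_i-\Gamma_id)\xi_2,$$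 with $\nabla$ the Levi-Civita connection; a parallel section $\xi$ is determined by $\xi^0=\xi(0)$. Writing $B_i=\lambda_i^2$, the following are Killing fields: $K_{(\pm)}=\partial_\pm$, $K_{(i)}=\cos(\lambda_ix^-)\partial_i+\lambda_i\sin(\lambda_ix^-)x^i\partial_+$, $K_{(i^*)}=-\lambda_i\sin(\lambda_ix^-)\partial_i+\lambda_i^2\cos(\lambda_ix^-)x^i\partial_+$, and $K_{(ij)}=x^j\partial_i-x^i\partial_j$ if $B_i=B_j$. A *geometric superalgebra* consists of a complex Lie algebra $\mathcal K_0$ of complexified Killing fields, spanned by $K_{(\pm)},K_{(i)},K_{(i^*)}$ and specified rotations $K_{(ij)}$, a space $\mathcal K_1$ of $D$-parallel spinors on which $\mathcal K_0$ acts by a representation through the spinorial Lie derivative $\mathcal L_X\xi=\nabla_X\xi-\Gamma(\nabla X)\xi$, and a symmetric bilinear map $\{\cdot,\cdot\}:\mathcal K_1\times\mathcal K_1\to\mathcal K_0$ with $2\{\mathcal L_X\xi,\xi\}=[X,\{\xi,\xi\}]$. It is a *geometric supersymmetry* if moreover $\mathcal L_{\{\xi,\xi\}}\xi=0$ for all $\xi\in\mathcal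 K_1$; it is *non-restricted* if $\mathcal K_1$ consists of all parallel spinors, otherwise *restricted*; it is *$N$-extended* if the spinor bundle is an irreducible Clifford module tensored with $\mathbb C^N$; and $\nu=\dim\mathcal K_1/\operatorname{rank}S$. **Six dimensions.** Take $n=4$, $B=-\alpha^2\mathbb 1_4$, $\lambda_i=-i\alpha$, $S=S_6\otimes\mathbb C^4$ with $S_6=\mathbb C^8$ irreducible, $c=\alpha\Gamma_{12}\otimes T$, $d=0$; rotations $K_{(12)},K_{(34)}$. Let $C=C_6\otimes C_5$ be the tensor product of the charge conjugations, $X^\pm_{1234}=\frac12(1\pm\Gamma_{1234})$, let $\mathcal K_1$ be the parallel spinors with $X^+_{1234}\xi^0_1=X^-_{1234}\xi^0_2=0$, and $$\{\xi,\eta\}=\{\xi,\eta\}^+K_{(+)}+\{\xi,\eta\}^-K_{(-)}+\sum_i\{\xi,\eta\}^iK_{(i)}+\sum_i\{\xi,\eta\}^{i^*}K_{(i^*)}+\{\xi,\eta\}^{12}K_{(12)}+\{\xi,\eta\}^{34}K_{(34)},$$ $\{\xi,\eta\}^+=C(\xi^0_1,\Gamma_-\eta^0_1)$, $\{\xi,\eta\}^-=C(\xi^0_2,\Gamma_+\eta^0_2)$,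 $\{\xi,\eta\}^i=C(\xi^0_1,\Gamma_i\eta^0_2)+C(\eta^0_1,\Gamma_i\xi^0_2)$, $\{\xi,\eta\}^{i^*}=\frac1\alpha\big(C(\xi^0_1,(\Gamma_{12}\Gamma_i\otimes T)\eta^0_2)+C(\eta^0_1,(\Gamma_{12}\Gamma_i\otimes T)\xi^0_2)\big)$, $\{\xi,\eta\}^{12}=\{\xi,\eta\}^{34}=-\alpha\,C(\xi^0_2,(\Gamma_+\otimes T)\eta^0_2)$. **Eleven dimensions.** For real $\alpha,\beta$ take $n=9$, $B=-\mathrm{diag}((\alpha-\beta)^2\mathbb 1_3,(\alpha+\beta)^2\mathbb 1_6)$, $\lambda_j=-i(\alpha-\beta)$ for $j\le3$, $\lambda_j=-i(\alpha+\beta)$ for $j\ge4$, $S=\mathbb C^{32}$ irreducible, $c=\alpha I$, $d=\beta I$, where $I$ is the Clifford element $e_1e_2e_3$ acting compatibly with $\Gamma_\pm$ (as $\Gamma_{123}$ on $S_-$ and as $-\Gamma_{123}$ on $S_+$); rotations $K_{(ij)}$ with $i,j\le3$ or $i,j\ge4$; $\mathcal K_1$ all parallel spinors; $C$ the (skew-symmetric)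 charge conjugation; and let $\{\cdot,\cdot\}$ be the polarization of $$\{\xi,\xi\}=\{\xi,\xi\}^+K_{(+)}+\{\xi,\xi\}^-K_{(-)}+\sum_i\{\xi,\xi\}^iK_{(i)}+\sum_i\{\xi,\xi\}^{i^*}K_{(i^*)}+\tfrac12\sum_{i,j}\{\xi,\xi\}^{ij}K_{(ij)},$$ $\{\xi,\xi\}^+=C(\xi^0_1,\Gamma_-\xi^0_1)$, $\{\xi,\xi\}^-=C(\xi^0_2,\Gamma_+\xi^0_2)$, $\{\xi,\xi\}^i=2C(\xi^0_1,\Gamma_i\xi^0_2)$, $\{\xi,\xi\}^{i^*}=\frac{2i}{\lambda_i}C(\xi^0_1,\Gamma_{123}\Gamma_i\xi^0_2)$, $\{\xi,\xi\}^{ij}=\mp i\lambda_i\,C(\xi^0_2,\Gamma_{123}\Gamma_i\Gamma_j\Gamma_+\xi^0_2)$, with the upper sign for $i,j\le3$ and the lower one for $i,j\ge4$ (and $0$ otherwise). **Claim.** The six-dimensional connection is flat, and the six-dimensional data form a restricted $4$-extended geometric supersymmetry with $\nu=\frac12$. The eleven-dimensional data with $\beta=0$ form a non-restricted geometric superalgebra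 with $N=1$ and $\nu=1$, which is not a geometric supersymmetry. The former is a reduction of the latter along the directions $(1,2,3,4)\mapsto(1,2,4,5)$, that is: $B$ restricts accordingly and $N'=2^{[(9-4)/2]}N$; after erasing from $\mathcal K_0$ the fields $K_{(i)},K_{(i^*)}$, $i\notin\{1,2,4,5\}$, and all rotations involving such an $i$, the remaining fields span a Lie algebra, which maps the span of the erased fields to itself and meets it trivially; and this remaining Lie algebra, together with the subspace of $\mathcal K_1$ given by $X^+_{1245}\xi^0_1=X^-_{1245}\xi^0_2=0$ and with the bracket truncated to the remaining fields, is isomorphic to the six-dimensional superalgebra (compatibly with Lie brackets, spinorial Lie derivatives and odd-odd brackets). -/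

import Mathlib

open scoped Kronecker Matrix ContDiff

noncomputable section

namespace CW

/-! ## Cahen-Wallach spaces in global coordinates `(x⁺, x⁻, x¹, …, xⁿ)` -/

/-- Index set `+, -, 1, …, n`. -/
abbrev Idx (n : ℕ) := Fin 2 ⊕ Fin n

abbrev ip {n : ℕ} : Idx n := Sum.inl 0
abbrev im {n : ℕ} : Idx n := Sum.inl 1
abbrev it {n : ℕ} (i : Fin n) : Idx n := Sum.inr i

/-- The underlying manifold `ℝⁿ⁺²`. -/
abbrev Pt (n : ℕ) := Idx n → ℝ

/-- (Complexified) vector fields, given by their coordinate components. -/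
abbrev VF (n : ℕ) := Pt n → Idx n → ℂ

/-- Sections of the (trivialized) spinor bundle with fibre `ℂ^ι`. -/
abbrev SF (n : ℕ) (ι : Type) := Pt n → ι → ℂ

/-- Partial derivative `∂_a f` at `x`. -/
def pd {n : ℕ} {F : Type} [NormedAddCommGroup F] [NormedSpace ℝ F]
    (a : Idx n) (f : Pt n → F) (x : Pt n) : F :=
  fderiv ℝ f x (Pi.single a 1)

/-- Lie bracket of vector fields. -/
def lieBr {n : ℕ} (X Y : VF n) : VF n := fun x b =>
  ∑ a, (X x a * pd a (fun y => Y y b) x - Y x a * pd a (fun y => X y b) x)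

/-- The metric `2 dx⁺dx⁻ - ∑ B_i (xⁱ)² (dx⁻)² + ∑ (dxⁱ)²`, for `B = diag(B_1, …, B_n)`. -/
def metric {n : ℕ} (B : Fin n → ℝ) (x : Pt n) : Matrix (Idx n) (Idx n) ℝ :=
  Matrix.fromBlocks !![0, 1; 1, -∑ i, B i * x (it i) ^ 2] 0 0 1

/-- Christoffel symbols of the first kind: `Γ_{a,bc} = g(∇_b ∂_c, ∂_a)`. -/
def chris {n : ℕ} (B : Fin n → ℝ) (x : Pt n) (a b c : Idx n) : ℝ :=
  (1 / 2) * (pd b (fun y => metric B y a c) x + pd c (fun y => metric B y a b) x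
    - pd a (fun y => metric B y b c) x)

/-- The Levi-Civita derivative of a vector field: `covLow B X x a b = g(∇_{∂_a} X, ∂_b)`. -/
def covLow {n : ℕ} (B : Fin n → ℝ) (X : VF n) (x : Pt n) (a b : Idx n) : ℂ :=
  ∑ c, ((metric B x b c : ℂ) * pd a (fun y => X y c) x + (chris B x b a c : ℂ) * X x c)

/-- (Complexified, smooth) Killing vector fields. -/
def IsKilling {n : ℕ} (B : Fin n → ℝ) (X : VF n) : Prop :=
  ContDiff ℝ ∞ X ∧ ∀ x a b, covLow B X x a b + covLow B X x b a = 0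

/-- The global frame `e_+ = ∂_+`, `e_- = ∂_- + ½ ∑ B_i (xⁱ)² ∂_+`, `e_i = ∂_i`; in it the metric
is constant, `g(e_+, e_-) = 1`, `g(e_i, e_j) = δ_ij`. -/
def frame {n : ℕ} (B : Fin n → ℝ) (a : Idx n) : VF n := fun x =>
  Pi.single a 1 + if a = im then Pi.single ip (((1 / 2) * ∑ i, B i * x (it i) ^ 2 : ℝ) : ℂ) else 0

/-! ## Clifford modules and spinors -/

/-- The involution `+ ↔ -`, `i ↔ i`; `e_a` is dual to `e_{bar a}` in the null frame. -/
def bar {n : ℕ} : Idx n → Idx n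
  | Sum.inl a => Sum.inl (1 - a)
  | Sum.inr i => Sum.inr i

section Spinors

variable {n : ℕ} {ι : Type} [Fintype ι] [DecidableEq ι]

/-- Clifford relations `Γ_a Γ_b + Γ_b Γ_a = -2 g_ab` in the null frame. -/
def IsClifford (Γ : Idx n → Matrix ι ι ℂ) : Prop :=
  ∀ a b, Γ a * Γ b + Γ b * Γ a = if b = bar a then (-2 : ℂ) • (1 : Matrix ι ι ℂ) else 0

/-- The Clifford module is `S ⊗ ℂ^N` with `S` an irreducible complex Clifford module; a complex
module over the Clifford algebra in `n + 2` dimensions is irreducible exactly if its dimension is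
`2 ^ ⌊(n + 2) / 2⌋`. -/
def IsExtended (N : ℕ) (Γ : Idx n → Matrix ι ι ℂ) : Prop :=
  ∃ (γ : Idx n → Matrix (Fin (2 ^ ((n + 2) / 2))) (Fin (2 ^ ((n + 2) / 2))) ℂ)
    (e : Fin (2 ^ ((n + 2) / 2)) × Fin N ≃ ι),
    IsClifford γ ∧
      ∀ a, Γ a = (γ a ⊗ₖ (1 : Matrix (Fin N) (Fin N) ℂ)).submatrix e.symm e.symm

/-- Projection `σ_+ = -½ Γ_- Γ_+`. -/
def sigP (Γ : Idx n → Matrix ι ι ℂ) : Matrix ι ι ℂ := (-(1 / 2) : ℂ) • (Γ im * Γ ip)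

/-- Projection `σ_- = -½ Γ_+ Γ_-` onto the kernel of `Γ_+`. -/
def sigM (Γ : Idx n → Matrix ι ι ℂ) : Matrix ι ι ℂ := (-(1 / 2) : ℂ) • (Γ ip * Γ im)

/-- The action on spinors of the skew endomorphism `A` with `g(A e_a, e_b) = A a b`; it satisfies
`[spinRep A, Γ(v)] = Γ(A v)`. -/
def spinRep (Γ : Idx n → Matrix ι ι ℂ) (A : Idx n → Idx n → ℂ) : Matrix ι ι ℂ :=
  (-(1 / 4) : ℂ) • ∑ a, ∑ b, A a b • (Γ (bar b) * Γ (bar a))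

/-- Levi-Civita connection on spinors, `∇_{∂_a} ξ`. -/
def nabla (B : Fin n → ℝ) (Γ : Idx n → Matrix ι ι ℂ) (a : Idx n) (ξ : SF n ι) : SF n ι := fun x =>
  pd a ξ x + spinRep Γ (fun b c => ∑ d, frame B c x d * covLow B (frame B b) x a d) *ᵥ ξ x

/-- Spinorial Lie derivative `L_X ξ = ∇_X ξ - Γ(∇X) ξ`. -/
def lieDer (B : Fin n → ℝ) (Γ : Idx n → Matrix ι ι ℂ) (X : VF n) (ξ : SF n ι) : SF n ι := fun x =>
  ∑ a, X x a • nabla B Γ a ξ x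
    - spinRep Γ (fun b c => ∑ a, ∑ d, frame B b x a * frame B c x d * covLow B X x a d) *ᵥ ξ x

/-- The connection `D` attached to endomorphisms `c`, `d` that commute with `Γ_+` and `Γ_-`:
with `ξ₁ = σ_- ξ`, `ξ₂ = σ_+ ξ`,
`D_+ = ∇_+`, `D_- ξ = ∇_- ξ + c ξ₁ + d ξ₂`, `D_i ξ = ∇_i ξ - ½ Γ_+ (c Γ_i - Γ_i d) ξ₂`. -/
def conn (B : Fin n → ℝ) (Γ : Idx n → Matrix ι ι ℂ) (c d : Matrix ι ι ℂ) :
    Idx n → SF n ι → SF n ι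
  | Sum.inl 0, ξ => nabla B Γ ip ξ
  | Sum.inl 1, ξ => fun x => nabla B Γ im ξ x + (c * sigM Γ + d * sigP Γ) *ᵥ ξ x
  | Sum.inr i, ξ => fun x => nabla B Γ (it i) ξ x
      - (1 / 2 : ℂ) • ((Γ ip * (c * Γ (it i) - Γ (it i) * d) * sigP Γ) *ᵥ ξ x)

/-- Flatness: the curvature of `D` vanishes. -/
def IsFlat (B : Fin n → ℝ) (Γ : Idx n → Matrix ι ι ℂ) (c d : Matrix ι ι ℂ) : Prop :=
  ∀ ξ : SF n ι, ContDiff ℝ ∞ ξ → ∀ a b,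
    conn B Γ c d a (conn B Γ c d b ξ) = conn B Γ c d b (conn B Γ c d a ξ)

end Spinors

/-! ## Killing vector fields -/

/-- Labels of the Killing fields `K_(+)`, `K_(-)`, `K_(i)`, `K_(i*)`, `K_(ij)`. -/
inductive Gen (n : ℕ) : Type
  | plus : Gen n
  | minus : Gen n
  | tr (i : Fin n) : Gen n
  | star (i : Fin n) : Gen n
  | rot (i j : Fin n) : Gen n

/-- The Killing fields, where `B_i = λ_i²`. -/
def gen {n : ℕ} (lam : Fin n → ℂ) : Gen n → VF n
  | Gen.plus => fun _ => Pi.single ip 1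
  | Gen.minus => fun _ => Pi.single im 1
  | Gen.tr i => fun x =>
      Pi.single (it i) (Complex.cos (lam i * x im))
        + Pi.single ip (lam i * Complex.sin (lam i * x im) * x (it i))
  | Gen.star i => fun x =>
      Pi.single (it i) (-(lam i * Complex.sin (lam i * x im)))
        + Pi.single ip (lam i ^ 2 * Complex.cos (lam i * x im) * x (it i))
  | Gen.rot i j => fun x =>
      Pi.single (it i) (x (it j) : ℂ) - Pi.single (it j) (x (it i) : ℂ)

/-- All transvection generators are admitted, and the rotations `K_(ij)` with `r i j`. -/
def Gen.Admits {n : ℕ} (r : Fin n → Fin n → Prop) : Gen n → Prop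
  | Gen.rot i j => r i j
  | _ => True

/-- The label only involves directions in `s`. -/
def Gen.Within {n : ℕ} (s : Set (Fin n)) : Gen n → Prop
  | Gen.plus => True
  | Gen.minus => True
  | Gen.tr i => i ∈ s
  | Gen.star i => i ∈ s
  | Gen.rot i j => i ∈ s ∧ j ∈ s

/-! ## Geometric superalgebras -/

/-- The data that enter a geometric superalgebra of a CW-space: the space (`B`, with square roots
`lam`), the spinor bundle (`Γ`, with extension number `N`), the connection (`c`, `d`), the
rotations `K_(ij)` in the even part, the odd part `K1` and the odd-odd bracket `br`. -/
structure SuperData (n : ℕ) (ι : Type) [Fintype ι] [DecidableEq ι] where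
  N : ℕ
  B : Fin n → ℝ
  lam : Fin n → ℂ
  Γ : Idx n → Matrix ι ι ℂ
  c : Matrix ι ι ℂ
  d : Matrix ι ι ℂ
  rot : Fin n → Fin n → Prop
  K1 : Submodule ℂ (SF n ι)
  br : SF n ι → SF n ι → VF n

namespace SuperData

variable {n : ℕ} {ι : Type} [Fintype ι] [DecidableEq ι]

/-- The even part, spanned by `K_(±)`, `K_(i)`, `K_(i*)` and the chosen rotations. -/
def K0 (D : SuperData n ι) : Submodule ℂ (VF n) :=
  Submodule.span ℂ (gen D.lam '' {g | g.Admits D.rot})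

/-- Spinorial Lie derivative. -/
abbrev L (D : SuperData n ι) (X : VF n) (ξ : SF n ι) : SF n ι := lieDer D.B D.Γ X ξ

/-- A geometric superalgebra on the CW-space. -/
structure IsGeometric (D : SuperData n ι) : Prop where
  lam_sq : ∀ i, D.lam i ^ 2 = (D.B i : ℂ)
  clifford : IsClifford D.Γ
  extended : IsExtended D.N D.Γ
  c_comm : Commute D.c (D.Γ ip) ∧ Commute D.c (D.Γ im)
  d_comm : Commute D.d (D.Γ ip) ∧ Commute D.d (D.Γ im)
  killing : ∀ X ∈ D.K0, IsKilling D.B X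
  lie_mem : ∀ X ∈ D.K0, ∀ Y ∈ D.K0, lieBr X Y ∈ D.K0
  smooth : ∀ ξ ∈ D.K1, ContDiff ℝ ∞ ξ
  parallel : ∀ ξ ∈ D.K1, ∀ a, conn D.B D.Γ D.c D.d a ξ = 0
  L_mem : ∀ X ∈ D.K0, ∀ ξ ∈ D.K1, D.L X ξ ∈ D.K1
  L_add_left : ∀ X ∈ D.K0, ∀ Y ∈ D.K0, ∀ ξ ∈ D.K1, D.L (X + Y) ξ = D.L X ξ + D.L Y ξ
  L_smul_left : ∀ (k : ℂ), ∀ X ∈ D.K0, ∀ ξ ∈ D.K1, D.L (k • X) ξ = k • D.L X ξ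
  L_add_right : ∀ X ∈ D.K0, ∀ ξ ∈ D.K1, ∀ η ∈ D.K1, D.L X (ξ + η) = D.L X ξ + D.L X η
  L_smul_right : ∀ (k : ℂ), ∀ X ∈ D.K0, ∀ ξ ∈ D.K1, D.L X (k • ξ) = k • D.L X ξ
  L_lie : ∀ X ∈ D.K0, ∀ Y ∈ D.K0, ∀ ξ ∈ D.K1,
    D.L X (D.L Y ξ) - D.L Y (D.L X ξ) = D.L (lieBr X Y) ξ
  br_mem : ∀ ξ ∈ D.K1, ∀ η ∈ D.K1, D.br ξ η ∈ D.K0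
  br_symm : ∀ ξ ∈ D.K1, ∀ η ∈ D.K1, D.br ξ η = D.br η ξ
  br_add : ∀ ξ ∈ D.K1, ∀ η ∈ D.K1, ∀ ζ ∈ D.K1, D.br (ξ + η) ζ = D.br ξ ζ + D.br η ζ
  br_smul : ∀ (k : ℂ), ∀ ξ ∈ D.K1, ∀ η ∈ D.K1, D.br (k • ξ) η = k • D.br ξ η
  br_equivariant : ∀ X ∈ D.K0, ∀ ξ ∈ D.K1, (2 : ℂ) • D.br (D.L X ξ) ξ = lieBr X (D.br ξ ξ)

/-- The superalgebra is a supersymmetry algebra (a super Lie algebra). -/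
def IsSupersymmetry (D : SuperData n ι) : Prop :=
  D.IsGeometric ∧ ∀ ξ ∈ D.K1, D.L (D.br ξ ξ) ξ = 0

/-- `K1` contains all parallel spinors. -/
def NonRestricted (D : SuperData n ι) : Prop :=
  ∀ ξ : SF n ι, ContDiff ℝ ∞ ξ → (∀ a, conn D.B D.Γ D.c D.d a ξ = 0) → ξ ∈ D.K1

/-- The quotient `dim K1 / dim S`, with `S` the full spinor space. -/
def nu (D : SuperData n ι) : ℚ := (Module.finrank ℂ D.K1 : ℚ) / (Fintype.card ι : ℚ)

/-- The part of `K0` that only involves the directions in `s`. -/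
def remaining (D : SuperData n ι) (s : Set (Fin n)) : Submodule ℂ (VF n) :=
  Submodule.span ℂ (gen D.lam '' {g | g.Admits D.rot ∧ g.Within s})

/-- The span of the generators that are erased if only the directions in `s` are kept. -/
def erased (D : SuperData n ι) (s : Set (Fin n)) : Submodule ℂ (VF n) :=
  Submodule.span ℂ (gen D.lam '' {g | g.Admits D.rot ∧ ¬ g.Within s})

/-- `D'` is a reduction of `D`: keep the directions in the range of `e` (erasing `n - n'` of the
`K_(i)`, the corresponding `K_(i*)`, and the rotations that involve an erased direction), restrict
the odd part to `R1`, and drop the erased components from the odd-odd bracket (compatibly with the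
action of what remains). The result is isomorphic to `D'`. -/
structure IsReduction {n' : ℕ} {ι' : Type} [Fintype ι'] [DecidableEq ι']
    (D' : SuperData n' ι') (D : SuperData n ι) (e : Fin n' ↪ Fin n)
    (R1 : Submodule ℂ (SF n ι)) : Prop where
  geometric' : D'.IsGeometric
  geometric : D.IsGeometric
  lt : n' < n
  N_eq : D'.N = 2 ^ ((n - n') / 2) * D.N
  B_eq : ∀ i, D'.B i = D.B (e i)
  lie_mem : ∀ X ∈ D.remaining (Set.range e), ∀ Y ∈ D.remaining (Set.range e),
    lieBr X Y ∈ D.remaining (Set.range e)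
  erased_stable : ∀ X ∈ D.remaining (Set.range e), ∀ Y ∈ D.erased (Set.range e),
    lieBr X Y ∈ D.erased (Set.range e)
  disjoint : Disjoint (D.remaining (Set.range e)) (D.erased (Set.range e))
  R1_le : R1 ≤ D.K1
  L_mem : ∀ X ∈ D.remaining (Set.range e), ∀ ξ ∈ R1, D.L X ξ ∈ R1
  iso : ∃ (φ₀ : D'.K0 ≃ₗ[ℂ] D.remaining (Set.range e)) (φ₁ : D'.K1 ≃ₗ[ℂ] R1),
    (∀ X Y Z : D'.K0, (Z : VF n') = lieBr (X : VF n') (Y : VF n') →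
      (φ₀ Z : VF n) = lieBr (φ₀ X : VF n) (φ₀ Y : VF n)) ∧
    (∀ (X : D'.K0) (ξ ζ : D'.K1), (ζ : SF n' ι') = D'.L (X : VF n') (ξ : SF n' ι') →
      (φ₁ ζ : SF n ι) = D.L (φ₀ X : VF n) (φ₁ ξ : SF n ι)) ∧
    (∀ (ξ η : D'.K1) (Z : D'.K0), (Z : VF n') = D'.br (ξ : SF n' ι') (η : SF n' ι') →
      D.br (φ₁ ξ : SF n ι) (φ₁ η : SF n ι) - (φ₀ Z : VF n) ∈ D.erased (Set.range e))

end SuperData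

/-! ## Parallel sections as a vector space -/

section Parallel

variable {n : ℕ} {ι : Type} [Fintype ι]

theorem pd_add {a : Idx n} {ξ η : SF n ι} (hξ : ContDiff ℝ ∞ ξ) (hη : ContDiff ℝ ∞ η) (x : Pt n) :
    pd a (ξ + η) x = pd a ξ x + pd a η x := by
  unfold pd
  rw [fderiv_add (hξ.differentiable (by simp) x) (hη.differentiable (by simp) x)]
  rfl

theorem pd_smul {a : Idx n} {ξ : SF n ι} (hξ : ContDiff ℝ ∞ ξ) (k : ℂ) (x : Pt n) :
    pd a (k • ξ) x = k • pd a ξ x := by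
  unfold pd
  rw [fderiv_const_smul (hξ.differentiable (by simp) x)]
  rfl

theorem conn_add (B : Fin n → ℝ) (Γ : Idx n → Matrix ι ι ℂ) (c d : Matrix ι ι ℂ) (a : Idx n)
    {ξ η : SF n ι} (hξ : ContDiff ℝ ∞ ξ) (hη : ContDiff ℝ ∞ η) :
    conn B Γ c d a (ξ + η) = conn B Γ c d a ξ + conn B Γ c d a η := by
  funext x
  rcases a with a | i
  · fin_cases a <;>
      simp only [conn, nabla, pd_add hξ hη, Pi.add_apply, Matrix.mulVec_add] <;> abel
  · simp only [conn, nabla, pd_add hξ hη, Pi.add_apply, Matrix.mulVec_add, smul_add]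
    abel

theorem conn_smul (B : Fin n → ℝ) (Γ : Idx n → Matrix ι ι ℂ) (c d : Matrix ι ι ℂ) (a : Idx n)
    {ξ : SF n ι} (hξ : ContDiff ℝ ∞ ξ) (k : ℂ) :
    conn B Γ c d a (k • ξ) = k • conn B Γ c d a ξ := by
  funext x
  rcases a with a | i
  · fin_cases a <;>
      simp only [conn, nabla, pd_smul hξ, Pi.smul_apply, Matrix.mulVec_smul, smul_add]
  · simp only [conn, nabla, pd_smul hξ, Pi.smul_apply, Matrix.mulVec_smul, smul_add, smul_sub]
    rw [smul_comm (1 / 2 : ℂ) k]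

/-- The space of parallel (smooth) sections of the spinor bundle. -/
def parallel (B : Fin n → ℝ) (Γ : Idx n → Matrix ι ι ℂ) (c d : Matrix ι ι ℂ) :
    Submodule ℂ (SF n ι) where
  carrier := {ξ | ContDiff ℝ ∞ ξ ∧ ∀ a, conn B Γ c d a ξ = 0}
  zero_mem' := by
    have h0 : ContDiff ℝ ∞ (0 : SF n ι) := contDiff_const
    refine ⟨h0, fun a => ?_⟩
    have := conn_smul B Γ c d a h0 0
    simpa using this
  add_mem' := by
    rintro ξ η ⟨hξ, h1⟩ ⟨hη, h2⟩
    exact ⟨hξ.add hη, fun a => by rw [conn_add B Γ c d a hξ hη, h1 a, h2 a, add_zero]⟩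
  smul_mem' := by
    rintro k ξ ⟨hξ, h1⟩
    exact ⟨hξ.const_smul k, fun a => by rw [conn_smul B Γ c d a hξ k, h1 a, smul_zero]⟩

/-- Parallel sections whose constant spinor `ξ⁰ = ξ(0)` satisfies `P₁ ξ⁰ = 0` and `P₂ ξ⁰ = 0`. -/
def restricted (B : Fin n → ℝ) (Γ : Idx n → Matrix ι ι ℂ) (c d P₁ P₂ : Matrix ι ι ℂ) :
    Submodule ℂ (SF n ι) :=
  parallel B Γ c d ⊓ LinearMap.ker (P₁.mulVecLin ∘ₗ LinearMap.proj (0 : Pt n))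
    ⊓ LinearMap.ker (P₂.mulVecLin ∘ₗ LinearMap.proj (0 : Pt n))

end Parallel

/-! ## Explicit irreducible Clifford modules and charge conjugations -/

/-- Index set of a basis of `ℂ⁴`, the spinors of `ℝ⁵`. -/
abbrev I5 := Fin 2 × Fin 2
/-- Index set of a basis of `S₆ = ℂ⁸`; the first factor distinguishes `S_-` and `S_+`. -/
abbrev I6 := Fin 2 × I5
/-- Index set of a basis of `S₆ ⊗ ℂ⁴`. -/
abbrev I32 := I6 × I5

def pauliX : Matrix (Fin 2) (Fin 2) ℂ := !![0, 1; 1, 0]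
def pauliY : Matrix (Fin 2) (Fin 2) ℂ := !![0, -Complex.I; Complex.I, 0]
def pauliZ : Matrix (Fin 2) (Fin 2) ℂ := !![1, 0; 0, -1]

/-- The spin representation of `ℝ⁵`: anticommuting matrices with square `-1`. -/
def T5 : Fin 5 → Matrix I5 I5 ℂ :=
  ![Complex.I • (pauliX ⊗ₖ 1), Complex.I • (pauliY ⊗ₖ 1), Complex.I • (pauliZ ⊗ₖ pauliX),
    Complex.I • (pauliZ ⊗ₖ pauliY), Complex.I • (pauliZ ⊗ₖ pauliZ)]

/-- Clifford action of a vector of `ℝ⁵` on `ℂ⁴`. -/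
def vec5 (t : EuclideanSpace ℝ (Fin 5)) : Matrix I5 I5 ℂ := ∑ a, (t a : ℂ) • T5 a

/-- The first four of the five matrices, as gamma matrices of `V = ℝ⁴`. -/
def T4 (i : Fin 4) : Matrix I5 I5 ℂ := T5 i.castSucc

/-- The irreducible Clifford module `S₆ = ℂ⁸` in signature `(1,5)`. -/
def gam6 : Idx 4 → Matrix I6 I6 ℂ
  | Sum.inl 0 => !![0, 2; 0, 0] ⊗ₖ 1
  | Sum.inl 1 => !![0, 0; -1, 0] ⊗ₖ 1
  | Sum.inr i => pauliZ ⊗ₖ T4 i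

/-- The six-dimensional chirality operator `½[Γ_+, Γ_-] Γ_1234`. -/
def chir6 : Matrix I6 I6 ℂ :=
  (1 / 2 : ℂ) • (gam6 ip * gam6 im - gam6 im * gam6 ip)
    * (gam6 (it 0) * gam6 (it 1) * gam6 (it 2) * gam6 (it 3))

/-- `Γ_a ⊗ 1` on `S₆ ⊗ ℂ⁴`. -/
def Gam6 (a : Idx 4) : Matrix I32 I32 ℂ := gam6 a ⊗ₖ 1

/-- The irreducible Clifford module `S₆ ⊗ ℂ⁴ = ℂ³²` in signature `(1,10)`. -/
def Gam11 : Idx 9 → Matrix I32 I32 ℂ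
  | Sum.inl a => Gam6 (Sum.inl a)
  | Sum.inr i => ![Gam6 (it 0), Gam6 (it 1), chir6 ⊗ₖ T5 0, Gam6 (it 2), Gam6 (it 3),
      chir6 ⊗ₖ T5 1, chir6 ⊗ₖ T5 2, chir6 ⊗ₖ T5 3, chir6 ⊗ₖ T5 4] i

/-- The charge conjugation `C₅` (skew-symmetric, and the `T5 a` are self-adjoint for it). -/
def C5 : Matrix I5 I5 ℂ := pauliX ⊗ₖ !![0, 1; -1, 0]

/-- The charge conjugation `C₆` (symmetric, and the `gam6 a` are skew-adjoint for it). -/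
def C6 : Matrix I6 I6 ℂ := !![0, 1; -1, 0] ⊗ₖ C5

/-- The bilinear form `C = C₆ ⊗ C₅`, which is also the charge conjugation in dimension eleven. -/
def C (u v : I32 → ℂ) : ℂ := u ⬝ᵥ ((C6 ⊗ₖ C5) *ᵥ v)

/-! ## The six-dimensional superalgebra -/

/-- The projections `X^±_{1234} = ½ (1 ± Γ_1234)` for `s = ±1`. -/
def X1234 (s : ℂ) : Matrix I32 I32 ℂ :=
  (1 / 2 : ℂ) • (1 + s • (Gam6 (it 0) * Gam6 (it 1) * Gam6 (it 2) * Gam6 (it 3)))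

/-- The odd-odd bracket in terms of the constant spinors `ξ⁰ = ξ(0)`, `η⁰ = η(0)`; in the
coefficients of `K_(i*)` and `K_(ij)` the matrix `Tm` acts on the second factor. -/
def br6 (α : ℝ) (Tm : Matrix I5 I5 ℂ) (ξ η : SF 4 I32) : VF 4 :=
  let K := gen (fun _ : Fin 4 => -Complex.I * (α : ℂ))
  let ξ₁ := sigM Gam6 *ᵥ ξ 0
  let ξ₂ := sigP Gam6 *ᵥ ξ 0
  let η₁ := sigM Gam6 *ᵥ η 0
  let η₂ := sigP Gam6 *ᵥ η 0
  let G (i : Fin 4) : Matrix I32 I32 ℂ := (gam6 (it 0) * gam6 (it 1) * gam6 (it i)) ⊗ₖ Tm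
  C ξ₁ (Gam6 im *ᵥ η₁) • K Gen.plus
    + C ξ₂ (Gam6 ip *ᵥ η₂) • K Gen.minus
    + ∑ i, (C ξ₁ (Gam6 (it i) *ᵥ η₂) + C η₁ (Gam6 (it i) *ᵥ ξ₂)) • K (Gen.tr i)
    + ∑ i, ((1 / (α : ℂ)) * (C ξ₁ (G i *ᵥ η₂) + C η₁ (G i *ᵥ ξ₂))) • K (Gen.star i)
    + (-(α : ℂ) * C ξ₂ ((gam6 ip ⊗ₖ Tm) *ᵥ η₂)) • (K (Gen.rot 0 1) + K (Gen.rot 2 3))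

/-- The six-dimensional data: `B = -α² 1₄`, `c = α Γ_12 ⊗ T`, `d = 0`, odd part restricted by
`X⁺_{1234} ξ₁⁰ = X⁻_{1234} ξ₂⁰ = 0`. -/
def six (α : ℝ) (t : EuclideanSpace ℝ (Fin 5)) : SuperData 4 I32 where
  N := 4
  B := fun _ => -α ^ 2
  lam := fun _ => -Complex.I * (α : ℂ)
  Γ := Gam6
  c := (α : ℂ) • ((gam6 (it 0) * gam6 (it 1)) ⊗ₖ vec5 t)
  d := 0
  rot := fun i j => ((i : ℕ) < 2 ↔ (j : ℕ) < 2)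
  K1 := restricted (fun _ => -α ^ 2) Gam6 ((α : ℂ) • ((gam6 (it 0) * gam6 (it 1)) ⊗ₖ vec5 t)) 0
    (X1234 1 * sigM Gam6) (X1234 (-1) * sigP Gam6)
  br := br6 α (vec5 t)

/-! ## The eleven-dimensional superalgebras -/

/-- `Γ_123` in dimension eleven. -/
def Gam123 : Matrix I32 I32 ℂ := Gam11 (it 0) * Gam11 (it 1) * Gam11 (it 2)

/-- The action of the element `e₁e₂e₃` of the Clifford algebra of `V`, commuting with `Γ_±`: it is
`Γ_123` on `S_-` and `-Γ_123` on `S_+`. -/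
def cl123 : Matrix I32 I32 ℂ := Gam123 * (sigM Gam11 - sigP Gam11)

/-- `λ_j = -i (α - β)` for `j ≤ 3`, `λ_j = -i (α + β)` for `j ≥ 4`. -/
def lam11 (α β : ℝ) (i : Fin 9) : ℂ :=
  if (i : ℕ) < 3 then -Complex.I * ((α : ℂ) - β) else -Complex.I * ((α : ℂ) + β)

/-- `B = -diag((α - β)² 1₃, (α + β)² 1₆)`. -/
def B11 (α β : ℝ) (i : Fin 9) : ℝ :=
  if (i : ℕ) < 3 then -(α - β) ^ 2 else -(α + β) ^ 2

/-- The odd-odd bracket in dimension eleven. -/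
def br11 (α β : ℝ) (ξ η : SF 9 I32) : VF 9 :=
  let K := gen (lam11 α β)
  let ξ₁ := sigM Gam11 *ᵥ ξ 0
  let ξ₂ := sigP Gam11 *ᵥ ξ 0
  let η₁ := sigM Gam11 *ᵥ η 0
  let η₂ := sigP Gam11 *ᵥ η 0
  C ξ₁ (Gam11 im *ᵥ η₁) • K Gen.plus
    + C ξ₂ (Gam11 ip *ᵥ η₂) • K Gen.minus
    + ∑ i, (C ξ₁ (Gam11 (it i) *ᵥ η₂) + C η₁ (Gam11 (it i) *ᵥ ξ₂)) • K (Gen.tr i)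
    + ∑ i, ((Complex.I / lam11 α β i)
        * (C ξ₁ ((Gam123 * Gam11 (it i)) *ᵥ η₂) + C η₁ ((Gam123 * Gam11 (it i)) *ᵥ ξ₂)))
          • K (Gen.star i)
    + (1 / 2 : ℂ) • ∑ i : Fin 9, ∑ j : Fin 9,
        (if (i : ℕ) < 3 ∧ (j : ℕ) < 3 then
          -Complex.I * lam11 α β i
            * C ξ₂ ((Gam123 * (Gam11 (it i) * Gam11 (it j)) * Gam11 ip) *ᵥ η₂)
        else if 3 ≤ (i : ℕ) ∧ 3 ≤ (j : ℕ) then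
          Complex.I * lam11 α β i
            * C ξ₂ ((Gam123 * (Gam11 (it i) * Gam11 (it j)) * Gam11 ip) *ᵥ η₂)
        else 0) • K (Gen.rot i j)

/-- The non-restricted eleven-dimensional family: `c = α Γ_123`, `d = β Γ_123`; the rotations are
those of `{1,2,3}` and of `{4,…,9}`. -/
def eleven (α β : ℝ) : SuperData 9 I32 where
  N := 1
  B := B11 α β
  lam := lam11 α β
  Γ := Gam11
  c := (α : ℂ) • cl123
  d := (β : ℂ) • cl123
  rot := fun i j => ((i : ℕ) < 3 ↔ (j : ℕ) < 3)
  K1 := parallel (B11 α β) Gam11 ((α : ℂ) • cl123) ((β : ℂ) • cl123)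
  br := br11 α β

/-- The embedding of directions `(1,2,3,4) → (1,2,4,5)`. -/
def emb : Fin 4 ↪ Fin 9 := ⟨![0, 1, 3, 4], by decide⟩

/-- The projections `X^±_{1245} = ½ (1 ± Γ_1245)` for `s = ±1`. -/
def X1245 (s : ℂ) : Matrix I32 I32 ℂ :=
  (1 / 2 : ℂ) • (1 + s • (Gam11 (it 0) * Gam11 (it 1) * Gam11 (it 3) * Gam11 (it 4)))

/-- The restriction of the odd part in dimension eleven, for `β = 0`, by
`X⁺_{1245} ξ₁⁰ = X⁻_{1245} ξ₂⁰ = 0`. -/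
def restr11 (α : ℝ) : Submodule ℂ (SF 9 I32) :=
  restricted (B11 α 0) Gam11 ((α : ℂ) • cl123) (((0 : ℝ) : ℂ) • cl123)
    (X1245 1 * sigM Gam11) (X1245 (-1) * sigP Gam11)

end CW

end

set_option linter.unusedSectionVars false

noncomputable section

namespace CW

/-! ## Partial derivatives -/

section PartialDerivatives

variable {n : ℕ}

/-! Both superalgebras have the same shape. For β = 0 the two frequencies of the eleven-dimensional
space coincide, so in both dimensions `B = -α²`, `d = 0` and `c² = α²`. Relative to `S = S_+ ⊕ S_-`,
parallel transport from the origin is then explicit: `σ_+ + exp(-x⁻c) σ_- + ∑ xⁱ ½ Γ_+ c Γ_i`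
(`trans`). Conjugation by it turns `D_a` into the partial derivative `∂_a` (`conn_eq`): the
curvature vanishes by the symmetry of second derivatives, and a parallel section is determined by
its value at the origin, which is arbitrary.

On these values every Killing generator acts by a constant matrix (`spinAct`, `lieDer_gen_par`), and
the matrices have the same commutators as the vector fields (`hasSymbol_lieBr`). Each coefficient of
the odd-odd bracket of `v` and `w` is `C(v, A w)` for a fixed operator `A`, so the bracket is the
field attached to the linear functional `A ↦ C(v, A w)` (`field`). Moving the action from `v` to `w`
by adjoints reduces equivariance to identities between operators (`field_minus`, `field_tr`,
`field_star`, `field_rot`). These use only the Clifford relations, `c² = α²` and `Γ_i c = ± c Γ_i`,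
with signs that are constant on each of the two blocks of directions. Symmetry of the bracket holds
because `C` is skew and the operators that matter are skew-adjoint. `IsHyperbolic` collects the
hypotheses, and `IsHyperbolic.isGeometric` yields both geometric superalgebras.

In dimension six the two conditions on `ξ⁰` say that it is fixed by the chirality operator
(`restriction_iff`). The action involves even products of gamma matrices, so it preserves chirality;
half of the 32 components survive, which gives `ν = 1/2`. For `L_{ξ,ξ} ξ = 0`, the part in `S_+`
vanishes because `Γ_12 + Γ_34` annihilates chiral spinors there, and the part in `S_-` is a Fierz
identity, cubic in the spinor, checked in coordinates (`selfAct_minus`). In dimension eleven a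
spinor in `S_+` with two nonzero entries violates the identity: only rotations act on it, and in a
suitable entry only `K_(69)` contributes.

For the reduction, fields on the six-dimensional space are lifted to fields constant in the other
directions, and fields in eleven dimensions are restricted to the subspace. The remaining fields are
the lifts, and the erased ones are the kernel of the restriction in `K0`. On odd parts, `Γ_123` acts
as `Γ_45 ⊗ T_0`, while the six-dimensional connection has `Γ_12 ⊗ T`. Chirality trades the two pairs
of directions up to a sign on `S_+`, and a reflection-like involution of `ℂ⁴` carries `T` to `T_0`
(`exists_twist`, `IsTwist`). It commutes with the six-dimensional gamma matrices and preserves `C`,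
so it intertwines actions and truncated brackets. -/

theorem pd_const {F : Type} [NormedAddCommGroup F] [NormedSpace ℝ F] (a : Idx n) (k : F)
    (x : Pt n) : pd a (fun _ => k) x = 0 := by
  simp [pd]

theorem pd_of_hasFDerivAt {F : Type} [NormedAddCommGroup F] [NormedSpace ℝ F] {a : Idx n}
    {f : Pt n → F} {f' : Pt n →L[ℝ] F} {x : Pt n} (h : HasFDerivAt f f' x) :
    pd a f x = f' (Pi.single a 1) := by
  rw [pd, h.fderiv]

theorem hasFDerivAt_ofReal_coord (b : Idx n) (x : Pt n) :
    HasFDerivAt (fun y : Pt n => ((y b : ℝ) : ℂ))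
      (Complex.ofRealCLM ∘L (ContinuousLinearMap.proj (R := ℝ) (φ := fun _ : Idx n => ℝ) b)) x :=
  (Complex.ofRealCLM.hasFDerivAt).comp x (hasFDerivAt_apply b x)

theorem pd_ofReal_coord (a b : Idx n) (x : Pt n) :
    pd a (fun y => ((y b : ℝ) : ℂ)) x = if b = a then 1 else 0 := by
  rw [pd_of_hasFDerivAt (hasFDerivAt_ofReal_coord b x)]
  simp [Pi.single_apply]
  split_ifs <;> simp

theorem hasFDerivAt_comp_coord {f : ℝ → ℂ} {f' : ℂ} {b : Idx n} {x : Pt n}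
    (h : HasDerivAt f f' (x b)) :
    HasFDerivAt (fun y : Pt n => f (y b))
      ((ContinuousLinearMap.toSpanSingleton ℝ f') ∘L
        (ContinuousLinearMap.proj (R := ℝ) (φ := fun _ : Idx n => ℝ) b)) x :=
  HasFDerivAt.comp (f := fun y : Pt n => y b) x h.hasFDerivAt (hasFDerivAt_apply b x)

theorem pd_comp_coord {f : ℝ → ℂ} {f' : ℂ} (a : Idx n) {b : Idx n} {x : Pt n}
    (h : HasDerivAt f f' (x b)) :
    pd a (fun y => f (y b)) x = if b = a then f' else 0 := by
  rw [pd_of_hasFDerivAt (hasFDerivAt_comp_coord h)]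
  simp [Pi.single_apply]

theorem pd_smul_fun {F : Type} [NormedAddCommGroup F] [NormedSpace ℝ F] [NormedSpace ℂ F]
    [IsScalarTower ℝ ℂ F] (a : Idx n)
    {f : Pt n → ℂ} {g : Pt n → F} {x : Pt n}
    (hf : DifferentiableAt ℝ f x) (hg : DifferentiableAt ℝ g x) :
    pd a (fun y => f y • g y) x = f x • pd a g x + pd a f x • g x := by
  unfold pd
  rw [fderiv_fun_smul hf hg]
  simp

theorem pd_mul {a : Idx n} {f g : Pt n → ℂ} {x : Pt n}
    (hf : DifferentiableAt ℝ f x) (hg : DifferentiableAt ℝ g x) :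
    pd a (fun y => f y * g y) x = f x * pd a g x + pd a f x * g x :=
  pd_smul_fun a hf hg

theorem pd_add_fun {F : Type} [NormedAddCommGroup F] [NormedSpace ℝ F] {a : Idx n}
    {f g : Pt n → F} {x : Pt n}
    (hf : DifferentiableAt ℝ f x) (hg : DifferentiableAt ℝ g x) :
    pd a (fun y => f y + g y) x = pd a f x + pd a g x := by
  unfold pd
  rw [fderiv_fun_add hf hg]
  rfl

theorem pd_sub_fun {F : Type} [NormedAddCommGroup F] [NormedSpace ℝ F] {a : Idx n}
    {f g : Pt n → F} {x : Pt n}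
    (hf : DifferentiableAt ℝ f x) (hg : DifferentiableAt ℝ g x) :
    pd a (fun y => f y - g y) x = pd a f x - pd a g x := by
  unfold pd
  rw [fderiv_fun_sub hf hg]
  rfl

theorem pd_neg_fun {F : Type} [NormedAddCommGroup F] [NormedSpace ℝ F] {a : Idx n}
    {f : Pt n → F} {x : Pt n} :
    pd a (fun y => -f y) x = -pd a f x := by
  unfold pd
  rw [fderiv_fun_neg]
  rfl

theorem pd_sum_fun {F κ : Type} [NormedAddCommGroup F] [NormedSpace ℝ F] {a : Idx n}
    (s : Finset κ) {f : κ → Pt n → F} {x : Pt n} (hf : ∀ k ∈ s, DifferentiableAt ℝ (f k) x) :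
    pd a (fun y => ∑ k ∈ s, f k y) x = ∑ k ∈ s, pd a (f k) x := by
  unfold pd
  rw [fderiv_fun_sum hf]
  simp

theorem pd_apply {κ : Type} [Fintype κ] {a : Idx n} {f : Pt n → κ → ℂ} {x : Pt n}
    (hf : DifferentiableAt ℝ f x) (k : κ) :
    pd a (fun y => f y k) x = pd a f x k := by
  have := (hasFDerivAt_pi'.1 hf.hasFDerivAt) k
  rw [pd_of_hasFDerivAt this]
  rfl

theorem contDiff_ofReal_coord (b : Idx n) : ContDiff ℝ ∞ (fun y : Pt n => ((y b : ℝ) : ℂ)) :=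
  Complex.ofRealCLM.contDiff.comp (contDiff_apply ℝ ℝ b)

theorem fderiv_eq_zero_of_pd {F : Type} [NormedAddCommGroup F] [NormedSpace ℝ F]
    {f : Pt n → F} {x : Pt n} (h : ∀ a, pd a f x = 0) : fderiv ℝ f x = 0 := by
  ext v
  rw [← Finset.univ_sum_single v, map_sum]
  refine Finset.sum_eq_zero fun a _ => ?_
  have : (Pi.single a (v a) : Pt n) = v a • Pi.single a 1 := by
    ext b; simp [Pi.single_apply]
  rw [this, map_smul]
  have := h a
  unfold pd at this
  simp [this]

theorem contDiff_pd {F : Type} [NormedAddCommGroup F] [NormedSpace ℝ F] (a : Idx n)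
    {f : Pt n → F} (hf : ContDiff ℝ ∞ f) : ContDiff ℝ ∞ (fun x => pd a f x) := by
  unfold pd
  exact (hf.fderiv_right (m := ∞) (by simp)).clm_apply contDiff_const

/-- Schwarz's theorem. Flatness of the connection rests on it, since in a parallel frame the
connection consists of partial derivatives. -/
theorem pd_comm {F : Type} [NormedAddCommGroup F] [NormedSpace ℝ F] (a b : Idx n)
    {f : Pt n → F} (hf : ContDiff ℝ ∞ f) (x : Pt n) :
    pd a (fun y => pd b f y) x = pd b (fun y => pd a f y) x := by
  have hs : IsSymmSndFDerivAt ℝ f x :=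
    (hf.contDiffAt).isSymmSndFDerivAt (by
      simpa using (WithTop.coe_le_coe.2 (le_top : (2 : ℕ∞) ≤ ⊤)))
  have hd : DifferentiableAt ℝ (fderiv ℝ f) x :=
    (hf.fderiv_right (m := ∞) (by simp)).differentiable (by simp) x
  have key : ∀ a b : Idx n, pd a (fun y => pd b f y) x
      = fderiv ℝ (fderiv ℝ f) x (Pi.single a 1) (Pi.single b 1) := by
    intro a b
    have h := hd.hasFDerivAt.clm_apply (hasFDerivAt_const (Pi.single b (1 : ℝ) : Pt n) x)
    rw [show (fun y => pd b f y) = fun y => fderiv ℝ f y (Pi.single b 1) from rfl,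
      pd_of_hasFDerivAt h]
    simp
  rw [key, key, hs]

end PartialDerivatives

/-! ## Christoffel symbols and Levi-Civita derivatives -/

section Geometry

variable {n : ℕ}

theorem metric_pp (B : Fin n → ℝ) (x : Pt n) : metric B x ip ip = 0 := by simp [metric]
theorem metric_pm (B : Fin n → ℝ) (x : Pt n) : metric B x ip im = 1 := by simp [metric]
theorem metric_mp (B : Fin n → ℝ) (x : Pt n) : metric B x im ip = 1 := by simp [metric]
theorem metric_mm (B : Fin n → ℝ) (x : Pt n) :
    metric B x im im = -∑ i, B i * x (it i) ^ 2 := by simp [metric]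
theorem metric_lr (B : Fin n → ℝ) (x : Pt n) (a : Fin 2) (i : Fin n) :
    metric B x (Sum.inl a) (Sum.inr i) = 0 := by simp [metric]
theorem metric_rl (B : Fin n → ℝ) (x : Pt n) (a : Fin 2) (i : Fin n) :
    metric B x (Sum.inr i) (Sum.inl a) = 0 := by simp [metric]
theorem metric_rr (B : Fin n → ℝ) (x : Pt n) (i j : Fin n) :
    metric B x (Sum.inr i) (Sum.inr j) = if i = j then 1 else 0 := by
  simp [metric, Matrix.one_apply]

/-- The derivative of the profile `-∑ B_i (xⁱ)²`. -/
def dProfile (B : Fin n → ℝ) (x : Pt n) : Idx n → ℝ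
  | Sum.inl _ => 0
  | Sum.inr i => -(2 * (B i * x (it i)))

theorem pd_sum_sq (B : Fin n → ℝ) (x : Pt n) (a : Idx n) :
    pd a (fun y => ∑ i, B i * y (it i) ^ 2) x = -dProfile B x a := by
  have hd : ∀ i : Fin n, HasFDerivAt (fun y : Pt n => B i * y (it i) ^ 2)
      ((B i * (2 * x (it i))) • ContinuousLinearMap.proj (R := ℝ) (φ := fun _ : Idx n => ℝ) (it i))
      x := by
    intro i
    have := ((hasFDerivAt_apply (𝕜 := ℝ) (it i) x).pow 2).const_mul (B i)
    refine this.congr_fderiv ?_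
    ext v
    simp
    ring
  rw [pd_sum_fun _ fun i _ => (hd i).differentiableAt]
  rw [Finset.sum_congr rfl fun i _ => pd_of_hasFDerivAt (hd i)]
  rcases a with a | j
  · simp [dProfile]
  · simp [dProfile, Pi.single_apply]
    ring

theorem pd_metric (B : Fin n → ℝ) (x : Pt n) (a b c : Idx n) :
    pd a (fun y => metric B y b c) x = if b = im ∧ c = im then dProfile B x a else 0 := by
  rcases b with b | i <;> rcases c with c | j
  · fin_cases b <;> fin_cases c
    · simp [metric_pp, pd_const]
    · simp [metric_pm, pd_const]
    · simp [metric_mp, pd_const]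
    · simp [metric_mm]
      rw [pd_neg_fun, pd_sum_sq, neg_neg]
  · simp [metric_lr, pd_const]
  · simp [metric_rl, pd_const]
  · simp [metric_rr, pd_const]

theorem chris_eq (B : Fin n → ℝ) (x : Pt n) (a b c : Idx n) :
    chris B x a b c = (1 / 2) * ((if a = im ∧ c = im then dProfile B x b else 0)
      + (if a = im ∧ b = im then dProfile B x c else 0)
      - (if b = im ∧ c = im then dProfile B x a else 0)) := by
  simp [chris, pd_metric]

/-- Lowering an index against `∂_+` picks out the minus component, and `∂_+` is parallel, so no
Christoffel term survives. -/
theorem covLow_plus (B : Fin n → ℝ) (X : VF n) (x : Pt n) (a : Idx n) :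
    covLow B X x a ip = pd a (fun y => X y im) x := by
  simp [covLow, chris_eq, Fintype.sum_sum_type, dProfile, metric_pp, metric_pm, metric_lr]

theorem covLow_tr (B : Fin n → ℝ) (X : VF n) (x : Pt n) (a : Idx n) (i : Fin n) :
    covLow B X x a (it i) = pd a (fun y => X y (it i)) x
      + (if a = im then (B i * x (it i) : ℂ) * X x im else 0) := by
  simp [covLow, chris_eq, Fintype.sum_sum_type, dProfile, metric_rl, metric_rr, Finset.sum_add_distrib,
    apply_ite Complex.ofReal]
  split_ifs <;> simp

/-- The only nonconstant entry of the metric is `g_{--}`; its value gives the middle term and its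
gradient the last one. -/
theorem covLow_minus (B : Fin n → ℝ) (X : VF n) (x : Pt n) (a : Idx n) :
    covLow B X x a im = pd a (fun y => X y ip) x
      - (∑ i, (B i : ℂ) * x (it i) ^ 2) * pd a (fun y => X y im) x
      - (match a with
        | Sum.inl b => if b = 1 then ∑ i, (B i * x (it i) : ℂ) * X x (it i) else 0
        | Sum.inr i => (B i * x (it i) : ℂ) * X x im) := by
  rcases a with a | i
  · fin_cases a
    · simp [covLow, chris_eq, Fintype.sum_sum_type, dProfile, metric_mp, metric_mm, metric_lr]
      ring
    · simp [covLow, chris_eq, Fintype.sum_sum_type, dProfile, metric_mp, metric_mm, metric_lr,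
        Finset.sum_add_distrib]
      ring
  · simp [covLow, chris_eq, Fintype.sum_sum_type, dProfile, metric_mp, metric_mm, metric_lr]
    ring

end Geometry

/-! ## Lie brackets of vector fields -/

section LieBracket

variable {n : ℕ}

theorem lieBr_antisymm (X Y : VF n) : lieBr Y X = -lieBr X Y := by
  funext x b
  simp only [lieBr, Pi.neg_apply, ← Finset.sum_neg_distrib, neg_sub]

theorem lieBr_self (X : VF n) : lieBr X X = 0 := by
  funext x b
  simp [lieBr]

theorem differentiableAt_component {X : VF n} (hX : ContDiff ℝ ∞ X) (b : Idx n) (x : Pt n) :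
    DifferentiableAt ℝ (fun y => X y b) x :=
  differentiableAt_pi.1 (hX.differentiable (by simp) x) b

theorem lieBr_add_right (X : VF n) {Y Z : VF n} (hY : ContDiff ℝ ∞ Y) (hZ : ContDiff ℝ ∞ Z) :
    lieBr X (Y + Z) = lieBr X Y + lieBr X Z := by
  funext x b
  simp only [lieBr, Pi.add_apply, ← Finset.sum_add_distrib]
  refine Finset.sum_congr rfl fun a _ => ?_
  rw [pd_add_fun (differentiableAt_component hY b x) (differentiableAt_component hZ b x)]
  ring

theorem lieBr_smul_right (X : VF n) (k : ℂ) {Y : VF n} (hY : ContDiff ℝ ∞ Y) :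
    lieBr X (k • Y) = k • lieBr X Y := by
  funext x b
  simp only [lieBr, Pi.smul_apply, smul_eq_mul, Finset.mul_sum]
  refine Finset.sum_congr rfl fun a _ => ?_
  rw [pd_mul (differentiableAt_const k) (differentiableAt_component hY b x), pd_const]
  ring

theorem lieBr_zero_right (X : VF n) : lieBr X 0 = 0 := by
  have := lieBr_smul_right X 0 (Y := 0) contDiff_const
  simpa using this

theorem lieBr_zero_left (X : VF n) : lieBr 0 X = 0 := by
  rw [lieBr_antisymm, lieBr_zero_right, neg_zero]

theorem lieBr_add_left {X Y : VF n} (Z : VF n) (hX : ContDiff ℝ ∞ X) (hY : ContDiff ℝ ∞ Y) :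
    lieBr (X + Y) Z = lieBr X Z + lieBr Y Z := by
  rw [lieBr_antisymm, lieBr_add_right Z hX hY, lieBr_antisymm X, lieBr_antisymm Y]
  abel

theorem lieBr_smul_left {X : VF n} (k : ℂ) (Y : VF n) (hX : ContDiff ℝ ∞ X) :
    lieBr (k • X) Y = k • lieBr X Y := by
  rw [lieBr_antisymm, lieBr_smul_right Y k hX, lieBr_antisymm X]
  simp

theorem lieBr_sum_right {κ : Type} (X : VF n) (s : Finset κ) {Y : κ → VF n}
    (hY : ∀ k ∈ s, ContDiff ℝ ∞ (Y k)) :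
    lieBr X (∑ k ∈ s, Y k) = ∑ k ∈ s, lieBr X (Y k) := by
  classical
  induction s using Finset.induction_on with
  | empty => simp [lieBr_zero_right]
  | insert a s ha ih =>
    have h1 : ContDiff ℝ ∞ (Y a) := hY a (by simp)
    have h2 : ∀ k ∈ s, ContDiff ℝ ∞ (Y k) := fun k hk => hY k (by simp [hk])
    have h3 : ContDiff ℝ ∞ (∑ k ∈ s, Y k) := by
      have := ContDiff.sum (𝕜 := ℝ) (n := ∞) h2
      convert this using 1
      funext x
      simp
    rw [Finset.sum_insert ha, Finset.sum_insert ha, lieBr_add_right X h1 h3, ih h2]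

theorem contDiff_of_mem_span {S : Set (VF n)} (hS : ∀ X ∈ S, ContDiff ℝ ∞ X) {X : VF n}
    (hX : X ∈ Submodule.span ℂ S) : ContDiff ℝ ∞ X := by
  induction hX using Submodule.span_induction with
  | mem X h => exact hS X h
  | zero => exact contDiff_const
  | add X Y _ _ h1 h2 => exact h1.add h2
  | smul k X _ h => exact h.const_smul k

/-- The bracket of two spans is controlled by the generators. -/
theorem lieBr_mem_of_span {S T : Set (VF n)} (hS : ∀ X ∈ S, ContDiff ℝ ∞ X)
    (hT : ∀ X ∈ T, ContDiff ℝ ∞ X) {U : Submodule ℂ (VF n)}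
    (h : ∀ X ∈ S, ∀ Y ∈ T, lieBr X Y ∈ U) {X Y : VF n} (hX : X ∈ Submodule.span ℂ S)
    (hY : Y ∈ Submodule.span ℂ T) : lieBr X Y ∈ U := by
  have hTs : ∀ Y ∈ Submodule.span ℂ T, ContDiff ℝ ∞ Y := fun _ => contDiff_of_mem_span hT
  have hSs : ∀ Y ∈ Submodule.span ℂ S, ContDiff ℝ ∞ Y := fun _ => contDiff_of_mem_span hS
  induction hX using Submodule.span_induction with
  | mem X hX =>
    induction hY using Submodule.span_induction with
    | mem Y hY => exact h X hX Y hY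
    | zero => rw [lieBr_zero_right]; exact U.zero_mem
    | add Y Z hY hZ h1 h2 =>
      rw [lieBr_add_right X (hTs Y hY) (hTs Z hZ)]; exact U.add_mem h1 h2
    | smul k Y hY h1 => rw [lieBr_smul_right X k (hTs Y hY)]; exact U.smul_mem k h1
  | zero => rw [lieBr_zero_left]; exact U.zero_mem
  | add X Z hX hZ h1 h2 =>
    rw [lieBr_add_left Y (hSs X hX) (hSs Z hZ)]; exact U.add_mem h1 h2
  | smul k X hX h1 => rw [lieBr_smul_left k Y (hSs X hX)]; exact U.smul_mem k h1

end LieBracket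

/-! ## The Killing fields -/

section Fields

variable {n : ℕ}

/-- The field `f(x⁻) ∂_i - g(x⁻) xⁱ ∂_+`. -/
def wave (f g : ℝ → ℂ) (i : Fin n) : VF n := fun x =>
  Pi.single (it i) (f (x im)) + Pi.single ip (-(g (x im) * x (it i)))

theorem gen_tr_eq_wave (lam : Fin n → ℂ) (i : Fin n) :
    gen lam (Gen.tr i) = wave (fun s => Complex.cos (lam i * s))
      (fun s => -(lam i * Complex.sin (lam i * s))) i := by
  funext x
  simp [gen, wave]

theorem gen_star_eq_wave (lam : Fin n → ℂ) (i : Fin n) :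
    gen lam (Gen.star i) = wave (fun s => -(lam i * Complex.sin (lam i * s)))
      (fun s => -(lam i ^ 2 * Complex.cos (lam i * s))) i := by
  funext x
  simp [gen, wave]

theorem hasDerivAt_cos_mul (l : ℂ) (s : ℝ) :
    HasDerivAt (fun s : ℝ => Complex.cos (l * s)) (-(l * Complex.sin (l * s))) s := by
  have h : HasDerivAt (fun z : ℂ => Complex.cos (l * z)) (-Complex.sin (l * s) * l) (s : ℂ) := by
    have h1 : HasDerivAt (fun z : ℂ => l * z) l (s : ℂ) := by
      simpa using (hasDerivAt_id (s : ℂ)).const_mul l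
    exact h1.ccos
  convert h.comp_ofReal using 1
  ring

theorem hasDerivAt_neg_sin_mul (l : ℂ) (s : ℝ) :
    HasDerivAt (fun s : ℝ => -(l * Complex.sin (l * s))) (-(l ^ 2 * Complex.cos (l * s))) s := by
  have h : HasDerivAt (fun z : ℂ => Complex.sin (l * z)) (Complex.cos (l * s) * l) (s : ℂ) := by
    have h1 : HasDerivAt (fun z : ℂ => l * z) l (s : ℂ) := by
      simpa using (hasDerivAt_id (s : ℂ)).const_mul l
    exact h1.csin
  have h2 := (h.comp_ofReal.const_mul l).neg
  have e : -(l * (Complex.cos (l * s) * l)) = -(l ^ 2 * Complex.cos (l * s)) := by ring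
  rw [e] at h2
  exact h2

theorem hasDerivAt_neg_cos_mul (l : ℂ) (s : ℝ) :
    HasDerivAt (fun s : ℝ => -(l ^ 2 * Complex.cos (l * s)))
      (-(l ^ 2 * -(l * Complex.sin (l * s)))) s :=
  ((hasDerivAt_cos_mul l s).const_mul (l ^ 2)).neg

/-- `f' = g` and `g' = h`. -/
def IsWave (f g h : ℝ → ℂ) : Prop :=
  (∀ s, HasDerivAt f (g s) s) ∧ ∀ s, HasDerivAt g (h s) s

theorem pd_wave {f g h : ℝ → ℂ} (hw : IsWave f g h) (i : Fin n) (a b : Idx n) (x : Pt n) :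
    pd a (fun y => wave f g i y b) x =
      if b = it i then (if im = a then g (x im) else 0)
      else if b = ip then -((if im = a then h (x im) else 0) * x (it i)
        + g (x im) * (if it i = a then 1 else 0)) else 0 := by
  by_cases hb : b = it i
  · subst hb
    simp only [wave, Pi.add_apply, Pi.single_eq_same, if_true]
    rw [show (fun y : Pt n => f (y im) + (Pi.single ip (-(g (y im) * (y (it i) : ℂ))) :
      Idx n → ℂ) (it i)) = fun y => f (y im) by funext y; simp]
    exact pd_comp_coord a (hw.1 _)
  · rw [if_neg hb]
    by_cases hp : b = ip
    · subst hp
      rw [if_pos rfl]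
      simp only [wave, Pi.add_apply, Pi.single_eq_same]
      rw [show (fun y : Pt n => (Pi.single (it i) (f (y im)) : Idx n → ℂ) ip +
        -(g (y im) * (y (it i) : ℂ))) = fun y => -(g (y im) * (y (it i) : ℂ)) by
          funext y; simp]
      rw [pd_neg_fun, pd_mul (hasFDerivAt_comp_coord (hw.2 _)).differentiableAt
        (hasFDerivAt_ofReal_coord _ _).differentiableAt, pd_ofReal_coord,
        pd_comp_coord a (hw.2 _)]
      ring
    · rw [if_neg hp]
      rw [show (fun y : Pt n => wave f g i y b) = fun _ => 0 by
        funext y; simp [wave, hb, hp]]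
      exact pd_const a 0 x

theorem pd_rot (lam : Fin n → ℂ) (i j : Fin n) (a b : Idx n) (x : Pt n) :
    pd a (fun y => gen lam (Gen.rot i j) y b) x =
      (if b = it i then (if it j = a then 1 else 0) else 0)
      - (if b = it j then (if it i = a then 1 else 0) else 0) := by
  have h : (fun y : Pt n => gen lam (Gen.rot i j) y b) = fun y =>
      (if b = it i then (1 : ℂ) else 0) * ((y (it j) : ℝ) : ℂ)
        - (if b = it j then (1 : ℂ) else 0) * ((y (it i) : ℝ) : ℂ) := by
    funext y
    simp [gen, Pi.single_apply]
  have hd := fun k : Fin n => (hasFDerivAt_ofReal_coord (it k) x).differentiableAt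
  rw [h, pd_sub_fun ((hd j).const_mul _) ((hd i).const_mul _),
    pd_mul (differentiableAt_const _) (hd j), pd_mul (differentiableAt_const _) (hd i),
    pd_const, pd_const, pd_ofReal_coord, pd_ofReal_coord]
  simp only [ite_mul, one_mul, zero_mul, add_zero]

theorem wave_plus (f g : ℝ → ℂ) (i : Fin n) (x : Pt n) :
    wave f g i x ip = -(g (x im) * x (it i)) := by simp [wave]
theorem wave_minus (f g : ℝ → ℂ) (i : Fin n) (x : Pt n) : wave f g i x im = 0 := by simp [wave]
theorem wave_tr (f g : ℝ → ℂ) (i j : Fin n) (x : Pt n) :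
    wave f g i x (it j) = if j = i then f (x im) else 0 := by simp [wave, Pi.single_apply]
theorem rot_inl (lam : Fin n → ℂ) (i j : Fin n) (x : Pt n) (a : Fin 2) :
    gen lam (Gen.rot i j) x (Sum.inl a) = 0 := by simp [gen]
theorem rot_tr (lam : Fin n → ℂ) (i j k : Fin n) (x : Pt n) :
    gen lam (Gen.rot i j) x (it k)
      = (if k = i then (x (it j) : ℂ) else 0) - if k = j then (x (it i) : ℂ) else 0 := by
  simp [gen, Pi.single_apply]

theorem rot_self (lam : Fin n → ℂ) (i : Fin n) : gen lam (Gen.rot i i) = 0 := by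
  funext x
  simp [gen]

theorem rot_swap (lam : Fin n → ℂ) (i j : Fin n) :
    gen lam (Gen.rot j i) = -gen lam (Gen.rot i j) := by
  funext x
  simp [gen]

theorem contDiff_wave {f g : ℝ → ℂ} (hf : ContDiff ℝ ∞ f) (hg : ContDiff ℝ ∞ g) (i : Fin n) :
    ContDiff ℝ ∞ (wave f g i) := by
  rw [contDiff_pi]
  intro b
  have hc : ContDiff ℝ ∞ (fun y : Pt n => y im) := contDiff_apply ℝ ℝ im
  have hd := contDiff_ofReal_coord (it i)
  simp only [wave, Pi.add_apply, Pi.single_apply]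
  split_ifs
  · exact (hf.comp hc).add ((hg.comp hc).mul hd).neg
  · exact (hf.comp hc).add contDiff_const
  · exact contDiff_const.add ((hg.comp hc).mul hd).neg
  · exact contDiff_const

theorem contDiff_cos_mul (l : ℂ) : ContDiff ℝ ∞ (fun s : ℝ => Complex.cos (l * s)) :=
  (Complex.contDiff_cos.restrict_scalars ℝ).comp (contDiff_const.mul Complex.ofRealCLM.contDiff)

theorem contDiff_sin_mul (l : ℂ) : ContDiff ℝ ∞ (fun s : ℝ => Complex.sin (l * s)) :=
  (Complex.contDiff_sin.restrict_scalars ℝ).comp (contDiff_const.mul Complex.ofRealCLM.contDiff)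

theorem contDiff_gen (lam : Fin n → ℂ) (g : Gen n) : ContDiff ℝ ∞ (gen lam g) := by
  cases g with
  | plus => exact contDiff_const
  | minus => exact contDiff_const
  | tr i =>
    rw [gen_tr_eq_wave]
    exact contDiff_wave (contDiff_cos_mul _) (contDiff_const.mul (contDiff_sin_mul _)).neg i
  | star i =>
    rw [gen_star_eq_wave]
    exact contDiff_wave (contDiff_const.mul (contDiff_sin_mul _)).neg
      (contDiff_const.mul (contDiff_cos_mul _)).neg i
  | rot i j =>
    rw [contDiff_pi]
    intro b
    simp only [gen, Pi.sub_apply, Pi.single_apply]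
    split_ifs
    · exact (contDiff_ofReal_coord _).sub (contDiff_ofReal_coord _)
    · exact (contDiff_ofReal_coord _).sub contDiff_const
    · exact contDiff_const.sub (contDiff_ofReal_coord _)
    · exact contDiff_const

theorem isWave_tr (l : ℂ) : IsWave (fun s : ℝ => Complex.cos (l * s))
    (fun s => -(l * Complex.sin (l * s))) (fun s => -(l ^ 2 * Complex.cos (l * s))) :=
  ⟨hasDerivAt_cos_mul l, hasDerivAt_neg_sin_mul l⟩

theorem isWave_star (l : ℂ) : IsWave (fun s : ℝ => -(l * Complex.sin (l * s)))
    (fun s => -(l ^ 2 * Complex.cos (l * s)))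
    (fun s => -(l ^ 2 * -(l * Complex.sin (l * s)))) :=
  ⟨hasDerivAt_neg_sin_mul l, hasDerivAt_neg_cos_mul l⟩

theorem sum_single_mul (a : Idx n) (k : ℂ) (F : Idx n → ℂ) :
    ∑ b, (Pi.single a k : Idx n → ℂ) b * F b = k * F a := by
  simp [Pi.single_apply]

theorem sum_wave_mul (f g : ℝ → ℂ) (i : Fin n) (x : Pt n) (F : Idx n → ℂ) :
    ∑ a, wave f g i x a * F a = f (x im) * F (it i) - g (x im) * x (it i) * F ip := by
  simp only [wave, Pi.add_apply, add_mul, Finset.sum_add_distrib, sum_single_mul]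
  ring

theorem sum_rot_mul (lam : Fin n → ℂ) (i j : Fin n) (x : Pt n) (F : Idx n → ℂ) :
    ∑ a, gen lam (Gen.rot i j) x a * F a = x (it j) * F (it i) - x (it i) * F (it j) := by
  simp only [gen, Pi.sub_apply, sub_mul, Finset.sum_sub_distrib, sum_single_mul]

theorem lieBr_apply (X Y : VF n) (x : Pt n) (b : Idx n) :
    lieBr X Y x b = ∑ a, X x a * pd a (fun y => Y y b) x
      - ∑ a, Y x a * pd a (fun y => X y b) x := by
  simp only [lieBr, Finset.sum_sub_distrib]

theorem lieBr_minus_plus (lam : Fin n → ℂ) :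
    lieBr (gen lam Gen.minus) (gen lam Gen.plus) = 0 := by
  funext x b
  simp [lieBr, gen, pd_const]

theorem lieBr_plus_wave (lam : Fin n → ℂ) {f g h : ℝ → ℂ} (hw : IsWave f g h) (i : Fin n) :
    lieBr (gen lam Gen.plus) (wave f g i) = 0 := by
  funext x b
  rw [lieBr_apply]
  simp only [gen, sum_single_mul, pd_const, pd_wave hw]
  simp

/-- The generator `∂_-` differentiates the profile in `x⁻`; no other coefficient depends on that
variable. -/
theorem lieBr_minus_wave (lam : Fin n → ℂ) {f g h : ℝ → ℂ} (hw : IsWave f g h) (i : Fin n) :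
    lieBr (gen lam Gen.minus) (wave f g i) = wave g h i := by
  funext x b
  rw [lieBr_apply]
  simp only [gen, sum_single_mul, pd_const, pd_wave hw]
  simp only [wave, Pi.add_apply, Pi.single_apply]
  split_ifs <;> simp_all

theorem lieBr_plus_rot (lam : Fin n → ℂ) (i j : Fin n) :
    lieBr (gen lam Gen.plus) (gen lam (Gen.rot i j)) = 0 := by
  funext x b
  rw [lieBr_apply]
  simp only [pd_rot]
  simp [gen, pd_const]

theorem lieBr_minus_rot (lam : Fin n → ℂ) (i j : Fin n) :
    lieBr (gen lam Gen.minus) (gen lam (Gen.rot i j)) = 0 := by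
  funext x b
  rw [lieBr_apply]
  simp only [pd_rot]
  simp [gen, pd_const]

/-- The coefficient of `∂_+` is the Wronskian of the two profiles, which is constant when both solve
the same oscillator equation. This produces the Heisenberg part of the algebra. -/
theorem lieBr_wave_wave (lam : Fin n → ℂ) {f g h f' g' h' : ℝ → ℂ} (hw : IsWave f g h)
    (hw' : IsWave f' g' h') (i j : Fin n) {k : ℂ}
    (hk : ∀ s, f' s * g s - f s * g' s = k) :
    lieBr (wave f g i) (wave f' g' j) = (if i = j then k else 0) • gen lam Gen.plus := by
  funext x b
  rw [lieBr_apply, sum_wave_mul, sum_wave_mul]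
  simp only [pd_wave hw, pd_wave hw', Pi.smul_apply, gen, Pi.single_apply, smul_eq_mul]
  rcases b with b | b
  · fin_cases b
    · by_cases hij : i = j
      · subst hij
        simp
        linear_combination hk (x im)
      · simp [hij, Ne.symm hij]
    · simp
  · simp

theorem lieBr_wave_rot (lam : Fin n → ℂ) {f g h : ℝ → ℂ} (hw : IsWave f g h) (i k l : Fin n) :
    lieBr (wave f g i) (gen lam (Gen.rot k l))
      = (if i = l then 1 else 0 : ℂ) • wave f g k - (if i = k then 1 else 0 : ℂ) • wave f g l := by
  funext x b
  rw [lieBr_apply, sum_wave_mul, sum_rot_mul]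
  simp only [pd_wave hw, pd_rot, Pi.sub_apply, Pi.smul_apply, smul_eq_mul]
  rcases b with b | b
  · fin_cases b
    · simp [wave_plus]
      by_cases h1 : i = k <;> by_cases h2 : i = l
      · subst h1; subst h2; simp
      · subst h1; simp [h2]; ring
      · subst h2; simp [h1]; ring
      · simp [h1, h2]
    · simp [wave_minus]
  · simp only [wave_tr]
    simp [eq_comm (a := l) (b := i), eq_comm (a := k) (b := i)]
    simp only [mul_sub, mul_ite, mul_one, mul_zero]

theorem lieBr_rot_rot (lam : Fin n → ℂ) (k l a b : Fin n) :
    lieBr (gen lam (Gen.rot k l)) (gen lam (Gen.rot a b))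
      = (if k = b then 1 else 0 : ℂ) • gen lam (Gen.rot a l)
        - (if k = a then 1 else 0 : ℂ) • gen lam (Gen.rot b l)
        - (if l = b then 1 else 0 : ℂ) • gen lam (Gen.rot a k)
        + (if l = a then 1 else 0 : ℂ) • gen lam (Gen.rot b k) := by
  funext x c
  rw [lieBr_apply, sum_rot_mul, sum_rot_mul]
  simp only [pd_rot, Pi.sub_apply, Pi.smul_apply, Pi.add_apply, smul_eq_mul]
  rcases c with c | c
  · simp [rot_inl]
  · simp only [rot_tr, Sum.inr.injEq, eq_comm (a := b) (b := k), eq_comm (a := b) (b := l),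
      eq_comm (a := a) (b := k), eq_comm (a := a) (b := l)]
    ring_nf
    simp only [mul_ite, ite_mul, mul_one, mul_zero, zero_mul, one_mul]
    ring

end Fields

/-! ### Covariant derivatives of the generators and the Killing equation -/

section CovariantDerivative

variable {n : ℕ}

theorem covLow_add (B : Fin n → ℝ) {X Y : VF n} (hX : ContDiff ℝ ∞ X) (hY : ContDiff ℝ ∞ Y)
    (x : Pt n) (a b : Idx n) : covLow B (X + Y) x a b = covLow B X x a b + covLow B Y x a b := by
  simp only [covLow, Pi.add_apply, ← Finset.sum_add_distrib]
  refine Finset.sum_congr rfl fun c _ => ?_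
  rw [pd_add_fun (differentiableAt_component hX c x) (differentiableAt_component hY c x)]
  ring

theorem covLow_smul (B : Fin n → ℝ) (k : ℂ) {X : VF n} (hX : ContDiff ℝ ∞ X)
    (x : Pt n) (a b : Idx n) : covLow B (k • X) x a b = k * covLow B X x a b := by
  simp only [covLow, Pi.smul_apply, smul_eq_mul, Finset.mul_sum]
  refine Finset.sum_congr rfl fun c _ => ?_
  rw [pd_mul (differentiableAt_const k) (differentiableAt_component hX c x), pd_const]
  ring

theorem isKilling_of_mem_span {B : Fin n → ℝ} {S : Set (VF n)} (hS : ∀ X ∈ S, IsKilling B X)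
    {X : VF n} (hX : X ∈ Submodule.span ℂ S) : IsKilling B X := by
  induction hX using Submodule.span_induction with
  | mem X h => exact hS X h
  | zero =>
    refine ⟨contDiff_const, fun x a b => ?_⟩
    have := covLow_smul B 0 (X := 0) contDiff_const x
    simp only [zero_smul, zero_mul] at this
    simp [this]
  | add X Y _ _ h1 h2 =>
    refine ⟨h1.1.add h2.1, fun x a b => ?_⟩
    rw [covLow_add B h1.1 h2.1, covLow_add B h1.1 h2.1]
    linear_combination h1.2 x a b + h2.2 x a b
  | smul k X _ h =>
    refine ⟨h.1.const_smul k, fun x a b => ?_⟩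
    rw [covLow_smul B k h.1, covLow_smul B k h.1]
    linear_combination k * h.2 x a b

theorem covLow_wave_plus (B : Fin n → ℝ) (f g : ℝ → ℂ) (i : Fin n) (x : Pt n) (a : Idx n) :
    covLow B (wave f g i) x a ip = 0 := by
  rw [covLow_plus]
  simp only [wave_minus]
  exact pd_const a 0 x

theorem covLow_wave_tr (B : Fin n → ℝ) {f g h : ℝ → ℂ} (hw : IsWave f g h) (i : Fin n) (x : Pt n)
    (a : Idx n) (j : Fin n) :
    covLow B (wave f g i) x a (it j) = if j = i then (if a = im then g (x im) else 0) else 0 := by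
  rw [covLow_tr, pd_wave hw, wave_minus]
  simp [eq_comm]

/-- The oscillator equation `f'' = -B_i f` enters here: it cancels the `(-,-)` component, leaving an
entry opposite to the one in `covLow_wave_tr`. -/
theorem covLow_wave_minus (B : Fin n → ℝ) {f g h : ℝ → ℂ} (hw : IsWave f g h) (i : Fin n)
    (hB : ∀ s, h s = -B i * f s) (x : Pt n) (a : Idx n) :
    covLow B (wave f g i) x a im = if a = it i then -g (x im) else 0 := by
  have h0 : pd a (fun y => wave f g i y im) x = 0 := by
    simp only [wave_minus]; exact pd_const a 0 x
  rw [covLow_minus, pd_wave hw, h0]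
  rcases a with a | a
  · fin_cases a
    · simp
    · simp [wave_tr, hB]
      ring
  · simp [wave_minus, eq_comm]
    split_ifs <;> simp

theorem covLow_rot_plus (B : Fin n → ℝ) (lam : Fin n → ℂ) (i j : Fin n) (x : Pt n) (a : Idx n) :
    covLow B (gen lam (Gen.rot i j)) x a ip = 0 := by
  rw [covLow_plus, pd_rot]
  simp

theorem covLow_rot_tr (B : Fin n → ℝ) (lam : Fin n → ℂ) (i j : Fin n) (x : Pt n) (a : Idx n)
    (k : Fin n) :
    covLow B (gen lam (Gen.rot i j)) x a (it k) =
      (if k = i then (if it j = a then 1 else 0) else 0)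
      - (if k = j then (if it i = a then 1 else 0) else 0) := by
  rw [covLow_tr, pd_rot, rot_inl]
  simp

/-- A rotation preserves the quadratic form `∑ B_k (x^k)²` exactly because the two eigenvalues
agree. -/
theorem covLow_rot_minus (B : Fin n → ℝ) (lam : Fin n → ℂ) {i j : Fin n} (hB : B i = B j)
    (x : Pt n) (a : Idx n) :
    covLow B (gen lam (Gen.rot i j)) x a im = 0 := by
  rw [covLow_minus, pd_rot, pd_rot]
  rcases a with a | a
  · fin_cases a
    · simp
    · simp [rot_tr, mul_sub, Finset.sum_sub_distrib, hB]
      ring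
  · simp [rot_inl]

theorem covLow_plus_field (B : Fin n → ℝ) (lam : Fin n → ℂ) (x : Pt n) (a b : Idx n) :
    covLow B (gen lam Gen.plus) x a b = 0 := by
  simp only [covLow, gen, pd_const, chris_eq]
  simp [Pi.single_apply, dProfile]

theorem covLow_minus_field_plus (B : Fin n → ℝ) (lam : Fin n → ℂ) (x : Pt n) (a : Idx n) :
    covLow B (gen lam Gen.minus) x a ip = 0 := by
  rw [covLow_plus]
  exact pd_const a _ x

theorem covLow_minus_field_tr (B : Fin n → ℝ) (lam : Fin n → ℂ) (x : Pt n) (a : Idx n)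
    (i : Fin n) : covLow B (gen lam Gen.minus) x a (it i)
      = if a = im then (B i * x (it i) : ℂ) else 0 := by
  rw [covLow_tr]
  simp [gen, pd_const]

theorem covLow_minus_field_minus (B : Fin n → ℝ) (lam : Fin n → ℂ) (x : Pt n) (a : Idx n) :
    covLow B (gen lam Gen.minus) x a im = match a with
      | Sum.inl _ => 0
      | Sum.inr i => -(B i * x (it i) : ℂ) := by
  rw [covLow_minus]
  rcases a with a | a <;> simp [gen, pd_const]

/-- The root condition `B_i = λ_i²`. -/
theorem isKilling_gen {B : Fin n → ℝ} {lam : Fin n → ℂ} (hlam : ∀ i, lam i ^ 2 = (B i : ℂ))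
    (g : Gen n) (hg : ∀ i j, g = Gen.rot i j → B i = B j) : IsKilling B (gen lam g) := by
  refine ⟨contDiff_gen lam g, fun x a b => ?_⟩
  -- Both `K_(i)` and `K_(i*)` are waves whose profile solves the oscillator equation, so one
  -- computation serves both.
  have hwave : ∀ (f g h : ℝ → ℂ) (i : Fin n), IsWave f g h → (∀ s, h s = -B i * f s) →
      covLow B (wave f g i) x a b + covLow B (wave f g i) x b a = 0 := by
    intro f g h i hw hB
    rcases a with a | a <;> rcases b with b | b
    · fin_cases a <;> fin_cases b <;>
        simp [covLow_wave_plus, covLow_wave_minus B hw i hB]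
    · fin_cases a <;> simp [covLow_wave_plus, covLow_wave_minus B hw i hB, covLow_wave_tr B hw]
      split_ifs <;> simp
    · fin_cases b <;> simp [covLow_wave_plus, covLow_wave_minus B hw i hB, covLow_wave_tr B hw]
      split_ifs <;> simp
    · simp [covLow_wave_tr B hw]
  cases g with
  | plus => simp [covLow_plus_field]
  | minus =>
    rcases a with a | a <;> rcases b with b | b
    · fin_cases a <;> fin_cases b <;>
        simp [covLow_minus_field_plus, covLow_minus_field_minus]
    · fin_cases a <;>
        simp [covLow_minus_field_plus, covLow_minus_field_minus, covLow_minus_field_tr]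
    · fin_cases b <;>
        simp [covLow_minus_field_plus, covLow_minus_field_minus, covLow_minus_field_tr]
    · simp [covLow_minus_field_tr]
  | tr i =>
    rw [gen_tr_eq_wave]
    exact hwave _ _ _ i (isWave_tr (lam i)) fun s => by rw [← hlam i]; ring
  | star i =>
    rw [gen_star_eq_wave]
    exact hwave _ _ _ i (isWave_star (lam i)) fun s => by rw [← hlam i]; ring
  | rot i j =>
    have hB := hg i j rfl
    rcases a with a | a <;> rcases b with b | b
    · fin_cases a <;> fin_cases b <;> simp [covLow_rot_plus, covLow_rot_minus B lam hB]
    · fin_cases a <;>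
        simp [covLow_rot_plus, covLow_rot_minus B lam hB, covLow_rot_tr]
    · fin_cases b <;>
        simp [covLow_rot_plus, covLow_rot_minus B lam hB, covLow_rot_tr]
    · simp only [covLow_rot_tr, Sum.inr.injEq]
      simp only [eq_comm (a := j), eq_comm (a := i), ← ite_and, and_comm]
      ring

end CovariantDerivative

/-! ## Spin connection and spinorial Lie derivative -/

section SpinConnection

variable {n : ℕ} {ι : Type} [Fintype ι] [DecidableEq ι] {Γ : Idx n → Matrix ι ι ℂ}

theorem IsClifford.plus_sq (h : IsClifford Γ) : Γ ip * Γ ip = 0 := by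
  have := h ip ip
  rw [if_neg (by simp [bar])] at this
  have h2 : (2 : ℂ) • (Γ ip * Γ ip) = 0 := by rw [two_smul]; exact this
  simpa using h2

theorem IsClifford.minus_sq (h : IsClifford Γ) : Γ im * Γ im = 0 := by
  have := h im im
  rw [if_neg (by simp [bar])] at this
  have h2 : (2 : ℂ) • (Γ im * Γ im) = 0 := by rw [two_smul]; exact this
  simpa using h2

theorem IsClifford.plus_minus (h : IsClifford Γ) :
    Γ ip * Γ im + Γ im * Γ ip = (-2 : ℂ) • 1 := by
  have := h ip im
  rwa [if_pos (by simp [bar])] at this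

theorem IsClifford.tr_inl (h : IsClifford Γ) (i : Fin n) (a : Fin 2) :
    Γ (it i) * Γ (Sum.inl a) = -(Γ (Sum.inl a) * Γ (it i)) := by
  have := h (it i) (Sum.inl a)
  rw [if_neg (by simp [bar])] at this
  exact eq_neg_of_add_eq_zero_left this

theorem IsClifford.tr_tr (h : IsClifford Γ) (i j : Fin n) :
    Γ (it i) * Γ (it j) + Γ (it j) * Γ (it i) = (if i = j then (-2 : ℂ) else 0) • 1 := by
  have := h (it i) (it j)
  simp only [bar, Sum.inr.injEq, eq_comm (a := j)] at this
  rw [this]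
  split_ifs <;> simp

theorem IsClifford.tr_sq (h : IsClifford Γ) (i : Fin n) : Γ (it i) * Γ (it i) = -1 := by
  have := h.tr_tr i i
  rw [if_pos rfl, ← two_smul ℂ, neg_smul, ← smul_neg] at this
  exact smul_right_injective _ (two_ne_zero) this

theorem IsClifford.tr_anticomm (h : IsClifford Γ) {i j : Fin n} (hij : i ≠ j) :
    Γ (it i) * Γ (it j) = -(Γ (it j) * Γ (it i)) := by
  have := h.tr_tr i j
  rw [if_neg hij, zero_smul] at this
  exact eq_neg_of_add_eq_zero_left this

/-- Only null rotations fixing `e_+` and spatial rotations occur, never a boost. The two orders of a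
mixed index pair contribute equally because `Γ_i` and `Γ_+` anticommute, which turns the factor 1/4
into 1/2. -/
theorem spinRep_eq (h : IsClifford Γ) (A : Idx n → Idx n → ℂ) (k : Fin n → ℂ)
    (R : Fin n → Fin n → ℂ) (h1 : ∀ a b, A (Sum.inl a) (Sum.inl b) = 0)
    (h2 : ∀ i, A ip (it i) = 0) (h3 : ∀ i, A (it i) ip = 0) (h4 : ∀ i, A im (it i) = k i)
    (h5 : ∀ i, A (it i) im = -k i) (h6 : ∀ i j, A (it i) (it j) = R i j) :
    spinRep Γ A = (1 / 2 : ℂ) • ∑ i, k i • (Γ ip * Γ (it i))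
      - (1 / 4 : ℂ) • ∑ i, ∑ j, R i j • (Γ (it j) * Γ (it i)) := by
  have e1 : ∀ i : Fin n, A (Sum.inl 0) (Sum.inr i) = 0 := h2
  have e2 : ∀ i : Fin n, A (Sum.inr i) (Sum.inl 0) = 0 := h3
  have e3 : ∀ i : Fin n, A (Sum.inl 1) (Sum.inr i) = k i := h4
  have e4 : ∀ i : Fin n, A (Sum.inr i) (Sum.inl 1) = -k i := h5
  have e5 : ∀ i j : Fin n, A (Sum.inr i) (Sum.inr j) = R i j := h6
  have e6 : ∀ i, Γ (Sum.inr i) * Γ (Sum.inl 0) = -(Γ (Sum.inl 0) * Γ (Sum.inr i)) :=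
    fun i => h.tr_inl i 0
  simp only [spinRep, Fintype.sum_sum_type, Fin.sum_univ_two, h1, e1, e2, e3, e4, e5, bar, zero_smul,
    zero_add, add_zero, Finset.sum_add_distrib, Finset.sum_const_zero]
  simp only [sub_self, e6, smul_neg, neg_smul, Finset.sum_neg_distrib]
  module

theorem frame_plus (B : Fin n → ℝ) (x : Pt n) : frame B ip x = Pi.single ip 1 := by
  simp [frame]
theorem frame_tr (B : Fin n → ℝ) (i : Fin n) (x : Pt n) :
    frame B (it i) x = Pi.single (it i) 1 := by
  simp [frame]
theorem frame_minus (B : Fin n → ℝ) (x : Pt n) : frame B im x =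
    Pi.single im 1 + Pi.single ip (((1 / 2) * ∑ i, B i * x (it i) ^ 2 : ℝ) : ℂ) := by
  simp [frame]

/-- The frame differs from the coordinate basis only by a multiple of `∂_+` in `e_-`. A covector
that annihilates `∂_+` therefore has the same components in both. -/
theorem sum_frame_mul (B : Fin n → ℝ) (x : Pt n) (b : Idx n) (F : Idx n → ℂ) (hF : F ip = 0) :
    ∑ d, frame B b x d * F d = F b := by
  have hs : ∀ (a : Idx n) (k : ℂ) (F : Idx n → ℂ),
      ∑ b, (Pi.single a k : Idx n → ℂ) b * F b = k * F a := sum_single_mul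
  rcases b with b | b
  · fin_cases b
    · have := frame_plus B x
      simp only [Fin.zero_eta]
      rw [this, hs, one_mul]
    · have := frame_minus B x
      simp only [Fin.mk_one]
      rw [this]
      simp only [Pi.add_apply, add_mul, Finset.sum_add_distrib, hs, hF]
      simp
  · rw [frame_tr, hs, one_mul]

theorem spinRep_frame (h : IsClifford Γ) (B : Fin n → ℝ) (X : VF n) (x : Pt n)
    (k : Fin n → ℂ) (R : Fin n → Fin n → ℂ)
    (hp : ∀ a, covLow B X x ip a = 0) (hp' : ∀ a, covLow B X x a ip = 0)
    (hm : covLow B X x im im = 0) (h4 : ∀ i, covLow B X x im (it i) = k i)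
    (h5 : ∀ i, covLow B X x (it i) im = -k i) (h6 : ∀ i j, covLow B X x (it i) (it j) = R i j) :
    spinRep Γ (fun b c => ∑ a, ∑ d, frame B b x a * frame B c x d * covLow B X x a d)
      = (1 / 2 : ℂ) • ∑ i, k i • (Γ ip * Γ (it i))
      - (1 / 4 : ℂ) • ∑ i, ∑ j, R i j • (Γ (it j) * Γ (it i)) := by
  have hA : ∀ b c, ∑ a, ∑ d, frame B b x a * frame B c x d * covLow B X x a d
      = covLow B X x b c := by
    intro b c
    rw [← sum_frame_mul B x b (fun a => covLow B X x a c) (hp c)]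
    refine Finset.sum_congr rfl fun a _ => ?_
    rw [← sum_frame_mul B x c (fun d => covLow B X x a d) (hp' a), Finset.mul_sum]
    simp only [mul_assoc]
  simp only [hA]
  refine spinRep_eq h _ k R ?_ (fun i => hp _) (fun i => hp' _) h4 h5 h6
  intro a b
  fin_cases a <;> fin_cases b
  · exact hp _
  · exact hp _
  · exact hp' _
  · exact hm

theorem pd_frame_minus (B : Fin n → ℝ) (x : Pt n) (a b : Idx n) :
    pd a (fun y => frame B im y b) x
      = if b = ip then (match a with
        | Sum.inl _ => 0
        | Sum.inr i => (B i * x (it i) : ℂ)) else 0 := by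
  simp only [frame_minus]
  by_cases hb : b = ip
  · subst hb
    have e : (fun y : Pt n => (Pi.single im 1 + Pi.single ip
        (((1 / 2) * ∑ i, B i * y (it i) ^ 2 : ℝ) : ℂ) : Idx n → ℂ) ip)
        = fun y => Complex.ofRealCLM ((1 / 2) * ∑ i, B i * y (it i) ^ 2) := by
      funext y
      simp
    rw [e]
    have hd : DifferentiableAt ℝ (fun y : Pt n => ∑ i, B i * y (it i) ^ 2) x := by fun_prop
    have h1 := (Complex.ofRealCLM.hasFDerivAt).comp x (hd.hasFDerivAt.const_mul (1 / 2))
    have h2 := pd_of_hasFDerivAt (a := a) h1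
    have h3 := pd_sum_sq B x a
    unfold pd at h3
    refine h2.trans ?_
    simp only [ContinuousLinearMap.comp_apply, smul_apply, h3, if_true]
    rcases a with a | a
    · simp [dProfile]
    · simp [dProfile]
  · rw [if_neg hb]
    rw [show (fun y : Pt n => (Pi.single im 1 + Pi.single ip
        (((1 / 2) * ∑ i, B i * y (it i) ^ 2 : ℝ) : ℂ) : Idx n → ℂ) b)
        = fun _ => (Pi.single im 1 : Idx n → ℂ) b by funext y; simp [hb]]
    exact pd_const _ _ _

/-- The frame is parallel along `∂_+` and `∂_i`. Along `∂_-` it undergoes an infinitesimal null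
rotation with parameter `B_i xⁱ`, whose spin lift is the extra term. -/
theorem nabla_eq (h : IsClifford Γ) (B : Fin n → ℝ) (a : Idx n) (ξ : SF n ι) (x : Pt n) :
    nabla B Γ a ξ x = pd a ξ x + (if a = im then
      (1 / 2 : ℂ) • ∑ i, (B i * x (it i) : ℂ) • (Γ ip * Γ (it i)) else 0) *ᵥ ξ x := by
  have hcp : ∀ b d, covLow B (frame B ip) x b d = 0 := by
    intro b d
    have : frame B ip = gen (fun _ => 0) Gen.plus := by
      funext y; simp [frame_plus, gen]
    rw [this, covLow_plus_field]
  -- `∇_- e_i` is a multiple of `∂_+`, hence visible only when paired with the minus direction.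
  have hct : ∀ i b d, covLow B (frame B (it i)) x b d
      = if b = im ∧ d = im then -(B i * x (it i) : ℂ) else 0 := by
    intro i b d
    have hf : ∀ d b, pd b (fun y => frame B (it i) y d) x = 0 := by
      intro d b
      simp only [frame_tr]
      exact pd_const _ _ _
    rcases d with d | d
    · fin_cases d
      · simpa [hf] using covLow_plus B (frame B (it i)) x b
      · have := covLow_minus B (frame B (it i)) x b
        simp only [frame_tr, pd_const] at this
        simp only [Fin.mk_one]
        rw [this]
        rcases b with b | b
        · fin_cases b <;> simp [Pi.single_apply]
        · simp
    · have := covLow_tr B (frame B (it i)) x b d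
      simp only [frame_tr, pd_const] at this
      rw [this]
      simp
  have hcm : ∀ b d, covLow B (frame B im) x b d = match d with
      | Sum.inl _ => 0
      | Sum.inr i => if b = im then (B i * x (it i) : ℂ) else 0 := by
    intro b d
    have hmt : ∀ i, frame B im x (it i) = 0 := fun i => by simp [frame_minus]
    have hmm : frame B im x im = 1 := by simp [frame_minus]
    rcases d with d | d
    · fin_cases d
      · have := covLow_plus B (frame B im) x b
        simp only [Fin.zero_eta]
        rw [this, pd_frame_minus]
        simp
      · have := covLow_minus B (frame B im) x b
        simp only [Fin.mk_one]
        rw [this, pd_frame_minus, pd_frame_minus]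
        rcases b with b | b
        · simp [hmt]
        · simp [hmm]
    · have := covLow_tr B (frame B im) x b d
      rw [this, pd_frame_minus, hmm]
      simp
  have hA : ∀ b c, ∑ d, frame B c x d * covLow B (frame B b) x a d
      = covLow B (frame B b) x a c := by
    intro b c
    refine sum_frame_mul B x c (fun d => covLow B (frame B b) x a d) ?_
    rcases b with b | b
    · fin_cases b
      · exact hcp _ _
      · exact hcm _ _
    · simp [hct]
  unfold nabla
  simp only [hA]
  by_cases ha : a = im
  · rw [if_pos ha, spinRep_eq h _ (fun i => (B i * x (it i) : ℂ)) 0]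
    · simp
    · intro b c
      fin_cases b
      · exact hcp _ _
      · exact hcm _ _
    · intro i; exact hcp _ _
    · intro i; rw [hct]; simp
    · intro i; rw [hcm]; simp [ha]
    · intro i; rw [hct]; simp [ha]
    · intro i j; rw [hct]; simp
  · rw [if_neg ha, spinRep_eq h _ 0 0]
    · simp
    · intro b c
      fin_cases b
      · exact hcp _ _
      · exact hcm _ _
    · intro i; exact hcp _ _
    · intro i; rw [hct]; simp
    · intro i; rw [hcm]; simp [ha]
    · intro i; rw [hct]; simp [ha]
    · intro i j; rw [hct]; simp [ha]

theorem lieDer_plus (h : IsClifford Γ) (B : Fin n → ℝ) (lam : Fin n → ℂ) (ξ : SF n ι) (x : Pt n) :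
    lieDer B Γ (gen lam Gen.plus) ξ x = pd ip ξ x := by
  unfold lieDer
  rw [spinRep_frame h B _ x 0 0]
  · simp [gen, Pi.single_apply, nabla_eq h]
  all_goals simp [covLow_plus_field]

/-- The flow of `∂_-` preserves the frame, so the spin connection in `∇_-` cancels against the spin
lift of `∇∂_-`. -/
theorem lieDer_minus (h : IsClifford Γ) (B : Fin n → ℝ) (lam : Fin n → ℂ) (ξ : SF n ι) (x : Pt n) :
    lieDer B Γ (gen lam Gen.minus) ξ x = pd im ξ x := by
  unfold lieDer
  rw [spinRep_frame h B _ x (fun i => (B i * x (it i) : ℂ)) 0]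
  · simp [gen, Pi.single_apply, nabla_eq h]
  · intro a
    rcases a with a | a
    · fin_cases a
      · exact covLow_minus_field_plus _ _ _ _
      · exact covLow_minus_field_minus _ _ _ _
    · simp [covLow_minus_field_tr]
  all_goals simp [covLow_minus_field_plus, covLow_minus_field_minus, covLow_minus_field_tr]

/-- A wave field has no `∂_-` component, so the spin connection does not enter; its covariant
derivative is a null rotation whose parameter is the derivative of the profile. -/
theorem lieDer_wave (hΓ : IsClifford Γ) (B : Fin n → ℝ) {f g h : ℝ → ℂ} (hw : IsWave f g h)
    (i : Fin n) (hB : ∀ s, h s = -B i * f s) (ξ : SF n ι) (x : Pt n) :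
    lieDer B Γ (wave f g i) ξ x = f (x im) • pd (it i) ξ x - (g (x im) * x (it i)) • pd ip ξ x
      - ((1 / 2 : ℂ) * g (x im)) • ((Γ ip * Γ (it i)) *ᵥ ξ x) := by
  have hm := covLow_wave_minus B hw i hB
  unfold lieDer
  rw [spinRep_frame hΓ B _ x (fun j => if j = i then g (x im) else 0) 0]
  · congr 1
    · simp only [Fintype.sum_sum_type, Fin.sum_univ_two]
      simp [wave_plus, wave_minus, wave_tr, nabla_eq hΓ]
      abel
    · simp [Matrix.smul_mulVec, smul_smul]
  · intro a
    rcases a with a | a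
    · fin_cases a
      · exact covLow_wave_plus _ _ _ _ _ _
      · simp [hm]
    · simp [covLow_wave_tr B hw]
  · intro a
    exact covLow_wave_plus _ _ _ _ _ _
  · simp [hm]
  · intro j
    simp [covLow_wave_tr B hw]
  · intro j
    simp [hm]
    split_ifs <;> simp
  · intro j k
    simp [covLow_wave_tr B hw]

theorem lieDer_rot (hΓ : IsClifford Γ) (B : Fin n → ℝ) (lam : Fin n → ℂ) {i j : Fin n}
    (hB : B i = B j) (ξ : SF n ι) (x : Pt n) :
    lieDer B Γ (gen lam (Gen.rot i j)) ξ x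
      = (x (it j) : ℂ) • pd (it i) ξ x - (x (it i) : ℂ) • pd (it j) ξ x
        + ((1 / 4 : ℂ) • (Γ (it i) * Γ (it j) - Γ (it j) * Γ (it i))) *ᵥ ξ x := by
  have hm := covLow_rot_minus B lam hB
  unfold lieDer
  rw [spinRep_frame hΓ B _ x 0 (fun k l => (if l = i then (if j = k then 1 else 0) else 0)
      - (if l = j then (if i = k then 1 else 0) else 0))]
  · rw [sub_eq_add_neg, ← Matrix.neg_mulVec]
    congr 1
    · simp only [Fintype.sum_sum_type, Fin.sum_univ_two]
      simp [rot_inl, rot_tr, nabla_eq hΓ, sub_smul, Finset.sum_sub_distrib]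
    · congr 1
      simp [sub_smul, Finset.sum_sub_distrib]
  · intro a
    rcases a with a | a
    · fin_cases a
      · exact covLow_rot_plus _ _ _ _ _ _
      · simp [hm]
    · simp [covLow_rot_tr]
  · intro a
    exact covLow_rot_plus _ _ _ _ _ _
  · simp [hm]
  · intro k
    simp [covLow_rot_tr]
  · intro k
    simp [hm]
  · intro k l
    simp [covLow_rot_tr]

theorem spinRep_add (A A' : Idx n → Idx n → ℂ) :
    spinRep Γ (fun a b => A a b + A' a b) = spinRep Γ A + spinRep Γ A' := by
  simp only [spinRep, add_smul, Finset.sum_add_distrib, smul_add]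

theorem spinRep_smul (k : ℂ) (A : Idx n → Idx n → ℂ) :
    spinRep Γ (fun a b => k * A a b) = k • spinRep Γ A := by
  simp only [spinRep, Finset.smul_sum, smul_smul]
  refine Finset.sum_congr rfl fun a _ => Finset.sum_congr rfl fun b _ => ?_
  congr 1
  ring

theorem lieDer_add_left (B : Fin n → ℝ) {X Y : VF n} (hX : ContDiff ℝ ∞ X) (hY : ContDiff ℝ ∞ Y)
    (ξ : SF n ι) : lieDer B Γ (X + Y) ξ = lieDer B Γ X ξ + lieDer B Γ Y ξ := by
  funext x
  simp only [lieDer, covLow_add B hX hY, mul_add, Finset.sum_add_distrib, Pi.add_apply, add_smul,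
    spinRep_add, Matrix.add_mulVec]
  abel

theorem lieDer_smul_left (B : Fin n → ℝ) (k : ℂ) {X : VF n} (hX : ContDiff ℝ ∞ X)
    (ξ : SF n ι) : lieDer B Γ (k • X) ξ = k • lieDer B Γ X ξ := by
  funext x
  have e : ∀ b c, ∑ a, ∑ d, frame B b x a * frame B c x d * (k * covLow B X x a d)
      = k * ∑ a, ∑ d, frame B b x a * frame B c x d * covLow B X x a d := by
    intro b c
    simp only [Finset.mul_sum]
    refine Finset.sum_congr rfl fun a _ => Finset.sum_congr rfl fun d _ => ?_
    ring
  simp only [lieDer, covLow_smul B k hX, e, spinRep_smul, Pi.smul_apply, smul_sub, Finset.smul_sum,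
    smul_smul, Matrix.smul_mulVec, smul_eq_mul]

theorem lieDer_zero_left (B : Fin n → ℝ) (ξ : SF n ι) : lieDer B Γ 0 ξ = 0 := by
  have := lieDer_smul_left (Γ := Γ) B 0 (X := 0) contDiff_const ξ
  simpa using this

theorem lieDer_add_right (B : Fin n → ℝ) (X : VF n) {ξ η : SF n ι} (hξ : ContDiff ℝ ∞ ξ)
    (hη : ContDiff ℝ ∞ η) : lieDer B Γ X (ξ + η) = lieDer B Γ X ξ + lieDer B Γ X η := by
  funext x
  simp only [lieDer, nabla, pd_add hξ hη, Pi.add_apply, Matrix.mulVec_add, smul_add,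
    Finset.sum_add_distrib]
  abel

theorem lieDer_smul_right (B : Fin n → ℝ) (X : VF n) (k : ℂ) {ξ : SF n ι} (hξ : ContDiff ℝ ∞ ξ) :
    lieDer B Γ X (k • ξ) = k • lieDer B Γ X ξ := by
  funext x
  simp only [lieDer, nabla, pd_smul hξ, Pi.smul_apply, Matrix.mulVec_smul, smul_sub,
    Finset.smul_sum, ← smul_add, smul_comm k]

end SpinConnection

/-! ## Matrix-valued functions -/

section MatrixFunctions

variable {n : ℕ} {ι : Type} [Fintype ι] [DecidableEq ι]

/-- The matrix function `M` is smooth with partial derivative `M'` at `x`. -/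
def HasPd (a : Idx n) (M : Pt n → Matrix ι ι ℂ) (M' : Matrix ι ι ℂ) (x : Pt n) : Prop :=
  ∀ i j, ContDiff ℝ ∞ (fun y => M y i j) ∧ pd a (fun y => M y i j) x = M' i j

variable {a : Idx n} {x : Pt n} {M N : Pt n → Matrix ι ι ℂ} {M' N' : Matrix ι ι ℂ}

theorem HasPd.differentiableAt (h : HasPd a M M' x) (i j : ι) (y : Pt n) :
    DifferentiableAt ℝ (fun y => M y i j) y :=
  (h i j).1.differentiable (by simp) y

theorem HasPd.congr (h : HasPd a M M' x) (e : N' = M') : HasPd a M N' x := e ▸ h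

theorem HasPd.const (K : Matrix ι ι ℂ) : HasPd a (fun _ => K) 0 x :=
  fun i j => ⟨contDiff_const, pd_const a (K i j) x⟩

theorem HasPd.add (hM : HasPd a M M' x) (hN : HasPd a N N' x) :
    HasPd a (fun y => M y + N y) (M' + N') x := by
  intro i j
  refine ⟨(hM i j).1.add (hN i j).1, ?_⟩
  simp only [Matrix.add_apply]
  rw [pd_add_fun (hM.differentiableAt i j x) (hN.differentiableAt i j x), (hM i j).2, (hN i j).2]

theorem HasPd.sub (hM : HasPd a M M' x) (hN : HasPd a N N' x) :
    HasPd a (fun y => M y - N y) (M' - N') x := by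
  intro i j
  refine ⟨(hM i j).1.sub (hN i j).1, ?_⟩
  simp only [Matrix.sub_apply]
  rw [pd_sub_fun (hM.differentiableAt i j x) (hN.differentiableAt i j x), (hM i j).2, (hN i j).2]

theorem HasPd.mul (hM : HasPd a M M' x) (hN : HasPd a N N' x) :
    HasPd a (fun y => M y * N y) (M' * N x + M x * N') x := by
  intro i j
  constructor
  · simp only [Matrix.mul_apply]
    exact ContDiff.sum fun k _ => (hM i k).1.mul (hN k j).1
  · simp only [Matrix.mul_apply, Matrix.add_apply]
    rw [pd_sum_fun (f := fun k y => M y i k * N y k j) Finset.univ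
        fun k _ => (hM.differentiableAt i k x).mul (hN.differentiableAt k j x),
      ← Finset.sum_add_distrib]
    refine Finset.sum_congr rfl fun k _ => ?_
    rw [pd_mul (hM.differentiableAt i k x) (hN.differentiableAt k j x), (hM i k).2, (hN k j).2]
    ring

theorem HasPd.smul_const {f : Pt n → ℂ} {f' : ℂ} (hf : ContDiff ℝ ∞ f) (hf' : pd a f x = f')
    (K : Matrix ι ι ℂ) : HasPd a (fun y => f y • K) (f' • K) x := by
  intro i j
  refine ⟨hf.mul contDiff_const, ?_⟩
  simp only [Matrix.smul_apply, smul_eq_mul]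
  rw [pd_mul (hf.differentiable (by simp) x) (differentiableAt_const _), pd_const, hf']
  ring

theorem HasPd.sum {κ : Type} [Fintype κ] {M : κ → Pt n → Matrix ι ι ℂ} {M' : κ → Matrix ι ι ℂ}
    (h : ∀ k, HasPd a (M k) (M' k) x) :
    HasPd a (fun y => ∑ k, M k y) (∑ k, M' k) x := by
  intro i j
  simp only [Matrix.sum_apply]
  refine ⟨ContDiff.sum fun k _ => (h k i j).1, ?_⟩
  rw [pd_sum_fun _ fun k _ => (h k).differentiableAt i j x]
  exact Finset.sum_congr rfl fun k _ => (h k i j).2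

theorem HasPd.contDiff_mulVec (hM : HasPd a M M' x) {ξ : SF n ι} (hξ : ContDiff ℝ ∞ ξ) :
    ContDiff ℝ ∞ (fun y => M y *ᵥ ξ y) := by
  rw [contDiff_pi]
  intro i
  simp only [Matrix.mulVec, dotProduct]
  exact ContDiff.sum fun k _ => (hM i k).1.mul (contDiff_pi.1 hξ k)

theorem HasPd.pd_mulVec (hM : HasPd a M M' x) {ξ : SF n ι} (hξ : ContDiff ℝ ∞ ξ) :
    pd a (fun y => M y *ᵥ ξ y) x = M' *ᵥ ξ x + M x *ᵥ pd a ξ x := by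
  have hd := (hM.contDiff_mulVec hξ).differentiable (by simp) x
  have hξd := hξ.differentiable (by simp) x
  funext i
  rw [← pd_apply hd i]
  have hk : ∀ k, DifferentiableAt ℝ (fun y => ξ y k) x := fun k => differentiableAt_pi.1 hξd k
  simp only [Matrix.mulVec, dotProduct, Pi.add_apply]
  rw [pd_sum_fun (f := fun k y => M y i k * ξ y k) Finset.univ
    fun k _ => (hM.differentiableAt i k x).mul (hk k), ← Finset.sum_add_distrib]
  refine Finset.sum_congr rfl fun k _ => ?_
  rw [pd_mul (hM.differentiableAt i k x) (hk k), (hM i k).2, pd_apply hξd]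
  ring

end MatrixFunctions

/-! ## Connections with `d = 0` and `c² = α²` -/

section Trivialization

variable {n : ℕ} {ι : Type} [Fintype ι] [DecidableEq ι]

/-- Hypotheses under which the connection with `d = 0` on the space with `B = -α²` is flat. -/
structure IsSquareRoot (Γ : Idx n → Matrix ι ι ℂ) (c : Matrix ι ι ℂ) (α : ℝ) : Prop where
  clifford : IsClifford Γ
  comm_plus : Commute c (Γ ip)
  comm_minus : Commute c (Γ im)
  sq : c * c = ((α : ℂ) ^ 2) • 1
  ne_zero : (α : ℂ) ≠ 0

namespace IsClifford

variable {Γ : Idx n → Matrix ι ι ℂ} (h : IsClifford Γ)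
include h

theorem sigP_add_sigM : sigP Γ + sigM Γ = 1 := by
  rw [sigP, sigM, ← smul_add, add_comm, h.plus_minus, smul_smul]
  norm_num

theorem sigM_eq : sigM Γ = 1 - sigP Γ := eq_sub_of_add_eq' h.sigP_add_sigM

theorem plus_sigM : Γ ip * sigM Γ = 0 := by
  rw [sigM, mul_smul_comm, ← mul_assoc, h.plus_sq, zero_mul, smul_zero]

theorem sigP_plus : sigP Γ * Γ ip = 0 := by
  rw [sigP, smul_mul_assoc, mul_assoc, h.plus_sq, mul_zero, smul_zero]

theorem plus_sigP : Γ ip * sigP Γ = Γ ip := by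
  have := h.plus_sigM
  rw [h.sigM_eq, mul_sub, mul_one, sub_eq_zero] at this
  exact this.symm

theorem sigM_plus : sigM Γ * Γ ip = Γ ip := by
  rw [h.sigM_eq, sub_mul, one_mul, h.sigP_plus, sub_zero]

theorem sigP_sigM : sigP Γ * sigM Γ = 0 := by
  rw [sigP, smul_mul_assoc, mul_assoc, h.plus_sigM, mul_zero, smul_zero]

theorem sigP_sigP : sigP Γ * sigP Γ = sigP Γ := by
  have := h.sigP_sigM
  rw [h.sigM_eq, mul_sub, mul_one, sub_eq_zero] at this
  exact this.symm

theorem sigM_sigP : sigM Γ * sigP Γ = 0 := by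
  rw [h.sigM_eq, sub_mul, one_mul, h.sigP_sigP, sub_self]

theorem sigM_sigM : sigM Γ * sigM Γ = sigM Γ := by
  nth_rewrite 2 [h.sigM_eq]
  rw [mul_sub, mul_one, h.sigM_sigP, sub_zero]

theorem commute_tr_sigP (i : Fin n) : Commute (Γ (it i)) (sigP Γ) := by
  have h1 := h.tr_inl i 0
  have h2 := h.tr_inl i 1
  rw [sigP]
  refine Commute.smul_right ?_ _
  show Γ (it i) * (Γ im * Γ ip) = Γ im * Γ ip * Γ (it i)
  rw [← mul_assoc, h2, neg_mul, mul_assoc, h1, mul_neg, neg_neg, mul_assoc]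

theorem commute_tr_sigM (i : Fin n) : Commute (Γ (it i)) (sigM Γ) := by
  rw [h.sigM_eq]
  exact (Commute.one_right _).sub_right (h.commute_tr_sigP i)

/-- The action of a rotation generator on spinors. -/
theorem rotation_comm (i j k : Fin n) :
    (1 / 4 : ℂ) • (Γ (it i) * Γ (it j) - Γ (it j) * Γ (it i)) * Γ (it k)
      - Γ (it k) * ((1 / 4 : ℂ) • (Γ (it i) * Γ (it j) - Γ (it j) * Γ (it i)))
      = (if i = k then 1 else 0 : ℂ) • Γ (it j) - (if j = k then 1 else 0 : ℂ) • Γ (it i) := by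
  have e : ∀ a b : Fin n, Γ (it a) * Γ (it b)
      = (if a = b then (-2 : ℂ) else 0) • 1 - Γ (it b) * Γ (it a) :=
    fun a b => eq_sub_of_add_eq (h.tr_tr a b)
  have e3 : ∀ a b : Fin n, Γ (it a) * Γ (it b) * Γ (it k) = Γ (it k) * (Γ (it a) * Γ (it b))
      + (if b = k then (-2 : ℂ) else 0) • Γ (it a) - (if a = k then (-2 : ℂ) else 0) • Γ (it b) := by
    intro a b
    rw [mul_assoc, e b k, mul_sub, ← mul_assoc, e a k, sub_mul, mul_assoc]
    simp
    abel
  rw [smul_mul_assoc, sub_mul, e3, e3, mul_smul_comm, mul_sub, ← smul_sub]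
  split_ifs <;> module

end IsClifford

/-- The part `½ Γ_+ c Γ_i` of the connection. -/
def tilt (Γ : Idx n → Matrix ι ι ℂ) (c : Matrix ι ι ℂ) (i : Fin n) : Matrix ι ι ℂ :=
  (1 / 2 : ℂ) • (Γ ip * c * Γ (it i))

/-- The linear part `∑ xⁱ ½ Γ_+ c Γ_i` of a parallel section. -/
def tiltSum (Γ : Idx n → Matrix ι ι ℂ) (c : Matrix ι ι ℂ) (x : Pt n) : Matrix ι ι ℂ :=
  ∑ i, (x (it i) : ℂ) • tilt Γ c i

/-- `exp (s c)` for `c² = α²`. -/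
def expMat (c : Matrix ι ι ℂ) (α : ℝ) (s : ℝ) : Matrix ι ι ℂ :=
  Complex.cosh (α * s) • 1 + Complex.sinh (α * s) • ((1 / (α : ℂ)) • c)

/-- Parallel transport from the origin. -/
def trans (Γ : Idx n → Matrix ι ι ℂ) (c : Matrix ι ι ℂ) (α : ℝ) (x : Pt n) : Matrix ι ι ℂ :=
  sigP Γ + expMat c α (-x im) * sigM Γ + tiltSum Γ c x

/-- Parallel transport to the origin. -/
def untrans (Γ : Idx n → Matrix ι ι ℂ) (c : Matrix ι ι ℂ) (α : ℝ) (x : Pt n) : Matrix ι ι ℂ :=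
  sigP Γ + expMat c α (x im) * (sigM Γ - tiltSum Γ c x)

theorem hasDerivAt_cosh_mul (α s : ℝ) :
    HasDerivAt (fun s : ℝ => Complex.cosh (α * s)) (α * Complex.sinh (α * s)) s := by
  have h1 : HasDerivAt (fun z : ℂ => (α : ℂ) * z) α (s : ℂ) := by
    simpa using (hasDerivAt_id (s : ℂ)).const_mul (α : ℂ)
  have h := h1.ccosh.comp_ofReal
  rwa [mul_comm] at h

theorem hasDerivAt_sinh_mul (α s : ℝ) :
    HasDerivAt (fun s : ℝ => Complex.sinh (α * s)) (α * Complex.cosh (α * s)) s := by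
  have h1 : HasDerivAt (fun z : ℂ => (α : ℂ) * z) α (s : ℂ) := by
    simpa using (hasDerivAt_id (s : ℂ)).const_mul (α : ℂ)
  have h := h1.csinh.comp_ofReal
  rwa [mul_comm] at h

theorem contDiff_cosh_mul (α : ℝ) : ContDiff ℝ ∞ (fun s : ℝ => Complex.cosh (α * s)) :=
  (Complex.contDiff_cosh.restrict_scalars ℝ).comp (contDiff_const.mul Complex.ofRealCLM.contDiff)

theorem contDiff_sinh_mul (α : ℝ) : ContDiff ℝ ∞ (fun s : ℝ => Complex.sinh (α * s)) :=
  (Complex.contDiff_sinh.restrict_scalars ℝ).comp (contDiff_const.mul Complex.ofRealCLM.contDiff)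

namespace IsSquareRoot

variable {Γ : Idx n → Matrix ι ι ℂ} {c : Matrix ι ι ℂ} {α : ℝ} (h : IsSquareRoot Γ c α)
include h

theorem commute_sigP : Commute c (sigP Γ) :=
  (h.comm_minus.mul_right h.comm_plus).smul_right _

theorem commute_sigM : Commute c (sigM Γ) :=
  (h.comm_plus.mul_right h.comm_minus).smul_right _

theorem c_mul_c_mul (M : Matrix ι ι ℂ) : c * (c * M) = ((α : ℂ) ^ 2) • M := by
  rw [← mul_assoc, h.sq, smul_mul_assoc, one_mul]

theorem expMat_comm_sigM (s : ℝ) : Commute (expMat c α s) (sigM Γ) :=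
  ((Commute.one_left _).smul_left _).add_left ((h.commute_sigM.smul_left _).smul_left _)

/-- Since `c² = α²`, this is `cosh² - sinh² = 1`; the cross terms cancel. -/
theorem expMat_neg_mul (s : ℝ) : expMat c α (-s) * expMat c α s = 1 := by
  have h1 := Complex.cosh_sq_sub_sinh_sq ((α : ℂ) * s)
  have hα := h.ne_zero
  simp only [expMat, Complex.ofReal_neg, mul_neg, Complex.cosh_neg, Complex.sinh_neg, add_mul,
    mul_add, smul_mul_assoc, mul_smul_comm, one_mul, mul_one, h.sq, smul_smul, neg_smul, neg_mul]
  match_scalars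
  · field_simp
    linear_combination h1
  · ring

/-- `c` and `Γ_i` preserve the splitting into `S_±`, while `Γ_+` kills `S_-` and has image in `S_-`.
Together with `sigM_tilt` this makes any product of two tilts vanish, so the dependence of parallel
sections on the `xⁱ` is linear. -/
theorem tilt_sigM (i : Fin n) : tilt Γ c i * sigM Γ = 0 := by
  rw [tilt, smul_mul_assoc, mul_assoc, (h.clifford.commute_tr_sigM i).eq, mul_assoc, ← mul_assoc c,
    h.commute_sigM.eq, ← mul_assoc, ← mul_assoc, h.clifford.plus_sigM, zero_mul, zero_mul, smul_zero]

theorem sigM_tilt (i : Fin n) : sigM Γ * tilt Γ c i = tilt Γ c i := by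
  rw [tilt, mul_smul_comm, ← mul_assoc, ← mul_assoc, h.clifford.sigM_plus]

theorem tiltSum_sigM (x : Pt n) : tiltSum Γ c x * sigM Γ = 0 := by
  simp [tiltSum, Finset.sum_mul, h.tilt_sigM]

theorem sigM_tiltSum (x : Pt n) : sigM Γ * tiltSum Γ c x = tiltSum Γ c x := by
  simp [tiltSum, Finset.mul_sum, h.sigM_tilt]

/-- Parallel transport acts on `S_-` by `exp (-x⁻ c)`. -/
theorem trans_mul {M : Matrix ι ι ℂ} (hM : sigM Γ * M = M) (x : Pt n) :
    trans Γ c α x * M = expMat c α (-x im) * M := by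
  have h1 : sigP Γ * M = 0 := by rw [← hM, ← mul_assoc, h.clifford.sigP_sigM, zero_mul]
  have h2 : tiltSum Γ c x * M = 0 := by rw [← hM, ← mul_assoc, h.tiltSum_sigM, zero_mul]
  rw [trans, add_mul, add_mul, h1, h2, mul_assoc, hM, zero_add, add_zero]

theorem sigM_mul_expMat_mul {M : Matrix ι ι ℂ} (hM : sigM Γ * M = M) (s : ℝ) :
    sigM Γ * (expMat c α s * M) = expMat c α s * M := by
  rw [← mul_assoc, ← (h.expMat_comm_sigM s).eq, mul_assoc, hM]

theorem trans_mul_expMat_mul {M : Matrix ι ι ℂ} (hM : sigM Γ * M = M) (x : Pt n) :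
    trans Γ c α x * (expMat c α (x im) * M) = M := by
  rw [h.trans_mul (h.sigM_mul_expMat_mul hM _), ← mul_assoc, h.expMat_neg_mul, one_mul]

theorem sigM_mul_shift (x : Pt n) :
    sigM Γ * (sigM Γ - tiltSum Γ c x) = sigM Γ - tiltSum Γ c x := by
  rw [mul_sub, h.clifford.sigM_sigM, h.sigM_tiltSum]

theorem trans_sigP (x : Pt n) : trans Γ c α x * sigP Γ = sigP Γ + tiltSum Γ c x := by
  rw [trans, add_mul, add_mul, h.clifford.sigP_sigP, mul_assoc, h.clifford.sigM_sigP, mul_zero,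
    add_zero]
  congr 1
  have := h.tiltSum_sigM x
  rw [h.clifford.sigM_eq, mul_sub, mul_one, sub_eq_zero] at this
  exact this.symm

/-- In block form transport is triangular: the identity on `S_+`, `exp(-x⁻c)` on `S_-`, and the tilt
from `S_+` to `S_-`. It is inverted block by block. -/
theorem trans_untrans (x : Pt n) : trans Γ c α x * untrans Γ c α x = 1 := by
  rw [untrans, mul_add, h.trans_sigP, h.trans_mul_expMat_mul (h.sigM_mul_shift x),
    ← h.clifford.sigP_add_sigM]
  abel

theorem untrans_trans (x : Pt n) : untrans Γ c α x * trans Γ c α x = 1 :=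
  mul_eq_one_comm.1 (h.trans_untrans x)

theorem hasPd_expMat (a : Idx n) (x : Pt n) :
    HasPd a (fun y => expMat c α (y im)) ((if im = a then 1 else 0 : ℂ) • (c * expMat c α (x im)))
      x := by
  have hc := pd_comp_coord (n := n) a (b := im) (x := x) (hasDerivAt_cosh_mul α (x im))
  have hs := pd_comp_coord (n := n) a (b := im) (x := x) (hasDerivAt_sinh_mul α (x im))
  have hm : ContDiff ℝ ∞ (fun y : Pt n => y im) := contDiff_apply ℝ ℝ im
  have h1 := (HasPd.smul_const ((contDiff_cosh_mul α).comp hm) hc (1 : Matrix ι ι ℂ)).add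
    (HasPd.smul_const ((contDiff_sinh_mul α).comp hm) hs ((1 / (α : ℂ)) • c))
  have hα := h.ne_zero
  refine HasPd.congr h1 ?_
  split_ifs
  · simp only [expMat, mul_add, mul_smul_comm, h.sq, mul_one, smul_smul]
    match_scalars
    · field_simp
    · field_simp
  · simp

theorem hasPd_tiltSum (a : Idx n) (x : Pt n) :
    HasPd a (fun y => tiltSum Γ c y) (∑ i, (if it i = a then 1 else 0 : ℂ) • tilt Γ c i) x :=
  HasPd.sum fun i => HasPd.smul_const (contDiff_ofReal_coord _) (pd_ofReal_coord a (it i) x) _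

theorem hasPd_untrans (a : Idx n) (x : Pt n) :
    HasPd a (fun y => untrans Γ c α y)
      (expMat c α (x im) * ((if im = a then 1 else 0 : ℂ) • (c * (sigM Γ - tiltSum Γ c x))
        - ∑ i, (if it i = a then 1 else 0 : ℂ) • tilt Γ c i)) x := by
  have h1 := (HasPd.const (a := a) (x := x) (sigP Γ)).add ((h.hasPd_expMat a x).mul
    ((HasPd.const (sigM Γ)).sub (h.hasPd_tiltSum a x)))
  have hcomm : Commute c (expMat c α (x im)) :=
    ((Commute.one_right _).smul_right _).add_right
      (((Commute.refl c).smul_right _).smul_right _)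
  refine HasPd.congr h1 ?_
  simp only [zero_add, mul_add, mul_neg, smul_mul_assoc, mul_smul_comm, hcomm.eq, mul_assoc,
    sub_eq_add_neg, smul_add, smul_neg]

theorem hasPd_trans (a : Idx n) (x : Pt n) :
    HasPd a (fun y => trans Γ c α y)
      (-((if im = a then 1 else 0 : ℂ) • (c * expMat c α (-x im) * sigM Γ))
        + ∑ i, (if it i = a then 1 else 0 : ℂ) • tilt Γ c i) x := by
  have hm : HasPd a (fun y : Pt n => expMat c α (-y im))
      (-((if im = a then 1 else 0 : ℂ) • (c * expMat c α (-x im)))) x := by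
    have hc := pd_comp_coord (n := n) a (b := im) (x := x) (hasDerivAt_cosh_mul α (x im))
    have hs := pd_comp_coord (n := n) a (b := im) (x := x) (hasDerivAt_sinh_mul α (x im))
    have hm : ContDiff ℝ ∞ (fun y : Pt n => y im) := contDiff_apply ℝ ℝ im
    have h1 := (HasPd.smul_const ((contDiff_cosh_mul α).comp hm) hc (1 : Matrix ι ι ℂ)).sub
      (HasPd.smul_const ((contDiff_sinh_mul α).comp hm) hs ((1 / (α : ℂ)) • c))
    have hα := h.ne_zero
    have e : (fun y : Pt n => expMat c α (-y im)) = fun y =>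
        Complex.cosh (α * (y im : ℝ)) • (1 : Matrix ι ι ℂ)
          - Complex.sinh (α * (y im : ℝ)) • ((1 / (α : ℂ)) • c) := by
      funext y
      simp [expMat, sub_eq_add_neg]
    rw [e]
    refine HasPd.congr h1 ?_
    · split_ifs
      · simp only [expMat, mul_add, mul_smul_comm, h.sq, mul_one, smul_smul,
          Complex.ofReal_neg, mul_neg, Complex.cosh_neg, Complex.sinh_neg]
        match_scalars
        · field_simp
        · field_simp
      · simp
  have h1 := ((HasPd.const (a := a) (x := x) (sigP Γ)).add (hm.mul (HasPd.const (sigM Γ)))).add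
    (h.hasPd_tiltSum a x)
  refine HasPd.congr h1 ?_
  simp

/-- The connection in the parallel frame. -/
theorem conn_eq (a : Idx n) {ξ : SF n ι} (hξ : ContDiff ℝ ∞ ξ) (x : Pt n) :
    conn (fun _ => -α ^ 2) Γ c 0 a ξ x
      = trans Γ c α x *ᵥ pd a (fun y => untrans Γ c α y *ᵥ ξ y) x := by
  have hshift := h.sigM_mul_shift x
  have hcshift : sigM Γ * (c * (sigM Γ - tiltSum Γ c x)) = c * (sigM Γ - tiltSum Γ c x) := by
    rw [← mul_assoc, ← h.commute_sigM.eq, mul_assoc, hshift]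
  rw [(h.hasPd_untrans a x).pd_mulVec hξ, Matrix.mulVec_add, Matrix.mulVec_mulVec,
    Matrix.mulVec_mulVec, h.trans_untrans, Matrix.one_mulVec]
  rcases a with a | i
  · fin_cases a
    · simp [conn, nabla_eq h.clifford]
    · have e : trans Γ c α x * (expMat c α (x im) * (c * (sigM Γ - tiltSum Γ c x)))
          = c * (sigM Γ - tiltSum Γ c x) := h.trans_mul_expMat_mul hcshift x
      -- This is where `c² = α²` meets the curvature of the space: differentiating the tilt produces
      -- exactly the spin connection term for `B = -α²`.
      have e2 : c * tiltSum Γ c x = (1 / 2 : ℂ) • ∑ i, ((α : ℂ) ^ 2 * x (it i)) • (Γ ip * Γ (it i)) := by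
        simp only [tiltSum, tilt, Finset.mul_sum, Finset.smul_sum, mul_smul_comm, smul_smul]
        refine Finset.sum_congr rfl fun i _ => ?_
        rw [← mul_assoc, ← mul_assoc, h.comm_plus.eq, mul_assoc (Γ ip), h.sq]
        rw [mul_smul_comm, smul_mul_assoc, mul_one, smul_smul]
        congr 1
        ring
      simp only [Fin.mk_one, conn, nabla_eq h.clifford, if_true, zero_mul, add_zero]
      simp only [one_smul, reduceCtorEq, if_false, zero_smul, Finset.sum_const_zero, sub_zero]
      rw [e, mul_sub, e2, Matrix.sub_mulVec]
      simp only [Complex.ofReal_neg, Complex.ofReal_pow, neg_mul, neg_smul, Finset.sum_neg_distrib,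
        smul_neg, Matrix.neg_mulVec]
      abel
  · have e : trans Γ c α x * (expMat c α (x im) * tilt Γ c i) = tilt Γ c i :=
      h.trans_mul_expMat_mul (h.sigM_tilt i) x
    have e2 : Γ ip * (c * Γ (it i)) * sigP Γ = Γ ip * c * Γ (it i) := by
      rw [mul_assoc, mul_assoc c, (h.clifford.commute_tr_sigP i).eq, ← mul_assoc c,
        h.commute_sigP.eq, mul_assoc, ← mul_assoc (Γ ip), h.clifford.plus_sigP, mul_assoc]
    simp only [conn, nabla_eq h.clifford, reduceCtorEq, if_false, Matrix.zero_mulVec, add_zero,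
      mul_zero, sub_zero, zero_smul, zero_sub, Sum.inr.injEq, ite_smul, one_smul, Finset.sum_ite_eq',
      Finset.mem_univ, if_true, mul_neg, e, Matrix.neg_mulVec, e2]
    rw [tilt, Matrix.smul_mulVec]
    abel

/-- By `conn_eq` each `D_a` is `∂_a` conjugated by the transport matrix. In a composite the inner
matrices cancel, and mixed partial derivatives commute. -/
theorem isFlat : IsFlat (fun _ => -α ^ 2) Γ c 0 := by
  have key : ∀ (ξ : SF n ι), ContDiff ℝ ∞ ξ → ∀ a b x,
      conn (fun _ => -α ^ 2) Γ c 0 a (conn (fun _ => -α ^ 2) Γ c 0 b ξ) x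
        = trans Γ c α x *ᵥ pd a (fun y => pd b (fun z => untrans Γ c α z *ᵥ ξ z) y) x := by
    intro ξ hξ a b x
    have hF : ContDiff ℝ ∞ (fun y => untrans Γ c α y *ᵥ ξ y) :=
      (h.hasPd_untrans a x).contDiff_mulVec hξ
    have hb : conn (fun _ => -α ^ 2) Γ c 0 b ξ
        = fun y => trans Γ c α y *ᵥ pd b (fun z => untrans Γ c α z *ᵥ ξ z) y := by
      funext y; exact h.conn_eq b hξ y
    have hsm : ContDiff ℝ ∞ (conn (fun _ => -α ^ 2) Γ c 0 b ξ) := by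
      rw [hb]
      exact (h.hasPd_trans a x).contDiff_mulVec (contDiff_pd b hF)
    rw [h.conn_eq a hsm, hb]
    simp only [Matrix.mulVec_mulVec, h.untrans_trans, Matrix.one_mulVec]
  intro ξ hξ a b
  funext x
  rw [key ξ hξ a b x, key ξ hξ b a x,
    pd_comm a b ((h.hasPd_untrans a x).contDiff_mulVec hξ)]

end IsSquareRoot

/-- The parallel section with value `v` at the origin. -/
def par (Γ : Idx n → Matrix ι ι ℂ) (c : Matrix ι ι ℂ) (α : ℝ) (v : ι → ℂ) : SF n ι :=
  fun x => trans Γ c α x *ᵥ v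

namespace IsSquareRoot

variable {Γ : Idx n → Matrix ι ι ℂ} {c : Matrix ι ι ℂ} {α : ℝ} (h : IsSquareRoot Γ c α)
include h

theorem contDiff_par (v : ι → ℂ) : ContDiff ℝ ∞ (par Γ c α v) :=
  (h.hasPd_trans ip 0).contDiff_mulVec contDiff_const

theorem trans_zero : trans Γ c α 0 = 1 := by
  simp [trans, tiltSum, expMat, h.clifford.sigP_add_sigM]

theorem par_zero (v : ι → ℂ) : par Γ c α v 0 = v := by
  rw [par, h.trans_zero, Matrix.one_mulVec]

theorem par_mem (v : ι → ℂ) : par Γ c α v ∈ parallel (fun _ => -α ^ 2) Γ c 0 := by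
  refine ⟨h.contDiff_par v, fun a => ?_⟩
  funext x
  rw [h.conn_eq a (h.contDiff_par v)]
  simp only [par, Matrix.mulVec_mulVec, h.untrans_trans, Matrix.one_mulVec, pd_const,
    Matrix.mulVec_zero]
  rfl

/-- Transported back to the origin, a parallel section has zero derivative everywhere, hence is
constant on `ℝⁿ⁺²`. -/
theorem eq_par {ξ : SF n ι} (hξ : ξ ∈ parallel (fun _ => -α ^ 2) Γ c 0) :
    ξ = par Γ c α (ξ 0) := by
  obtain ⟨hs, hp⟩ := hξ
  have hF : ContDiff ℝ ∞ (fun y => untrans Γ c α y *ᵥ ξ y) :=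
    (h.hasPd_untrans ip 0).contDiff_mulVec hs
  have hz : ∀ x, fderiv ℝ (fun y => untrans Γ c α y *ᵥ ξ y) x = 0 := by
    intro x
    refine fderiv_eq_zero_of_pd fun a => ?_
    have h1 := h.conn_eq a hs x
    rw [hp a] at h1
    have h2 := congrArg (fun v => untrans Γ c α x *ᵥ v) h1
    simpa only [Matrix.mulVec_mulVec, h.untrans_trans, Matrix.one_mulVec, Pi.zero_apply,
      Matrix.mulVec_zero, eq_comm] using h2
  have hc := is_const_of_fderiv_eq_zero (hF.differentiable (by simp)) hz
  funext x
  have h3 := congrArg (fun v => trans Γ c α x *ᵥ v) (hc x 0)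
  have h4 : untrans Γ c α 0 = 1 := by
    have := h.trans_untrans 0
    rwa [h.trans_zero, one_mul] at this
  simp only [Matrix.mulVec_mulVec, h.trans_untrans, Matrix.one_mulVec, h4] at h3
  exact h3

/-- Parallel sections correspond to their values at the origin. -/
def parallelEquiv : parallel (fun _ => -α ^ 2) Γ c 0 ≃ₗ[ℂ] (ι → ℂ) where
  toFun ξ := (ξ : SF n ι) 0
  map_add' _ _ := rfl
  map_smul' _ _ := rfl
  invFun v := ⟨par Γ c α v, h.par_mem v⟩
  left_inv ξ := Subtype.ext (h.eq_par ξ.2).symm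
  right_inv v := h.par_zero v

theorem pd_par (a : Idx n) (v : ι → ℂ) (x : Pt n) :
    pd a (par Γ c α v) x = (-((if im = a then 1 else 0 : ℂ) • (c * expMat c α (-x im) * sigM Γ))
        + ∑ i, (if it i = a then 1 else 0 : ℂ) • tilt Γ c i) *ᵥ v := by
  have := (h.hasPd_trans a x).pd_mulVec (contDiff_const (c := v))
  rw [pd_const, Matrix.mulVec_zero, add_zero] at this
  exact this

end IsSquareRoot

end Trivialization

/-! ## Lie brackets of the generators for `λ_i = -iα` -/

section HyperbolicFields

variable {n : ℕ}

/-- The common frequency `λ_i = -iα`. -/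
def freq (n : ℕ) (α : ℝ) : Fin n → ℂ := fun _ => -Complex.I * (α : ℂ)

theorem freq_sq (α : ℝ) (i : Fin n) : freq n α i ^ 2 = ((-α ^ 2 : ℝ) : ℂ) := by
  simp [freq, mul_pow]

/-- For the imaginary frequency `-iα` the trigonometric profiles become hyperbolic, which matches
the entries of `exp(s c)`. -/
theorem cos_freq (α : ℝ) (i : Fin n) (s : ℝ) :
    Complex.cos (freq n α i * s) = Complex.cosh (α * s) := by
  rw [freq, ← Complex.cos_mul_I, ← Complex.cos_neg]
  congr 1
  ring

theorem sin_freq (α : ℝ) (i : Fin n) (s : ℝ) :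
    -(freq n α i * Complex.sin (freq n α i * s)) = α * Complex.sinh (α * s) := by
  have h : freq n α i * s = -((α * s) * Complex.I) := by rw [freq]; ring
  rw [h, Complex.sin_neg, Complex.sin_mul_I, freq]
  linear_combination (-(α : ℂ) * Complex.sinh (α * s)) * Complex.I_sq

theorem gen_tr_eq (α : ℝ) (i : Fin n) : gen (freq n α) (Gen.tr i)
    = wave (fun s => Complex.cosh (α * s)) (fun s => α * Complex.sinh (α * s)) i := by
  rw [gen_tr_eq_wave]
  simp only [cos_freq, sin_freq]

theorem gen_star_eq (α : ℝ) (i : Fin n) : gen (freq n α) (Gen.star i)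
    = wave (fun s => α * Complex.sinh (α * s)) (fun s => α ^ 2 * Complex.cosh (α * s)) i := by
  rw [gen_star_eq_wave]
  simp only [cos_freq, sin_freq, freq_sq]
  congr 1
  funext s
  push_cast
  ring

theorem isWave_cosh (α : ℝ) : IsWave (fun s : ℝ => Complex.cosh (α * s))
    (fun s => α * Complex.sinh (α * s)) (fun s => α ^ 2 * Complex.cosh (α * s)) := by
  refine ⟨hasDerivAt_cosh_mul α, fun s => ?_⟩
  have := (hasDerivAt_sinh_mul α s).const_mul (α : ℂ)
  rwa [← mul_assoc, ← sq] at this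

theorem isWave_sinh (α : ℝ) : IsWave (fun s : ℝ => α * Complex.sinh (α * s))
    (fun s => α ^ 2 * Complex.cosh (α * s))
    (fun s => α ^ 2 * (α * Complex.sinh (α * s))) :=
  ⟨(isWave_cosh α).2, fun s => (hasDerivAt_cosh_mul α s).const_mul ((α : ℂ) ^ 2)⟩

variable (α : ℝ)

theorem lieBr_minus_tr (i : Fin n) :
    lieBr (gen (freq n α) Gen.minus) (gen (freq n α) (Gen.tr i)) = gen (freq n α) (Gen.star i) := by
  rw [gen_tr_eq, gen_star_eq, lieBr_minus_wave _ (isWave_cosh α)]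

theorem lieBr_minus_star (i : Fin n) :
    lieBr (gen (freq n α) Gen.minus) (gen (freq n α) (Gen.star i))
      = ((α : ℂ) ^ 2) • gen (freq n α) (Gen.tr i) := by
  rw [gen_tr_eq, gen_star_eq, lieBr_minus_wave _ (isWave_sinh α)]
  funext x
  simp only [wave, Pi.smul_apply, smul_add, ← Pi.single_smul, smul_eq_mul]
  ring_nf

theorem lieBr_plus_gen (g : Gen n) : lieBr (gen (freq n α) Gen.plus) (gen (freq n α) g) = 0 := by
  cases g with
  | plus => exact lieBr_self _
  | minus => rw [lieBr_antisymm, lieBr_minus_plus, neg_zero]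
  | tr i => rw [gen_tr_eq]; exact lieBr_plus_wave _ (isWave_cosh α) i
  | star i => rw [gen_star_eq]; exact lieBr_plus_wave _ (isWave_sinh α) i
  | rot i j => exact lieBr_plus_rot _ i j

theorem lieBr_tr_tr (i j : Fin n) :
    lieBr (gen (freq n α) (Gen.tr i)) (gen (freq n α) (Gen.tr j)) = 0 := by
  rw [gen_tr_eq, gen_tr_eq, lieBr_wave_wave (freq n α) (isWave_cosh α) (isWave_cosh α) i j (k := 0)]
  · simp
  · intro s; ring

theorem lieBr_star_star (i j : Fin n) :
    lieBr (gen (freq n α) (Gen.star i)) (gen (freq n α) (Gen.star j)) = 0 := by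
  rw [gen_star_eq, gen_star_eq,
    lieBr_wave_wave (freq n α) (isWave_sinh α) (isWave_sinh α) i j (k := 0)]
  · simp
  · intro s; ring

/-- The Wronskian of the profiles `cosh` and `α sinh` is `α² (sinh² - cosh²) = -α²`. -/
theorem lieBr_tr_star (i j : Fin n) :
    lieBr (gen (freq n α) (Gen.tr i)) (gen (freq n α) (Gen.star j))
      = (if i = j then -(α : ℂ) ^ 2 else 0) • gen (freq n α) Gen.plus := by
  rw [gen_tr_eq, gen_star_eq,
    lieBr_wave_wave (freq n α) (isWave_cosh α) (isWave_sinh α) i j (k := -(α : ℂ) ^ 2)]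
  intro s
  linear_combination (-(α : ℂ) ^ 2) * Complex.cosh_sq_sub_sinh_sq ((α : ℂ) * s)

theorem lieBr_tr_rot (i k l : Fin n) :
    lieBr (gen (freq n α) (Gen.tr i)) (gen (freq n α) (Gen.rot k l))
      = (if i = l then 1 else 0 : ℂ) • gen (freq n α) (Gen.tr k)
        - (if i = k then 1 else 0 : ℂ) • gen (freq n α) (Gen.tr l) := by
  simp only [gen_tr_eq]
  exact lieBr_wave_rot _ (isWave_cosh α) i k l

theorem lieBr_star_rot (i k l : Fin n) :
    lieBr (gen (freq n α) (Gen.star i)) (gen (freq n α) (Gen.rot k l))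
      = (if i = l then 1 else 0 : ℂ) • gen (freq n α) (Gen.star k)
        - (if i = k then 1 else 0 : ℂ) • gen (freq n α) (Gen.star l) := by
  simp only [gen_star_eq]
  exact lieBr_wave_rot _ (isWave_sinh α) i k l

/-- An antisymmetric property of pairs of generators needs to be checked in one order only. -/
theorem Gen.pair_induction {P : Gen n → Gen n → Prop} (hsymm : ∀ g h, P g h → P h g)
    (plus : ∀ g, P Gen.plus g) (mm : P Gen.minus Gen.minus) (mt : ∀ i, P Gen.minus (Gen.tr i))
    (ms : ∀ i, P Gen.minus (Gen.star i)) (mr : ∀ i j, P Gen.minus (Gen.rot i j))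
    (tt : ∀ i j, P (Gen.tr i) (Gen.tr j)) (ts : ∀ i j, P (Gen.tr i) (Gen.star j))
    (tr : ∀ i k l, P (Gen.tr i) (Gen.rot k l)) (ss : ∀ i j, P (Gen.star i) (Gen.star j))
    (sr : ∀ i k l, P (Gen.star i) (Gen.rot k l))
    (rr : ∀ i j k l, P (Gen.rot i j) (Gen.rot k l)) (g h : Gen n) : P g h := by
  cases g <;> cases h
  all_goals first
    | exact plus _ | exact hsymm _ _ (plus _) | exact mm | exact mt _ | exact hsymm _ _ (mt _)
    | exact ms _ | exact hsymm _ _ (ms _) | exact mr _ _ | exact hsymm _ _ (mr _ _)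
    | exact tt _ _ | exact ts _ _ | exact hsymm _ _ (ts _ _) | exact tr _ _ _
    | exact hsymm _ _ (tr _ _ _) | exact ss _ _ | exact sr _ _ _ | exact hsymm _ _ (sr _ _ _)
    | exact rr _ _ _ _

/-- The generators admitted by an equivalence relation on the directions span a Lie algebra. -/
theorem lieBr_gen_mem {r : Fin n → Fin n → Prop} (hr : Equivalence r) {g h : Gen n}
    (hg : g.Admits r) (hh : h.Admits r) :
    lieBr (gen (freq n α) g) (gen (freq n α) h)
      ∈ Submodule.span ℂ (gen (freq n α) '' {g | g.Admits r}) := by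
  set U := Submodule.span ℂ (gen (freq n α) '' {g | g.Admits r})
  have hm : ∀ g : Gen n, g.Admits r → gen (freq n α) g ∈ U :=
    fun g hg => Submodule.subset_span ⟨g, hg, rfl⟩
  have hi : ∀ (p : Prop) [Decidable p] (g : Gen n), (p → g.Admits r) →
      (if p then 1 else 0 : ℂ) • gen (freq n α) g ∈ U := by
    intro p _ g hp
    split_ifs with h
    · exact U.smul_mem _ (hm g (hp h))
    · rw [zero_smul]; exact U.zero_mem
  revert hg hh
  refine Gen.pair_induction (P := fun g h => g.Admits r → h.Admits r →
    lieBr (gen (freq n α) g) (gen (freq n α) h) ∈ U) ?_ ?_ ?_ ?_ ?_ ?_ ?_ ?_ ?_ ?_ ?_ ?_ g h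
  · intro g h hgh hh hg
    rw [lieBr_antisymm]
    exact U.neg_mem (hgh hg hh)
  · intro g _ _
    rw [lieBr_plus_gen]; exact U.zero_mem
  · intro _ _
    rw [lieBr_self]; exact U.zero_mem
  · intro i _ _
    rw [lieBr_minus_tr]; exact hm _ trivial
  · intro i _ _
    rw [lieBr_minus_star]; exact U.smul_mem _ (hm _ trivial)
  · intro i j _ _
    rw [lieBr_minus_rot]; exact U.zero_mem
  · intro i j _ _
    rw [lieBr_tr_tr]; exact U.zero_mem
  · intro i j _ _
    rw [lieBr_tr_star]; exact U.smul_mem _ (hm _ trivial)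
  · intro i k l _ _
    rw [lieBr_tr_rot]
    exact U.sub_mem (hi _ _ fun _ => trivial) (hi _ _ fun _ => trivial)
  · intro i j _ _
    rw [lieBr_star_star]; exact U.zero_mem
  · intro i k l _ _
    rw [lieBr_star_rot]
    exact U.sub_mem (hi _ _ fun _ => trivial) (hi _ _ fun _ => trivial)
  · intro k l a b (hkl : r k l) (hab : r a b)
    rw [lieBr_rot_rot]
    -- A term of the bracket of two rotations survives only if they share an index; the new pair is
    -- then related by symmetry and transitivity.
    refine U.add_mem (U.sub_mem (U.sub_mem ?_ ?_) ?_) ?_ <;> refine hi _ _ ?_ <;> rintro rfl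
    · exact hr.trans hab hkl
    · exact hr.trans (hr.symm hab) hkl
    · exact hr.trans hab (hr.symm hkl)
    · exact hr.trans (hr.symm hab) (hr.symm hkl)

end HyperbolicFields

/-! ## The action on parallel sections -/

section Action

variable {n : ℕ} {ι : Type} [Fintype ι] [DecidableEq ι]

/-- The action of the generators on the values at the origin of parallel sections. -/
def spinAct (Γ : Idx n → Matrix ι ι ℂ) (c : Matrix ι ι ℂ) (α : ℝ) : Gen n → Matrix ι ι ℂ
  | Gen.plus => 0
  | Gen.minus => -(c * sigM Γ)
  | Gen.tr i => tilt Γ c i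
  | Gen.star i => (-(1 / 2) * (α : ℂ) ^ 2) • (Γ ip * Γ (it i))
  | Gen.rot i j => (1 / 4 : ℂ) • (Γ (it i) * Γ (it j) - Γ (it j) * Γ (it i))

namespace IsSquareRoot

variable {Γ : Idx n → Matrix ι ι ℂ} {c : Matrix ι ι ℂ} {α : ℝ} (h : IsSquareRoot Γ c α)
include h

theorem sigM_plus_tr (i : Fin n) : sigM Γ * (Γ ip * Γ (it i)) = Γ ip * Γ (it i) := by
  rw [← mul_assoc, h.clifford.sigM_plus]

theorem c_mul_tilt (i : Fin n) : c * tilt Γ c i = ((1 / 2) * (α : ℂ) ^ 2) • (Γ ip * Γ (it i)) := by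
  rw [tilt, mul_smul_comm, mul_assoc, ← mul_assoc, h.comm_plus.eq, mul_assoc, h.c_mul_c_mul,
    mul_smul_comm, smul_smul]

theorem c_mul_plus_tr (i : Fin n) : c * (Γ ip * Γ (it i)) = (2 : ℂ) • tilt Γ c i := by
  rw [tilt, smul_smul, ← mul_assoc, h.comm_plus.eq]
  norm_num

theorem plus_tr_sigM (i : Fin n) : Γ ip * Γ (it i) * sigM Γ = 0 := by
  rw [mul_assoc, (h.clifford.commute_tr_sigM i).eq, ← mul_assoc, h.clifford.plus_sigM, zero_mul]

/-- Modulo `S_-`, parallel transport is the projection `σ_+`, and `Γ_+ Γ_i` annihilates `S_-`. The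
spin term of the Lie derivative thus sees only the value at the origin. -/
theorem plus_tr_mul_trans (i : Fin n) (x : Pt n) :
    Γ ip * Γ (it i) * trans Γ c α x = Γ ip * Γ (it i) := by
  have h1 := h.plus_tr_sigM i
  have h2 : Γ ip * Γ (it i) * sigP Γ = Γ ip * Γ (it i) := by
    have := h1
    rw [h.clifford.sigM_eq, mul_sub, mul_one, sub_eq_zero] at this
    exact this.symm
  rw [trans, mul_add, mul_add, h2, (h.expMat_comm_sigM _).eq, ← mul_assoc, h1, zero_mul,
    ← h.sigM_tiltSum, ← mul_assoc, h1, zero_mul, add_zero, add_zero]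

theorem commute_rotation_sigP (i j : Fin n) :
    Commute ((1 / 4 : ℂ) • (Γ (it i) * Γ (it j) - Γ (it j) * Γ (it i))) (sigP Γ) :=
  (((h.clifford.commute_tr_sigP i).mul_left (h.clifford.commute_tr_sigP j)).sub_left
    ((h.clifford.commute_tr_sigP j).mul_left (h.clifford.commute_tr_sigP i))).smul_left _

theorem commute_rotation_sigM (i j : Fin n) :
    Commute ((1 / 4 : ℂ) • (Γ (it i) * Γ (it j) - Γ (it j) * Γ (it i))) (sigM Γ) := by
  rw [h.clifford.sigM_eq]
  exact (Commute.one_right _).sub_right (h.commute_rotation_sigP i j)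

theorem commute_rotation_plus (i j : Fin n) :
    Commute ((1 / 4 : ℂ) • (Γ (it i) * Γ (it j) - Γ (it j) * Γ (it i))) (Γ ip) := by
  have key : ∀ i j : Fin n, Commute (Γ (it i) * Γ (it j)) (Γ ip) := by
    intro i j
    show Γ (it i) * Γ (it j) * Γ ip = Γ ip * (Γ (it i) * Γ (it j))
    rw [mul_assoc, h.clifford.tr_inl, mul_neg, ← mul_assoc, h.clifford.tr_inl, neg_mul, neg_neg,
      mul_assoc]
  exact ((key i j).sub_left (key j i)).smul_left _

theorem commute_rotation_c {i j : Fin n} (hc : Commute c (Γ (it i) * Γ (it j))) :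
    Commute ((1 / 4 : ℂ) • (Γ (it i) * Γ (it j) - Γ (it j) * Γ (it i))) c := by
  have e : Γ (it j) * Γ (it i) = (if i = j then (-2 : ℂ) else 0) • 1 - Γ (it i) * Γ (it j) :=
    eq_sub_of_add_eq' (h.clifford.tr_tr i j)
  rw [e]
  exact (hc.symm.sub_left (((Commute.one_left _).smul_left _).sub_left hc.symm)).smul_left _

/-- The rotation commutes with `Γ_+`, and with `c` by hypothesis, so it acts on the tilt only
through the vector `Γ_k`. -/
theorem rotation_comm_tilt {i j : Fin n} (hc : Commute c (Γ (it i) * Γ (it j))) (k : Fin n) :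
    (1 / 4 : ℂ) • (Γ (it i) * Γ (it j) - Γ (it j) * Γ (it i)) * tilt Γ c k
      - tilt Γ c k * ((1 / 4 : ℂ) • (Γ (it i) * Γ (it j) - Γ (it j) * Γ (it i)))
      = (if i = k then 1 else 0 : ℂ) • tilt Γ c j - (if j = k then 1 else 0 : ℂ) • tilt Γ c i := by
  have h1 := h.commute_rotation_c hc
  have h2 := h.commute_rotation_plus i j
  have h3 := h.clifford.rotation_comm i j k
  generalize (1 / 4 : ℂ) • (Γ (it i) * Γ (it j) - Γ (it j) * Γ (it i)) = P at *
  have h4 : P * (Γ ip * c * Γ (it k)) = Γ ip * c * (P * Γ (it k)) := by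
    rw [← mul_assoc, ← mul_assoc, h2.eq, mul_assoc (Γ ip), h1.eq]
    simp only [mul_assoc]
  simp only [tilt]
  rw [mul_smul_comm, h4, smul_mul_assoc, mul_assoc (Γ ip * c), ← smul_sub, ← mul_sub, h3]
  simp only [mul_sub, mul_smul_comm, smul_sub]
  simp only [smul_comm (1 / 2 : ℂ)]

/-- The spinorial Lie derivative of parallel sections along a generator. -/
theorem lieDer_gen_par (g : Gen n) (hg : ∀ i j, g = Gen.rot i j → Commute c (Γ (it i) * Γ (it j)))
    (v : ι → ℂ) :
    lieDer (fun _ => -α ^ 2) Γ (gen (freq n α) g) (par Γ c α v)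
      = par Γ c α (spinAct Γ c α g *ᵥ v) := by
  have hα := h.ne_zero
  funext x
  rw [par, Matrix.mulVec_mulVec]
  have hptr := fun i => (h.pd_par (it i) v x)
  simp only [reduceCtorEq, if_false, zero_smul, neg_zero, zero_add, Sum.inr.injEq, ite_smul,
    one_smul, Finset.sum_ite_eq', Finset.mem_univ, if_true] at hptr
  have hpp := h.pd_par ip v x
  simp only [Sum.inl.injEq, one_ne_zero, reduceCtorEq, if_false, zero_smul, neg_zero, zero_add,
    Finset.sum_const_zero, Matrix.zero_mulVec] at hpp
  have hpm := h.pd_par im v x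
  simp only [reduceCtorEq, if_false, zero_smul, Finset.sum_const_zero, if_true, one_smul,
    add_zero] at hpm
  -- Because `c` maps the tilt to `½ α² Γ_+ Γ_i`, the exponential reproduces the profile `cosh` of
  -- `K_(i)` and its derivative `α sinh`. These are the two coefficients in `lieDer_wave`.
  have hE : ∀ s : ℝ, ∀ i, expMat c α (-s) * tilt Γ c i = Complex.cosh (α * s) • tilt Γ c i
      - ((1 / 2) * (α * Complex.sinh (α * s))) • (Γ ip * Γ (it i)) := by
    intro s i
    simp only [expMat, add_mul, smul_mul_assoc, one_mul, h.c_mul_tilt, Complex.ofReal_neg, mul_neg,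
      Complex.cosh_neg, Complex.sinh_neg]
    match_scalars
    · ring
    · field_simp
  cases g with
  | plus =>
    rw [lieDer_plus h.clifford, hpp]
    simp [spinAct]
  | minus =>
    rw [lieDer_minus h.clifford, hpm]
    have e : trans Γ c α x * (c * sigM Γ) = c * expMat c α (-x im) * sigM Γ := by
      have hcomm : Commute c (expMat c α (-x im)) :=
        ((Commute.one_right _).smul_right _).add_right
          (((Commute.refl c).smul_right _).smul_right _)
      rw [h.trans_mul, ← mul_assoc, hcomm.eq]
      rw [h.commute_sigM.eq, ← mul_assoc, h.clifford.sigM_sigM]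
    simp only [spinAct, mul_neg, e]
  | tr i =>
    rw [gen_tr_eq, lieDer_wave h.clifford _ (isWave_cosh α) i (fun s => by push_cast; ring), hptr,
      hpp, smul_zero, sub_zero]
    rw [par, Matrix.mulVec_mulVec, h.plus_tr_mul_trans, ← Matrix.smul_mulVec, ← Matrix.smul_mulVec,
      ← Matrix.sub_mulVec]
    simp only [spinAct]
    rw [h.trans_mul (h.sigM_tilt i), hE]
  | star i =>
    rw [gen_star_eq, lieDer_wave h.clifford _ (isWave_sinh α) i (fun s => by push_cast; ring), hptr,
      hpp, smul_zero, sub_zero]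
    rw [par, Matrix.mulVec_mulVec, h.plus_tr_mul_trans, ← Matrix.smul_mulVec, ← Matrix.smul_mulVec,
      ← Matrix.sub_mulVec]
    simp only [spinAct]
    rw [mul_smul_comm, h.trans_mul (h.sigM_plus_tr i)]
    congr 1
    simp only [expMat, add_mul, smul_mul_assoc, one_mul, h.c_mul_plus_tr, Complex.ofReal_neg, mul_neg,
      Complex.cosh_neg, Complex.sinh_neg]
    match_scalars
    · field_simp
    · ring
  | rot i j =>
    have hc := hg i j rfl
    rw [lieDer_rot h.clifford (fun _ => -α ^ 2) _ (i := i) (j := j) rfl, hptr, hptr, par, Matrix.mulVec_mulVec, ← Matrix.smul_mulVec,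
      ← Matrix.smul_mulVec, ← Matrix.sub_mulVec, ← Matrix.add_mulVec]
    simp only [spinAct]
    congr 1
    have h1 := h.commute_rotation_c hc
    have h2 := h.commute_rotation_sigP i j
    have h3 := h.commute_rotation_sigM i j
    have h4 := fun k => h.rotation_comm_tilt hc k
    set P := (1 / 4 : ℂ) • (Γ (it i) * Γ (it j) - Γ (it j) * Γ (it i))
    have h5 : Commute P (expMat c α (-x im)) :=
      ((Commute.one_right _).smul_right _).add_right ((h1.smul_right _).smul_right _)
    -- The tilt sum is linear in `x`. Commuting the spin rotation past it compensates the derivative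
    -- along the rotation field, and the rest of the transport commutes with the rotation.
    have h6 : P * tiltSum Γ c x - tiltSum Γ c x * P
        = (x (it i) : ℂ) • tilt Γ c j - (x (it j) : ℂ) • tilt Γ c i := by
      simp only [tiltSum, Finset.mul_sum, Finset.sum_mul, ← Finset.sum_sub_distrib, mul_smul_comm,
        smul_mul_assoc, ← smul_sub, h4]
      simp [smul_sub, Finset.sum_sub_distrib]
    rw [trans, mul_add, mul_add, add_mul, add_mul, h2.eq, ← mul_assoc, h5.eq, mul_assoc, h3.eq,
      mul_assoc, ← sub_eq_zero, ← sub_eq_zero.2 h6]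
    abel

theorem par_injective {v w : ι → ℂ} (e : par Γ c α v = par Γ c α w) : v = w := by
  rw [← h.par_zero v, e, h.par_zero]

end IsSquareRoot

/-- `X` acts on parallel sections by the matrix `M`. -/
def HasSymbol (Γ : Idx n → Matrix ι ι ℂ) (c : Matrix ι ι ℂ) (α : ℝ) (X : VF n)
    (M : Matrix ι ι ℂ) : Prop :=
  ContDiff ℝ ∞ X ∧ ∀ v, lieDer (fun _ => -α ^ 2) Γ X (par Γ c α v) = par Γ c α (M *ᵥ v)

namespace HasSymbol

variable {Γ : Idx n → Matrix ι ι ℂ} {c : Matrix ι ι ℂ} {α : ℝ} {X Y : VF n} {M N : Matrix ι ι ℂ}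

theorem par_add (v w : ι → ℂ) : par Γ c α (v + w) = par Γ c α v + par Γ c α w := by
  funext x; exact Matrix.mulVec_add _ _ _

theorem par_smul (k : ℂ) (v : ι → ℂ) : par Γ c α (k • v) = k • par Γ c α v := by
  funext x; exact Matrix.mulVec_smul _ _ _

theorem zero : HasSymbol Γ c α 0 0 := by
  refine ⟨contDiff_const, fun v => ?_⟩
  rw [lieDer_zero_left, Matrix.zero_mulVec]
  funext x
  simp [par]

theorem add (hX : HasSymbol Γ c α X M) (hY : HasSymbol Γ c α Y N) :
    HasSymbol Γ c α (X + Y) (M + N) := by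
  refine ⟨hX.1.add hY.1, fun v => ?_⟩
  rw [lieDer_add_left _ hX.1 hY.1, hX.2, hY.2, Matrix.add_mulVec, par_add]

theorem smul (k : ℂ) (hX : HasSymbol Γ c α X M) : HasSymbol Γ c α (k • X) (k • M) := by
  refine ⟨hX.1.const_smul k, fun v => ?_⟩
  rw [lieDer_smul_left _ k hX.1, hX.2, Matrix.smul_mulVec, par_smul]

theorem neg (hX : HasSymbol Γ c α X M) : HasSymbol Γ c α (-X) (-M) := by
  simpa using hX.smul (-1)

theorem sub (hX : HasSymbol Γ c α X M) (hY : HasSymbol Γ c α Y N) :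
    HasSymbol Γ c α (X - Y) (M - N) := by
  simpa [sub_eq_add_neg] using hX.add hY.neg

theorem sum {κ : Type} (s : Finset κ) {X : κ → VF n} {M : κ → Matrix ι ι ℂ}
    (hX : ∀ k ∈ s, HasSymbol Γ c α (X k) (M k)) :
    HasSymbol Γ c α (∑ k ∈ s, X k) (∑ k ∈ s, M k) := by
  classical
  induction s using Finset.induction_on with
  | empty => simpa using zero
  | insert a s ha ih =>
    rw [Finset.sum_insert ha, Finset.sum_insert ha]
    exact (hX a (by simp)).add (ih fun k hk => hX k (by simp [hk]))

/-- Parallel sections with equal values at the origin coincide, and every value is attained, so the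
matrix by which a field acts is determined. -/
theorem unique (h : IsSquareRoot Γ c α) (hX : HasSymbol Γ c α X M) (hX' : HasSymbol Γ c α X N) :
    M = N := by
  have key : ∀ v, M *ᵥ v = N *ᵥ v := fun v =>
    h.par_injective ((hX.2 v).symm.trans (hX'.2 v))
  ext i j
  have := congrFun (key (Pi.single j 1)) i
  simpa using this

end HasSymbol

namespace IsSquareRoot

variable {Γ : Idx n → Matrix ι ι ℂ} {c : Matrix ι ι ℂ} {α : ℝ} (h : IsSquareRoot Γ c α)
include h

theorem hasSymbol_gen {r : Fin n → Fin n → Prop}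
    (hc : ∀ i j, r i j → Commute c (Γ (it i) * Γ (it j))) {g : Gen n} (hg : g.Admits r) :
    HasSymbol Γ c α (gen (freq n α) g) (spinAct Γ c α g) := by
  refine ⟨contDiff_gen _ g, fun v => h.lieDer_gen_par g ?_ v⟩
  rintro i j rfl
  exact hc i j hg

theorem tilt_mul_tilt (i j : Fin n) : tilt Γ c i * tilt Γ c j = 0 := by
  rw [← h.sigM_tilt j, ← mul_assoc, h.tilt_sigM, zero_mul]

theorem tilt_mul_plus_tr (i j : Fin n) : tilt Γ c i * (Γ ip * Γ (it j)) = 0 := by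
  rw [← h.sigM_plus_tr j, ← mul_assoc, h.tilt_sigM, zero_mul]

theorem plus_tr_mul_tilt (i j : Fin n) : Γ ip * Γ (it i) * tilt Γ c j = 0 := by
  rw [← h.sigM_tilt j, ← mul_assoc, h.plus_tr_sigM, zero_mul]

theorem plus_tr_mul_plus_tr (i j : Fin n) : Γ ip * Γ (it i) * (Γ ip * Γ (it j)) = 0 := by
  rw [← h.sigM_plus_tr j, ← mul_assoc, h.plus_tr_sigM, zero_mul]

theorem rotation_comm_plus_tr (i j k : Fin n) :
    (1 / 4 : ℂ) • (Γ (it i) * Γ (it j) - Γ (it j) * Γ (it i)) * (Γ ip * Γ (it k))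
      - (Γ ip * Γ (it k)) * ((1 / 4 : ℂ) • (Γ (it i) * Γ (it j) - Γ (it j) * Γ (it i)))
      = (if i = k then 1 else 0 : ℂ) • (Γ ip * Γ (it j))
        - (if j = k then 1 else 0 : ℂ) • (Γ ip * Γ (it i)) := by
  have h2 := h.commute_rotation_plus i j
  have h3 := h.clifford.rotation_comm i j k
  generalize (1 / 4 : ℂ) • (Γ (it i) * Γ (it j) - Γ (it j) * Γ (it i)) = P at *
  rw [← mul_assoc, h2.eq, mul_assoc, mul_assoc, ← mul_sub, h3, mul_sub, mul_smul_comm,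
    mul_smul_comm]

theorem rotation_comm_rotation (k l a b : Fin n) :
    spinAct Γ c α (Gen.rot k l) * spinAct Γ c α (Gen.rot a b)
      - spinAct Γ c α (Gen.rot a b) * spinAct Γ c α (Gen.rot k l)
      = (if k = b then 1 else 0 : ℂ) • spinAct Γ c α (Gen.rot a l)
        - (if k = a then 1 else 0 : ℂ) • spinAct Γ c α (Gen.rot b l)
        - (if l = b then 1 else 0 : ℂ) • spinAct Γ c α (Gen.rot a k)
        + (if l = a then 1 else 0 : ℂ) • spinAct Γ c α (Gen.rot b k) := by
  have ha := h.clifford.rotation_comm k l a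
  have hb := h.clifford.rotation_comm k l b
  simp only [spinAct]
  generalize (1 / 4 : ℂ) • (Γ (it k) * Γ (it l) - Γ (it l) * Γ (it k)) = P at *
  -- Commutation with a fixed matrix is a derivation, so the action on each vector `Γ_a`, `Γ_b`
  -- determines the action on their product.
  have e : ∀ x y : Matrix ι ι ℂ, P * (x * y) - x * y * P = (P * x - x * P) * y + x * (P * y - y * P) := by
    intro x y; noncomm_ring
  have e2 : ∀ x y : Matrix ι ι ℂ, P * ((1 / 4 : ℂ) • (x * y - y * x))
      - (1 / 4 : ℂ) • (x * y - y * x) * P = (1 / 4 : ℂ) • ((P * (x * y) - x * y * P)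
        - (P * (y * x) - y * x * P)) := by
    intro x y
    rw [mul_smul_comm, smul_mul_assoc, ← smul_sub]
    congr 1
    noncomm_ring
  rw [e2, e, e, ha, hb]
  simp only [sub_mul, mul_sub, smul_mul_assoc, mul_smul_comm]
  module

/-- Case by case, the structure constants of the vector fields are matched with the matrix
commutators. The mixed commutators of tilts and `Γ_+ Γ_i` vanish, in agreement with the fact that
`K_(+)` acts trivially. -/
theorem hasSymbol_lieBr_gen {r : Fin n → Fin n → Prop}
    (hc : ∀ i j, r i j → Commute c (Γ (it i) * Γ (it j))) (hr : Equivalence r) {g g' : Gen n}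
    (hg : g.Admits r) (hg' : g'.Admits r) :
    HasSymbol Γ c α (lieBr (gen (freq n α) g) (gen (freq n α) g'))
      (spinAct Γ c α g * spinAct Γ c α g' - spinAct Γ c α g' * spinAct Γ c α g) := by
  have hs : ∀ {g : Gen n}, g.Admits r → HasSymbol Γ c α (gen (freq n α) g) (spinAct Γ c α g) :=
    fun hg => h.hasSymbol_gen hc hg
  have hi : ∀ (p : Prop) [Decidable p] (g : Gen n), (p → g.Admits r) →
      HasSymbol Γ c α ((if p then 1 else 0 : ℂ) • gen (freq n α) g)
        ((if p then 1 else 0 : ℂ) • spinAct Γ c α g) := by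
    intro p _ g hp
    split_ifs with h
    · exact (hs (hp h)).smul _
    · simpa using HasSymbol.zero
  revert hg hg'
  refine Gen.pair_induction (P := fun g g' => g.Admits r → g'.Admits r →
    HasSymbol Γ c α (lieBr (gen (freq n α) g) (gen (freq n α) g'))
      (spinAct Γ c α g * spinAct Γ c α g' - spinAct Γ c α g' * spinAct Γ c α g))
    ?_ ?_ ?_ ?_ ?_ ?_ ?_ ?_ ?_ ?_ ?_ ?_ g g'
  · intro g g' hgg hg' hg
    rw [lieBr_antisymm, ← neg_sub]
    exact (hgg hg hg').neg
  · intro g _ _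
    rw [lieBr_plus_gen]
    simpa [spinAct] using HasSymbol.zero
  · intro _ _
    rw [lieBr_self, sub_self]
    exact HasSymbol.zero
  · intro i _ _
    rw [lieBr_minus_tr]
    convert hs (g := Gen.star i) trivial using 1
    simp only [spinAct]
    rw [neg_mul, mul_neg, mul_assoc, h.sigM_tilt, h.c_mul_tilt, h.commute_sigM.eq, ← mul_assoc,
      h.tilt_sigM, zero_mul]
    module
  · intro i _ _
    rw [lieBr_minus_star]
    convert (hs (g := Gen.tr i) trivial).smul ((α : ℂ) ^ 2) using 1
    simp only [spinAct]
    rw [neg_mul, mul_neg, mul_smul_comm, mul_assoc, h.sigM_plus_tr, h.c_mul_plus_tr, smul_mul_assoc,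
      h.commute_sigM.eq, ← mul_assoc, h.plus_tr_sigM, zero_mul]
    module
  · intro i j _ hij
    rw [lieBr_minus_rot]
    convert HasSymbol.zero (Γ := Γ) (c := c) (α := α) using 1
    simp only [spinAct]
    have h1 := (h.commute_rotation_c (hc i j hij)).mul_right (h.commute_rotation_sigM i j)
    rw [neg_mul, mul_neg, h1.eq]
    abel
  · intro i j _ _
    rw [lieBr_tr_tr]
    simpa [spinAct, h.tilt_mul_tilt] using HasSymbol.zero
  · intro i j _ _
    rw [lieBr_tr_star]
    convert (hs (g := Gen.plus) trivial).smul (if i = j then -(α : ℂ) ^ 2 else 0) using 1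
    simp [spinAct, h.tilt_mul_plus_tr, h.plus_tr_mul_tilt]
  · intro i k l _ hkl
    rw [lieBr_tr_rot]
    convert (hi (i = l) (Gen.tr k) fun _ => trivial).sub (hi (i = k) (Gen.tr l) fun _ => trivial)
      using 1
    have := h.rotation_comm_tilt (hc k l hkl) i
    simp only [spinAct]
    rw [← neg_sub, this, neg_sub]
    simp only [eq_comm]
  · intro i j _ _
    rw [lieBr_star_star]
    simpa [spinAct, h.plus_tr_mul_plus_tr] using HasSymbol.zero
  · intro i k l _ hkl
    rw [lieBr_star_rot]
    convert (hi (i = l) (Gen.star k) fun _ => trivial).sub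
      (hi (i = k) (Gen.star l) fun _ => trivial) using 1
    have := h.rotation_comm_plus_tr k l i
    simp only [spinAct]
    generalize (1 / 4 : ℂ) • (Γ (it k) * Γ (it l) - Γ (it l) * Γ (it k)) = P at *
    rw [mul_smul_comm, smul_mul_assoc, ← smul_sub, ← neg_sub, this]
    simp only [eq_comm (a := i)]
    module
  · intro k l a b (hkl : r k l) (hab : r a b)
    rw [lieBr_rot_rot, h.rotation_comm_rotation]
    refine (((hi _ _ ?_).sub (hi _ _ ?_)).sub (hi _ _ ?_)).add (hi _ _ ?_) <;> rintro rfl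
    · exact hr.trans hab hkl
    · exact hr.trans (hr.symm hab) hkl
    · exact hr.trans hab (hr.symm hkl)
    · exact hr.trans (hr.symm hab) (hr.symm hkl)

theorem exists_hasSymbol {r : Fin n → Fin n → Prop}
    (hc : ∀ i j, r i j → Commute c (Γ (it i) * Γ (it j))) {X : VF n}
    (hX : X ∈ Submodule.span ℂ (gen (freq n α) '' {g | g.Admits r})) :
    ∃ M, HasSymbol Γ c α X M := by
  induction hX using Submodule.span_induction with
  | mem X hX =>
    obtain ⟨g, hg, rfl⟩ := hX
    exact ⟨_, h.hasSymbol_gen hc hg⟩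
  | zero => exact ⟨_, HasSymbol.zero⟩
  | add X Y _ _ h1 h2 =>
    obtain ⟨M, hM⟩ := h1
    obtain ⟨N, hN⟩ := h2
    exact ⟨_, hM.add hN⟩
  | smul k X _ h1 =>
    obtain ⟨M, hM⟩ := h1
    exact ⟨_, hM.smul k⟩

/-- The action on parallel sections is a representation. -/
theorem hasSymbol_lieBr {r : Fin n → Fin n → Prop}
    (hc : ∀ i j, r i j → Commute c (Γ (it i) * Γ (it j))) (hr : Equivalence r) {X Y : VF n}
    (hX : X ∈ Submodule.span ℂ (gen (freq n α) '' {g | g.Admits r}))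
    (hY : Y ∈ Submodule.span ℂ (gen (freq n α) '' {g | g.Admits r})) {M N : Matrix ι ι ℂ}
    (hM : HasSymbol Γ c α X M) (hN : HasSymbol Γ c α Y N) :
    HasSymbol Γ c α (lieBr X Y) (M * N - N * M) := by
  induction hX using Submodule.span_induction generalizing M with
  | mem X hX =>
    obtain ⟨g, hg, rfl⟩ := hX
    -- Uniqueness of the matrix allows an arbitrary one to be replaced by that of the generator
    -- before the induction on the second field.
    obtain rfl := hM.unique h (h.hasSymbol_gen hc hg)
    induction hY using Submodule.span_induction generalizing N with
    | mem Y hY =>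
      obtain ⟨g', hg', rfl⟩ := hY
      obtain rfl := hN.unique h (h.hasSymbol_gen hc hg')
      exact h.hasSymbol_lieBr_gen hc hr hg hg'
    | zero =>
      obtain rfl := hN.unique h HasSymbol.zero
      rw [lieBr_zero_right, mul_zero, zero_mul, sub_zero]
      exact HasSymbol.zero
    | add Y Z hY hZ h1 h2 =>
      obtain ⟨N₁, hN₁⟩ := h.exists_hasSymbol hc hY
      obtain ⟨N₂, hN₂⟩ := h.exists_hasSymbol hc hZ
      obtain rfl := hN.unique h (hN₁.add hN₂)
      rw [lieBr_add_right _ hN₁.1 hN₂.1]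
      convert (h1 hN₁).add (h2 hN₂) using 1
      noncomm_ring
    | smul k Y hY h1 =>
      obtain ⟨N₁, hN₁⟩ := h.exists_hasSymbol hc hY
      obtain rfl := hN.unique h (hN₁.smul k)
      rw [lieBr_smul_right _ k hN₁.1]
      convert (h1 hN₁).smul k using 1
      rw [mul_smul_comm, smul_mul_assoc, smul_sub]
  | zero =>
    obtain rfl := hM.unique h HasSymbol.zero
    rw [lieBr_zero_left, mul_zero, zero_mul, sub_zero]
    exact HasSymbol.zero
  | add X Z hX hZ h1 h2 =>
    obtain ⟨N₁, hN₁⟩ := h.exists_hasSymbol hc hX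
    obtain ⟨N₂, hN₂⟩ := h.exists_hasSymbol hc hZ
    obtain rfl := hM.unique h (hN₁.add hN₂)
    rw [lieBr_add_left _ hN₁.1 hN₂.1]
    convert (h1 hN₁).add (h2 hN₂) using 1
    noncomm_ring
  | smul k X hX h1 =>
    obtain ⟨N₁, hN₁⟩ := h.exists_hasSymbol hc hX
    obtain rfl := hM.unique h (hN₁.smul k)
    rw [lieBr_smul_left k _ hN₁.1]
    convert (h1 hN₁).smul k using 1
    rw [mul_smul_comm, smul_mul_assoc, smul_sub]

end IsSquareRoot

end Action

/-! ## Brackets of spinors -/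

section SpinorBracket

variable {n : ℕ} {ι : Type} [Fintype ι] [DecidableEq ι]

/-- The sign that is `1` on `p` and `-1` off `p`. -/
def sgn (p : Fin n → Prop) [DecidablePred p] (i : Fin n) : ℂ := if p i then 1 else -1

theorem sgn_mul_self (p : Fin n → Prop) [DecidablePred p] (i : Fin n) :
    sgn p i * sgn p i = 1 := by
  unfold sgn; split_ifs <;> simp

theorem sgn_congr (p : Fin n → Prop) [DecidablePred p] {i j : Fin n} (h : p i ↔ p j) :
    sgn p i = sgn p j := by
  simp [sgn, h]

theorem sgn_eq_neg (p : Fin n → Prop) [DecidablePred p] {i j : Fin n} (h : ¬ (p i ↔ p j)) :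
    sgn p i = -sgn p j := by
  unfold sgn
  by_cases hi : p i <;> by_cases hj : p j <;> simp_all

/-- The operator in the `K_(i*)` component of the bracket. -/
def starOp (Γ : Idx n → Matrix ι ι ℂ) (c : Matrix ι ι ℂ) (α : ℝ) (p : Fin n → Prop)
    [DecidablePred p] (i : Fin n) : Matrix ι ι ℂ :=
  (1 / (α : ℂ) ^ 2) • (c * Γ (it i) * (sigP Γ - sgn p i • sigM Γ))

/-- The operator in the `K_(ij)` component of the bracket. -/
def rotOp (Γ : Idx n → Matrix ι ι ℂ) (c : Matrix ι ι ℂ) (p : Fin n → Prop)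
    [DecidablePred p] (i j : Fin n) : Matrix ι ι ℂ :=
  if p i ↔ p j then (-sgn p i) • (c * (Γ (it i) * Γ (it j)) * Γ ip) else 0

/-- The field whose components are the values of a linear functional on the bracket operators. -/
def field (Γ : Idx n → Matrix ι ι ℂ) (c : Matrix ι ι ℂ) (α : ℝ) (p : Fin n → Prop)
    [DecidablePred p] (φ : Matrix ι ι ℂ →ₗ[ℂ] ℂ) : VF n :=
  φ (Γ im) • gen (freq n α) Gen.plus + φ (Γ ip) • gen (freq n α) Gen.minus
    + ∑ i, φ (Γ (it i)) • gen (freq n α) (Gen.tr i)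
    + ∑ i, φ (starOp Γ c α p i) • gen (freq n α) (Gen.star i)
    + (1 / 2 : ℂ) • ∑ i, ∑ j, φ (rotOp Γ c p i j) • gen (freq n α) (Gen.rot i j)

theorem map_eq_mul (φ : Matrix ι ι ℂ →ₗ[ℂ] ℂ) {k : ℂ} {A B : Matrix ι ι ℂ} (h : A = k • B) :
    φ A = k * φ B := by
  rw [h, map_smul, smul_eq_mul]

theorem contDiff_sum_vf {κ : Type} (s : Finset κ) {Y : κ → VF n}
    (hY : ∀ k ∈ s, ContDiff ℝ ∞ (Y k)) : ContDiff ℝ ∞ (∑ k ∈ s, Y k) := by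
  have := ContDiff.sum (𝕜 := ℝ) (n := ∞) hY
  convert this using 1
  funext x
  simp

theorem lieBr_field (Γ : Idx n → Matrix ι ι ℂ) (c : Matrix ι ι ℂ) (α : ℝ) (p : Fin n → Prop)
    [DecidablePred p] (φ : Matrix ι ι ℂ →ₗ[ℂ] ℂ) (X : VF n) :
    lieBr X (field Γ c α p φ) = φ (Γ im) • lieBr X (gen (freq n α) Gen.plus)
      + φ (Γ ip) • lieBr X (gen (freq n α) Gen.minus)
      + ∑ i, φ (Γ (it i)) • lieBr X (gen (freq n α) (Gen.tr i))
      + ∑ i, φ (starOp Γ c α p i) • lieBr X (gen (freq n α) (Gen.star i))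
      + (1 / 2 : ℂ) • ∑ i, ∑ j, φ (rotOp Γ c p i j) • lieBr X (gen (freq n α) (Gen.rot i j)) := by
  have h : ∀ (k : ℂ) (g : Gen n), ContDiff ℝ ∞ (k • gen (freq n α) g) :=
    fun k g => (contDiff_gen _ g).const_smul k
  have h1 : ContDiff ℝ ∞ (∑ i, φ (Γ (it i)) • gen (freq n α) (Gen.tr i)) :=
    contDiff_sum_vf _ fun i _ => h _ _
  have h2 : ContDiff ℝ ∞ (∑ i, φ (starOp Γ c α p i) • gen (freq n α) (Gen.star i)) :=
    contDiff_sum_vf _ fun i _ => h _ _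
  have h3 : ∀ i, ContDiff ℝ ∞ (∑ j, φ (rotOp Γ c p i j) • gen (freq n α) (Gen.rot i j)) :=
    fun i => contDiff_sum_vf _ fun j _ => h _ _
  have h4 : ContDiff ℝ ∞ (∑ i, ∑ j, φ (rotOp Γ c p i j) • gen (freq n α) (Gen.rot i j)) :=
    contDiff_sum_vf _ fun i _ => h3 i
  have h5 : ContDiff ℝ ∞ (φ (Γ im) • gen (freq n α) Gen.plus + φ (Γ ip) • gen (freq n α) Gen.minus) :=
    (h _ _).add (h _ _)
  have h6 : ContDiff ℝ ∞ (φ (Γ im) • gen (freq n α) Gen.plus + φ (Γ ip) • gen (freq n α) Gen.minus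
      + ∑ i, φ (Γ (it i)) • gen (freq n α) (Gen.tr i)) := h5.add h1
  have h7 : ContDiff ℝ ∞ (φ (Γ im) • gen (freq n α) Gen.plus + φ (Γ ip) • gen (freq n α) Gen.minus
      + ∑ i, φ (Γ (it i)) • gen (freq n α) (Gen.tr i)
      + ∑ i, φ (starOp Γ c α p i) • gen (freq n α) (Gen.star i)) := h6.add h2
  have h8 : ContDiff ℝ ∞
      ((1 / 2 : ℂ) • ∑ i, ∑ j, φ (rotOp Γ c p i j) • gen (freq n α) (Gen.rot i j)) :=
    contDiff_const.smul h4
  rw [field, lieBr_add_right X h7 h8, lieBr_add_right X h6 h2, lieBr_add_right X h5 h1,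
    lieBr_add_right X (h _ _) (h _ _), lieBr_smul_right X _ h4, lieBr_sum_right X _ fun i _ => h _ _,
    lieBr_sum_right X _ fun i _ => h _ _, lieBr_sum_right X _ fun i _ => h3 i]
  simp only [lieBr_sum_right X _ fun i _ => h _ _, lieBr_smul_right X _ (contDiff_gen _ _)]

/-- The adjoint of the action of a generator, for a bilinear form for which the gamma matrices and
`c` are skew. -/
def spinActAdj (Γ : Idx n → Matrix ι ι ℂ) (c : Matrix ι ι ℂ) (α : ℝ) (p : Fin n → Prop)
    [DecidablePred p] : Gen n → Matrix ι ι ℂ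
  | Gen.plus => 0
  | Gen.minus => c * sigP Γ
  | Gen.tr i => sgn p i • tilt Γ c i
  | Gen.star i => -spinAct Γ c α (Gen.star i)
  | Gen.rot i j => -spinAct Γ c α (Gen.rot i j)

/-- The functional `A ↦ φ (ρ' A + A ρ)`. -/
def actOn (φ : Matrix ι ι ℂ →ₗ[ℂ] ℂ) (ρ' ρ : Matrix ι ι ℂ) : Matrix ι ι ℂ →ₗ[ℂ] ℂ :=
  φ ∘ₗ (LinearMap.mulLeft ℂ ρ' + LinearMap.mulRight ℂ ρ)

theorem actOn_apply (φ : Matrix ι ι ℂ →ₗ[ℂ] ℂ) (ρ' ρ A : Matrix ι ι ℂ) :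
    actOn φ ρ' ρ A = φ (ρ' * A + A * ρ) := rfl

theorem field_congr {Γ : Idx n → Matrix ι ι ℂ} {c : Matrix ι ι ℂ} {α : ℝ} {p : Fin n → Prop}
    [DecidablePred p] {φ : Matrix ι ι ℂ →ₗ[ℂ] ℂ} {a b : ℂ} {t u : Fin n → ℂ} {r : Fin n → Fin n → ℂ}
    (ha : φ (Γ im) = a) (hb : φ (Γ ip) = b) (ht : ∀ i, φ (Γ (it i)) = t i)
    (hu : ∀ i, φ (starOp Γ c α p i) = u i) (hr : ∀ i j, φ (rotOp Γ c p i j) = r i j) :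
    field Γ c α p φ = a • gen (freq n α) Gen.plus + b • gen (freq n α) Gen.minus
      + ∑ i, t i • gen (freq n α) (Gen.tr i) + ∑ i, u i • gen (freq n α) (Gen.star i)
      + (1 / 2 : ℂ) • ∑ i, ∑ j, r i j • gen (freq n α) (Gen.rot i j) := by
  simp only [field, ha, hb, ht, hu, hr]

namespace IsSquareRoot

variable {Γ : Idx n → Matrix ι ι ℂ} {c : Matrix ι ι ℂ} {α : ℝ} (h : IsSquareRoot Γ c α)
  {p : Fin n → Prop} [DecidablePred p]
include h

theorem sigP_minus : sigP Γ * Γ im = Γ im := by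
  have h1 : sigM Γ * Γ im = 0 := by
    rw [sigM, smul_mul_assoc, mul_assoc, h.clifford.minus_sq, mul_zero, smul_zero]
  rw [h.clifford.sigM_eq, sub_mul, one_mul, sub_eq_zero] at h1
  exact h1.symm

theorem minus_sigM : Γ im * sigM Γ = Γ im := by
  have h1 : Γ im * sigP Γ = 0 := by
    rw [sigP, mul_smul_comm, ← mul_assoc, h.clifford.minus_sq, zero_mul, smul_zero]
  rw [h.clifford.sigM_eq, mul_sub, mul_one, h1, sub_zero]

theorem tr_plus (i : Fin n) : Γ (it i) * Γ ip = -(Γ ip * Γ (it i)) := h.clifford.tr_inl i 0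
theorem tr_minus (i : Fin n) : Γ (it i) * Γ im = -(Γ im * Γ (it i)) := h.clifford.tr_inl i 1

theorem tilt_eq (i : Fin n) : tilt Γ c i = (1 / 2 : ℂ) • (c * (Γ ip * Γ (it i))) := by
  rw [h.c_mul_plus_tr, smul_smul]; norm_num

/-- Equivariance under `K_(-)`. -/
theorem field_minus (hs : ∀ i, Γ (it i) * c = sgn p i • (c * Γ (it i)))
    (φ : Matrix ι ι ℂ →ₗ[ℂ] ℂ) :
    field Γ c α p (actOn φ (c * sigP Γ) (-(c * sigM Γ)))
      = lieBr (gen (freq n α) Gen.minus) (field Γ c α p φ) := by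
  have hα := h.ne_zero
  have hss := fun i => sgn_mul_self p i
  rw [lieBr_field]
  simp only [lieBr_minus_plus, lieBr_self, lieBr_minus_tr, lieBr_minus_star, lieBr_minus_rot,
    smul_zero, Finset.sum_const_zero, add_zero, zero_add]
  -- The coefficients are read off from `[K_(-), K_(i)] = K_(i*)` and `[K_(-), K_(i*)] = α² K_(i)`,
  -- while `K_(-)` commutes with everything else. The goals that follow check that the operators
  -- transform in the same way.
  rw [field_congr (a := 0) (b := 0) (t := fun i => (α : ℂ) ^ 2 * φ (starOp Γ c α p i))
    (u := fun i => φ (Γ (it i))) (r := fun _ _ => 0)]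
  · simp only [zero_smul, Finset.sum_const_zero, smul_zero, add_zero, zero_add]
    rw [add_comm]
    simp only [smul_smul, mul_comm]
  · rw [actOn_apply, mul_assoc, h.sigP_minus, mul_neg, ← mul_assoc, ← h.comm_minus.eq, mul_assoc,
      h.minus_sigM, add_neg_cancel, map_zero]
  · rw [actOn_apply, mul_assoc, h.clifford.sigP_plus, mul_neg, ← mul_assoc, ← h.comm_plus.eq,
      mul_assoc, h.clifford.plus_sigM, mul_zero, neg_zero, add_zero, map_zero]
  · intro i
    rw [actOn_apply]
    refine map_eq_mul φ ?_
    rw [starOp, smul_smul, mul_one_div_cancel (pow_ne_zero 2 hα), one_smul, mul_neg, ← mul_assoc, hs,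
      mul_assoc c, ← (h.clifford.commute_tr_sigP i).eq]
    simp only [mul_sub, mul_smul_comm, smul_mul_assoc, mul_assoc]
    abel
  · intro i
    rw [actOn_apply]
    congr 1
    have e1 : c * sigP Γ * (c * Γ (it i) * (sigP Γ - sgn p i • sigM Γ))
        = ((α : ℂ) ^ 2) • (Γ (it i) * sigP Γ) := by
      have : sigP Γ * (c * Γ (it i) * (sigP Γ - sgn p i • sigM Γ)) = c * (Γ (it i) * sigP Γ) := by
        rw [← mul_assoc, ← mul_assoc, ← h.commute_sigP.eq, mul_assoc c,
          ← (h.clifford.commute_tr_sigP i).eq, mul_assoc, mul_assoc, mul_sub, mul_smul_comm,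
          h.clifford.sigP_sigP, h.clifford.sigP_sigM, smul_zero, sub_zero]
      rw [mul_assoc, this, h.c_mul_c_mul]
    have e2 : c * Γ (it i) * (sigP Γ - sgn p i • sigM Γ) * (c * sigM Γ)
        = -((α : ℂ) ^ 2 • (Γ (it i) * sigM Γ)) := by
      have : (sigP Γ - sgn p i • sigM Γ) * (c * sigM Γ) = -(sgn p i • (c * sigM Γ)) := by
        rw [h.commute_sigM.eq, ← mul_assoc, sub_mul, smul_mul_assoc, h.clifford.sigP_sigM,
          h.clifford.sigM_sigM, zero_sub, neg_mul, smul_mul_assoc]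
      rw [mul_assoc, this, mul_neg, mul_smul_comm, mul_assoc, ← mul_assoc (Γ (it i)), hs,
        smul_mul_assoc, mul_smul_comm, smul_smul, hss, one_smul, mul_assoc c, h.c_mul_c_mul]
    rw [starOp, mul_smul_comm, smul_mul_assoc, ← smul_add, mul_neg, e1, e2, neg_neg, ← smul_add,
      ← mul_add, h.clifford.sigP_add_sigM, mul_one, smul_smul,
      one_div_mul_cancel (pow_ne_zero 2 hα), one_smul]
  · intro i j
    rw [actOn_apply, rotOp]
    have e1 : sigP Γ * (c * (Γ (it i) * Γ (it j)) * Γ ip) = 0 := by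
      rw [← mul_assoc, ← mul_assoc, ← h.commute_sigP.eq, mul_assoc c, ← mul_assoc (sigP Γ),
        ← (h.clifford.commute_tr_sigP i).eq, mul_assoc (Γ (it i)),
        ← (h.clifford.commute_tr_sigP j).eq, mul_assoc, mul_assoc, mul_assoc, h.clifford.sigP_plus]
      simp
    have e2 : Γ ip * (c * sigM Γ) = 0 := by
      rw [← mul_assoc, ← h.comm_plus.eq, mul_assoc, h.clifford.plus_sigM, mul_zero]
    split_ifs
    · rw [mul_smul_comm, mul_assoc c (sigP Γ), e1, smul_mul_assoc, mul_neg, mul_assoc _ (Γ ip), e2]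
      simp
    · simp

/-- The commutator that relates the `K_(i)` components to the rotation components. -/
theorem rotOp_sub (i k : Fin n) :
    rotOp Γ c p i k - rotOp Γ c p k i
      = c * (Γ ip * (sgn p k • (Γ (it k) * Γ (it i)) - sgn p i • (Γ (it i) * Γ (it k)))) := by
  have e : ∀ i j : Fin n, Γ (it i) * Γ (it j) * Γ ip = Γ ip * (Γ (it i) * Γ (it j)) := by
    intro i j
    rw [mul_assoc, h.tr_plus, mul_neg, ← mul_assoc, h.tr_plus, neg_mul, neg_neg, mul_assoc]
  by_cases hik : p i ↔ p k
  · rw [rotOp, rotOp, if_pos hik, if_pos hik.symm, sgn_congr p hik, mul_assoc c,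
      mul_assoc c, e, e]
    simp only [mul_sub, mul_smul_comm]
    module
  · have hne : i ≠ k := by rintro rfl; exact hik Iff.rfl
    rw [rotOp, rotOp, if_neg hik, if_neg fun hh => hik hh.symm, sgn_eq_neg p hik,
      h.clifford.tr_anticomm hne]
    simp

theorem starOp_mul_left (hs : ∀ i, Γ (it i) * c = sgn p i • (c * Γ (it i))) (i k : Fin n) :
    Γ ip * Γ (it k) * starOp Γ c α p i
      = (1 / (α : ℂ) ^ 2 * sgn p k) • (c * (Γ ip * (Γ (it k) * Γ (it i)))) := by
  have e : Γ ip * Γ (it k) * Γ (it i) * (sigP Γ - sgn p i • sigM Γ)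
      = Γ ip * Γ (it k) * Γ (it i) := by
    have e1 : Γ ip * Γ (it k) * Γ (it i) * sigM Γ = 0 := by
      rw [mul_assoc, (h.clifford.commute_tr_sigM i).eq, ← mul_assoc, h.plus_tr_sigM, zero_mul]
    have e2 : Γ ip * Γ (it k) * Γ (it i) * sigP Γ = Γ ip * Γ (it k) * Γ (it i) := by
      have := e1
      rw [h.clifford.sigM_eq, mul_sub, mul_one, sub_eq_zero] at this
      exact this.symm
    rw [mul_sub, mul_smul_comm, e1, e2, smul_zero, sub_zero]
  have e3 : Γ ip * Γ (it k) * (c * Γ (it i)) = sgn p k • (c * (Γ ip * Γ (it k) * Γ (it i))) := by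
    rw [← mul_assoc, mul_assoc (Γ ip), hs, mul_smul_comm, ← mul_assoc, ← h.comm_plus.eq,
      smul_mul_assoc]
    simp only [mul_assoc]
  rw [starOp, mul_smul_comm, ← mul_assoc, e3, smul_mul_assoc, mul_assoc, e, smul_smul]
  simp only [mul_assoc]

theorem starOp_mul_right (i k : Fin n) :
    starOp Γ c α p i * (Γ ip * Γ (it k))
      = (1 / (α : ℂ) ^ 2 * sgn p i) • (c * (Γ ip * (Γ (it i) * Γ (it k)))) := by
  rw [starOp, smul_mul_assoc, mul_assoc _ (_ - _), sub_mul, ← mul_assoc (sigP Γ),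
    h.clifford.sigP_plus, smul_mul_assoc, h.sigM_plus_tr, zero_mul, zero_sub, mul_neg, mul_smul_comm,
    mul_assoc c, ← mul_assoc (Γ (it i)), h.tr_plus]
  simp only [neg_mul, mul_neg, smul_neg, neg_neg, mul_assoc, smul_smul]

/-- The operator `rotOp` begins on the right with `Γ_+` and has image in `S_-`. Since `Γ_+² = 0` and
`Γ_+ Γ_k` kills `S_-`, the rotation components receive nothing from `K_(k)` and `K_(k*)`. -/
theorem plus_tr_mul_rotOp (i j k : Fin n) : Γ ip * Γ (it k) * (c * rotOp Γ c p i j) = 0 ∧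
    Γ ip * Γ (it k) * rotOp Γ c p i j = 0 ∧ rotOp Γ c p i j * (Γ ip * Γ (it k)) = 0 := by
  have e : sigM Γ * (c * (Γ (it i) * Γ (it j)) * Γ ip) = c * (Γ (it i) * Γ (it j)) * Γ ip := by
    rw [← mul_assoc, ← mul_assoc, ← h.commute_sigM.eq, mul_assoc c, ← mul_assoc (sigM Γ),
      ← (h.clifford.commute_tr_sigM i).eq, mul_assoc (Γ (it i)),
      ← (h.clifford.commute_tr_sigM j).eq, mul_assoc, mul_assoc, mul_assoc, h.clifford.sigM_plus]
    simp only [mul_assoc]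
  have e' : sigM Γ * rotOp Γ c p i j = rotOp Γ c p i j := by
    rw [rotOp]
    split_ifs
    · rw [mul_smul_comm, e]
    · simp
  refine ⟨?_, ?_, ?_⟩
  · rw [← e', ← mul_assoc c, h.commute_sigM.eq, ← mul_assoc, ← mul_assoc, h.plus_tr_sigM, zero_mul,
      zero_mul]
  · rw [← e', ← mul_assoc, h.plus_tr_sigM, zero_mul]
  · rw [rotOp]
    split_ifs
    · rw [smul_mul_assoc, mul_assoc, ← mul_assoc (Γ ip), h.clifford.plus_sq]
      simp
    · simp

theorem plus_mul_minus : Γ ip * Γ im = (-2 : ℂ) • sigM Γ := by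
  rw [sigM, smul_smul]; norm_num

theorem minus_mul_plus : Γ im * Γ ip = (-2 : ℂ) • sigP Γ := by
  rw [sigP, smul_smul]; norm_num

theorem tilt_eq_right (hs : ∀ i, Γ (it i) * c = sgn p i • (c * Γ (it i))) (i : Fin n) :
    tilt Γ c i = ((1 / 2) * sgn p i) • (Γ ip * Γ (it i) * c) := by
  rw [mul_assoc, hs, mul_smul_comm, smul_smul, mul_assoc, sgn_mul_self, mul_one, tilt, mul_assoc]

/-- Equivariance under `K_(k)`. -/
theorem field_tr (hs : ∀ i, Γ (it i) * c = sgn p i • (c * Γ (it i))) (k : Fin n)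
    (φ : Matrix ι ι ℂ →ₗ[ℂ] ℂ) :
    field Γ c α p (actOn φ (sgn p k • tilt Γ c k) (tilt Γ c k))
      = lieBr (gen (freq n α) (Gen.tr k)) (field Γ c α p φ) := by
  have hα := h.ne_zero
  have hss := fun i => sgn_mul_self p i
  rw [lieBr_field]
  -- The plus coefficient comes from `[K_(k), K_(k*)] = -α² K_(+)`, the starred one from `[K_(k),
  -- K_(-)] = -K_(k*)`. The factor 1/2 in the translations reflects that the double sum counts each
  -- rotation twice.
  rw [field_congr (a := -(α : ℂ) ^ 2 * φ (starOp Γ c α p k)) (b := 0)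
    (t := fun i => (1 / 2) * (φ (rotOp Γ c p i k) - φ (rotOp Γ c p k i)))
    (u := fun i => if i = k then -φ (Γ ip) else 0) (r := fun _ _ => 0)]
  · have e1 : lieBr (gen (freq n α) (Gen.tr k)) (gen (freq n α) Gen.plus) = 0 := by
      rw [lieBr_antisymm, lieBr_plus_gen, neg_zero]
    have e2 : lieBr (gen (freq n α) (Gen.tr k)) (gen (freq n α) Gen.minus)
        = -gen (freq n α) (Gen.star k) := by
      rw [lieBr_antisymm, lieBr_minus_tr]
    simp only [e1, e2, lieBr_tr_star, lieBr_tr_rot, lieBr_tr_tr, smul_sub, ite_smul, smul_ite,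
      zero_smul, smul_zero, one_smul, Finset.sum_sub_distrib, Finset.sum_ite_irrel,
      Finset.sum_ite_eq, Finset.sum_ite_eq', Finset.mem_univ, if_true,
      sub_smul, smul_smul, smul_neg, neg_smul, mul_sub,
      Finset.sum_const_zero, add_zero, zero_add]
    simp only [Finset.smul_sum, smul_smul]
    module
  · rw [actOn_apply]
    refine map_eq_mul φ ?_
    rw [h.tilt_eq, starOp, smul_mul_assoc, smul_mul_assoc, mul_smul_comm, mul_assoc c, mul_assoc (Γ ip),
      h.tr_minus, mul_neg, ← mul_assoc (Γ ip), h.plus_mul_minus, ← mul_assoc (Γ im),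
      ← h.comm_minus.eq, mul_assoc c, ← mul_assoc (Γ im), h.minus_mul_plus, smul_mul_assoc,
      smul_mul_assoc, ← (h.clifford.commute_tr_sigP k).eq, ← (h.clifford.commute_tr_sigM k).eq,
      smul_smul, mul_sub]
    simp only [mul_smul_comm, mul_neg, mul_assoc]
    match_scalars <;> field_simp
  · rw [actOn_apply, tilt, smul_mul_assoc, smul_mul_assoc, mul_smul_comm, mul_assoc (Γ ip * c),
      h.tr_plus, mul_neg, ← h.comm_plus.eq, mul_assoc c, ← mul_assoc (Γ ip), h.clifford.plus_sq,
      ← mul_assoc (Γ ip), ← mul_assoc (Γ ip), ← h.comm_plus.eq, mul_assoc c, h.clifford.plus_sq]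
    simp
  · intro i
    rw [actOn_apply, ← map_sub φ, h.rotOp_sub]
    refine map_eq_mul φ ?_
    rw [h.tilt_eq, smul_mul_assoc, smul_mul_assoc, mul_smul_comm, ← mul_assoc (Γ (it i)), hs,
      smul_mul_assoc, mul_assoc c, mul_assoc c, ← mul_assoc (Γ (it i)), h.tr_plus, mul_assoc (Γ ip)]
    simp only [neg_mul, mul_neg, mul_sub, mul_smul_comm, mul_assoc]
    module
  · intro i
    rw [actOn_apply]
    have e1 : sgn p k • tilt Γ c k * starOp Γ c α p i
        = (1 / 2 : ℂ) • (Γ ip * (Γ (it k) * Γ (it i))) := by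
      rw [h.tilt_eq, smul_mul_assoc, smul_mul_assoc, mul_assoc c, h.starOp_mul_left hs,
        mul_smul_comm, h.c_mul_c_mul, smul_smul, smul_smul, smul_smul]
      congr 1
      field_simp
      rw [pow_two, hss]
    have e2 : starOp Γ c α p i * tilt Γ c k = (1 / 2 : ℂ) • (Γ ip * (Γ (it i) * Γ (it k))) := by
      have e3 : Γ ip * (Γ (it i) * Γ (it k)) * c
          = (sgn p i * sgn p k) • (c * (Γ ip * (Γ (it i) * Γ (it k)))) := by
        rw [mul_assoc, mul_assoc (Γ (it i)), hs k, mul_smul_comm, ← mul_assoc (Γ (it i)), hs i,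
          smul_mul_assoc, smul_smul, mul_smul_comm, ← mul_assoc (Γ ip), ← mul_assoc (Γ ip),
          ← h.comm_plus.eq, mul_comm (sgn p k)]
        simp only [mul_assoc]
      rw [h.tilt_eq_right hs, mul_smul_comm, ← mul_assoc, h.starOp_mul_right, smul_mul_assoc,
        mul_assoc c, e3, mul_smul_comm, h.c_mul_c_mul, smul_smul, smul_smul, smul_smul]
      congr 1
      have e4 : (1 / 2) * sgn p k * (1 / (α : ℂ) ^ 2 * sgn p i) * (sgn p i * sgn p k) * (α : ℂ) ^ 2
          = (1 / 2) * (sgn p k * sgn p k) * (sgn p i * sgn p i) * (1 / (α : ℂ) ^ 2 * (α : ℂ) ^ 2) := by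
        ring
      rw [← mul_assoc] at *
      rw [e4, hss, hss, one_div_mul_cancel (pow_ne_zero 2 hα)]
      norm_num
    -- The signs cancel in pairs and the two products combine into the anticommutator of `Γ_k` and
    -- `Γ_i`, so only `i = k` survives.
    rw [e1, e2, ← smul_add, ← mul_add, h.clifford.tr_tr, mul_smul_comm, mul_one, smul_smul, map_smul]
    simp only [eq_comm (a := k), smul_eq_mul]
    split_ifs
    · ring
    · ring
  · intro i j
    obtain ⟨e1, e2, e3⟩ := h.plus_tr_mul_rotOp (p := p) i j k
    rw [actOn_apply, h.tilt_eq_right hs, smul_mul_assoc, smul_mul_assoc, mul_assoc _ c, e1,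
      mul_smul_comm, ← mul_assoc (rotOp Γ c p i j), e3]
    simp

/-- Equivariance under `K_(k*)`. -/
theorem field_star (hs : ∀ i, Γ (it i) * c = sgn p i • (c * Γ (it i))) (k : Fin n)
    (φ : Matrix ι ι ℂ →ₗ[ℂ] ℂ) :
    field Γ c α p (actOn φ (-spinAct Γ c α (Gen.star k)) (spinAct Γ c α (Gen.star k)))
      = lieBr (gen (freq n α) (Gen.star k)) (field Γ c α p φ) := by
  have hα := h.ne_zero
  -- The generator is skew for the form, so the functional is evaluated on a commutator.
  have hact : ∀ A, actOn φ (-spinAct Γ c α (Gen.star k)) (spinAct Γ c α (Gen.star k)) A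
      = ((1 / 2) * (α : ℂ) ^ 2) * φ (Γ ip * Γ (it k) * A - A * (Γ ip * Γ (it k))) := by
    intro A
    rw [actOn_apply, spinAct]
    refine map_eq_mul φ ?_
    simp only [neg_mul, smul_mul_assoc, mul_smul_comm]
    module
  rw [lieBr_field]
  rw [field_congr (a := (α : ℂ) ^ 2 * φ (Γ (it k))) (b := 0)
    (t := fun i => if i = k then -((α : ℂ) ^ 2) * φ (Γ ip) else 0)
    (u := fun i => (1 / 2) * (φ (rotOp Γ c p i k) - φ (rotOp Γ c p k i))) (r := fun _ _ => 0)]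
  · have e1 : lieBr (gen (freq n α) (Gen.star k)) (gen (freq n α) Gen.plus) = 0 := by
      rw [lieBr_antisymm, lieBr_plus_gen, neg_zero]
    have e2 : lieBr (gen (freq n α) (Gen.star k)) (gen (freq n α) Gen.minus)
        = -((α : ℂ) ^ 2 • gen (freq n α) (Gen.tr k)) := by
      rw [lieBr_antisymm, lieBr_minus_star]
    have e3 : ∀ i, lieBr (gen (freq n α) (Gen.star k)) (gen (freq n α) (Gen.tr i))
        = -((if i = k then -(α : ℂ) ^ 2 else 0) • gen (freq n α) Gen.plus) := by
      intro i
      rw [lieBr_antisymm, lieBr_tr_star]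
    simp only [e1, e2, e3, lieBr_star_star, lieBr_star_rot, smul_sub, ite_smul, smul_ite,
      zero_smul, smul_zero, one_smul, Finset.sum_sub_distrib, Finset.sum_ite_irrel,
      Finset.sum_ite_eq, Finset.sum_ite_eq', Finset.mem_univ, if_true, Finset.sum_neg_distrib,
      sub_smul, smul_smul, smul_neg, neg_smul, mul_sub,
      Finset.sum_const_zero, add_zero, zero_add]
    simp only [Finset.smul_sum, smul_smul]
    module
  · rw [hact, mul_assoc (Γ ip), h.tr_minus, mul_neg, ← mul_assoc, ← mul_assoc, ← neg_add', ← add_mul,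
      h.clifford.plus_minus, smul_mul_assoc, one_mul, ← neg_smul, map_smul, smul_eq_mul]
    ring
  · have e : Γ ip * Γ (it k) * Γ ip - Γ ip * (Γ ip * Γ (it k)) = 0 := by
      rw [mul_assoc (Γ ip), h.tr_plus, mul_neg, ← mul_assoc, h.clifford.plus_sq]
      simp
    rw [hact, e, map_zero, mul_zero]
  · intro i
    have e : Γ ip * Γ (it k) * Γ (it i) - Γ (it i) * (Γ ip * Γ (it k))
        = (if k = i then -2 else 0 : ℂ) • Γ ip := by
      rw [← mul_assoc (Γ (it i)), h.tr_plus, neg_mul, sub_neg_eq_add, mul_assoc, mul_assoc,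
        ← mul_add, h.clifford.tr_tr, mul_smul_comm, mul_one]
    rw [hact, e, map_smul]
    simp only [eq_comm (a := k), smul_eq_mul]
    split_ifs
    · ring
    · ring
  · intro i
    rw [hact, ← map_sub φ, h.rotOp_sub, h.starOp_mul_left hs, h.starOp_mul_right, mul_sub, mul_sub]
    simp only [mul_smul_comm, map_sub, map_smul, smul_eq_mul]
    field_simp
  · intro i j
    obtain ⟨e1, e2, e3⟩ := h.plus_tr_mul_rotOp (p := p) i j k
    rw [hact, e2, e3]
    simp

/-- Moving `c` past two gamma matrices of the same block gives the square of one sign. This is why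
precisely these rotations are admitted. -/
theorem commute_c_tr_tr (hs : ∀ i, Γ (it i) * c = sgn p i • (c * Γ (it i))) {k l : Fin n}
    (hkl : p k ↔ p l) : Commute c (Γ (it k) * Γ (it l)) := by
  show c * (Γ (it k) * Γ (it l)) = Γ (it k) * Γ (it l) * c
  rw [mul_assoc, hs, mul_smul_comm, ← mul_assoc (Γ (it k)), hs, smul_mul_assoc, smul_smul,
    sgn_congr p hkl, sgn_mul_self, one_smul, mul_assoc]

theorem commute_rotation_minus (i j : Fin n) :
    Commute ((1 / 4 : ℂ) • (Γ (it i) * Γ (it j) - Γ (it j) * Γ (it i))) (Γ im) := by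
  have key : ∀ i j : Fin n, Commute (Γ (it i) * Γ (it j)) (Γ im) := by
    intro i j
    show Γ (it i) * Γ (it j) * Γ im = Γ im * (Γ (it i) * Γ (it j))
    rw [mul_assoc, h.clifford.tr_inl, mul_neg, ← mul_assoc, h.clifford.tr_inl, neg_mul, neg_neg,
      mul_assoc]
  exact ((key i j).sub_left (key j i)).smul_left _

/-- Equivariance under `K_(kl)`. -/
theorem field_rot (hs : ∀ i, Γ (it i) * c = sgn p i • (c * Γ (it i))) {k l : Fin n}
    (hkl : p k ↔ p l) (φ : Matrix ι ι ℂ →ₗ[ℂ] ℂ) :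
    field Γ c α p (actOn φ (-spinAct Γ c α (Gen.rot k l)) (spinAct Γ c α (Gen.rot k l)))
      = lieBr (gen (freq n α) (Gen.rot k l)) (field Γ c α p φ) := by
  have hP := h.commute_rotation_plus k l
  have hM := h.commute_rotation_minus k l
  have hc := h.commute_rotation_c (h.commute_c_tr_tr hs hkl)
  have hσ := h.commute_rotation_sigP k l
  have hσ' := h.commute_rotation_sigM k l
  have hΓ := h.clifford.rotation_comm k l
  rw [lieBr_field]
  simp only [spinAct]
  generalize (1 / 4 : ℂ) • (Γ (it k) * Γ (it l) - Γ (it l) * Γ (it k)) = P at *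
  have hact : ∀ A, actOn φ (-P) P A = -φ (P * A - A * P) := by
    intro A
    rw [actOn_apply, ← map_neg φ]
    congr 1
    noncomm_ring
  have hR : ∀ i j, rotOp Γ c p i j = (if p i ↔ p j then -sgn p i else 0)
      • (c * (Γ (it i) * Γ (it j)) * Γ ip) := by
    intro i j
    rw [rotOp]
    split_ifs <;> simp
  rw [field_congr (a := 0) (b := 0)
    (t := fun i => (if l = i then φ (Γ (it k)) else 0) - (if k = i then φ (Γ (it l)) else 0))
    (u := fun i => (if l = i then φ (starOp Γ c α p k) else 0)
      - (if k = i then φ (starOp Γ c α p l) else 0))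
    (r := fun i j => (if l = i then φ (rotOp Γ c p k j) else 0)
      - (if k = i then φ (rotOp Γ c p l j) else 0)
      + ((if l = j then φ (rotOp Γ c p i k) else 0) - (if k = j then φ (rotOp Γ c p i l) else 0)))]
  · have e1 : lieBr (gen (freq n α) (Gen.rot k l)) (gen (freq n α) Gen.plus) = 0 := by
      rw [lieBr_antisymm, lieBr_plus_gen, neg_zero]
    have e2 : lieBr (gen (freq n α) (Gen.rot k l)) (gen (freq n α) Gen.minus) = 0 := by
      rw [lieBr_antisymm, lieBr_minus_rot, neg_zero]
    have e3 : ∀ i, lieBr (gen (freq n α) (Gen.rot k l)) (gen (freq n α) (Gen.tr i))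
        = (if i = k then 1 else 0 : ℂ) • gen (freq n α) (Gen.tr l)
          - (if i = l then 1 else 0 : ℂ) • gen (freq n α) (Gen.tr k) := by
      intro i
      rw [lieBr_antisymm, lieBr_tr_rot, neg_sub]
    have e4 : ∀ i, lieBr (gen (freq n α) (Gen.rot k l)) (gen (freq n α) (Gen.star i))
        = (if i = k then 1 else 0 : ℂ) • gen (freq n α) (Gen.star l)
          - (if i = l then 1 else 0 : ℂ) • gen (freq n α) (Gen.star k) := by
      intro i
      rw [lieBr_antisymm, lieBr_star_rot, neg_sub]
    have e5 : ∀ i j, lieBr (gen (freq n α) (Gen.rot k l)) (gen (freq n α) (Gen.rot i j))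
        = (if i = k then 1 else 0 : ℂ) • gen (freq n α) (Gen.rot l j)
          - (if i = l then 1 else 0 : ℂ) • gen (freq n α) (Gen.rot k j)
          + ((if j = k then 1 else 0 : ℂ) • gen (freq n α) (Gen.rot i l)
          - (if j = l then 1 else 0 : ℂ) • gen (freq n α) (Gen.rot i k)) := by
      intro i j
      -- Antisymmetry brings the bracket to the form in which each term replaces one of the two
      -- indices of `K_(ij)`.
      rw [lieBr_rot_rot, rot_swap _ l j, rot_swap _ k j]
      simp only [eq_comm (a := i), eq_comm (a := j)]
      module
    simp only [e1, e2, e3, e4, e5, smul_sub, ite_smul, smul_ite, smul_add, add_smul,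
      zero_smul, smul_zero, one_smul, Finset.sum_sub_distrib, Finset.sum_add_distrib,
      Finset.sum_ite_irrel, Finset.sum_ite_eq, Finset.sum_ite_eq', Finset.mem_univ, if_true,
      sub_smul, Finset.sum_const_zero, add_zero, zero_add]
  · rw [hact, hM.eq, sub_self, map_zero, neg_zero]
  · rw [hact, hP.eq, sub_self, map_zero, neg_zero]
  · intro i
    rw [hact, hΓ]
    simp only [map_sub, map_smul, smul_eq_mul, ite_mul, one_mul, zero_mul]
    ring
  · intro i
    have e : P * starOp Γ c α p i - starOp Γ c α p i * P
        = (if k = i then 1 else 0 : ℂ) • starOp Γ c α p l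
          - (if l = i then 1 else 0 : ℂ) • starOp Γ c α p k := by
      have h1 : Commute P (sigP Γ - sgn p i • sigM Γ) := hσ.sub_right (hσ'.smul_right _)
      have h2 : P * starOp Γ c α p i - starOp Γ c α p i * P = (1 / (α : ℂ) ^ 2) •
          (c * (P * Γ (it i) - Γ (it i) * P) * (sigP Γ - sgn p i • sigM Γ)) := by
        rw [starOp, mul_smul_comm, smul_mul_assoc, ← smul_sub, mul_assoc _ _ P, ← h1.eq, ← mul_assoc,
          ← mul_assoc, ← mul_assoc, hc.eq, ← sub_mul]
        simp only [mul_sub, mul_assoc]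
      rw [h2, hΓ]
      have h3 := sgn_congr p hkl
      by_cases hk : k = i
      · by_cases hl : l = i
        · subst hk; subst hl; simp
        · subst hk; simp [hl, starOp, h3]
      · by_cases hl : l = i
        · subst hl; simp [hk, starOp, h3]
        · simp [hk, hl]
    rw [hact, e]
    simp only [map_sub, map_smul, smul_eq_mul, ite_mul, one_mul, zero_mul]
    ring
  · intro i j
    have e : P * rotOp Γ c p i j - rotOp Γ c p i j * P
        = (if k = i then 1 else 0 : ℂ) • rotOp Γ c p l j
          - (if l = i then 1 else 0 : ℂ) • rotOp Γ c p k j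
          + ((if k = j then 1 else 0 : ℂ) • rotOp Γ c p i l
          - (if l = j then 1 else 0 : ℂ) • rotOp Γ c p i k) := by
      have h2 : P * (c * (Γ (it i) * Γ (it j)) * Γ ip) - c * (Γ (it i) * Γ (it j)) * Γ ip * P
          = c * ((P * Γ (it i) - Γ (it i) * P) * Γ (it j)
            + Γ (it i) * (P * Γ (it j) - Γ (it j) * P)) * Γ ip := by
        have h6 : P * (c * (Γ (it i) * Γ (it j)) * Γ ip) = c * (P * (Γ (it i) * Γ (it j))) * Γ ip := by
          rw [← mul_assoc, ← mul_assoc, hc.eq, mul_assoc c]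
        rw [mul_assoc _ _ P, ← hP.eq, h6]
        noncomm_ring
      have h3 := sgn_congr p hkl
      rw [hR i j, mul_smul_comm, smul_mul_assoc, ← smul_sub, h2, hΓ, hΓ]
      -- The coefficient of `rotOp` depends only on the blocks of its indices, and `k`, `l` lie in
      -- the same block. Exchanging them therefore affects only the gamma matrices.
      have h4 : ∀ x, (if p l ↔ p x then -sgn p l else 0) = if p k ↔ p x then -sgn p k else 0 := by
        intro x; simp only [hkl, h3]
      have h5 : ∀ x, (if p x ↔ p l then -sgn p x else 0) = if p x ↔ p k then -sgn p x else 0 := by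
        intro x; simp only [hkl]
      simp only [hR, h4, h5]
      set s : Fin n → Fin n → ℂ := fun i j => if p i ↔ p j then -sgn p i else 0 with hs'
      have hsl : ∀ x, s l x = s k x := h4
      have hsr : ∀ x, s x l = s x k := h5
      have a1 : s i j * (if k = i then 1 else 0) = (if k = i then 1 else 0) * s k j := by
        split_ifs with h <;> simp [h]
      have a2 : s i j * (if l = i then 1 else 0) = (if l = i then 1 else 0) * s k j := by
        rw [← hsl]; split_ifs with h <;> simp [h]
      have a3 : s i j * (if k = j then 1 else 0) = (if k = j then 1 else 0) * s i k := by
        split_ifs with h <;> simp [h]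
      have a4 : s i j * (if l = j then 1 else 0) = (if l = j then 1 else 0) * s i k := by
        rw [← hsr]; split_ifs with h <;> simp [h]
      simp only [sub_mul, mul_sub, add_mul, mul_add, smul_mul_assoc, mul_smul_comm, smul_add,
        smul_sub, smul_smul]
      change (s i j * _) • _ - (s i j * _) • _ + ((s i j * _) • _ - (s i j * _) • _)
        = (_ * s k j) • _ - (_ * s k j) • _ + ((_ * s i k) • _ - (_ * s i k) • _)
      rw [a1, a2, a3, a4]
    rw [hact, e]
    simp only [map_sub, map_add, map_smul, smul_eq_mul, ite_mul, one_mul, zero_mul]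
    ring

end IsSquareRoot
end SpinorBracket

/-! ## The bracket of spinors defined by a bilinear form -/

section SpinForm

variable {n : ℕ} {ι : Type} [Fintype ι] [DecidableEq ι]

/-- The functional `A ↦ v ⬝ᵥ (Cm A) w`. -/
def pairing (Cm : Matrix ι ι ℂ) (v w : ι → ℂ) : Matrix ι ι ℂ →ₗ[ℂ] ℂ where
  toFun A := v ⬝ᵥ (Cm *ᵥ (A *ᵥ w))
  map_add' A B := by rw [Matrix.add_mulVec, Matrix.mulVec_add, dotProduct_add]
  map_smul' k A := by
    rw [Matrix.smul_mulVec, Matrix.mulVec_smul, dotProduct_smul, RingHom.id_apply]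

theorem pairing_apply (Cm : Matrix ι ι ℂ) (v w : ι → ℂ) (A : Matrix ι ι ℂ) :
    pairing Cm v w A = v ⬝ᵥ (Cm *ᵥ (A *ᵥ w)) := rfl

/-- `A'` is the adjoint of `A` for the bilinear form `Cm`. -/
def IsAdj (Cm A A' : Matrix ι ι ℂ) : Prop := Aᵀ * Cm = Cm * A'

namespace IsAdj

variable {Cm A A' B B' : Matrix ι ι ℂ}

theorem mul (hA : IsAdj Cm A A') (hB : IsAdj Cm B B') : IsAdj Cm (A * B) (B' * A') := by
  rw [IsAdj, Matrix.transpose_mul, Matrix.mul_assoc, hA, ← Matrix.mul_assoc, hB, Matrix.mul_assoc]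

theorem sub (hA : IsAdj Cm A A') (hB : IsAdj Cm B B') : IsAdj Cm (A - B) (A' - B') := by
  rw [IsAdj, Matrix.transpose_sub, sub_mul, mul_sub, hA, hB]

theorem smul (k : ℂ) (hA : IsAdj Cm A A') : IsAdj Cm (k • A) (k • A') := by
  rw [IsAdj, Matrix.transpose_smul, smul_mul_assoc, mul_smul_comm, hA]

theorem neg (hA : IsAdj Cm A A') : IsAdj Cm (-A) (-A') := by
  rw [IsAdj, Matrix.transpose_neg, neg_mul, mul_neg, hA]

theorem zero : IsAdj Cm 0 0 := by simp [IsAdj]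

theorem one : IsAdj Cm 1 1 := by simp [IsAdj]

theorem congr (hA : IsAdj Cm A A') (e : A' = B') : IsAdj Cm A B' := e ▸ hA

theorem pairing_mulVec_left (hA : IsAdj Cm A A') (v w : ι → ℂ) (M : Matrix ι ι ℂ) :
    pairing Cm (A *ᵥ v) w M = pairing Cm v w (A' * M) := by
  rw [pairing_apply, pairing_apply, ← Matrix.vecMul_transpose, ← Matrix.dotProduct_mulVec,
    Matrix.mulVec_mulVec, hA]
  simp only [Matrix.mulVec_mulVec, Matrix.mul_assoc]

/-- Transposing costs one sign from the skew form. A second sign appears when the operator is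
skew-adjoint, and the pairing is then symmetric in the two spinors. -/
theorem pairing_swap (hC : Cmᵀ = -Cm) (hA : IsAdj Cm A A') (v w : ι → ℂ) :
    pairing Cm w v A = -pairing Cm v w A' := by
  rw [pairing_apply, pairing_apply, Matrix.mulVec_mulVec, Matrix.mulVec_mulVec, ← hA,
    Matrix.dotProduct_mulVec, dotProduct_comm, ← Matrix.mulVec_transpose, Matrix.transpose_mul, hC,
    mul_neg, Matrix.neg_mulVec, dotProduct_neg]

end IsAdj

theorem pairing_mulVec_right (Cm : Matrix ι ι ℂ) (v w : ι → ℂ) (A M : Matrix ι ι ℂ) :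
    pairing Cm v (A *ᵥ w) M = pairing Cm v w (M * A) := by
  rw [pairing_apply, pairing_apply, Matrix.mulVec_mulVec w M A]

theorem pairing_add_left (Cm : Matrix ι ι ℂ) (v v' w : ι → ℂ) :
    pairing Cm (v + v') w = pairing Cm v w + pairing Cm v' w := by
  ext1 A; exact add_dotProduct _ _ _

theorem pairing_smul_left (Cm : Matrix ι ι ℂ) (k : ℂ) (v w : ι → ℂ) :
    pairing Cm (k • v) w = k • pairing Cm v w := by
  ext1 A; exact smul_dotProduct _ _ _

/-- A skew bilinear form on spinors for which the gamma matrices and `c` are skew. -/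
structure IsSpinForm (Γ : Idx n → Matrix ι ι ℂ) (c Cm : Matrix ι ι ℂ) : Prop where
  skew : Cmᵀ = -Cm
  gamma : ∀ a, IsAdj Cm (Γ a) (-Γ a)
  adj_c : IsAdj Cm c (-c)

theorem field_add (Γ : Idx n → Matrix ι ι ℂ) (c : Matrix ι ι ℂ) (α : ℝ) (p : Fin n → Prop)
    [DecidablePred p] (φ ψ : Matrix ι ι ℂ →ₗ[ℂ] ℂ) :
    field Γ c α p (φ + ψ) = field Γ c α p φ + field Γ c α p ψ := by
  simp only [field, LinearMap.add_apply, add_smul, Finset.sum_add_distrib, smul_add]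
  abel

theorem field_smul (Γ : Idx n → Matrix ι ι ℂ) (c : Matrix ι ι ℂ) (α : ℝ) (p : Fin n → Prop)
    [DecidablePred p] (k : ℂ) (φ : Matrix ι ι ℂ →ₗ[ℂ] ℂ) :
    field Γ c α p (k • φ) = k • field Γ c α p φ := by
  simp only [field, LinearMap.smul_apply, smul_eq_mul, mul_smul, smul_add, Finset.smul_sum]
  simp only [smul_comm k (1 / 2 : ℂ)]

/-- Rotations that mix the two blocks are not admitted, but their operator is zero by definition. -/
theorem field_mem (Γ : Idx n → Matrix ι ι ℂ) (c : Matrix ι ι ℂ) (α : ℝ) (p : Fin n → Prop)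
    [DecidablePred p] (φ : Matrix ι ι ℂ →ₗ[ℂ] ℂ) :
    field Γ c α p φ
      ∈ Submodule.span ℂ (gen (freq n α) '' {g | g.Admits fun i j => (p i ↔ p j)}) := by
  set U := Submodule.span ℂ (gen (freq n α) '' {g | g.Admits fun i j => (p i ↔ p j)})
  have hm : ∀ g : Gen n, g.Admits (fun i j => (p i ↔ p j)) → gen (freq n α) g ∈ U :=
    fun g hg => Submodule.subset_span ⟨g, hg, rfl⟩
  have ht : ∀ g : Gen n, (∀ i j, g ≠ Gen.rot i j) → gen (freq n α) g ∈ U := by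
    intro g hg
    apply hm
    cases g <;> first | trivial | exact absurd rfl (hg _ _)
  refine U.add_mem (U.add_mem (U.add_mem (U.add_mem (U.smul_mem _ ?_) (U.smul_mem _ ?_))
    (U.sum_mem fun i _ => U.smul_mem _ ?_)) (U.sum_mem fun i _ => U.smul_mem _ ?_))
    (U.smul_mem _ (U.sum_mem fun i _ => U.sum_mem fun j _ => ?_))
  · exact ht _ (by simp)
  · exact ht _ (by simp)
  · exact ht _ (by simp)
  · exact ht _ (by simp)
  · by_cases hij : p i ↔ p j
    · exact U.smul_mem _ (hm _ hij)
    · rw [rotOp, if_neg hij, map_zero, zero_smul]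
      exact U.zero_mem

namespace IsSpinForm

variable {Γ : Idx n → Matrix ι ι ℂ} {c Cm : Matrix ι ι ℂ} {α : ℝ} (f : IsSpinForm Γ c Cm)
  {p : Fin n → Prop} [DecidablePred p]
include f

/-- Reversing the order of `Γ_-` and `Γ_+` exchanges the projections. Hence the form pairs `S_+`
with `S_-` and vanishes on each of them. -/
theorem adj_sigP : IsAdj Cm (sigP Γ) (sigM Γ) := by
  have := ((f.gamma im).mul (f.gamma ip)).smul (-(1 / 2))
  rwa [neg_mul_neg] at this

theorem adj_sigM : IsAdj Cm (sigM Γ) (sigP Γ) := by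
  have := ((f.gamma ip).mul (f.gamma im)).smul (-(1 / 2))
  rwa [neg_mul_neg] at this

variable (h : IsSquareRoot Γ c α)
include h

theorem adj_c_tr (hs : ∀ i, Γ (it i) * c = sgn p i • (c * Γ (it i))) (i : Fin n) :
    IsAdj Cm (c * Γ (it i)) (sgn p i • (c * Γ (it i))) := by
  have := f.adj_c.mul (f.gamma (it i))
  rwa [neg_mul_neg, hs] at this

/-- The adjoint of `c Γ_i` carries the sign of the direction `i` and the adjoint exchanges `σ_±`.
The relative sign in `starOp` is chosen so that the two effects combine to an overall minus. -/
theorem adj_starOp (hs : ∀ i, Γ (it i) * c = sgn p i • (c * Γ (it i))) (i : Fin n) :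
    IsAdj Cm (starOp Γ c α p i) (-starOp Γ c α p i) := by
  refine (((f.adj_c_tr h hs i).mul (f.adj_sigP.sub (f.adj_sigM.smul (sgn p i)))).smul _).congr ?_
  have e1 : Commute (sigM Γ) (c * Γ (it i)) :=
    h.commute_sigM.symm.mul_right (h.clifford.commute_tr_sigM i).symm
  have e2 : Commute (sigP Γ) (c * Γ (it i)) :=
    h.commute_sigP.symm.mul_right (h.clifford.commute_tr_sigP i).symm
  rw [starOp, ← smul_neg, sub_mul, smul_mul_assoc, mul_smul_comm, mul_smul_comm, e1.eq, e2.eq,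
    smul_smul, sgn_mul_self, mul_sub, mul_smul_comm]
  module

/-- Reversal of the product gives the sign from `Γ_j Γ_i = -Γ_i Γ_j`. On the diagonal it is absent,
which is harmless since `K_(ii) = 0`. -/
theorem adj_rotOp (hs : ∀ i, Γ (it i) * c = sgn p i • (c * Γ (it i))) {i j : Fin n} (hij : i ≠ j) :
    IsAdj Cm (rotOp Γ c p i j) (-rotOp Γ c p i j) := by
  by_cases hp : p i ↔ p j
  · rw [rotOp, if_pos hp]
    refine (((f.adj_c.mul ((f.gamma (it i)).mul (f.gamma (it j)))).mul (f.gamma ip)).smul _).congr ?_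
    have e : Γ ip * (Γ (it j) * Γ (it i)) = Γ (it j) * Γ (it i) * Γ ip := by
      rw [mul_assoc, h.tr_plus, mul_neg, ← mul_assoc (Γ (it j)), h.tr_plus, neg_mul, neg_neg,
        mul_assoc]
    rw [neg_mul_neg, mul_neg, neg_mul, mul_neg, neg_neg, ← (h.commute_c_tr_tr hs hp.symm).eq,
      ← mul_assoc, ← h.comm_plus.eq, mul_assoc, e, h.clifford.tr_anticomm hij.symm, mul_assoc c]
    simp only [neg_mul, mul_neg, smul_neg]
  · rw [rotOp, if_neg hp, neg_zero]
    exact IsAdj.zero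

theorem field_comm (hs : ∀ i, Γ (it i) * c = sgn p i • (c * Γ (it i))) (v w : ι → ℂ) :
    field Γ c α p (pairing Cm v w) = field Γ c α p (pairing Cm w v) := by
  have key : ∀ A, IsAdj Cm A (-A) → pairing Cm v w A = pairing Cm w v A := by
    intro A hA
    rw [hA.pairing_swap f.skew, map_neg, neg_neg]
  unfold field
  have hr : ∀ i j, pairing Cm v w (rotOp Γ c p i j) • gen (freq n α) (Gen.rot i j)
      = pairing Cm w v (rotOp Γ c p i j) • gen (freq n α) (Gen.rot i j) := by
    intro i j
    by_cases hij : i = j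
    · rw [hij, rot_self, smul_zero, smul_zero]
    · rw [key _ (f.adj_rotOp h hs hij)]
  simp only [key _ (f.gamma _), key _ (f.adj_starOp h hs _), hr]

/-- Together with `pairing_mulVec_left`, this moves the action from the first spinor onto the
operator, so that equivariance becomes a statement about `actOn`. -/
theorem adj_spinAct (hs : ∀ i, Γ (it i) * c = sgn p i • (c * Γ (it i))) (g : Gen n) :
    IsAdj Cm (spinAct Γ c α g) (spinActAdj Γ c α p g) := by
  cases g with
  | plus => exact IsAdj.zero
  | minus =>
    refine (f.adj_c.mul f.adj_sigM).neg.congr ?_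
    rw [mul_neg, neg_neg, spinActAdj, h.commute_sigP.eq]
  | tr i =>
    refine (((f.gamma ip).mul f.adj_c).mul (f.gamma (it i))).smul (1 / 2) |>.congr ?_
    rw [neg_mul_neg, neg_mul, spinActAdj, ← mul_assoc, hs, tilt, ← h.comm_plus.eq,
      smul_mul_assoc, mul_assoc c, mul_assoc c, h.tr_plus]
    simp only [mul_neg, smul_neg, neg_neg, smul_smul, mul_comm]
  | star i =>
    refine ((f.gamma ip).mul (f.gamma (it i))).smul (-(1 / 2) * (α : ℂ) ^ 2) |>.congr ?_
    rw [neg_mul_neg, spinActAdj, spinAct, h.tr_plus, smul_neg]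
  | rot i j =>
    refine (((f.gamma (it i)).mul (f.gamma (it j))).sub
      ((f.gamma (it j)).mul (f.gamma (it i)))).smul (1 / 4) |>.congr ?_
    rw [neg_mul_neg, neg_mul_neg, spinActAdj, spinAct, ← smul_neg, neg_sub]

theorem field_equivariant (hs : ∀ i, Γ (it i) * c = sgn p i • (c * Γ (it i))) {g : Gen n}
    (hg : g.Admits fun i j => (p i ↔ p j)) (v w : ι → ℂ) :
    field Γ c α p (pairing Cm (spinAct Γ c α g *ᵥ v) w)
      + field Γ c α p (pairing Cm v (spinAct Γ c α g *ᵥ w))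
      = lieBr (gen (freq n α) g) (field Γ c α p (pairing Cm v w)) := by
  have e : pairing Cm (spinAct Γ c α g *ᵥ v) w + pairing Cm v (spinAct Γ c α g *ᵥ w)
      = actOn (pairing Cm v w) (spinActAdj Γ c α p g) (spinAct Γ c α g) := by
    ext1 A
    rw [LinearMap.add_apply, (f.adj_spinAct h hs g).pairing_mulVec_left, pairing_mulVec_right,
      actOn_apply, map_add]
  rw [← field_add, e]
  cases g with
  | plus =>
    have e0 : actOn (pairing Cm v w) (spinActAdj Γ c α p Gen.plus) (spinAct Γ c α Gen.plus) = 0 := by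
      ext1 A
      simp [actOn_apply, spinActAdj, spinAct]
    have e1 := field_smul Γ c α p 0 0
    rw [zero_smul, zero_smul] at e1
    rw [e0, e1, lieBr_field]
    simp [lieBr_plus_gen]
  | minus => exact h.field_minus hs _
  | tr i => exact h.field_tr hs i _
  | star i => exact h.field_star hs i _
  | rot i j => exact h.field_rot hs hg _

end IsSpinForm

/-! ## Geometric superalgebras from a square root and a bilinear form -/

/-- The data are those of a space with `B = -α² 1`, of a connection given by a square root `c` of
`α²`, and of the bracket defined by a bilinear form. -/
structure IsHyperbolic (D : SuperData n ι) (α : ℝ) (p : Fin n → Prop) [DecidablePred p]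
    (Cm : Matrix ι ι ℂ) : Prop where
  B_eq : D.B = fun _ => -α ^ 2
  lam_eq : D.lam = freq n α
  d_eq : D.d = 0
  root : IsSquareRoot D.Γ D.c α
  sign : ∀ i, D.Γ (it i) * D.c = sgn p i • (D.c * D.Γ (it i))
  form : IsSpinForm D.Γ D.c Cm
  extended : IsExtended D.N D.Γ
  rot_eq : D.rot = fun i j => (p i ↔ p j)
  K1_le : D.K1 ≤ parallel (fun _ => -α ^ 2) D.Γ D.c 0
  stable : ∀ g : Gen n, g.Admits D.rot → ∀ ξ ∈ D.K1, par D.Γ D.c α (spinAct D.Γ D.c α g *ᵥ ξ 0) ∈ D.K1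
  br_eq : ∀ ξ ∈ D.K1, ∀ η ∈ D.K1, D.br ξ η = field D.Γ D.c α p (pairing Cm (ξ 0) (η 0))

namespace IsHyperbolic

variable {D : SuperData n ι} {α : ℝ} {p : Fin n → Prop} [DecidablePred p] {Cm : Matrix ι ι ℂ}
  (h : IsHyperbolic D α p Cm)
include h

theorem K0_eq : D.K0
    = Submodule.span ℂ (gen (freq n α) '' {g | g.Admits fun i j => (p i ↔ p j)}) := by
  rw [SuperData.K0, h.lam_eq, h.rot_eq]

theorem commute_rot : ∀ i j : Fin n, (p i ↔ p j) → Commute D.c (D.Γ (it i) * D.Γ (it j)) :=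
  fun _ _ hij => h.root.commute_c_tr_tr h.sign hij

theorem contDiff_of_mem_K0 {X : VF n} (hX : X ∈ D.K0) : ContDiff ℝ ∞ X := by
  refine contDiff_of_mem_span ?_ hX
  rintro _ ⟨g, _, rfl⟩
  exact contDiff_gen _ g

theorem L_gen {g : Gen n} (hg : g.Admits fun i j => (p i ↔ p j)) {ξ : SF n ι} (hξ : ξ ∈ D.K1) :
    D.L (gen (freq n α) g) ξ = par D.Γ D.c α (spinAct D.Γ D.c α g *ᵥ ξ 0) := by
  rw [SuperData.L, h.B_eq, h.root.eq_par (h.K1_le hξ), h.root.par_zero]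
  exact (h.root.hasSymbol_gen h.commute_rot hg).2 _

/-- The set of labels and the subspace are kept general so that the same argument covers the full
odd part and the restricted odd part of the reduction. -/
theorem L_mem_of_span {K : Submodule ℂ (SF n ι)} {S : Set (Gen n)}
    (hS : ∀ g ∈ S, ∀ ξ ∈ K, par D.Γ D.c α (spinAct D.Γ D.c α g *ᵥ ξ 0) ∈ K) (hK : K ≤ D.K1)
    (hA : ∀ g ∈ S, g.Admits D.rot) {X : VF n} (hX : X ∈ Submodule.span ℂ (gen D.lam '' S))
    {ξ : SF n ι} (hξ : ξ ∈ K) : D.L X ξ ∈ K := by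
  rw [h.lam_eq] at hX
  have hs : ∀ X ∈ Submodule.span ℂ (gen (freq n α) '' S), ContDiff ℝ ∞ X := by
    intro X hX
    refine contDiff_of_mem_span ?_ hX
    rintro _ ⟨g, _, rfl⟩
    exact contDiff_gen _ g
  induction hX using Submodule.span_induction with
  | mem X hX =>
    obtain ⟨g, hg, rfl⟩ := hX
    rw [h.L_gen (by have := hA g hg; rwa [h.rot_eq] at this) (hK hξ)]
    exact hS g hg ξ hξ
  | zero =>
    rw [SuperData.L, lieDer_zero_left]
    exact K.zero_mem
  | add X Y hX hY h1 h2 =>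
    rw [SuperData.L, lieDer_add_left _ (hs X hX) (hs Y hY)]
    exact K.add_mem h1 h2
  | smul k X hX h1 =>
    rw [SuperData.L, lieDer_smul_left _ _ (hs X hX)]
    exact K.smul_mem k h1

theorem contDiff_of_mem_K1 {ξ : SF n ι} (hξ : ξ ∈ D.K1) : ContDiff ℝ ∞ ξ := (h.K1_le hξ).1

theorem L_mem {X : VF n} (hX : X ∈ D.K0) {ξ : SF n ι} (hξ : ξ ∈ D.K1) : D.L X ξ ∈ D.K1 :=
  h.L_mem_of_span h.stable le_rfl (fun _ hg => hg) hX hξ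

theorem br_comm {ξ η : SF n ι} (hξ : ξ ∈ D.K1) (hη : η ∈ D.K1) : D.br ξ η = D.br η ξ := by
  rw [h.br_eq ξ hξ η hη, h.br_eq η hη ξ hξ, h.form.field_comm h.root h.sign]

theorem br_add {ξ η ζ : SF n ι} (hξ : ξ ∈ D.K1) (hη : η ∈ D.K1) (hζ : ζ ∈ D.K1) :
    D.br (ξ + η) ζ = D.br ξ ζ + D.br η ζ := by
  rw [h.br_eq _ (D.K1.add_mem hξ hη) ζ hζ, h.br_eq ξ hξ ζ hζ, h.br_eq η hη ζ hζ, ← field_add,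
    ← pairing_add_left]
  rfl

theorem br_smul (k : ℂ) {ξ η : SF n ι} (hξ : ξ ∈ D.K1) (hη : η ∈ D.K1) :
    D.br (k • ξ) η = k • D.br ξ η := by
  rw [h.br_eq _ (D.K1.smul_mem k hξ) η hη, h.br_eq ξ hξ η hη, ← field_smul, ← pairing_smul_left]
  rfl

theorem br_mem {ξ η : SF n ι} (hξ : ξ ∈ D.K1) (hη : η ∈ D.K1) : D.br ξ η ∈ D.K0 := by
  rw [h.br_eq ξ hξ η hη, h.K0_eq]
  exact field_mem _ _ _ _ _

/-- Bilinear form of the equivariance. It is linear in `X`, so the generators suffice; the inductive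
steps need the symmetry of the bracket because additivity is available in the first argument only.
-/
theorem br_equivariant {X : VF n} (hX : X ∈ D.K0) {ξ η : SF n ι} (hξ : ξ ∈ D.K1) (hη : η ∈ D.K1) :
    D.br (D.L X ξ) η + D.br ξ (D.L X η) = lieBr X (D.br ξ η) := by
  have hX' := hX
  rw [h.K0_eq] at hX'
  induction hX' using Submodule.span_induction with
  | mem X hX' =>
    obtain ⟨g, hg, rfl⟩ := hX'
    rw [h.br_eq _ (h.L_mem hX hξ) η hη, h.br_eq ξ hξ _ (h.L_mem hX hη), h.br_eq ξ hξ η hη,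
      h.L_gen hg hξ, h.L_gen hg hη, h.root.par_zero, h.root.par_zero]
    exact h.form.field_equivariant h.root h.sign hg _ _
  | zero =>
    have e := h.br_smul 0 hξ hη
    have e' := h.br_smul 0 hη hξ
    rw [zero_smul, zero_smul] at e e'
    simp only [SuperData.L]
    rw [lieDer_zero_left, lieDer_zero_left, e, h.br_comm hξ D.K1.zero_mem, e',
      lieBr_zero_left, add_zero]
  | add X Y h1 h2 ih1 ih2 =>
    rw [← h.K0_eq] at h1 h2
    have sX := h.contDiff_of_mem_K0 h1
    have sY := h.contDiff_of_mem_K0 h2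
    have sB := h.contDiff_of_mem_K0 (h.br_mem hξ hη)
    have a1 := h.L_mem h1 hξ
    have a2 := h.L_mem h1 hη
    have a3 := h.L_mem h2 hξ
    have a4 := h.L_mem h2 hη
    simp only [SuperData.L] at a1 a2 a3 a4 ih1 ih2 ⊢
    rw [lieDer_add_left _ sX sY, lieDer_add_left _ sX sY, h.br_add a1 a3 hη,
      h.br_comm hξ (D.K1.add_mem a2 a4), h.br_add a2 a4 hξ, h.br_comm a2 hξ, h.br_comm a4 hξ,
      lieBr_add_left _ sX sY, ← ih1 h1, ← ih2 h2]
    abel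
  | smul k X h1 ih1 =>
    rw [← h.K0_eq] at h1
    have sX := h.contDiff_of_mem_K0 h1
    have a1 := h.L_mem h1 hξ
    have a2 := h.L_mem h1 hη
    simp only [SuperData.L] at a1 a2 ih1 ⊢
    rw [lieDer_smul_left _ _ sX, lieDer_smul_left _ _ sX, h.br_smul k a1 hη,
      h.br_comm hξ (D.K1.smul_mem k a2), h.br_smul k a2 hξ, h.br_comm a2 hξ,
      lieBr_smul_left k _ sX, ← ih1 h1, smul_add]

theorem isGeometric : D.IsGeometric where
  lam_sq i := by rw [h.lam_eq, h.B_eq, freq_sq]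
  clifford := h.root.clifford
  extended := h.extended
  c_comm := ⟨h.root.comm_plus, h.root.comm_minus⟩
  d_comm := by rw [h.d_eq]; exact ⟨Commute.zero_left _, Commute.zero_left _⟩
  killing X hX := by
    rw [h.K0_eq] at hX
    rw [h.B_eq]
    refine isKilling_of_mem_span ?_ hX
    rintro _ ⟨g, _, rfl⟩
    exact isKilling_gen (freq_sq α) g fun _ _ _ => rfl
  lie_mem X hX Y hY := by
    rw [h.K0_eq] at hX hY ⊢
    have hr : Equivalence fun i j => (p i ↔ p j) := ⟨fun _ => Iff.rfl, Iff.symm, Iff.trans⟩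
    refine lieBr_mem_of_span ?_ ?_ ?_ hX hY
    · rintro _ ⟨g, _, rfl⟩
      exact contDiff_gen _ g
    · rintro _ ⟨g, _, rfl⟩
      exact contDiff_gen _ g
    · rintro _ ⟨g, hg, rfl⟩ _ ⟨g', hg', rfl⟩
      exact lieBr_gen_mem α hr hg hg'
  smooth ξ hξ := h.contDiff_of_mem_K1 hξ
  parallel ξ hξ := by
    rw [h.B_eq, h.d_eq]
    exact (h.K1_le hξ).2
  L_mem X hX ξ hξ := h.L_mem hX hξ
  L_add_left X hX Y hY ξ _ := by
    simp only [SuperData.L]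
    exact lieDer_add_left _ (h.contDiff_of_mem_K0 hX) (h.contDiff_of_mem_K0 hY) ξ
  L_smul_left k X hX ξ _ := by
    simp only [SuperData.L]
    exact lieDer_smul_left _ k (h.contDiff_of_mem_K0 hX) ξ
  L_add_right X _ ξ hξ η hη := by
    simp only [SuperData.L]
    exact lieDer_add_right _ X (h.contDiff_of_mem_K1 hξ) (h.contDiff_of_mem_K1 hη)
  L_smul_right k X _ ξ hξ := by
    simp only [SuperData.L]
    exact lieDer_smul_right _ X k (h.contDiff_of_mem_K1 hξ)
  L_lie X hX Y hY ξ hξ := by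
    rw [h.K0_eq] at hX hY
    obtain ⟨M, hM⟩ := h.root.exists_hasSymbol h.commute_rot hX
    obtain ⟨N, hN⟩ := h.root.exists_hasSymbol h.commute_rot hY
    have hr : Equivalence fun i j => (p i ↔ p j) := ⟨fun _ => Iff.rfl, Iff.symm, Iff.trans⟩
    have hMN := h.root.hasSymbol_lieBr h.commute_rot hr
      hX hY hM hN
    simp only [SuperData.L]
    rw [h.B_eq, h.root.eq_par (h.K1_le hξ), hM.2, hN.2, hM.2, hN.2, hMN.2, Matrix.sub_mulVec,
      Matrix.mulVec_mulVec, Matrix.mulVec_mulVec, sub_eq_add_neg, sub_eq_add_neg,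
      HasSymbol.par_add, ← neg_one_smul ℂ (_ *ᵥ _), HasSymbol.par_smul, neg_one_smul]
  br_mem ξ hξ η hη := h.br_mem hξ hη
  br_symm ξ hξ η hη := h.br_comm hξ hη
  br_add ξ hξ η hη ζ hζ := h.br_add hξ hη hζ
  br_smul k ξ hξ η hη := h.br_smul k hξ hη
  br_equivariant X hX ξ hξ := by
    -- On the diagonal the two terms of the bilinear identity agree by symmetry.
    rw [← h.br_equivariant hX hξ hξ, h.br_comm hξ (h.L_mem hX hξ), two_smul]

end IsHyperbolic
end SpinForm

/-! ## The explicit Clifford modules -/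

theorem IsAdj.kronecker {ι κ : Type} [Fintype ι] [DecidableEq ι] [Fintype κ] [DecidableEq κ]
    {C₁ A A' : Matrix ι ι ℂ} {C₂ B B' : Matrix κ κ ℂ} (hA : IsAdj C₁ A A') (hB : IsAdj C₂ B B') :
    IsAdj (C₁ ⊗ₖ C₂) (A ⊗ₖ B) (A' ⊗ₖ B') := by
  rw [IsAdj, ← Matrix.mul_kronecker_mul, ← hA, ← hB, Matrix.mul_kronecker_mul,
    Matrix.kroneckerMap_transpose]

theorem pauliX_mul_X : pauliX * pauliX = 1 := by
  ext i j; fin_cases i <;> fin_cases j <;> simp [pauliX]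
theorem pauliY_mul_Y : pauliY * pauliY = 1 := by
  ext i j; fin_cases i <;> fin_cases j <;> simp [pauliY]
theorem pauliZ_mul_Z : pauliZ * pauliZ = 1 := by
  ext i j; fin_cases i <;> fin_cases j <;> simp [pauliZ]
theorem pauliX_mul_Y : pauliX * pauliY = Complex.I • pauliZ := by
  ext i j; fin_cases i <;> fin_cases j <;> simp [pauliX, pauliY, pauliZ]
theorem pauliY_mul_X : pauliY * pauliX = -(Complex.I • pauliZ) := by
  ext i j; fin_cases i <;> fin_cases j <;> simp [pauliX, pauliY, pauliZ]
theorem pauliX_mul_Z : pauliX * pauliZ = -(Complex.I • pauliY) := by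
  ext i j; fin_cases i <;> fin_cases j <;> simp [pauliX, pauliY, pauliZ]
theorem pauliZ_mul_X : pauliZ * pauliX = Complex.I • pauliY := by
  ext i j; fin_cases i <;> fin_cases j <;> simp [pauliX, pauliY, pauliZ]
theorem pauliY_mul_Z : pauliY * pauliZ = Complex.I • pauliX := by
  ext i j; fin_cases i <;> fin_cases j <;> simp [pauliX, pauliY, pauliZ]
theorem pauliZ_mul_Y : pauliZ * pauliY = -(Complex.I • pauliX) := by
  ext i j; fin_cases i <;> fin_cases j <;> simp [pauliX, pauliY, pauliZ]

theorem kronecker_neg {ι κ : Type} (A : Matrix ι ι ℂ) (B : Matrix κ κ ℂ) :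
    A ⊗ₖ (-B) = -(A ⊗ₖ B) := by
  ext i j; simp

theorem neg_kronecker {ι κ : Type} (A : Matrix ι ι ℂ) (B : Matrix κ κ ℂ) :
    (-A) ⊗ₖ B = -(A ⊗ₖ B) := by
  ext i j; simp

theorem T5_mul_add (a b : Fin 5) :
    T5 a * T5 b + T5 b * T5 a = if a = b then (-2 : ℂ) • (1 : Matrix I5 I5 ℂ) else 0 := by
  have h2 : (-1 : Matrix I5 I5 ℂ) + -1 = (-2 : ℂ) • 1 := by module
  fin_cases a <;> fin_cases b <;>
    simp [T5, ← Matrix.mul_kronecker_mul, pauliX_mul_X, pauliY_mul_Y, pauliZ_mul_Z, pauliX_mul_Y,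
      pauliY_mul_X, pauliX_mul_Z, pauliZ_mul_X, pauliY_mul_Z, pauliZ_mul_Y, smul_smul,
      Matrix.smul_kronecker, Matrix.kronecker_smul, kronecker_neg, neg_kronecker, h2]

theorem T5_sq (a : Fin 5) : T5 a * T5 a = -1 := by
  have := T5_mul_add a a
  rw [if_pos rfl, ← two_smul ℂ (T5 a * T5 a)] at this
  have h2 := congrArg (fun M : Matrix I5 I5 ℂ => (1 / 2 : ℂ) • M) this
  simp only [smul_smul] at h2
  norm_num at h2
  exact h2

theorem T5_anticomm {a b : Fin 5} (hab : a ≠ b) : T5 a * T5 b = -(T5 b * T5 a) := by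
  have := T5_mul_add a b
  rw [if_neg hab] at this
  exact eq_neg_of_add_eq_zero_left this

theorem adj_T5 (a : Fin 5) : IsAdj C5 (T5 a) (T5 a) := by
  have hX : IsAdj pauliX pauliX pauliX := by
    ext i j; fin_cases i <;> fin_cases j <;> simp [Matrix.mul_apply, Fin.sum_univ_two, pauliX]
  have hY : IsAdj pauliX pauliY pauliY := by
    ext i j; fin_cases i <;> fin_cases j <;> simp [Matrix.mul_apply, Fin.sum_univ_two, pauliX, pauliY]
  have hZ : IsAdj pauliX pauliZ (-pauliZ) := by
    ext i j; fin_cases i <;> fin_cases j <;> simp [Matrix.mul_apply, Fin.sum_univ_two, pauliX, pauliZ]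
  have eX : IsAdj !![0, 1; -1, 0] pauliX (-pauliX) := by
    ext i j; fin_cases i <;> fin_cases j <;> simp [Matrix.mul_apply, Fin.sum_univ_two, pauliX]
  have eY : IsAdj !![0, 1; -1, 0] pauliY (-pauliY) := by
    ext i j; fin_cases i <;> fin_cases j <;> simp [Matrix.mul_apply, Fin.sum_univ_two, pauliY]
  have eZ : IsAdj !![0, 1; -1, 0] pauliZ (-pauliZ) := by
    ext i j; fin_cases i <;> fin_cases j <;> simp [Matrix.mul_apply, Fin.sum_univ_two, pauliZ]
  fin_cases a
  · exact (hX.kronecker IsAdj.one).smul _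
  · exact (hY.kronecker IsAdj.one).smul _
  · exact ((hZ.kronecker eX).smul _).congr (by simp [kronecker_neg, neg_kronecker, T5])
  · exact ((hZ.kronecker eY).smul _).congr (by simp [kronecker_neg, neg_kronecker, T5])
  · exact ((hZ.kronecker eZ).smul _).congr (by simp [kronecker_neg, neg_kronecker, T5])

theorem C5_transpose : C5ᵀ = -C5 := by
  ext ⟨a, b⟩ ⟨c, d⟩
  fin_cases a <;> fin_cases b <;> fin_cases c <;> fin_cases d <;> simp [C5, pauliX]

/-- `[0 2; 0 0]`, `[0 0; -1 0]`, the two-dimensional factors of `Γ_+` and `Γ_-`. -/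
abbrev upM : Matrix (Fin 2) (Fin 2) ℂ := !![0, 2; 0, 0]
abbrev downM : Matrix (Fin 2) (Fin 2) ℂ := !![0, 0; -1, 0]
abbrev epsM : Matrix (Fin 2) (Fin 2) ℂ := !![0, 1; -1, 0]

theorem upM_sq : upM * upM = 0 := by
  ext i j; fin_cases i <;> fin_cases j <;> simp
theorem downM_sq : downM * downM = 0 := by
  ext i j; fin_cases i <;> fin_cases j <;> simp
theorem upM_downM : upM * downM + downM * upM = (-2 : ℂ) • 1 := by
  ext i j; fin_cases i <;> fin_cases j <;> simp
theorem upM_Z : upM * pauliZ = -(pauliZ * upM) := by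
  ext i j; fin_cases i <;> fin_cases j <;> simp [pauliZ]
theorem downM_Z : downM * pauliZ = -(pauliZ * downM) := by
  ext i j; fin_cases i <;> fin_cases j <;> simp [pauliZ]

theorem gam6_tr_inl (i : Fin 4) (a : Fin 2) :
    gam6 (it i) * gam6 (Sum.inl a) = -(gam6 (Sum.inl a) * gam6 (it i)) := by
  fin_cases a
  · show (pauliZ ⊗ₖ T4 i) * (upM ⊗ₖ 1) = -((upM ⊗ₖ 1) * (pauliZ ⊗ₖ T4 i))
    rw [← Matrix.mul_kronecker_mul, ← Matrix.mul_kronecker_mul, upM_Z, neg_kronecker, neg_neg,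
      mul_one, one_mul]
  · show (pauliZ ⊗ₖ T4 i) * (downM ⊗ₖ 1) = -((downM ⊗ₖ 1) * (pauliZ ⊗ₖ T4 i))
    rw [← Matrix.mul_kronecker_mul, ← Matrix.mul_kronecker_mul, downM_Z, neg_kronecker, neg_neg,
      mul_one, one_mul]

theorem gam6_tr_mul (i j : Fin 4) : gam6 (it i) * gam6 (it j) = 1 ⊗ₖ (T4 i * T4 j) := by
  show (pauliZ ⊗ₖ T4 i) * (pauliZ ⊗ₖ T4 j) = _
  rw [← Matrix.mul_kronecker_mul, pauliZ_mul_Z]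

theorem isClifford_gam6 : IsClifford gam6 := by
  have h0 : gam6 (Sum.inl 0) = upM ⊗ₖ 1 := rfl
  have h1 : gam6 (Sum.inl 1) = downM ⊗ₖ 1 := rfl
  rintro (a | i) (b | j)
  · have hz : (0 : Matrix (Fin 2) (Fin 2) ℂ) ⊗ₖ (1 : Matrix I5 I5 ℂ) = 0 := Matrix.zero_kronecker _
    fin_cases a <;> fin_cases b <;>
      simp only [Fin.zero_eta, Fin.mk_one, h0, h1, ← Matrix.mul_kronecker_mul, upM_sq, downM_sq,
        mul_one, hz, add_zero, bar]
    · rfl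
    · rw [← Matrix.add_kronecker, upM_downM, Matrix.smul_kronecker, Matrix.one_kronecker_one]
      rfl
    · rw [← Matrix.add_kronecker, add_comm, upM_downM, Matrix.smul_kronecker,
        Matrix.one_kronecker_one]
      rfl
    · rfl
  · rw [gam6_tr_inl, add_neg_cancel, if_neg (by simp [bar])]
  · rw [gam6_tr_inl, neg_add_cancel, if_neg (by simp [bar])]
  · rw [gam6_tr_mul, gam6_tr_mul, ← Matrix.kronecker_add, T4, T4, T5_mul_add]
    simp only [bar, Sum.inr.injEq, Fin.castSucc_inj, eq_comm (a := i)]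
    split_ifs
    · rw [Matrix.kronecker_smul, Matrix.one_kronecker_one]
    · rw [Matrix.kronecker_zero]

theorem adj_gam6 (a : Idx 4) : IsAdj C6 (gam6 a) (-gam6 a) := by
  have hu : IsAdj epsM upM (-upM) := by
    ext i j; fin_cases i <;> fin_cases j <;> simp [Matrix.mul_apply, Fin.sum_univ_two]
  have hd : IsAdj epsM downM (-downM) := by
    ext i j; fin_cases i <;> fin_cases j <;> simp [Matrix.mul_apply, Fin.sum_univ_two]
  have hz : IsAdj epsM pauliZ (-pauliZ) := by
    ext i j; fin_cases i <;> fin_cases j <;> simp [Matrix.mul_apply, Fin.sum_univ_two, pauliZ]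
  rcases a with a | i
  · fin_cases a
    · exact (hu.kronecker IsAdj.one).congr (neg_kronecker _ _)
    · exact (hd.kronecker IsAdj.one).congr (neg_kronecker _ _)
  · exact (hz.kronecker (adj_T5 _)).congr (neg_kronecker _ _)

theorem C6_transpose : C6ᵀ = C6 := by
  have he : epsMᵀ = -epsM := by
    ext i j; fin_cases i <;> fin_cases j <;> simp
  rw [C6, ← Matrix.kroneckerMap_transpose, C5_transpose]
  show epsMᵀ ⊗ₖ (-C5) = _
  rw [he, neg_kronecker, kronecker_neg, neg_neg]

theorem gam6_quad : gam6 (it 0) * gam6 (it 1) * gam6 (it 2) * gam6 (it 3)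
    = 1 ⊗ₖ (-(pauliZ ⊗ₖ pauliZ)) := by
  rw [mul_assoc, gam6_tr_mul, gam6_tr_mul, ← Matrix.mul_kronecker_mul, one_mul]
  congr 1
  show (Complex.I • (pauliX ⊗ₖ 1)) * (Complex.I • (pauliY ⊗ₖ 1))
    * ((Complex.I • (pauliZ ⊗ₖ pauliX)) * (Complex.I • (pauliZ ⊗ₖ pauliY))) = _
  simp only [smul_mul_assoc, mul_smul_comm, ← Matrix.mul_kronecker_mul, pauliX_mul_Y, pauliZ_mul_Z,
    smul_smul, Matrix.smul_kronecker, Matrix.kronecker_smul, one_mul, mul_one]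
  have : Complex.I * (Complex.I * (Complex.I * (Complex.I * (Complex.I * Complex.I)))) = -1 := by
    linear_combination (Complex.I ^ 4 - Complex.I ^ 2 + 1) * Complex.I_sq
  simp only [mul_assoc, this, neg_smul, one_smul]

theorem chir6_eq : chir6 = pauliZ ⊗ₖ (pauliZ ⊗ₖ pauliZ) := by
  have h : (1 / 2 : ℂ) • (upM * downM - downM * upM) = -pauliZ := by
    ext i j; fin_cases i <;> fin_cases j <;> simp [pauliZ]
  have h2 : gam6 ip * gam6 im - gam6 im * gam6 ip = (upM * downM - downM * upM) ⊗ₖ 1 := by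
    show (upM ⊗ₖ 1) * (downM ⊗ₖ 1) - (downM ⊗ₖ 1) * (upM ⊗ₖ 1) = _
    rw [← Matrix.mul_kronecker_mul, ← Matrix.mul_kronecker_mul, mul_one]
    ext i j
    simp only [Matrix.sub_apply, Matrix.kroneckerMap_apply, sub_mul]
  rw [chir6, gam6_quad, h2, ← Matrix.smul_kronecker, h, ← Matrix.mul_kronecker_mul, mul_one, one_mul,
    neg_kronecker, kronecker_neg, neg_neg]

/-- Up to a scalar, the chirality operator is the gamma matrix that the fifth matrix of `ℝ⁵` would
define. Its anticommutation with the gamma matrices and its adjoint follow from those of `T5`. -/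
theorem chir6_eq_T5 : chir6 = (-Complex.I) • (pauliZ ⊗ₖ T5 4) := by
  rw [chir6_eq]
  show _ = (-Complex.I) • (pauliZ ⊗ₖ (Complex.I • (pauliZ ⊗ₖ pauliZ)))
  rw [Matrix.kronecker_smul, smul_smul]
  simp

theorem chir6_sq : chir6 * chir6 = 1 := by
  rw [chir6_eq]
  simp only [← Matrix.mul_kronecker_mul, pauliZ_mul_Z, Matrix.one_kronecker_one]

theorem gam6_mul_chir6 (a : Idx 4) : gam6 a * chir6 = -(chir6 * gam6 a) := by
  rw [chir6_eq_T5, mul_smul_comm, smul_mul_assoc, ← smul_neg]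
  congr 1
  rcases a with a | i
  · fin_cases a
    · show (upM ⊗ₖ 1) * (pauliZ ⊗ₖ T5 4) = -((pauliZ ⊗ₖ T5 4) * (upM ⊗ₖ 1))
      rw [← Matrix.mul_kronecker_mul, ← Matrix.mul_kronecker_mul, upM_Z, neg_kronecker,
        mul_one, one_mul]
    · show (downM ⊗ₖ 1) * (pauliZ ⊗ₖ T5 4) = -((pauliZ ⊗ₖ T5 4) * (downM ⊗ₖ 1))
      rw [← Matrix.mul_kronecker_mul, ← Matrix.mul_kronecker_mul, downM_Z, neg_kronecker,
        mul_one, one_mul]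
  · show (pauliZ ⊗ₖ T5 i.castSucc) * (pauliZ ⊗ₖ T5 4) = -((pauliZ ⊗ₖ T5 4) * (pauliZ ⊗ₖ T5 i.castSucc))
    rw [← Matrix.mul_kronecker_mul, ← Matrix.mul_kronecker_mul, T5_anticomm (a := i.castSucc) (b := 4)
      (by fin_cases i <;> decide), kronecker_neg]

theorem adj_chir6 : IsAdj C6 chir6 (-chir6) := by
  have hz : IsAdj epsM pauliZ (-pauliZ) := by
    ext i j; fin_cases i <;> fin_cases j <;> simp [Matrix.mul_apply, Fin.sum_univ_two, pauliZ]
  rw [chir6_eq_T5]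
  exact ((hz.kronecker (adj_T5 4)).smul _).congr (by rw [neg_kronecker, smul_neg])

theorem IsClifford.kronecker_one {n : ℕ} {ι κ : Type} [Fintype ι] [DecidableEq ι] [Fintype κ]
    [DecidableEq κ] {Γ : Idx n → Matrix ι ι ℂ} (h : IsClifford Γ) :
    IsClifford fun a => Γ a ⊗ₖ (1 : Matrix κ κ ℂ) := by
  intro a b
  simp only [← Matrix.mul_kronecker_mul, mul_one, ← Matrix.add_kronecker, h a b]
  split_ifs
  · rw [Matrix.smul_kronecker, Matrix.one_kronecker_one]
  · rw [Matrix.zero_kronecker]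

theorem isClifford_Gam6 : IsClifford Gam6 := isClifford_gam6.kronecker_one

/-- The charge conjugation on `S₆ ⊗ ℂ⁴`. -/
def Cmat : Matrix I32 I32 ℂ := C6 ⊗ₖ C5

theorem Cmat_transpose : Cmatᵀ = -Cmat := by
  rw [Cmat, ← Matrix.kroneckerMap_transpose, C6_transpose, C5_transpose, kronecker_neg]

theorem C_eq_pairing (u v : I32 → ℂ) (A : Matrix I32 I32 ℂ) :
    C u (A *ᵥ v) = pairing Cmat u v A := rfl

theorem adj_Gam6 (a : Idx 4) : IsAdj Cmat (Gam6 a) (-Gam6 a) :=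
  ((adj_gam6 a).kronecker IsAdj.one).congr (neg_kronecker _ _)

/-- The directions of eleven dimensions, split into those of six dimensions and the others. -/
def slot : Fin 9 → Fin 4 ⊕ Fin 5 :=
  ![Sum.inl 0, Sum.inl 1, Sum.inr 0, Sum.inl 2, Sum.inl 3, Sum.inr 1, Sum.inr 2, Sum.inr 3, Sum.inr 4]

theorem slot_injective : Function.Injective slot := by decide

theorem slot_emb (k : Fin 4) : slot (emb k) = Sum.inl k := by
  fin_cases k <;> rfl

theorem Gam11_tr (i : Fin 9) :
    Gam11 (it i) = Sum.elim (fun k => Gam6 (it k)) (fun a => chir6 ⊗ₖ T5 a) (slot i) := by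
  fin_cases i <;> rfl

theorem Gam11_inl (a : Fin 2) : Gam11 (Sum.inl a) = Gam6 (Sum.inl a) := rfl

theorem Gam6_mul_chir (a : Idx 4) (M : Matrix I5 I5 ℂ) :
    Gam6 a * (chir6 ⊗ₖ M) = -((chir6 ⊗ₖ M) * Gam6 a) := by
  rw [Gam6, ← Matrix.mul_kronecker_mul, ← Matrix.mul_kronecker_mul, gam6_mul_chir6, neg_kronecker,
    mul_one, one_mul]

/-- The five additional gamma matrices are `chir6 ⊗ T_a`: `chir6` squares to one and anticommutes
with the six-dimensional ones, while the `T_a` satisfy the Clifford relations among themselves. -/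
theorem isClifford_Gam11 : IsClifford Gam11 := by
  have hmix : ∀ (i : Fin 9) (a : Fin 2), Gam11 (Sum.inl a) * Gam11 (it i)
      = -(Gam11 (it i) * Gam11 (Sum.inl a)) := by
    intro i a
    rw [Gam11_inl, Gam11_tr]
    rcases slot i with k | b
    · exact (neg_eq_iff_eq_neg.mpr (isClifford_Gam6.tr_inl k a)).symm
    · exact Gam6_mul_chir _ _
  rintro (a | i) (b | j)
  · have hb : (Sum.inl b : Idx 9) = bar (Sum.inl a) ↔ (Sum.inl b : Idx 4) = bar (Sum.inl a) := by
      simp [bar]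
    simp only [hb]
    exact isClifford_Gam6 (Sum.inl a) (Sum.inl b)
  · rw [hmix, neg_add_cancel, if_neg (by simp [bar])]
  · rw [hmix, add_neg_cancel, if_neg (by simp [bar])]
  · have hij : (it j = bar (it i)) ↔ slot i = slot j := by
      rw [slot_injective.eq_iff]
      simp [bar, eq_comm]
    simp only [hij, Gam11_tr]
    rcases slot i with k | a <;> rcases slot j with l | b
    · have := isClifford_Gam6 (it k) (it l)
      simpa [bar, eq_comm] using this
    · simp only [Sum.elim_inl, Sum.elim_inr, Gam6_mul_chir, neg_add_cancel]
      simp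
    · simp only [Sum.elim_inl, Sum.elim_inr, Gam6_mul_chir, add_neg_cancel]
      simp
    · simp only [Sum.elim_inr, ← Matrix.mul_kronecker_mul, chir6_sq, ← Matrix.kronecker_add,
        T5_mul_add, Sum.inr.injEq]
      split_ifs
      · rw [Matrix.kronecker_smul, Matrix.one_kronecker_one]
      · rw [Matrix.kronecker_zero]

theorem adj_Gam11 (a : Idx 9) : IsAdj Cmat (Gam11 a) (-Gam11 a) := by
  rcases a with a | i
  · exact adj_Gam6 _
  · rw [Gam11_tr]
    rcases slot i with k | b
    · exact adj_Gam6 _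
    · exact (adj_chir6.kronecker (adj_T5 b)).congr (neg_kronecker _ _)

/-! ### Extension numbers -/

theorem IsClifford.submatrix {n : ℕ} {ι κ : Type} [Fintype ι] [DecidableEq ι] [Fintype κ]
    [DecidableEq κ] {Γ : Idx n → Matrix ι ι ℂ} (h : IsClifford Γ) (e : κ ≃ ι) :
    IsClifford fun a => (Γ a).submatrix e e := by
  intro a b
  simp only [Matrix.submatrix_mul_equiv]
  have := congrArg (fun M : Matrix ι ι ℂ => M.submatrix e e) (h a b)
  rw [Matrix.submatrix_add] at this
  refine this.trans ?_
  split_ifs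
  · ext i j
    by_cases hij : i = j <;> simp [hij]
  · rfl

theorem isExtended_Gam6 : IsExtended 4 Gam6 := by
  have h8 : Fintype.card (Fin (2 ^ ((4 + 2) / 2))) = Fintype.card I6 := by simp
  have h4 : Fintype.card (Fin 4) = Fintype.card I5 := by simp
  let f := Fintype.equivOfCardEq h8
  let g := Fintype.equivOfCardEq h4
  refine ⟨fun a => (gam6 a).submatrix f f, Equiv.prodCongr f g, isClifford_gam6.submatrix f, ?_⟩
  intro a
  ext ⟨i, j⟩ ⟨k, l⟩
  simp [Gam6, Matrix.one_apply]

theorem isExtended_Gam11 : IsExtended 1 Gam11 := by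
  have h32 : Fintype.card (Fin (2 ^ ((9 + 2) / 2))) = Fintype.card I32 := by simp
  let f := Fintype.equivOfCardEq h32
  refine ⟨fun a => (Gam11 a).submatrix f f, (Equiv.prodUnique _ _).trans f,
    isClifford_Gam11.submatrix f, ?_⟩
  intro a
  ext i k
  simp

/-! ### The square roots that define the connections -/

theorem vec5_mul_self (t : EuclideanSpace ℝ (Fin 5)) :
    vec5 t * vec5 t = (-((‖t‖ : ℂ) ^ 2)) • (1 : Matrix I5 I5 ℂ) := by
  have h : vec5 t * vec5 t + vec5 t * vec5 t = (-2 * (‖t‖ : ℂ) ^ 2) • (1 : Matrix I5 I5 ℂ) := by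
    have e1 : vec5 t * vec5 t = ∑ a, ∑ b, ((t a : ℂ) * t b) • (T5 a * T5 b) := by
      simp only [vec5, Finset.sum_mul_sum, smul_mul_assoc, mul_smul_comm, smul_smul]
      simp only [mul_comm]
    -- The same double sum with the factors exchanged; adding both expressions produces
    -- anticommutators, which are diagonal.
    have e2 : vec5 t * vec5 t = ∑ a, ∑ b, ((t a : ℂ) * t b) • (T5 b * T5 a) := by
      rw [e1, Finset.sum_comm]
      simp only [mul_comm]
    nth_rewrite 1 [e1]
    rw [e2]
    simp only [← Finset.sum_add_distrib, ← smul_add, T5_mul_add, smul_ite, smul_zero,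
      Finset.sum_ite_eq, Finset.mem_univ, if_true, smul_smul, ← Finset.sum_smul]
    congr 1
    have hn : (‖t‖ : ℂ) ^ 2 = ∑ a, (t a : ℂ) * t a := by
      have := EuclideanSpace.real_norm_sq_eq t
      have h' := congrArg (fun r : ℝ => (r : ℂ)) this
      simp only [sq] at h'
      push_cast at h'
      rw [sq, h']
    rw [hn, Finset.mul_sum]
    exact Finset.sum_congr rfl fun a _ => by ring
  rw [← two_smul ℂ (vec5 t * vec5 t)] at h
  have h2 := congrArg (fun M : Matrix I5 I5 ℂ => (1 / 2 : ℂ) • M) h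
  simp only [smul_smul] at h2
  norm_num at h2
  rw [h2, ← neg_smul]
  congr 1
  ring

theorem adj_vec5 (t : EuclideanSpace ℝ (Fin 5)) : IsAdj C5 (vec5 t) (vec5 t) := by
  have : ∀ a, IsAdj C5 ((t a : ℂ) • T5 a) ((t a : ℂ) • T5 a) := fun a => (adj_T5 a).smul _
  rw [IsAdj, vec5, Matrix.transpose_sum, Finset.sum_mul, Finset.mul_sum]
  exact Finset.sum_congr rfl fun a _ => this a

/-! ### The square roots that define the connections -/

theorem IsClifford.quad_sq {n : ℕ} {ι : Type} [Fintype ι] [DecidableEq ι]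
    {Γ : Idx n → Matrix ι ι ℂ} (h : IsClifford Γ) {i j : Fin n} (hij : i ≠ j) :
    Γ (it i) * Γ (it j) * (Γ (it i) * Γ (it j)) = -1 := by
  rw [mul_assoc, ← mul_assoc (Γ (it j)), h.tr_anticomm hij.symm, neg_mul, mul_assoc (Γ (it i)),
    h.tr_sq, mul_neg, mul_neg, mul_neg, neg_neg, mul_one, h.tr_sq]

theorem IsClifford.commute_pair_inl {n : ℕ} {ι : Type} [Fintype ι] [DecidableEq ι]
    {Γ : Idx n → Matrix ι ι ℂ} (h : IsClifford Γ) (i j : Fin n) (a : Fin 2) :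
    Commute (Γ (it i) * Γ (it j)) (Γ (Sum.inl a)) := by
  show Γ (it i) * Γ (it j) * Γ (Sum.inl a) = Γ (Sum.inl a) * (Γ (it i) * Γ (it j))
  rw [mul_assoc, h.tr_inl, mul_neg, ← mul_assoc, h.tr_inl, neg_mul, neg_neg, mul_assoc]

theorem IsClifford.tr_mul_pair {n : ℕ} {ι : Type} [Fintype ι] [DecidableEq ι]
    {Γ : Idx n → Matrix ι ι ℂ} (h : IsClifford Γ) {i j k : Fin n} (hij : i ≠ j) :
    Γ (it k) * (Γ (it i) * Γ (it j))
      = (if k = i ∨ k = j then -1 else 1 : ℂ) • (Γ (it i) * Γ (it j) * Γ (it k)) := by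
  by_cases h1 : k = i
  · subst h1
    rw [if_pos (Or.inl rfl), neg_one_smul, mul_assoc (Γ (it k)), h.tr_anticomm hij.symm, mul_neg,
      neg_neg]
  · by_cases h2 : k = j
    · subst h2
      rw [if_pos (Or.inr rfl), neg_one_smul, ← mul_assoc, h.tr_anticomm hij.symm, neg_mul]
    · rw [if_neg (by simp [h1, h2]), one_smul, ← mul_assoc, h.tr_anticomm h1, neg_mul, mul_assoc,
        h.tr_anticomm h2, mul_neg, neg_neg, mul_assoc]

/-- `c = α Γ_12 ⊗ T` in dimension six. -/
def c6 (α : ℝ) (t : EuclideanSpace ℝ (Fin 5)) : Matrix I32 I32 ℂ :=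
  (α : ℂ) • ((gam6 (it 0) * gam6 (it 1)) ⊗ₖ vec5 t)

/-- `c = α Γ_123` in dimension eleven. -/
def c11 (α : ℝ) : Matrix I32 I32 ℂ := (α : ℂ) • cl123

/-- A product of two orthogonal gamma matrices squares to -1 and so does `Tm`; on the tensor product
the signs cancel. The product is even, hence commutes with `Γ_±`. Both square roots are of this
form. -/
theorem isSquareRoot_of_pair {n : ℕ} {Γ : Idx n → Matrix I32 I32 ℂ} (hΓ : IsClifford Γ)
    (hi : ∀ a, Γ (Sum.inl a) = Gam6 (Sum.inl a)) {α : ℝ} (hα : α ≠ 0) {i j : Fin 4} (hij : i ≠ j)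
    {Tm : Matrix I5 I5 ℂ} (hT : Tm * Tm = -1) :
    IsSquareRoot Γ ((α : ℂ) • ((gam6 (it i) * gam6 (it j)) ⊗ₖ Tm)) α := by
  have hcomm : ∀ a : Fin 2,
      Commute ((α : ℂ) • ((gam6 (it i) * gam6 (it j)) ⊗ₖ Tm)) (Γ (Sum.inl a)) := by
    intro a
    rw [hi, Gam6]
    refine Commute.smul_left ?_ _
    show (gam6 (it i) * gam6 (it j)) ⊗ₖ Tm * (gam6 (Sum.inl a) ⊗ₖ 1) = _
    rw [← Matrix.mul_kronecker_mul, ← Matrix.mul_kronecker_mul,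
      (isClifford_gam6.commute_pair_inl i j a).eq, mul_one, one_mul]
  refine ⟨hΓ, hcomm 0, hcomm 1, ?_, by exact_mod_cast hα⟩
  rw [smul_mul_smul_comm, ← Matrix.mul_kronecker_mul, isClifford_gam6.quad_sq hij, hT, neg_kronecker,
    kronecker_neg, neg_neg, Matrix.one_kronecker_one, sq]

theorem vec5_sq {t : EuclideanSpace ℝ (Fin 5)} (ht : ‖t‖ = 1) : vec5 t * vec5 t = -1 := by
  rw [vec5_mul_self, ht]
  simp

theorem isSquareRoot_c6 {α : ℝ} (hα : α ≠ 0) {t : EuclideanSpace ℝ (Fin 5)} (ht : ‖t‖ = 1) :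
    IsSquareRoot Gam6 (c6 α t) α :=
  isSquareRoot_of_pair isClifford_Gam6 (fun _ => rfl) hα (by decide) (vec5_sq ht)

theorem sigM_sub_sigP : sigM Gam11 - sigP Gam11 = pauliZ ⊗ₖ 1 ⊗ₖ 1 := by
  have h : (-(1 / 2) : ℂ) • (upM * downM) - (-(1 / 2) : ℂ) • (downM * upM) = pauliZ := by
    ext i j; fin_cases i <;> fin_cases j <;> simp [pauliZ]
  have h1 : sigM Gam11 = ((-(1 / 2) : ℂ) • (upM * downM)) ⊗ₖ (1 : Matrix I5 I5 ℂ)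
      ⊗ₖ (1 : Matrix I5 I5 ℂ) := by
    show (-(1 / 2) : ℂ) • (((upM ⊗ₖ 1) ⊗ₖ 1) * ((downM ⊗ₖ 1) ⊗ₖ 1)) = _
    rw [← Matrix.mul_kronecker_mul, ← Matrix.mul_kronecker_mul, mul_one,
      Matrix.smul_kronecker, Matrix.smul_kronecker]
  have h2 : sigP Gam11 = ((-(1 / 2) : ℂ) • (downM * upM)) ⊗ₖ (1 : Matrix I5 I5 ℂ)
      ⊗ₖ (1 : Matrix I5 I5 ℂ) := by
    show (-(1 / 2) : ℂ) • (((downM ⊗ₖ 1) ⊗ₖ 1) * ((upM ⊗ₖ 1) ⊗ₖ 1)) = _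
    rw [← Matrix.mul_kronecker_mul, ← Matrix.mul_kronecker_mul, mul_one,
      Matrix.smul_kronecker, Matrix.smul_kronecker]
  rw [h1, h2, ← h]
  ext i j
  simp only [Matrix.sub_apply, Matrix.kroneckerMap_apply, sub_mul]

/-- The third direction of dimension eleven is `chir6 ⊗ T_0`. The difference of the projections,
built into `cl123`, strips `chir6` down to `-Γ_1234` (six-dimensional labels), and `Γ_12 · Γ_1234 =
-Γ_34`. So the eleven-dimensional square root has the same shape as the six-dimensional one, with
the other pair of directions. -/
theorem cl123_eq : cl123 = (gam6 (it 2) * gam6 (it 3)) ⊗ₖ T5 0 := by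
  have h1 : Gam123 = (gam6 (it 0) * gam6 (it 1) * chir6) ⊗ₖ T5 0 := by
    show (gam6 (it 0) ⊗ₖ 1) * (gam6 (it 1) ⊗ₖ 1) * (chir6 ⊗ₖ T5 0) = _
    rw [← Matrix.mul_kronecker_mul, ← Matrix.mul_kronecker_mul, one_mul, one_mul]
  have h2 : chir6 * (pauliZ ⊗ₖ 1) = -(gam6 (it 0) * gam6 (it 1) * (gam6 (it 2) * gam6 (it 3))) := by
    rw [← mul_assoc, gam6_quad, kronecker_neg, neg_neg, chir6_eq, ← Matrix.mul_kronecker_mul,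
      pauliZ_mul_Z, mul_one]
  rw [cl123, h1, sigM_sub_sigP, ← Matrix.mul_kronecker_mul, mul_one, mul_assoc, h2, mul_neg,
    ← mul_assoc (gam6 (it 0) * gam6 (it 1)), isClifford_gam6.quad_sq (by decide), neg_mul, one_mul,
    neg_neg]

theorem c11_eq (α : ℝ) : c11 α = (α : ℂ) • ((gam6 (it 2) * gam6 (it 3)) ⊗ₖ T5 0) := by
  rw [c11, cl123_eq]

theorem isSquareRoot_c11 {α : ℝ} (hα : α ≠ 0) : IsSquareRoot Gam11 (c11 α) α := by
  rw [c11_eq]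
  exact isSquareRoot_of_pair isClifford_Gam11 (fun _ => rfl) hα (by decide) (T5_sq 0)

/-- Taking adjoints reverses two anticommuting skew-adjoint factors, which yields one sign; the
factor on `ℂ⁴` is self-adjoint. -/
theorem adj_pair {i j : Fin 4} (hij : i ≠ j) {Tm : Matrix I5 I5 ℂ} (hT : IsAdj C5 Tm Tm) (α : ℂ) :
    IsAdj Cmat (α • ((gam6 (it i) * gam6 (it j)) ⊗ₖ Tm))
      (-(α • ((gam6 (it i) * gam6 (it j)) ⊗ₖ Tm))) := by
  refine ((((adj_gam6 (it i)).mul (adj_gam6 (it j))).kronecker hT).smul α).congr ?_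
  rw [neg_mul_neg, isClifford_gam6.tr_anticomm hij.symm, neg_kronecker, smul_neg]

theorem isSpinForm_six (α : ℝ) (t : EuclideanSpace ℝ (Fin 5)) : IsSpinForm Gam6 (c6 α t) Cmat :=
  ⟨Cmat_transpose, adj_Gam6, adj_pair (by decide) (adj_vec5 t) _⟩

theorem isSpinForm_eleven (α : ℝ) : IsSpinForm Gam11 (c11 α) Cmat := by
  refine ⟨Cmat_transpose, adj_Gam11, ?_⟩
  rw [c11_eq]
  exact adj_pair (by decide) (adj_T5 0) _

theorem sign_six (α : ℝ) (t : EuclideanSpace ℝ (Fin 5)) (i : Fin 4) :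
    Gam6 (it i) * c6 α t = sgn (fun i : Fin 4 => ¬ (i : ℕ) < 2) i • (c6 α t * Gam6 (it i)) := by
  rw [c6, mul_smul_comm, smul_mul_assoc, smul_comm (sgn _ i)]
  congr 1
  rw [Gam6, ← Matrix.mul_kronecker_mul, ← Matrix.mul_kronecker_mul, one_mul, mul_one,
    isClifford_gam6.tr_mul_pair (by decide), Matrix.smul_kronecker]
  congr 1
  fin_cases i <;> simp [sgn]

/-- In the form `Γ_45 ⊗ T_0` of the square root, directions 1 and 2 commute with it because they are
disjoint from the pair, and direction 3 because it shares the factor `T_0`. Directions 4, 5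
anticommute through the pair, and 6 to 9 through `T_0`. -/
theorem sign_eleven (α : ℝ) (i : Fin 9) :
    Gam11 (it i) * c11 α = sgn (fun i : Fin 9 => (i : ℕ) < 3) i • (c11 α * Gam11 (it i)) := by
  rw [c11_eq, mul_smul_comm, smul_mul_assoc, smul_comm (sgn _ i)]
  congr 1
  have h1 : ∀ k : Fin 4, Gam6 (it k) * ((gam6 (it 2) * gam6 (it 3)) ⊗ₖ T5 0)
      = (if k = 2 ∨ k = 3 then -1 else 1 : ℂ)
        • (((gam6 (it 2) * gam6 (it 3)) ⊗ₖ T5 0) * Gam6 (it k)) := by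
    intro k
    rw [Gam6, ← Matrix.mul_kronecker_mul, ← Matrix.mul_kronecker_mul, one_mul, mul_one,
      isClifford_gam6.tr_mul_pair (by decide), Matrix.smul_kronecker]
  have hc : chir6 * (gam6 (it 2) * gam6 (it 3)) = gam6 (it 2) * gam6 (it 3) * chir6 := by
    rw [mul_assoc, gam6_mul_chir6, mul_neg, ← mul_assoc (gam6 (it 2)), gam6_mul_chir6, neg_mul,
      neg_neg, mul_assoc]
  have h2 : ∀ a : Fin 5, (chir6 ⊗ₖ T5 a) * ((gam6 (it 2) * gam6 (it 3)) ⊗ₖ T5 0)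
      = (if a = 0 then 1 else -1 : ℂ)
        • (((gam6 (it 2) * gam6 (it 3)) ⊗ₖ T5 0) * (chir6 ⊗ₖ T5 a)) := by
    intro a
    rw [← Matrix.mul_kronecker_mul, ← Matrix.mul_kronecker_mul, hc]
    split_ifs with h
    · rw [h, one_smul]
    · rw [T5_anticomm h, kronecker_neg, neg_one_smul]
  rw [Gam11_tr]
  fin_cases i
  · exact (h1 0).trans (by simp [sgn, slot])
  · exact (h1 1).trans (by simp [sgn, slot])
  · exact (h2 0).trans (by simp [sgn, slot])
  · exact (h1 2).trans (by simp [sgn, slot])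
  · exact (h1 3).trans (by simp [sgn, slot])
  · exact (h2 1).trans (by simp [sgn, slot])
  · exact (h2 2).trans (by simp [sgn, slot])
  · exact (h2 3).trans (by simp [sgn, slot])
  · exact (h2 4).trans (by simp [sgn, slot])

/-! ### The brackets in terms of the bilinear form -/

section Components

variable {n : ℕ} {ι : Type} [Fintype ι] [DecidableEq ι] {Γ : Idx n → Matrix ι ι ℂ}
  {c Cm : Matrix ι ι ℂ} {α : ℝ} (f : IsSpinForm Γ c Cm) (h : IsSquareRoot Γ c α)
  {p : Fin n → Prop} [DecidablePred p]
include f h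

theorem IsSpinForm.pairing_minus (v w : ι → ℂ) :
    pairing Cm (sigM Γ *ᵥ v) (sigM Γ *ᵥ w) (Γ im) = pairing Cm v w (Γ im) := by
  rw [f.adj_sigM.pairing_mulVec_left, pairing_mulVec_right, mul_assoc, h.minus_sigM, h.sigP_minus]

theorem IsSpinForm.pairing_plus (v w : ι → ℂ) :
    pairing Cm (sigP Γ *ᵥ v) (sigP Γ *ᵥ w) (Γ ip) = pairing Cm v w (Γ ip) := by
  rw [f.adj_sigP.pairing_mulVec_left, pairing_mulVec_right, mul_assoc, h.clifford.plus_sigP,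
    h.clifford.sigM_plus]

/-- The symmetrized mixed component of an operator with adjoint `s A`. -/
theorem IsSpinForm.pairing_mixed {A : Matrix ι ι ℂ} {s : ℂ} (hA : IsAdj Cm A (s • A))
    (hP : Commute A (sigP Γ)) (v w : ι → ℂ) :
    pairing Cm (sigM Γ *ᵥ v) (sigP Γ *ᵥ w) A + pairing Cm (sigM Γ *ᵥ w) (sigP Γ *ᵥ v) A
      = pairing Cm v w (A * (sigP Γ - s • sigM Γ)) := by
  have hM : Commute A (sigM Γ) := by
    rw [h.clifford.sigM_eq]
    exact (Commute.one_right A).sub_right hP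
  have e1 : sigP Γ * A * sigP Γ = A * sigP Γ := by
    rw [← hP.eq, mul_assoc, h.clifford.sigP_sigP]
  have e2 : sigM Γ * (s • A) * sigM Γ = s • (A * sigM Γ) := by
    rw [mul_smul_comm, smul_mul_assoc, ← hM.eq, mul_assoc, h.clifford.sigM_sigM]
  rw [hA.pairing_swap f.skew (sigP Γ *ᵥ v) (sigM Γ *ᵥ w), f.adj_sigM.pairing_mulVec_left,
    f.adj_sigP.pairing_mulVec_left, pairing_mulVec_right, pairing_mulVec_right,
    e1, e2, mul_sub, mul_smul_comm, map_sub, sub_eq_add_neg]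

/-- For a skew-adjoint operator the two projections in the mixed formula add up to the identity. -/
theorem IsSpinForm.pairing_tr (i : Fin n) (v w : ι → ℂ) :
    pairing Cm (sigM Γ *ᵥ v) (sigP Γ *ᵥ w) (Γ (it i))
      + pairing Cm (sigM Γ *ᵥ w) (sigP Γ *ᵥ v) (Γ (it i)) = pairing Cm v w (Γ (it i)) := by
  rw [f.pairing_mixed h ((f.gamma (it i)).congr (neg_one_smul ℂ _).symm)
    (h.clifford.commute_tr_sigP i), neg_one_smul, sub_neg_eq_add, h.clifford.sigP_add_sigM, mul_one]

theorem IsSpinForm.pairing_star (hs : ∀ i, Γ (it i) * c = sgn p i • (c * Γ (it i))) (i : Fin n)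
    (v w : ι → ℂ) :
    (1 / (α : ℂ) ^ 2) * (pairing Cm (sigM Γ *ᵥ v) (sigP Γ *ᵥ w) (c * Γ (it i))
      + pairing Cm (sigM Γ *ᵥ w) (sigP Γ *ᵥ v) (c * Γ (it i)))
      = pairing Cm v w (starOp Γ c α p i) := by
  rw [f.pairing_mixed h (f.adj_c_tr h hs i)
    (h.commute_sigP.mul_left (h.clifford.commute_tr_sigP i)), starOp, map_smul, smul_eq_mul]

theorem IsSpinForm.pairing_rot (i j : Fin n) (v w : ι → ℂ) :
    pairing Cm (sigP Γ *ᵥ v) (sigP Γ *ᵥ w) (c * (Γ (it i) * Γ (it j)) * Γ ip)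
      = pairing Cm v w (c * (Γ (it i) * Γ (it j)) * Γ ip) := by
  have e : Commute (c * (Γ (it i) * Γ (it j))) (sigM Γ) :=
    h.commute_sigM.mul_left
      ((h.clifford.commute_tr_sigM i).mul_left (h.clifford.commute_tr_sigM j))
  rw [f.adj_sigP.pairing_mulVec_left, pairing_mulVec_right, mul_assoc (sigM Γ),
    mul_assoc _ (Γ ip), h.clifford.plus_sigP, ← mul_assoc, ← e.eq, mul_assoc, h.clifford.sigM_plus]

end Components

/-! ### The eleven-dimensional superalgebra with `β = 0` -/

theorem lam11_zero (α : ℝ) : lam11 α 0 = freq 9 α := by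
  funext i
  simp [lam11, freq]

theorem B11_zero (α : ℝ) : B11 α 0 = fun _ => -α ^ 2 := by
  funext i
  simp [B11]

/-- On `S_+` the element `e₁e₂e₃` acts as `-Γ_123`. This sign enters the starred components, which
evaluate on `S_+`. -/
theorem cl123_mul_sigP (i : Fin 9) :
    cl123 * Gam11 (it i) * sigP Gam11 = -(Gam123 * Gam11 (it i) * sigP Gam11) := by
  have h := isClifford_Gam11
  rw [cl123, mul_assoc, (h.commute_tr_sigP i).eq, mul_assoc, ← mul_assoc (_ - _), sub_mul,
    h.sigM_sigP, h.sigP_sigP, zero_sub, neg_mul, mul_neg, mul_assoc, (h.commute_tr_sigP i).eq]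

/-- The image of `Γ_+` lies in `S_-`, where `e₁e₂e₃` acts as `Γ_123`, so here no sign appears. -/
theorem cl123_mul_plus (i j : Fin 9) :
    cl123 * (Gam11 (it i) * Gam11 (it j)) * Gam11 ip
      = Gam123 * (Gam11 (it i) * Gam11 (it j)) * Gam11 ip := by
  have h := isClifford_Gam11
  have e1 : Commute (Gam11 (it i) * Gam11 (it j)) (sigM Gam11 - sigP Gam11) :=
    ((h.commute_tr_sigM i).sub_right (h.commute_tr_sigP i)).mul_left
      ((h.commute_tr_sigM j).sub_right (h.commute_tr_sigP j))
  rw [cl123, mul_assoc Gam123, ← e1.eq, mul_assoc, mul_assoc (Gam11 (it i) * _), sub_mul,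
    h.sigM_plus, h.sigP_plus, sub_zero, ← mul_assoc]

/-- Matching of constants for `λ = -iα`: `i/λ = -1/α` combines with the factor `-1/α` relating
`Γ_123` to `c` on `S_+` to give the `1/α²` in `starOp`. Likewise `∓iλ = ∓α` cancels against `1/α`
and leaves the sign of the block. -/
theorem br11_zero {α : ℝ} (hα : α ≠ 0) (ξ η : SF 9 I32) :
    br11 α 0 ξ η = field Gam11 (c11 α) α (fun i : Fin 9 => (i : ℕ) < 3)
      (pairing Cmat (ξ 0) (η 0)) := by
  have f := isSpinForm_eleven α
  have h := isSquareRoot_c11 hα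
  have hα' := h.ne_zero
  have e1 : ∀ (i : Fin 9) (v w : I32 → ℂ),
      pairing Cmat v (sigP Gam11 *ᵥ w) (Gam123 * Gam11 (it i))
        = -(1 / (α : ℂ)) * pairing Cmat v (sigP Gam11 *ᵥ w) (c11 α * Gam11 (it i)) := by
    intro i v w
    rw [pairing_mulVec_right, pairing_mulVec_right, c11, smul_mul_assoc, smul_mul_assoc,
      cl123_mul_sigP, map_smul, map_neg, smul_eq_mul]
    field_simp
  rw [br11, field_congr (a := _) (b := _) (t := _) (u := _) (r := _)
    (f.pairing_minus h (ξ 0) (η 0)).symm (f.pairing_plus h (ξ 0) (η 0)).symm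
    (fun i => (f.pairing_tr h i (ξ 0) (η 0)).symm)
    (fun i => (f.pairing_star h (sign_eleven α) i (ξ 0) (η 0)).symm) (fun i j => rfl)]
  simp only [C_eq_pairing, lam11_zero, e1]
  congr 1
  · congr 1
    refine Finset.sum_congr rfl fun i _ => ?_
    congr 1
    rw [freq]
    field_simp
    simp [add_comm]
  · congr 1
    refine Finset.sum_congr rfl fun i _ => Finset.sum_congr rfl fun j _ => ?_
    congr 1
    -- The projections may be dropped because `Γ_+` and the form already select `S_+` in both
    -- arguments.
    have e2 : pairing Cmat (sigP Gam11 *ᵥ ξ 0) (sigP Gam11 *ᵥ η 0)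
        (Gam123 * (Gam11 (it i) * Gam11 (it j)) * Gam11 ip)
        = (1 / (α : ℂ)) * pairing Cmat (ξ 0) (η 0) (c11 α * (Gam11 (it i) * Gam11 (it j)) * Gam11 ip) := by
      rw [← cl123_mul_plus, ← f.pairing_rot h, c11, smul_mul_assoc, smul_mul_assoc, map_smul,
        smul_eq_mul]
      field_simp
    rw [e2, rotOp, freq]
    by_cases hi : (i : ℕ) < 3 <;> by_cases hj : (j : ℕ) < 3
    · simp only [hi, hj, and_self, if_true, iff_self, map_smul, smul_eq_mul, sgn]
      field_simp
      linear_combination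
        (pairing Cmat (ξ 0) (η 0) (c11 α * (Gam11 (it i) * Gam11 (it j)) * Gam11 ip)) * Complex.I_sq
    · simp [hi, hj]
    · simp [hi, hj]
    · simp only [hi, hj, and_self, if_true, iff_self, map_smul, smul_eq_mul, sgn, if_false,
        not_lt.mp hi, not_lt.mp hj]
      field_simp
      linear_combination
        -(pairing Cmat (ξ 0) (η 0) (c11 α * (Gam11 (it i) * Gam11 (it j)) * Gam11 ip)) * Complex.I_sq

theorem parallel_eleven (α : ℝ) : parallel (B11 α 0) Gam11 ((α : ℂ) • cl123) (((0 : ℝ) : ℂ) • cl123)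
    = parallel (fun _ => -α ^ 2) Gam11 (c11 α) 0 := by
  rw [B11_zero, Complex.ofReal_zero, zero_smul, c11]

theorem isHyperbolic_eleven {α : ℝ} (hα : α ≠ 0) :
    IsHyperbolic (eleven α 0) α (fun i : Fin 9 => (i : ℕ) < 3) Cmat where
  B_eq := B11_zero α
  lam_eq := lam11_zero α
  d_eq := by simp [eleven]
  root := isSquareRoot_c11 hα
  sign := sign_eleven α
  form := isSpinForm_eleven α
  extended := isExtended_Gam11
  rot_eq := rfl
  K1_le := (parallel_eleven α).le
  stable g _ ξ _ := (parallel_eleven α).ge ((isSquareRoot_c11 hα).par_mem _)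
  br_eq ξ _ η _ := br11_zero hα ξ η

theorem nonRestricted_eleven (α : ℝ) : (eleven α 0).NonRestricted := fun _ h1 h2 => ⟨h1, h2⟩

theorem nu_eleven {α : ℝ} (hα : α ≠ 0) : (eleven α 0).nu = 1 := by
  have h1 : (eleven α 0).K1 = parallel (fun _ => -α ^ 2) Gam11 (c11 α) 0 := parallel_eleven α
  have h2 : Module.finrank ℂ (parallel (fun _ : Fin 9 => -α ^ 2) Gam11 (c11 α) 0)
      = Fintype.card I32 := by
    rw [(isSquareRoot_c11 hα).parallelEquiv.finrank_eq, Module.finrank_fintype_fun_eq_card]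
  rw [SuperData.nu, h1, h2, div_self]
  simp

/-! ### The six-dimensional superalgebra -/

/-- The chirality operator of six dimensions on `S₆ ⊗ ℂ⁴`. -/
def chiral : Matrix I32 I32 ℂ := chir6 ⊗ₖ 1

theorem anticomm_chiral (a : Idx 4) : Gam6 a * chiral = -(chiral * Gam6 a) := Gam6_mul_chir a 1

theorem commute_chiral_mul (a b : Idx 4) : Commute (Gam6 a * Gam6 b) chiral := by
  show Gam6 a * Gam6 b * chiral = chiral * (Gam6 a * Gam6 b)
  rw [mul_assoc, anticomm_chiral, mul_neg, ← mul_assoc, anticomm_chiral, neg_mul, neg_neg, mul_assoc]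

theorem commute_pair_chiral (i j : Fin 4) (k : ℂ) (Tm : Matrix I5 I5 ℂ) :
    Commute (k • ((gam6 (it i) * gam6 (it j)) ⊗ₖ Tm)) chiral := by
  refine Commute.smul_left ?_ k
  show _ * (chir6 ⊗ₖ 1) = (chir6 ⊗ₖ 1) * _
  rw [← Matrix.mul_kronecker_mul, ← Matrix.mul_kronecker_mul, mul_assoc, gam6_mul_chir6, mul_neg,
    ← mul_assoc, gam6_mul_chir6, neg_mul, neg_neg, mul_one, one_mul, mul_assoc]

/-- On `S_+` chirality is `Γ_1234`, on `S_-` it is its negative. This explains the opposite signs in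
the two conditions on the constant spinors. -/
theorem chiral_eq : chiral = (sigP Gam6 - sigM Gam6)
    * (Gam6 (it 0) * Gam6 (it 1) * Gam6 (it 2) * Gam6 (it 3)) := by
  have e : ∀ A B : Matrix I6 I6 ℂ, (A * B) ⊗ₖ (1 : Matrix I5 I5 ℂ) = (A ⊗ₖ 1) * (B ⊗ₖ 1) := by
    intro A B
    rw [← Matrix.mul_kronecker_mul, mul_one]
  have e' : ∀ A B : Matrix I6 I6 ℂ, (A - B) ⊗ₖ (1 : Matrix I5 I5 ℂ) = A ⊗ₖ 1 - B ⊗ₖ 1 := by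
    intro A B
    ext i j
    simp only [Matrix.sub_apply, Matrix.kroneckerMap_apply, sub_mul]
  rw [chiral, chir6, e, e, e, e, Matrix.smul_kronecker, e', e, e]
  congr 1
  show (1 / 2 : ℂ) • (Gam6 ip * Gam6 im - Gam6 im * Gam6 ip)
    = (-(1 / 2) : ℂ) • (Gam6 im * Gam6 ip) - (-(1 / 2) : ℂ) • (Gam6 ip * Gam6 im)
  module

theorem commute_quad_sigP :
    Commute (Gam6 (it 0) * Gam6 (it 1) * Gam6 (it 2) * Gam6 (it 3)) (sigP Gam6) := by
  have h := isClifford_Gam6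
  exact (((h.commute_tr_sigP 0).mul_left (h.commute_tr_sigP 1)).mul_left
    (h.commute_tr_sigP 2)).mul_left (h.commute_tr_sigP 3)

theorem commute_quad_sigM :
    Commute (Gam6 (it 0) * Gam6 (it 1) * Gam6 (it 2) * Gam6 (it 3)) (sigM Gam6) := by
  have h := isClifford_Gam6
  exact (((h.commute_tr_sigM 0).mul_left (h.commute_tr_sigM 1)).mul_left
    (h.commute_tr_sigM 2)).mul_left (h.commute_tr_sigM 3)

/-- The two conditions on the constant spinors say that they are chiral. -/
theorem restriction_iff (v : I32 → ℂ) :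
    ((X1234 1 * sigM Gam6) *ᵥ v = 0 ∧ (X1234 (-1) * sigP Gam6) *ᵥ v = 0) ↔ chiral *ᵥ v = v := by
  have h := isClifford_Gam6
  have h1 := commute_quad_sigP
  have h2 := commute_quad_sigM
  have h3 := chiral_eq
  simp only [X1234]
  generalize Gam6 (it 0) * Gam6 (it 1) * Gam6 (it 2) * Gam6 (it 3) = R at h1 h2 h3 ⊢
  -- Each of the two conditions is one half of `(1 - chiral) v = 0`, projected to `S_-` and to
  -- `S_+`; the projections add up to the identity.
  have eM : (1 / 2 : ℂ) • (1 + (1 : ℂ) • R) * sigM Gam6 = (1 / 2 : ℂ) • (sigM Gam6 * (1 - chiral)) := by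
    rw [h3, mul_sub, mul_one, ← mul_assoc, mul_sub, h.sigM_sigP, h.sigM_sigM, zero_sub, neg_mul,
      sub_neg_eq_add, smul_mul_assoc, add_mul, one_mul, one_smul, h2.eq]
  have eP : (1 / 2 : ℂ) • (1 + (-1 : ℂ) • R) * sigP Gam6
      = (1 / 2 : ℂ) • (sigP Gam6 * (1 - chiral)) := by
    rw [h3, mul_sub, mul_one, ← mul_assoc, mul_sub, h.sigP_sigP, h.sigP_sigM, sub_zero,
      smul_mul_assoc, add_mul, one_mul, neg_one_smul, neg_mul, h1.eq, sub_eq_add_neg]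
  have e0 : (1 - chiral) *ᵥ v = v - chiral *ᵥ v := by rw [Matrix.sub_mulVec, Matrix.one_mulVec]
  rw [eM, eP]
  constructor
  · rintro ⟨a1, a2⟩
    rw [Matrix.smul_mulVec, smul_eq_zero_iff_right (by norm_num)] at a1 a2
    have := congrArg (fun M => M *ᵥ v)
      (congrArg (fun M : Matrix I32 I32 ℂ => M * (1 - chiral)) h.sigP_add_sigM)
    simp only [add_mul, one_mul, Matrix.add_mulVec, a1, a2, add_zero, e0] at this
    exact (sub_eq_zero.mp this.symm).symm
  · intro hv
    constructor <;> rw [Matrix.smul_mulVec, ← Matrix.mulVec_mulVec, e0, hv, sub_self,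
      Matrix.mulVec_zero, smul_zero]

/-- The dimension is arbitrary: the eleven-dimensional gamma matrices in directions 1, 2, 4, 5 are
the six-dimensional ones, so the restriction there is literally the same condition. -/
theorem mem_restricted_iff {n : ℕ} {B : Fin n → ℝ} {Γ : Idx n → Matrix I32 I32 ℂ}
    {c d : Matrix I32 I32 ℂ} {ξ : SF n I32} :
    ξ ∈ restricted B Γ c d (X1234 1 * sigM Gam6) (X1234 (-1) * sigP Gam6)
      ↔ ξ ∈ parallel B Γ c d ∧ chiral *ᵥ ξ 0 = ξ 0 := by
  rw [restricted, Submodule.mem_inf, Submodule.mem_inf, and_assoc, ← restriction_iff]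
  rfl

theorem commute_sigM_chiral : Commute (sigM Gam6) chiral := (commute_chiral_mul ip im).smul_left _

theorem commute_c6_chiral (α : ℝ) (t : EuclideanSpace ℝ (Fin 5)) : Commute (c6 α t) chiral :=
  commute_pair_chiral _ _ _ _

/-- Every generator acts through even products of gamma matrices (`c` being even too), and these
commute with chirality. -/
theorem commute_spinAct_chiral {α : ℝ} (hα : α ≠ 0) {t : EuclideanSpace ℝ (Fin 5)} (ht : ‖t‖ = 1)
    (g : Gen 4) : Commute (spinAct Gam6 (c6 α t) α g) chiral := by
  cases g with
  | plus => exact Commute.zero_left _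
  | minus => exact ((commute_c6_chiral α t).mul_left commute_sigM_chiral).neg_left
  | tr i =>
    rw [spinAct, (isSquareRoot_c6 hα ht).tilt_eq]
    exact ((commute_c6_chiral α t).mul_left (commute_chiral_mul _ _)).smul_left _
  | star i => exact (commute_chiral_mul _ _).smul_left _
  | rot i j => exact ((commute_chiral_mul _ _).sub_left (commute_chiral_mul _ _)).smul_left _

/-- The general bracket has independent coefficients for `K_(12)` and `K_(34)`. They coincide only
after the restriction, since `Γ_1234` acts on the chiral part of `S_+` as the identity. -/
theorem br6_eq {α : ℝ} (hα : α ≠ 0) {t : EuclideanSpace ℝ (Fin 5)} (ht : ‖t‖ = 1) (ξ η : SF 4 I32)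
    (hη : chiral *ᵥ η 0 = η 0) :
    br6 α (vec5 t) ξ η = field Gam6 (c6 α t) α (fun i : Fin 4 => ¬ (i : ℕ) < 2)
      (pairing Cmat (ξ 0) (η 0)) := by
  have f := isSpinForm_six α t
  have h := isSquareRoot_c6 hα ht
  have hα' := h.ne_zero
  have e1 : ∀ i : Fin 4, c6 α t * Gam6 (it i)
      = (α : ℂ) • ((gam6 (it 0) * gam6 (it 1) * gam6 (it i)) ⊗ₖ vec5 t) := by
    intro i
    rw [c6, smul_mul_assoc, Gam6, ← Matrix.mul_kronecker_mul, mul_one]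
  have e2 : c6 α t * (Gam6 (it 0) * Gam6 (it 1)) * Gam6 ip = (-(α : ℂ)) • (gam6 ip ⊗ₖ vec5 t) := by
    rw [c6, smul_mul_assoc, smul_mul_assoc, neg_smul, ← smul_neg]
    congr 1
    show _ * ((gam6 (it 0) ⊗ₖ 1) * (gam6 (it 1) ⊗ₖ 1)) * (gam6 ip ⊗ₖ 1) = _
    rw [← Matrix.mul_kronecker_mul, ← Matrix.mul_kronecker_mul, ← Matrix.mul_kronecker_mul,
      isClifford_gam6.quad_sq (by decide), mul_one, mul_one, mul_one, neg_mul, one_mul,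
      neg_kronecker]
  have e3 : c6 α t * (Gam6 (it 2) * Gam6 (it 3)) * Gam6 ip
      = (α : ℂ) • (gam6 ip ⊗ₖ vec5 t) * chiral := by
    have a1 : Gam6 ip * (sigP Gam6 - sigM Gam6) = Gam6 ip := by
      rw [mul_sub, h.clifford.plus_sigP, h.clifford.plus_sigM, sub_zero]
    have a2 : (α : ℂ) • (gam6 ip ⊗ₖ vec5 t) = (α : ℂ) • ((1 ⊗ₖ vec5 t) * Gam6 ip) := by
      rw [Gam6, ← Matrix.mul_kronecker_mul, one_mul, mul_one]
    have a3 : c6 α t = (α : ℂ) • ((1 ⊗ₖ vec5 t) * (Gam6 (it 0) * Gam6 (it 1))) := by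
      rw [c6, Gam6, Gam6, ← Matrix.mul_kronecker_mul, ← Matrix.mul_kronecker_mul, one_mul, mul_one,
        mul_one]
    have a4 : Gam6 (it 0) * Gam6 (it 1) * (Gam6 (it 2) * Gam6 (it 3)) * Gam6 ip
        = Gam6 ip * (Gam6 (it 0) * Gam6 (it 1) * Gam6 (it 2) * Gam6 (it 3)) := by
      have := ((h.clifford.commute_pair_inl 0 1 0).mul_left (h.clifford.commute_pair_inl 2 3 0)).eq
      rw [this]
      simp only [mul_assoc]
    have a5 : Gam6 ip * ((sigP Gam6 - sigM Gam6)
        * (Gam6 (it 0) * Gam6 (it 1) * Gam6 (it 2) * Gam6 (it 3)))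
        = Gam6 ip * (Gam6 (it 0) * Gam6 (it 1) * Gam6 (it 2) * Gam6 (it 3)) := by
      rw [← mul_assoc, a1]
    rw [a2, a3, chiral_eq, smul_mul_assoc, smul_mul_assoc, smul_mul_assoc, mul_assoc (1 ⊗ₖ vec5 t),
      mul_assoc (1 ⊗ₖ vec5 t), a4, mul_assoc (1 ⊗ₖ vec5 t), a5]
  -- The chirality operator produced by `Γ_34` is absorbed by the chiral spinor on the right.
  have e4 : pairing Cmat (ξ 0) (η 0) (c6 α t * (Gam6 (it 2) * Gam6 (it 3)) * Gam6 ip)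
      = α * pairing Cmat (ξ 0) (η 0) (gam6 ip ⊗ₖ vec5 t) := by
    rw [e3, ← pairing_mulVec_right, hη, map_smul, smul_eq_mul]
  have e5 : pairing Cmat (ξ 0) (η 0) (c6 α t * (Gam6 (it 0) * Gam6 (it 1)) * Gam6 ip)
      = -(α : ℂ) * pairing Cmat (ξ 0) (η 0) (gam6 ip ⊗ₖ vec5 t) := by
    rw [e2, map_smul, smul_eq_mul]
  have e6 : -(α : ℂ) * C (sigP Gam6 *ᵥ ξ 0) ((gam6 ip ⊗ₖ vec5 t) *ᵥ (sigP Gam6 *ᵥ η 0))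
      = -(α : ℂ) * pairing Cmat (ξ 0) (η 0) (gam6 ip ⊗ₖ vec5 t) := by
    rw [← e5, ← f.pairing_rot h, e2, map_smul, smul_eq_mul, C_eq_pairing]
  rw [br6, field_congr (a := _) (b := _) (t := _) (u := _) (r := _)
    (f.pairing_minus h (ξ 0) (η 0)).symm (f.pairing_plus h (ξ 0) (η 0)).symm
    (fun i => (f.pairing_tr h i (ξ 0) (η 0)).symm)
    (fun i => (f.pairing_star h (sign_six α t) i (ξ 0) (η 0)).symm) (fun i j => rfl)]
  have hlam : (fun _ : Fin 4 => -Complex.I * (α : ℂ)) = freq 4 α := rfl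
  have s10 : rotOp Gam6 (c6 α t) (fun i : Fin 4 => ¬ (i : ℕ) < 2) 1 0
      = -(c6 α t * (Gam6 (it 0) * Gam6 (it 1)) * Gam6 ip) := by
    rw [rotOp, h.clifford.tr_anticomm (by decide : (1 : Fin 4) ≠ 0)]
    simp [sgn]
  have s01 : rotOp Gam6 (c6 α t) (fun i : Fin 4 => ¬ (i : ℕ) < 2) 0 1
      = c6 α t * (Gam6 (it 0) * Gam6 (it 1)) * Gam6 ip := by
    rw [rotOp]
    simp [sgn]
  have s32 : rotOp Gam6 (c6 α t) (fun i : Fin 4 => ¬ (i : ℕ) < 2) 3 2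
      = c6 α t * (Gam6 (it 2) * Gam6 (it 3)) * Gam6 ip := by
    rw [rotOp, h.clifford.tr_anticomm (by decide : (3 : Fin 4) ≠ 2)]
    simp [sgn]
  have s23 : rotOp Gam6 (c6 α t) (fun i : Fin 4 => ¬ (i : ℕ) < 2) 2 3
      = -(c6 α t * (Gam6 (it 2) * Gam6 (it 3)) * Gam6 ip) := by
    rw [rotOp]
    simp [sgn]
  have s0 : ∀ i j : Fin 4, ¬ ((¬ (i : ℕ) < 2) ↔ ¬ (j : ℕ) < 2) →
      rotOp Gam6 (c6 α t) (fun i : Fin 4 => ¬ (i : ℕ) < 2) i j = 0 := fun i j hij => if_neg hij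
  simp only [hlam, e6]
  congr 1
  · simp only [C_eq_pairing, e1, map_smul, smul_eq_mul]
    congr 1
    refine Finset.sum_congr rfl fun i _ => ?_
    congr 1
    field_simp
  · simp only [Fin.sum_univ_four, rot_self, smul_zero, s10, s01, s23, s32,
      s0 0 2 (by decide), s0 0 3 (by decide), s0 1 2 (by decide), s0 1 3 (by decide),
      s0 2 0 (by decide), s0 2 1 (by decide), s0 3 0 (by decide), s0 3 1 (by decide), map_zero,
      zero_smul, add_zero, zero_add, map_neg, e4, e5, rot_swap _ 0 1, rot_swap _ 2 3]
    module

theorem isHyperbolic_six {α : ℝ} (hα : α ≠ 0) {t : EuclideanSpace ℝ (Fin 5)} (ht : ‖t‖ = 1) :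
    IsHyperbolic (six α t) α (fun i : Fin 4 => ¬ (i : ℕ) < 2) Cmat where
  B_eq := rfl
  lam_eq := rfl
  d_eq := rfl
  root := isSquareRoot_c6 hα ht
  sign := sign_six α t
  form := isSpinForm_six α t
  extended := isExtended_Gam6
  -- The block with sign 1 consists of the directions 3 and 4, the complement of the set used to
  -- state which rotations are admitted.
  rot_eq := by
    funext i j
    exact propext not_iff_not.symm
  K1_le _ hξ := (mem_restricted_iff.mp hξ).1
  stable g _ ξ hξ := by
    refine mem_restricted_iff.mpr ⟨(isSquareRoot_c6 hα ht).par_mem _, ?_⟩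
    show chiral *ᵥ par Gam6 (c6 α t) α (spinAct Gam6 (c6 α t) α g *ᵥ ξ 0) 0
      = par Gam6 (c6 α t) α (spinAct Gam6 (c6 α t) α g *ᵥ ξ 0) 0
    rw [(isSquareRoot_c6 hα ht).par_zero, Matrix.mulVec_mulVec,
      ← (commute_spinAct_chiral hα ht g).eq, ← Matrix.mulVec_mulVec, (mem_restricted_iff.mp hξ).2]
  br_eq ξ _ η hη := br6_eq hα ht ξ η (mem_restricted_iff.mp hη).2

/-! ### Coordinates -/

/-- The sign `1, -1` of the two values of an index. -/
def zsign (a : Fin 2) : ℂ := if a = 0 then 1 else -1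

theorem zsign_zero : zsign 0 = 1 := rfl
theorem zsign_one : zsign 1 = -1 := by simp [zsign]
theorem zsign_add_one (a : Fin 2) : zsign (a + 1) = -zsign a := by
  fin_cases a <;> simp [zsign]

theorem kronecker_mulVec_apply {ι κ : Type} [Fintype ι] [Fintype κ] (A : Matrix ι ι ℂ)
    (B : Matrix κ κ ℂ) (v : ι × κ → ℂ) (i : ι) (j : κ) :
    ((A ⊗ₖ B) *ᵥ v) (i, j) = (A *ᵥ fun i' => (B *ᵥ fun j' => v (i', j')) j) i := by
  simp only [Matrix.mulVec, dotProduct, Fintype.sum_prod_type, Matrix.kroneckerMap_apply,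
    Finset.mul_sum, mul_assoc]

theorem pauliX_mulVec (f : Fin 2 → ℂ) (a : Fin 2) : (pauliX *ᵥ f) a = f (a + 1) := by
  fin_cases a <;> simp [pauliX, Matrix.mulVec, dotProduct]

theorem pauliY_mulVec (f : Fin 2 → ℂ) (a : Fin 2) :
    (pauliY *ᵥ f) a = -Complex.I * zsign a * f (a + 1) := by
  fin_cases a <;> simp [pauliY, Matrix.mulVec, dotProduct, zsign]

theorem pauliZ_mulVec (f : Fin 2 → ℂ) (a : Fin 2) : (pauliZ *ᵥ f) a = zsign a * f a := by
  fin_cases a <;> simp [pauliZ, Matrix.mulVec, dotProduct, zsign]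

theorem epsM_mulVec (f : Fin 2 → ℂ) (a : Fin 2) : (epsM *ᵥ f) a = zsign a * f (a + 1) := by
  fin_cases a <;> simp [Matrix.mulVec, dotProduct, zsign]

theorem upM_mulVec (f : Fin 2 → ℂ) (a : Fin 2) : (upM *ᵥ f) a = (1 + zsign a) * f (a + 1) := by
  fin_cases a
  · norm_num [Matrix.mulVec, dotProduct, zsign]
  · simp [Matrix.mulVec, dotProduct, zsign]

theorem downM_mulVec (f : Fin 2 → ℂ) (a : Fin 2) :
    (downM *ᵥ f) a = -(1 / 2) * (1 - zsign a) * f (a + 1) := by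
  fin_cases a
  · simp [Matrix.mulVec, dotProduct, zsign]
  · norm_num [Matrix.mulVec, dotProduct, zsign]
    rfl

section Entries

variable (v : I32 → ℂ) (a b c : Fin 2) (q : I5)

theorem Gam6_ip_apply : (Gam6 ip *ᵥ v) ((a, (b, c)), q)
    = (1 + zsign a) * v ((a + 1, (b, c)), q) := by
  show ((upM ⊗ₖ 1 ⊗ₖ 1) *ᵥ v) _ = _
  simp only [kronecker_mulVec_apply, upM_mulVec, Matrix.one_mulVec]

theorem Gam6_im_apply : (Gam6 im *ᵥ v) ((a, (b, c)), q)
    = -(1 / 2) * (1 - zsign a) * v ((a + 1, (b, c)), q) := by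
  show ((downM ⊗ₖ 1 ⊗ₖ 1) *ᵥ v) _ = _
  simp only [kronecker_mulVec_apply, downM_mulVec, Matrix.one_mulVec]

theorem Gam6_0_apply : (Gam6 (it 0) *ᵥ v) ((a, (b, c)), q)
    = Complex.I * zsign a * v ((a, (b + 1, c)), q) := by
  show ((pauliZ ⊗ₖ (Complex.I • (pauliX ⊗ₖ 1)) ⊗ₖ 1) *ᵥ v) _ = _
  simp only [kronecker_mulVec_apply, pauliX_mulVec, pauliZ_mulVec, Matrix.one_mulVec,
    Matrix.smul_mulVec, Pi.smul_apply, smul_eq_mul]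
  ring

theorem Gam6_1_apply : (Gam6 (it 1) *ᵥ v) ((a, (b, c)), q)
    = zsign a * zsign b * v ((a, (b + 1, c)), q) := by
  show ((pauliZ ⊗ₖ (Complex.I • (pauliY ⊗ₖ 1)) ⊗ₖ 1) *ᵥ v) _ = _
  simp only [kronecker_mulVec_apply, pauliY_mulVec, pauliZ_mulVec, Matrix.one_mulVec,
    Matrix.smul_mulVec, Pi.smul_apply, smul_eq_mul]
  linear_combination -(zsign a * zsign b * v ((a, (b + 1, c)), q)) * Complex.I_sq

theorem Gam6_2_apply : (Gam6 (it 2) *ᵥ v) ((a, (b, c)), q)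
    = Complex.I * zsign a * zsign b * v ((a, (b, c + 1)), q) := by
  show ((pauliZ ⊗ₖ (Complex.I • (pauliZ ⊗ₖ pauliX)) ⊗ₖ 1) *ᵥ v) _ = _
  simp only [kronecker_mulVec_apply, pauliX_mulVec, pauliZ_mulVec, Matrix.one_mulVec,
    Matrix.smul_mulVec, Pi.smul_apply, smul_eq_mul]
  ring

theorem Gam6_3_apply : (Gam6 (it 3) *ᵥ v) ((a, (b, c)), q)
    = zsign a * zsign b * zsign c * v ((a, (b, c + 1)), q) := by
  show ((pauliZ ⊗ₖ (Complex.I • (pauliZ ⊗ₖ pauliY)) ⊗ₖ 1) *ᵥ v) _ = _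
  simp only [kronecker_mulVec_apply, pauliY_mulVec, pauliZ_mulVec, Matrix.one_mulVec,
    Matrix.smul_mulVec, Pi.smul_apply, smul_eq_mul]
  linear_combination -(zsign a * zsign b * zsign c * v ((a, (b, c + 1)), q)) * Complex.I_sq

theorem chiral_apply : (chiral *ᵥ v) ((a, (b, c)), q)
    = zsign a * zsign b * zsign c * v ((a, (b, c)), q) := by
  rw [chiral, chir6_eq]
  simp only [kronecker_mulVec_apply, pauliZ_mulVec, Matrix.one_mulVec]
  ring

theorem one_kronecker_apply (Tm : Matrix I5 I5 ℂ) (p : I6) (q : I5) :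
    (((1 : Matrix I6 I6 ℂ) ⊗ₖ Tm) *ᵥ v) (p, q) = (Tm *ᵥ fun q' => v (p, q')) q := by
  rw [kronecker_mulVec_apply, Matrix.one_mulVec]

theorem C_apply (u v : I32 → ℂ) : C u v = ∑ a, ∑ b, ∑ c, ∑ d, ∑ e,
    u ((a, (b, c)), (d, e)) * (zsign a * zsign c * zsign e)
      * v ((a + 1, (b + 1, c + 1)), (d + 1, e + 1)) := by
  have h : ∀ a b c d e, ((C6 ⊗ₖ C5) *ᵥ v) ((a, (b, c)), (d, e))
      = zsign a * zsign c * zsign e * v ((a + 1, (b + 1, c + 1)), (d + 1, e + 1)) := by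
    intro a b c d e
    show ((epsM ⊗ₖ (pauliX ⊗ₖ epsM) ⊗ₖ (pauliX ⊗ₖ epsM)) *ᵥ v) _ = _
    simp only [kronecker_mulVec_apply, pauliX_mulVec, epsM_mulVec]
    ring
  simp only [C, dotProduct, Fintype.sum_prod_type, h]
  simp only [mul_assoc]

end Entries

/-- The indices on which the chirality is `1`. -/
def IsEven (i : I32) : Prop := i.1.2.2 = i.1.1 + i.1.2.1

instance : DecidablePred IsEven := fun i => inferInstanceAs (Decidable (i.1.2.2 = i.1.1 + i.1.2.1))

/-- In the chosen basis chirality is diagonal with entries ±1, so its fixed vectors are those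
supported on half of the indices. -/
theorem chiral_iff (v : I32 → ℂ) : chiral *ᵥ v = v ↔ ∀ i, ¬ IsEven i → v i = 0 := by
  constructor
  · rintro h ⟨⟨a, b, c⟩, q⟩ hi
    have := congrFun h ((a, (b, c)), q)
    rw [chiral_apply] at this
    have hz : zsign a * zsign b * zsign c = -1 := by
      revert hi
      fin_cases a <;> fin_cases b <;> fin_cases c <;> simp [IsEven, zsign]
    rw [hz, neg_one_mul, neg_eq_iff_add_eq_zero, ← two_mul] at this
    simpa using this
  · intro h
    funext ⟨⟨a, b, c⟩, q⟩
    rw [chiral_apply]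
    by_cases hi : IsEven ((a, (b, c)), q)
    · have hz : zsign a * zsign b * zsign c = 1 := by
        revert hi
        fin_cases a <;> fin_cases b <;> fin_cases c <;> simp [IsEven, zsign]
      rw [hz, one_mul]
    · rw [h _ hi, mul_zero]

/-! ### Six dimensions: the quotient ν, the restriction and the Fierz identity -/

theorem nu_six {α : ℝ} (hα : α ≠ 0) {t : EuclideanSpace ℝ (Fin 5)} (ht : ‖t‖ = 1) :
    (six α t).nu = 1 / 2 := by
  have h := isSquareRoot_c6 hα ht
  let F : (six α t).K1 →ₗ[ℂ] ({i // IsEven i} → ℂ) :=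
    { toFun := fun ξ i => (ξ : SF 4 I32) 0 i
      map_add' := fun _ _ => rfl
      map_smul' := fun _ _ => rfl }
  have hF : Function.Bijective F := by
    constructor
    · intro ξ η e
      obtain ⟨h1, h2⟩ := mem_restricted_iff.mp ξ.2
      obtain ⟨h3, h4⟩ := mem_restricted_iff.mp η.2
      refine Subtype.ext ((h.eq_par h1).trans (Eq.trans ?_ (h.eq_par h3).symm))
      congr 1
      funext i
      by_cases hi : IsEven i
      · exact congrFun e ⟨i, hi⟩
      · rw [(chiral_iff _).mp h2 i hi, (chiral_iff _).mp h4 i hi]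
    · intro w
      let v : I32 → ℂ := fun i => if hi : IsEven i then w ⟨i, hi⟩ else 0
      refine ⟨⟨par Gam6 (c6 α t) α v, mem_restricted_iff.mpr ⟨h.par_mem v, ?_⟩⟩, ?_⟩
      · show chiral *ᵥ par Gam6 (c6 α t) α v 0 = par Gam6 (c6 α t) α v 0
        rw [h.par_zero, chiral_iff]
        intro i hi
        exact dif_neg hi
      · funext i
        show par Gam6 (c6 α t) α v 0 i = w i
        rw [h.par_zero]
        exact dif_pos i.2
  have hc : Fintype.card {i // IsEven i} = 16 := by
    rw [Fintype.card_subtype]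
    decide
  rw [SuperData.nu, (LinearEquiv.ofBijective F hF).finrank_eq, Module.finrank_fintype_fun_eq_card, hc]
  simp
  norm_num

theorem not_nonRestricted_six {α : ℝ} (hα : α ≠ 0) {t : EuclideanSpace ℝ (Fin 5)} (ht : ‖t‖ = 1) :
    ¬ (six α t).NonRestricted := by
  intro hn
  have h := isSquareRoot_c6 hα ht
  -- A basis vector of the wrong chirality extends to a parallel section outside the odd part.
  obtain ⟨h1, h2⟩ := h.par_mem (Pi.single ((0, (0, 1)), (0, 0)) 1)
  have h3 := (chiral_iff _).mp (mem_restricted_iff.mp (hn _ h1 h2)).2 ((0, (0, 1)), (0, 0))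
    (by decide)
  rw [h.par_zero] at h3
  simp at h3

/-- The action of the field `{ξ, ξ}` on constant spinors. -/
def selfAct (α : ℝ) (t : EuclideanSpace ℝ (Fin 5)) (v : I32 → ℂ) : Matrix I32 I32 ℂ :=
  C (sigM Gam6 *ᵥ v) (Gam6 im *ᵥ (sigM Gam6 *ᵥ v)) • spinAct Gam6 (c6 α t) α Gen.plus
    + C (sigP Gam6 *ᵥ v) (Gam6 ip *ᵥ (sigP Gam6 *ᵥ v)) • spinAct Gam6 (c6 α t) α Gen.minus
    + ∑ i, (2 * C (sigM Gam6 *ᵥ v) (Gam6 (it i) *ᵥ (sigP Gam6 *ᵥ v)))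
        • spinAct Gam6 (c6 α t) α (Gen.tr i)
    + ∑ i, ((1 / (α : ℂ)) * (2 * C (sigM Gam6 *ᵥ v)
        (((gam6 (it 0) * gam6 (it 1) * gam6 (it i)) ⊗ₖ vec5 t) *ᵥ (sigP Gam6 *ᵥ v))))
        • spinAct Gam6 (c6 α t) α (Gen.star i)
    + (-(α : ℂ) * C (sigP Gam6 *ᵥ v) ((gam6 ip ⊗ₖ vec5 t) *ᵥ (sigP Gam6 *ᵥ v)))
        • (spinAct Gam6 (c6 α t) α (Gen.rot 0 1) + spinAct Gam6 (c6 α t) α (Gen.rot 2 3))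

theorem hasSymbol_br6 {α : ℝ} (hα : α ≠ 0) {t : EuclideanSpace ℝ (Fin 5)} (ht : ‖t‖ = 1)
    (ξ : SF 4 I32) :
    HasSymbol Gam6 (c6 α t) α (br6 α (vec5 t) ξ ξ) (selfAct α t (ξ 0)) := by
  have h := isHyperbolic_six hα ht
  have hg : ∀ g : Gen 4, g.Admits (fun i j : Fin 4 => (¬ (i : ℕ) < 2 ↔ ¬ (j : ℕ) < 2)) →
      HasSymbol Gam6 (c6 α t) α (gen (freq 4 α) g) (spinAct Gam6 (c6 α t) α g) :=
    fun g hg => h.root.hasSymbol_gen h.commute_rot hg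
  unfold br6 selfAct
  simp only [← two_mul]
  exact (((((hg Gen.plus trivial).smul _).add ((hg Gen.minus trivial).smul _)).add
    (HasSymbol.sum Finset.univ fun i _ => (hg (Gen.tr i) trivial).smul _)).add
    (HasSymbol.sum Finset.univ fun i _ => (hg (Gen.star i) trivial).smul _)).add
    (((hg (Gen.rot 0 1) (by simp [Gen.Admits])).add
      (hg (Gen.rot 2 3) (by simp [Gen.Admits]))).smul _)

theorem sigM_apply (v : I32 → ℂ) (a : Fin 2) (p q : I5) :
    (sigM Gam6 *ᵥ v) ((a, p), q) = (1 + zsign a) / 2 * v ((a, p), q) := by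
  obtain ⟨b, c⟩ := p
  have e : (a + 1 + 1 : Fin 2) = a := by fin_cases a <;> rfl
  rw [sigM, Matrix.smul_mulVec, ← Matrix.mulVec_mulVec, Pi.smul_apply, Gam6_ip_apply, Gam6_im_apply,
    zsign_add_one, e, smul_eq_mul]
  fin_cases a <;> (simp [zsign]; try ring)

theorem sigP_apply (v : I32 → ℂ) (a : Fin 2) (p q : I5) :
    (sigP Gam6 *ᵥ v) ((a, p), q) = (1 - zsign a) / 2 * v ((a, p), q) := by
  rw [isClifford_Gam6.sigP_add_sigM |> eq_sub_of_add_eq, Matrix.sub_mulVec, Pi.sub_apply, sigM_apply,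
    Matrix.one_mulVec]
  ring

theorem pair_kronecker_mulVec (i j : Fin 4) (Tm : Matrix I5 I5 ℂ) (v : I32 → ℂ) :
    ((gam6 (it i) * gam6 (it j)) ⊗ₖ Tm) *ᵥ v
      = Gam6 (it i) *ᵥ (Gam6 (it j) *ᵥ ((1 ⊗ₖ Tm) *ᵥ v)) := by
  simp only [Matrix.mulVec_mulVec]
  congr 1
  show _ = (gam6 (it i) ⊗ₖ 1) * ((gam6 (it j) ⊗ₖ 1) * (1 ⊗ₖ Tm))
  simp only [← Matrix.mul_kronecker_mul, mul_one, one_mul]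

theorem triple_kronecker_mulVec (i j k : Fin 4) (Tm : Matrix I5 I5 ℂ) (v : I32 → ℂ) :
    ((gam6 (it i) * gam6 (it j) * gam6 (it k)) ⊗ₖ Tm) *ᵥ v
      = Gam6 (it i) *ᵥ (Gam6 (it j) *ᵥ (Gam6 (it k) *ᵥ ((1 ⊗ₖ Tm) *ᵥ v))) := by
  simp only [Matrix.mulVec_mulVec]
  congr 1
  show _ = (gam6 (it i) ⊗ₖ 1) * ((gam6 (it j) ⊗ₖ 1) * ((gam6 (it k) ⊗ₖ 1) * (1 ⊗ₖ Tm)))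
  simp only [← Matrix.mul_kronecker_mul, mul_one, one_mul, mul_assoc]

theorem plus_kronecker_mulVec (Tm : Matrix I5 I5 ℂ) (v : I32 → ℂ) :
    (gam6 ip ⊗ₖ Tm) *ᵥ v = Gam6 ip *ᵥ ((1 ⊗ₖ Tm) *ᵥ v) := by
  rw [Matrix.mulVec_mulVec]
  congr 1
  show _ = (gam6 ip ⊗ₖ 1) * (1 ⊗ₖ Tm)
  rw [← Matrix.mul_kronecker_mul, mul_one, one_mul]

theorem T5_mulVec (w : I5 → ℂ) (d e : Fin 2) (a : Fin 5) :
    (T5 a *ᵥ w) (d, e) = ![Complex.I * w (d + 1, e), zsign d * w (d + 1, e),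
    Complex.I * zsign d * w (d, e + 1), zsign d * zsign e * w (d, e + 1),
    Complex.I * zsign d * zsign e * w (d, e)] a := by
  fin_cases a
  · show ((Complex.I • (pauliX ⊗ₖ 1)) *ᵥ w) _ = _
    simp [Matrix.smul_mulVec, kronecker_mulVec_apply, pauliX_mulVec]
  · show ((Complex.I • (pauliY ⊗ₖ 1)) *ᵥ w) _ = _
    simp [Matrix.smul_mulVec, kronecker_mulVec_apply, pauliY_mulVec]
    linear_combination -(zsign d * w (d + 1, e)) * Complex.I_sq
  · show ((Complex.I • (pauliZ ⊗ₖ pauliX)) *ᵥ w) _ = _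
    simp [Matrix.smul_mulVec, kronecker_mulVec_apply, pauliX_mulVec, pauliZ_mulVec]
    ring
  · show ((Complex.I • (pauliZ ⊗ₖ pauliY)) *ᵥ w) _ = _
    simp [Matrix.smul_mulVec, kronecker_mulVec_apply, pauliY_mulVec, pauliZ_mulVec]
    linear_combination -(zsign d * zsign e * w (d, e + 1)) * Complex.I_sq
  · show ((Complex.I • (pauliZ ⊗ₖ pauliZ)) *ᵥ w) _ = _
    simp [Matrix.smul_mulVec, kronecker_mulVec_apply, pauliZ_mulVec]
    ring

/-- The entries of a Clifford vector in five dimensions. -/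
theorem vec5_mulVec (t : EuclideanSpace ℝ (Fin 5)) (w : I5 → ℂ) (d e : Fin 2) :
    (vec5 t *ᵥ w) (d, e) = (Complex.I * t 0 + zsign d * t 1) * w (d + 1, e)
      + zsign d * ((Complex.I * t 2 + zsign e * t 3) * w (d, e + 1)
        + Complex.I * t 4 * zsign e * w (d, e)) := by
  rw [vec5, Matrix.sum_mulVec, Finset.sum_apply]
  simp only [Matrix.smul_mulVec, Pi.smul_apply, T5_mulVec, smul_eq_mul, Fin.sum_univ_five]
  simp
  ring

/-- The powers of α balance: for `K_(-)`, `K_(i)` and the rotations one factor α occurs, and for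
`K_(i*)` the product of `1/α` and `α²`. With α factored out, a polynomial identity in the entries
remains. -/
theorem selfAct_mulVec (α : ℝ) (hα : α ≠ 0) (t : EuclideanSpace ℝ (Fin 5)) (v : I32 → ℂ) :
    selfAct α t v *ᵥ v = (α : ℂ) • (
      -(C (sigP Gam6 *ᵥ v) (Gam6 ip *ᵥ (sigP Gam6 *ᵥ v)) •
          (Gam6 (it 0) *ᵥ (Gam6 (it 1) *ᵥ ((1 ⊗ₖ vec5 t) *ᵥ (sigM Gam6 *ᵥ v)))))
      + ∑ i, C (sigM Gam6 *ᵥ v) (Gam6 (it i) *ᵥ (sigP Gam6 *ᵥ v)) •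
          (Gam6 ip *ᵥ (Gam6 (it 0) *ᵥ (Gam6 (it 1) *ᵥ ((1 ⊗ₖ vec5 t) *ᵥ (Gam6 (it i) *ᵥ v)))))
      - ∑ i, C (sigM Gam6 *ᵥ v) (Gam6 (it 0) *ᵥ (Gam6 (it 1) *ᵥ (Gam6 (it i) *ᵥ ((1 ⊗ₖ vec5 t) *ᵥ
          (sigP Gam6 *ᵥ v))))) • (Gam6 ip *ᵥ (Gam6 (it i) *ᵥ v))
      - ((1 / 2 : ℂ) * C (sigP Gam6 *ᵥ v) (Gam6 ip *ᵥ ((1 ⊗ₖ vec5 t) *ᵥ (sigP Gam6 *ᵥ v)))) •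
          (Gam6 (it 0) *ᵥ (Gam6 (it 1) *ᵥ v) + Gam6 (it 2) *ᵥ (Gam6 (it 3) *ᵥ v))) := by
  have hα' : (α : ℂ) ≠ 0 := by exact_mod_cast hα
  have e1 : spinAct Gam6 (c6 α t) α (Gen.rot 0 1) = (1 / 2 : ℂ) • (Gam6 (it 0) * Gam6 (it 1)) := by
    rw [spinAct, isClifford_Gam6.tr_anticomm (by decide : (1 : Fin 4) ≠ 0)]
    module
  have e2 : spinAct Gam6 (c6 α t) α (Gen.rot 2 3) = (1 / 2 : ℂ) • (Gam6 (it 2) * Gam6 (it 3)) := by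
    rw [spinAct, isClifford_Gam6.tr_anticomm (by decide : (3 : Fin 4) ≠ 2)]
    module
  have m1 : ∀ x : ℂ, (x • spinAct Gam6 (c6 α t) α Gen.minus) *ᵥ v = (α : ℂ) •
      -(x • (Gam6 (it 0) *ᵥ (Gam6 (it 1) *ᵥ ((1 ⊗ₖ vec5 t) *ᵥ (sigM Gam6 *ᵥ v))))) := by
    intro x
    rw [spinAct, c6, Matrix.smul_mulVec, Matrix.neg_mulVec, smul_mul_assoc, Matrix.smul_mulVec,
      ← Matrix.mulVec_mulVec, pair_kronecker_mulVec]
    module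
  have m2 : ∀ (i : Fin 4) (x : ℂ), ((2 * x) • spinAct Gam6 (c6 α t) α (Gen.tr i)) *ᵥ v = (α : ℂ) •
      (x • (Gam6 ip *ᵥ (Gam6 (it 0) *ᵥ (Gam6 (it 1) *ᵥ
        ((1 ⊗ₖ vec5 t) *ᵥ (Gam6 (it i) *ᵥ v)))))) := by
    intro i x
    rw [spinAct, tilt, c6, Matrix.smul_mulVec, Matrix.smul_mulVec, ← Matrix.mulVec_mulVec,
      ← Matrix.mulVec_mulVec, Matrix.smul_mulVec, pair_kronecker_mulVec, Matrix.mulVec_smul]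
    module
  have m3 : ∀ (i : Fin 4) (x : ℂ), ((1 / (α : ℂ) * (2 * x)) • spinAct Gam6 (c6 α t) α (Gen.star i)) *ᵥ v
      = (α : ℂ) • -(x • (Gam6 ip *ᵥ (Gam6 (it i) *ᵥ v))) := by
    intro i x
    rw [spinAct, Matrix.smul_mulVec, Matrix.smul_mulVec, ← Matrix.mulVec_mulVec, smul_smul,
      ← neg_smul, smul_smul]
    congr 1
    field_simp
  have m4 : ∀ x : ℂ, ((-(α : ℂ) * x) • (spinAct Gam6 (c6 α t) α (Gen.rot 0 1)
      + spinAct Gam6 (c6 α t) α (Gen.rot 2 3))) *ᵥ v = (α : ℂ) • -(((1 / 2 : ℂ) * x) •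
        (Gam6 (it 0) *ᵥ (Gam6 (it 1) *ᵥ v) + Gam6 (it 2) *ᵥ (Gam6 (it 3) *ᵥ v))) := by
    intro x
    rw [e1, e2, Matrix.smul_mulVec, ← smul_add, Matrix.smul_mulVec, Matrix.add_mulVec,
      ← Matrix.mulVec_mulVec, ← Matrix.mulVec_mulVec]
    module
  unfold selfAct
  rw [show spinAct Gam6 (c6 α t) α Gen.plus = 0 from rfl, smul_zero, zero_add]
  simp only [Matrix.add_mulVec _ _ v, Matrix.sum_mulVec, m1, m2, m3, m4, triple_kronecker_mulVec,
    plus_kronecker_mulVec, ← Finset.smul_sum, ← smul_add, Finset.sum_neg_distrib, sub_eq_add_neg]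

set_option maxRecDepth 100000 in
set_option maxHeartbeats 4000000 in
/-- The components in `S_-`: a Fierz identity. -/
theorem selfAct_minus {α : ℝ} (hα : α ≠ 0) (t : EuclideanSpace ℝ (Fin 5)) {v : I32 → ℂ}
    (hv : ∀ i, ¬ IsEven i → v i = 0) (b d e : Fin 2) :
    (selfAct α t v *ᵥ v) ((0, (b, b)), (d, e)) = 0 := by
  have h1 : ∀ q, v ((0, (0, 1)), q) = 0 := fun q => hv _ (by simp [IsEven])
  have h2 : ∀ q, v ((0, (1, 0)), q) = 0 := fun q => hv _ (by simp [IsEven])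
  have h3 : ∀ q, v ((1, (0, 0)), q) = 0 := fun q => hv _ (by simp [IsEven])
  have h4 : ∀ q, v ((1, (1, 1)), q) = 0 := fun q => hv _ (by simp [IsEven])
  have f10 : (1 + 1 : Fin 2) = 0 := rfl
  have f01 : (0 + 1 : Fin 2) = 1 := rfl
  have hf : ∀ x : Fin 2, x = 0 ∨ x = 1 := by decide
  rw [selfAct_mulVec α hα]
  rcases hf b with rfl | rfl <;> rcases hf d with rfl | rfl <;> rcases hf e with rfl | rfl <;>
  -- Each of the eight even components in `S_-` becomes an identity cubic in the sixteen surviving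
  -- entries of `v` and linear in the components of `t`. After powers of the imaginary unit are
  -- reduced, it holds in a commutative ring.
  · simp only [Pi.smul_apply, Pi.add_apply, Pi.sub_apply, Pi.neg_apply, smul_eq_mul,
      Fin.sum_univ_four, C_apply, Fin.sum_univ_two, sigM_apply, sigP_apply, Gam6_ip_apply,
      Gam6_0_apply, Gam6_1_apply, Gam6_2_apply, Gam6_3_apply, one_kronecker_apply, vec5_mulVec,
      zsign_zero, zsign_one, f10, f01, h1, h2, h3, h4, mul_zero, zero_mul, add_zero, zero_add,
      sub_self, add_neg_cancel, zero_div]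
    ring_nf
    simp only [Complex.I_sq, Complex.I_pow_three, Complex.I_pow_four]
    ring

/-- `K_(i)` and `K_(i*)` act with image in `S_-`, and so does `K_(-)`. For the rotations, `Γ_12` and
`Γ_34` are diagonal in this basis and opposite on the even indices of `S_+`, where `Γ_1234 = 1`. -/
theorem selfAct_plus {α : ℝ} (hα : α ≠ 0) (t : EuclideanSpace ℝ (Fin 5)) (v : I32 → ℂ)
    (b : Fin 2) (q : I5) : (selfAct α t v *ᵥ v) ((1, (b, b + 1)), q) = 0 := by
  have e : (b + 1 + 1 : Fin 2) = b := by fin_cases b <;> rfl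
  have h1 : ∀ w : I32 → ℂ, (Gam6 ip *ᵥ w) ((1, (b, b + 1)), q) = 0 := by
    intro w
    rw [Gam6_ip_apply, zsign_one, add_neg_cancel, zero_mul]
  have h2 : (Gam6 (it 0) *ᵥ (Gam6 (it 1) *ᵥ ((1 ⊗ₖ vec5 t) *ᵥ (sigM Gam6 *ᵥ v)))) ((1, (b, b + 1)), q)
      = 0 := by
    have : (fun q' => (sigM Gam6 *ᵥ v) ((1, (b, b + 1)), q')) = 0 := by
      funext q'
      rw [sigM_apply, zsign_one, add_neg_cancel, zero_div, zero_mul, Pi.zero_apply]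
    rw [Gam6_0_apply, Gam6_1_apply, e, one_kronecker_apply, this, Matrix.mulVec_zero, Pi.zero_apply]
    ring
  have h3 : (Gam6 (it 0) *ᵥ (Gam6 (it 1) *ᵥ v)) ((1, (b, b + 1)), q)
      + (Gam6 (it 2) *ᵥ (Gam6 (it 3) *ᵥ v)) ((1, (b, b + 1)), q) = 0 := by
    have hz : zsign b * zsign b = 1 := by fin_cases b <;> simp [zsign]
    rw [Gam6_0_apply, Gam6_1_apply, Gam6_2_apply, Gam6_3_apply, e, zsign_one, zsign_add_one]
    linear_combination (Complex.I * zsign b * v ((1, b, b + 1), q)) * hz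
  rw [selfAct_mulVec α hα]
  simp only [Pi.smul_apply, Pi.add_apply, Pi.sub_apply, Pi.neg_apply, Finset.sum_apply, h1, h2, h3,
    smul_zero, Finset.sum_const_zero, neg_zero, add_zero, sub_zero]

theorem isSupersymmetry_six {α : ℝ} (hα : α ≠ 0) {t : EuclideanSpace ℝ (Fin 5)} (ht : ‖t‖ = 1) :
    (six α t).IsSupersymmetry := by
  have h := isHyperbolic_six hα ht
  refine ⟨h.isGeometric, fun ξ hξ => ?_⟩
  have hL : (six α t).L ((six α t).br ξ ξ) ξ
      = par Gam6 (c6 α t) α (selfAct α t (ξ 0) *ᵥ ξ 0) := by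
    have e := (hasSymbol_br6 hα ht ξ).2 (ξ 0)
    rwa [← (isSquareRoot_c6 hα ht).eq_par (h.K1_le hξ)] at e
  -- The action preserves the odd part, so the components of the wrong chirality vanish
  -- automatically and only the even ones need the explicit identities.
  have hmem := h.L_mem (h.br_mem hξ hξ) hξ
  rw [hL] at hmem
  have h1 := (chiral_iff _).mp (mem_restricted_iff.mp hmem).2
  have h2 := (chiral_iff _).mp (mem_restricted_iff.mp hξ).2
  rw [(isSquareRoot_c6 hα ht).par_zero] at h1
  have h0 : selfAct α t (ξ 0) *ᵥ ξ 0 = 0 := by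
    funext ⟨⟨a, b, c⟩, d, e⟩
    by_cases hi : IsEven ((a, (b, c)), (d, e))
    · have hf : a = 0 ∨ a = 1 := by
        have : ∀ x : Fin 2, x = 0 ∨ x = 1 := by decide
        exact this a
      have hc : c = a + b := hi
      rcases hf with rfl | rfl
      · rw [hc, zero_add]
        exact selfAct_minus hα t h2 b d e
      · rw [hc, add_comm]
        exact selfAct_plus hα t _ b _
    · exact h1 _ hi
  rw [hL, h0]
  funext x
  exact Matrix.mulVec_zero _

/-! ### The eleven-dimensional superalgebra is not a supersymmetry algebra -/

theorem hasSymbol_field {n : ℕ} {ι : Type} [Fintype ι] [DecidableEq ι] {D : SuperData n ι} {α : ℝ}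
    {p : Fin n → Prop} [DecidablePred p] {Cm : Matrix ι ι ℂ} (h : IsHyperbolic D α p Cm)
    (φ : Matrix ι ι ℂ →ₗ[ℂ] ℂ) :
    HasSymbol D.Γ D.c α (field D.Γ D.c α p φ)
      (φ (D.Γ im) • 0 + φ (D.Γ ip) • spinAct D.Γ D.c α Gen.minus
        + ∑ i, φ (D.Γ (it i)) • spinAct D.Γ D.c α (Gen.tr i)
        + ∑ i, φ (starOp D.Γ D.c α p i) • spinAct D.Γ D.c α (Gen.star i)
        + (1 / 2 : ℂ) • ∑ i, ∑ j, φ (rotOp D.Γ D.c p i j) • spinAct D.Γ D.c α (Gen.rot i j)) := by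
  have hg : ∀ g : Gen n, g.Admits (fun i j => (p i ↔ p j)) →
      HasSymbol D.Γ D.c α (gen (freq n α) g) (spinAct D.Γ D.c α g) :=
    fun g hg => h.root.hasSymbol_gen h.commute_rot hg
  have hr : ∀ i j, HasSymbol D.Γ D.c α (φ (rotOp D.Γ D.c p i j) • gen (freq n α) (Gen.rot i j))
      (φ (rotOp D.Γ D.c p i j) • spinAct D.Γ D.c α (Gen.rot i j)) := by
    intro i j
    by_cases hij : p i ↔ p j
    · exact (hg (Gen.rot i j) hij).smul _
    · rw [rotOp, if_neg hij, map_zero, zero_smul, zero_smul]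
      exact HasSymbol.zero
  exact (((((hg Gen.plus trivial).smul _).add ((hg Gen.minus trivial).smul _)).add
    (HasSymbol.sum Finset.univ fun i _ => (hg (Gen.tr i) trivial).smul _)).add
    (HasSymbol.sum Finset.univ fun i _ => (hg (Gen.star i) trivial).smul _)).add
    ((HasSymbol.sum Finset.univ fun i _ => HasSymbol.sum Finset.univ fun j _ => hr i j).smul _)

/-- The entries that a gamma matrix flips. -/
def flip11 (i : Fin 9) (x : I32) : I32 :=
  ![((x.1.1, (x.1.2.1 + 1, x.1.2.2)), x.2), ((x.1.1, (x.1.2.1 + 1, x.1.2.2)), x.2),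
    (x.1, (x.2.1 + 1, x.2.2)), ((x.1.1, (x.1.2.1, x.1.2.2 + 1)), x.2),
    ((x.1.1, (x.1.2.1, x.1.2.2 + 1)), x.2), (x.1, (x.2.1 + 1, x.2.2)), (x.1, (x.2.1, x.2.2 + 1)),
    (x.1, (x.2.1, x.2.2 + 1)), x] i

theorem chir_kronecker_apply (v : I32 → ℂ) (a : Fin 5) (x y z d e : Fin 2) :
    ((chir6 ⊗ₖ T5 a) *ᵥ v) ((x, (y, z)), (d, e))
      = zsign x * zsign y * zsign z * (T5 a *ᵥ fun q => v ((x, (y, z)), q)) (d, e) := by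
  rw [chir6_eq]
  simp only [kronecker_mulVec_apply, pauliZ_mulVec]
  ring

/-- The spatial gamma matrices are monomial in this basis: each entry of the product depends on a
single entry of the vector. Vanishing questions become questions about index flips, which are
decidable. -/
theorem Gam11_flip (i : Fin 9) (x : I32) : ∃ k : ℂ, ∀ v : I32 → ℂ,
    (Gam11 (it i) *ᵥ v) x = k * v (flip11 i x) := by
  obtain ⟨⟨a, b, c⟩, d, e⟩ := x
  rw [Gam11_tr]
  fin_cases i
  · exact ⟨_, fun v => Gam6_0_apply v a b c (d, e)⟩
  · exact ⟨_, fun v => Gam6_1_apply v a b c (d, e)⟩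
  · refine ⟨zsign a * zsign b * zsign c * Complex.I, fun v => ?_⟩
    refine (chir_kronecker_apply v 0 a b c d e).trans ?_
    exact (congrArg _ (T5_mulVec _ d e 0)).trans (mul_assoc _ _ _).symm
  · exact ⟨_, fun v => Gam6_2_apply v a b c (d, e)⟩
  · exact ⟨_, fun v => Gam6_3_apply v a b c (d, e)⟩
  · refine ⟨zsign a * zsign b * zsign c * zsign d, fun v => ?_⟩
    refine (chir_kronecker_apply v 1 a b c d e).trans ?_
    exact (congrArg _ (T5_mulVec _ d e 1)).trans (mul_assoc _ _ _).symm
  · refine ⟨zsign a * zsign b * zsign c * (Complex.I * zsign d), fun v => ?_⟩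
    refine (chir_kronecker_apply v 2 a b c d e).trans ?_
    exact (congrArg _ (T5_mulVec _ d e 2)).trans (mul_assoc _ _ _).symm
  · refine ⟨zsign a * zsign b * zsign c * (zsign d * zsign e), fun v => ?_⟩
    refine (chir_kronecker_apply v 3 a b c d e).trans ?_
    exact (congrArg _ (T5_mulVec _ d e 3)).trans (mul_assoc _ _ _).symm
  · refine ⟨zsign a * zsign b * zsign c * (Complex.I * zsign d * zsign e), fun v => ?_⟩
    refine (chir_kronecker_apply v 4 a b c d e).trans ?_
    exact (congrArg _ (T5_mulVec _ d e 4)).trans (mul_assoc _ _ _).symm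

/-- A constant spinor on which `L_{ξ, ξ} ξ` does not vanish. -/
def witness (x : I32) : ℂ :=
  if x = ((1, (0, 0)), (0, 0)) ∨ x = ((1, (1, 1)), (1, 1)) then 1 else 0

theorem sigM_witness : sigM Gam11 *ᵥ witness = 0 := by
  funext ⟨⟨a, p⟩, q⟩
  refine (sigM_apply witness a p q).trans ?_
  have hf : a = 0 ∨ a = 1 := by
    have : ∀ x : Fin 2, x = 0 ∨ x = 1 := by decide
    exact this a
  rcases hf with rfl | rfl
  · simp [witness]
  · simp [zsign]

/-- From the chosen entry, the first nonzero position of the witness is reached by flipping a single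
bit of the second factor, the other by flipping three bits. Inside one block only directions 6 and 9
(indices 5 and 8) achieve this with two gamma matrices. -/
theorem pair_witness_eq_zero {i j : Fin 9} (hij : (i : ℕ) < 3 ↔ (j : ℕ) < 3)
    (h1 : ¬ (i = 5 ∧ j = 8)) (h2 : ¬ (i = 8 ∧ j = 5)) (hne : i ≠ j) :
    ((Gam11 (it i) * Gam11 (it j)) *ᵥ witness) ((1, (0, 0)), (1, 0)) = 0 := by
  obtain ⟨k, hk⟩ := Gam11_flip i ((1, (0, 0)), (1, 0))
  obtain ⟨l, hl⟩ := Gam11_flip j (flip11 i ((1, (0, 0)), (1, 0)))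
  rw [← Matrix.mulVec_mulVec, hk, hl]
  have : ∀ i j : Fin 9, ((i : ℕ) < 3 ↔ (j : ℕ) < 3) → ¬ (i = 5 ∧ j = 8) → ¬ (i = 8 ∧ j = 5) →
      i ≠ j → ¬ (flip11 j (flip11 i ((1, (0, 0)), (1, 0))) = ((1, (0, 0)), (0, 0)) ∨
        flip11 j (flip11 i ((1, (0, 0)), (1, 0))) = ((1, (1, 1)), (1, 1))) := by
    decide
  rw [witness, if_neg (this i j hij h1 h2 hne), mul_zero, mul_zero]

theorem pair_witness_ne_zero :
    ((Gam11 (it 5) * Gam11 (it 8)) *ᵥ witness) ((1, (0, 0)), (1, 0)) ≠ 0 := by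
  have f : (1 + 1 : Fin 2) = 0 := rfl
  rw [← Matrix.mulVec_mulVec]
  show ((chir6 ⊗ₖ T5 1) *ᵥ ((chir6 ⊗ₖ T5 4) *ᵥ witness)) _ ≠ 0
  rw [chir_kronecker_apply, T5_mulVec]
  simp [chir_kronecker_apply, T5_mulVec, zsign, f, witness]

theorem pairing_witness_ne_zero :
    C witness ((cl123 * (Gam11 (it 5) * Gam11 (it 8)) * Gam11 ip) *ᵥ witness) ≠ 0 := by
  have f10 : (1 + 1 : Fin 2) = 0 := rfl
  have f01 : (0 + 1 : Fin 2) = 1 := rfl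
  have e : ∀ x, ((cl123 * (Gam11 (it 5) * Gam11 (it 8)) * Gam11 ip) *ᵥ witness) x
      = (Gam6 (it 2) *ᵥ (Gam6 (it 3) *ᵥ ((1 ⊗ₖ T5 0) *ᵥ ((chir6 ⊗ₖ T5 1) *ᵥ ((chir6 ⊗ₖ T5 4) *ᵥ
        (Gam6 ip *ᵥ witness)))))) x := by
    intro x
    rw [cl123_eq, ← Matrix.mulVec_mulVec, ← Matrix.mulVec_mulVec, ← Matrix.mulVec_mulVec,
      pair_kronecker_mulVec]
    rfl
  rw [C_apply]
  simp only [e, Fin.sum_univ_two, f10, f01, Gam6_2_apply, Gam6_3_apply, one_kronecker_apply, T5_mulVec,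
    chir_kronecker_apply, Gam6_ip_apply]
  simp [witness, zsign]

/-- On a spinor in `S_+` the translations have zero coefficient and `K_(-)` acts by zero, so the
action of the bracket is purely by rotations. One entry isolates a single rotation, whose
coefficient and action are both nonzero. -/
theorem not_isSupersymmetry_eleven {α : ℝ} (hα : α ≠ 0) : ¬ (eleven α 0).IsSupersymmetry := by
  rintro ⟨-, hs⟩
  have h := isHyperbolic_eleven hα
  have hr := isSquareRoot_c11 hα
  have f := isSpinForm_eleven α
  have hmem : par Gam11 (c11 α) α witness ∈ (eleven α 0).K1 := (parallel_eleven α).ge (hr.par_mem _)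
  have h1 := hs _ hmem
  have hb := h.br_eq _ hmem _ hmem
  set φ := pairing Cmat witness witness with hφ
  have h0 : par (eleven α 0).Γ (eleven α 0).c α witness 0 = witness := hr.par_zero witness
  have h0' : par Gam11 (c11 α) α witness 0 = witness := hr.par_zero witness
  rw [h0', ← hφ] at hb
  have hsym := (hasSymbol_field h φ).2 witness
  have hz : par Gam11 (c11 α) α 0 = 0 := by
    funext x
    exact Matrix.mulVec_zero _
  rw [hb, SuperData.L, h.B_eq] at h1
  have key := hr.par_injective ((hsym.symm.trans h1).trans hz.symm)
  -- The form vanishes on `S_+ × S_+`, and an operator commuting with `σ_-` keeps the witness in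
  -- `S_+`.
  have hM : ∀ A : Matrix I32 I32 ℂ, Commute A (sigM Gam11) → φ A = 0 := by
    intro A hA
    have hw : sigP Gam11 *ᵥ witness = witness := by
      have := congrArg (fun M => M *ᵥ witness) isClifford_Gam11.sigP_add_sigM
      simpa [Matrix.add_mulVec, sigM_witness] using this
    rw [hφ, ← hw, f.adj_sigP.pairing_mulVec_left, hw, ← hA.eq, ← pairing_mulVec_right, sigM_witness,
      pairing_apply, Matrix.mulVec_zero, Matrix.mulVec_zero, dotProduct_zero]
  have ht : ∀ i, φ (Gam11 (it i)) = 0 := fun i => hM _ (isClifford_Gam11.commute_tr_sigM i)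
  have hst : ∀ i, φ (starOp Gam11 (c11 α) α (fun i : Fin 9 => (i : ℕ) < 3) i) = 0 := by
    intro i
    rw [starOp, map_smul, hM, smul_zero]
    refine (hr.commute_sigM.mul_left (isClifford_Gam11.commute_tr_sigM i)).mul_left
      (Commute.sub_left ?_ ((Commute.refl _).smul_left _))
    rw [Commute, SemiconjBy, isClifford_Gam11.sigP_sigM, isClifford_Gam11.sigM_sigP]
  have hm : spinAct Gam11 (c11 α) α Gen.minus *ᵥ witness = 0 := by
    rw [spinAct, Matrix.neg_mulVec, ← Matrix.mulVec_mulVec, sigM_witness, Matrix.mulVec_zero, neg_zero]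
  have key2 := congrFun key ((1, (0, 0)), (1, 0))
  simp only [show (eleven α 0).Γ = Gam11 from rfl, show (eleven α 0).c = c11 α from rfl, ht, hst,
    zero_smul, smul_zero, Finset.sum_const_zero, add_zero, zero_add, Matrix.add_mulVec,
    Matrix.smul_mulVec, hm, Matrix.sum_mulVec, Pi.smul_apply, Finset.sum_apply, smul_eq_mul,
    Pi.zero_apply] at key2
  set g : Fin 9 × Fin 9 → ℂ := fun ij =>
    φ (rotOp Gam11 (c11 α) (fun i : Fin 9 => (i : ℕ) < 3) ij.1 ij.2)
      * (spinAct Gam11 (c11 α) α (Gen.rot ij.1 ij.2) *ᵥ witness) ((1, (0, 0)), (1, 0)) with hg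
  -- All other pairs drop out: mixed pairs have zero operator, equal indices give no rotation, and
  -- the remaining ones miss the support of the witness.
  have hsum : ∑ i, ∑ j, g (i, j) = g (5, 8) + g (8, 5) := by
    rw [← Fintype.sum_prod_type', ← Finset.sum_pair (f := g) (by decide : ((5, 8) : Fin 9 × Fin 9) ≠ (8, 5))]
    refine (Finset.sum_subset (Finset.subset_univ _) ?_).symm
    rintro ⟨i, j⟩ - hij
    have hij' : ¬ (i = 5 ∧ j = 8) ∧ ¬ (i = 8 ∧ j = 5) := by
      simpa [not_or] using hij
    simp only [hg]
    by_cases hp : (i : ℕ) < 3 ↔ (j : ℕ) < 3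
    · by_cases hne : i = j
      · subst hne
        rw [spinAct, sub_self, smul_zero, Matrix.zero_mulVec, Pi.zero_apply, mul_zero]
      · rw [spinAct, Matrix.smul_mulVec, Matrix.sub_mulVec, Pi.smul_apply, Pi.sub_apply,
          pair_witness_eq_zero hp hij'.1 hij'.2 hne,
          pair_witness_eq_zero hp.symm (fun x => hij'.2 x.symm) (fun x => hij'.1 x.symm)
            (Ne.symm hne), sub_zero, smul_zero, mul_zero]
    · rw [rotOp, if_neg hp, map_zero, zero_mul]
  -- Coefficient and action are both antisymmetric in the two indices, so their product is symmetric
  -- and nothing cancels.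
  have h58 : g (8, 5) = g (5, 8) := by
    simp only [hg, rotOp, spinAct]
    rw [isClifford_Gam11.tr_anticomm (by decide : (8 : Fin 9) ≠ 5)]
    simp [sgn, Matrix.smul_mulVec, Matrix.sub_mulVec, Matrix.neg_mulVec, Matrix.add_mulVec]
    ring
  have hg58 : g (5, 8) = (α * C witness ((cl123 * (Gam11 (it 5) * Gam11 (it 8)) * Gam11 ip) *ᵥ witness))
      * ((1 / 2) * ((Gam11 (it 5) * Gam11 (it 8)) *ᵥ witness) ((1, (0, 0)), (1, 0))) := by
    simp only [hg, rotOp, spinAct]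
    rw [isClifford_Gam11.tr_anticomm (by decide : (8 : Fin 9) ≠ 5), C_eq_pairing, ← hφ, c11]
    simp [sgn, Matrix.smul_mulVec, Matrix.add_mulVec]
    left
    ring
  have hfin : (1 / 2 : ℂ) * ∑ i, ∑ j, g (i, j) = 0 := key2
  rw [hsum, h58, hg58] at hfin
  have hα' : (α : ℂ) ≠ 0 := by exact_mod_cast hα
  have p1 := pair_witness_ne_zero
  have p2 := pairing_witness_ne_zero
  have : (α : ℂ) * C witness ((cl123 * (Gam11 (it 5) * Gam11 (it 8)) * Gam11 ip) *ᵥ witness)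
      * ((Gam11 (it 5) * Gam11 (it 8)) *ᵥ witness) ((1, (0, 0)), (1, 0)) = 0 := by
    linear_combination 2 * hfin
  exact mul_ne_zero (mul_ne_zero hα' p2) p1 this

/-! ### Vector fields on a subspace spanned by some of the directions -/

section LiftField

variable {m n : ℕ} (e : Fin m ↪ Fin n)

/-- The inclusion of coordinate directions. -/
def idxMap : Idx m → Idx n := Sum.map id e

theorem idxMap_injective : Function.Injective (idxMap e) :=
  Sum.map_injective.mpr ⟨Function.injective_id, e.injective⟩

theorem ne_idxMap {j : Fin n} (hj : j ∉ Set.range e) (b : Idx m) : idxMap e b ≠ it j := by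
  rcases b with a | k
  · simp [idxMap]
  · intro h
    exact hj ⟨k, Sum.inr_injective h⟩

/-- The projection onto the chosen directions. -/
def projPt : Pt n →L[ℝ] Pt m := ContinuousLinearMap.pi fun k => ContinuousLinearMap.proj (idxMap e k)

theorem projPt_apply (y : Pt n) (k : Idx m) : projPt e y k = y (idxMap e k) := rfl

/-- The inclusion of the chosen directions. -/
def inclPt : Pt m →L[ℝ] Pt n :=
  LinearMap.toContinuousLinearMap (Function.ExtendByZero.linearMap ℝ (idxMap e))

theorem inclPt_idxMap (x : Pt m) (k : Idx m) : inclPt e x (idxMap e k) = x k :=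
  (idxMap_injective e).extend_apply x 0 k

theorem inclPt_of_notMem (x : Pt m) {b : Idx n} (hb : b ∉ Set.range (idxMap e)) :
    inclPt e x b = 0 :=
  Function.extend_apply' x (0 : Idx n → ℝ) b hb

theorem projPt_inclPt (x : Pt m) : projPt e (inclPt e x) = x :=
  funext fun k => inclPt_idxMap e x k

theorem projPt_single (a : Idx m) : projPt e (Pi.single (idxMap e a) 1) = Pi.single a 1 := by
  funext k
  simp [projPt_apply, Pi.single_apply, (idxMap_injective e).eq_iff]

theorem projPt_single_of_notMem {b : Idx n} (hb : b ∉ Set.range (idxMap e)) :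
    projPt e (Pi.single b 1) = 0 := by
  funext k
  exact Pi.single_eq_of_ne (fun h => hb ⟨k, h⟩) 1

theorem inclPt_single (a : Idx m) : inclPt e (Pi.single a 1) = Pi.single (idxMap e a) 1 := by
  funext b
  by_cases hb : b ∈ Set.range (idxMap e)
  · obtain ⟨k, rfl⟩ := hb
    rw [inclPt_idxMap]
    simp [Pi.single_apply, (idxMap_injective e).eq_iff]
  · rw [inclPt_of_notMem e _ hb, Pi.single_eq_of_ne fun h => hb ⟨a, h.symm⟩]

theorem pd_comp_projPt {f : Pt m → ℂ} (hf : Differentiable ℝ f) (b : Idx n) (y : Pt n) :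
    pd b (fun y => f (projPt e y)) y = fderiv ℝ f (projPt e y) (projPt e (Pi.single b 1)) := by
  rw [pd, show (fun y => f (projPt e y)) = f ∘ projPt e from rfl,
    fderiv_comp y (hf _) (projPt e).differentiableAt, (projPt e).fderiv]
  rfl

theorem pd_comp_inclPt {f : Pt n → ℂ} (hf : Differentiable ℝ f) (a : Idx m) (x : Pt m) :
    pd a (fun x => f (inclPt e x)) x = pd (idxMap e a) f (inclPt e x) := by
  rw [pd, show (fun x => f (inclPt e x)) = f ∘ inclPt e from rfl,
    fderiv_comp x (hf _) (inclPt e).differentiableAt, (inclPt e).fderiv, pd, ← inclPt_single]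
  rfl

/-- A vector field of the subspace, extended constantly in the other directions. -/
def liftField : VF m →ₗ[ℂ] VF n where
  toFun X y := Function.extend (idxMap e) (X (projPt e y)) 0
  map_add' X Y := by
    funext y
    exact (Function.ExtendByZero.linearMap ℂ (idxMap e)).map_add _ _
  map_smul' k X := by
    funext y
    exact (Function.ExtendByZero.linearMap ℂ (idxMap e)).map_smul k _

/-- The tangential part of a vector field along the subspace. -/
def restrictField : VF n →ₗ[ℂ] VF m where
  toFun Y x k := Y (inclPt e x) (idxMap e k)
  map_add' _ _ := rfl
  map_smul' _ _ := rfl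

theorem restrictField_apply (Y : VF n) (x : Pt m) (k : Idx m) :
    restrictField e Y x k = Y (inclPt e x) (idxMap e k) := rfl

theorem liftField_idxMap (X : VF m) (y : Pt n) (k : Idx m) :
    liftField e X y (idxMap e k) = X (projPt e y) k :=
  (idxMap_injective e).extend_apply _ _ _

theorem liftField_of_notMem (X : VF m) (y : Pt n) {b : Idx n} (hb : b ∉ Set.range (idxMap e)) :
    liftField e X y b = 0 :=
  Function.extend_apply' _ _ _ hb

theorem restrictField_liftField (X : VF m) : restrictField e (liftField e X) = X := by
  funext x k
  rw [restrictField_apply, liftField_idxMap, projPt_inclPt]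

theorem liftField_injective : Function.Injective (liftField e) :=
  Function.LeftInverse.injective (restrictField_liftField e)

theorem differentiable_component {X : VF n} (hX : ContDiff ℝ ∞ X) (b : Idx n) :
    Differentiable ℝ fun y => X y b := fun x => differentiableAt_component hX b x

/-- Lifted fields have no normal component and coefficients independent of the normal coordinates,
so all sums collapse to the subspace. -/
theorem lieBr_liftField {X Y : VF m} (hX : ContDiff ℝ ∞ X) (hY : ContDiff ℝ ∞ Y) :
    lieBr (liftField e X) (liftField e Y) = liftField e (lieBr X Y) := by
  funext y b
  by_cases hb : b ∈ Set.range (idxMap e)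
  · obtain ⟨k, rfl⟩ := hb
    rw [liftField_idxMap, lieBr, lieBr]
    refine (Fintype.sum_of_injective _ (idxMap_injective e) _ _ (fun a ha => ?_) fun a => ?_).symm
    · rw [liftField_of_notMem e X y ha, liftField_of_notMem e Y y ha, zero_mul, zero_mul, sub_zero]
    · simp only [liftField_idxMap, pd_comp_projPt e (differentiable_component hY k),
        pd_comp_projPt e (differentiable_component hX k), projPt_single]
      rfl
  · rw [liftField_of_notMem e _ y hb, lieBr]
    refine Finset.sum_eq_zero fun a _ => ?_
    have h0 : ∀ Z : VF m, pd a (fun y => liftField e Z y b) y = 0 := by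
      intro Z
      simp only [liftField_of_notMem e Z _ hb]
      simp [pd]
    rw [h0, h0, mul_zero, mul_zero, sub_zero]

/-- A lifted field is tangent to the subspace and constant in the normal directions. Hence normal
components of `Y` do not contribute, and the kernel of the restriction is stable under brackets with
lifted fields. -/
theorem restrictField_lieBr {X : VF m} {Y : VF n} (hX : ContDiff ℝ ∞ X) (hY : ContDiff ℝ ∞ Y) :
    restrictField e (lieBr (liftField e X) Y) = lieBr X (restrictField e Y) := by
  funext x k
  rw [restrictField_apply, lieBr, lieBr]
  refine (Fintype.sum_of_injective _ (idxMap_injective e) _ _ (fun a ha => ?_) fun a => ?_).symm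
  · rw [liftField_of_notMem e X _ ha, zero_mul, zero_sub]
    simp only [liftField_idxMap, pd_comp_projPt e (differentiable_component hX k),
      projPt_single_of_notMem e ha, map_zero, mul_zero, neg_zero]
  · simp only [liftField_idxMap, pd_comp_projPt e (differentiable_component hX k), projPt_single,
      projPt_inclPt, restrictField_apply,
      pd_comp_inclPt e (differentiable_component hY (idxMap e k))]
    rfl

/-- The labels of the subspace. -/
def Gen.map : Gen m → Gen n
  | Gen.plus => Gen.plus
  | Gen.minus => Gen.minus
  | Gen.tr i => Gen.tr (e i)
  | Gen.star i => Gen.star (e i)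
  | Gen.rot i j => Gen.rot (e i) (e j)

theorem extend_single (k : Idx m) (z : ℂ) :
    Function.extend (idxMap e) (Pi.single k z) 0 = Pi.single (idxMap e k) z := by
  funext b
  by_cases hb : b ∈ Set.range (idxMap e)
  · obtain ⟨l, rfl⟩ := hb
    rw [(idxMap_injective e).extend_apply]
    simp [Pi.single_apply, (idxMap_injective e).eq_iff]
  · rw [Function.extend_apply' _ _ _ hb, Pi.single_eq_of_ne fun h => hb ⟨k, h.symm⟩]
    rfl

theorem extend_add (u v : Idx m → ℂ) : Function.extend (idxMap e) (u + v) 0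
    = Function.extend (idxMap e) u 0 + Function.extend (idxMap e) v 0 :=
  (Function.ExtendByZero.linearMap ℂ (idxMap e)).map_add u v

theorem extend_sub (u v : Idx m → ℂ) : Function.extend (idxMap e) (u - v) 0
    = Function.extend (idxMap e) u 0 - Function.extend (idxMap e) v 0 :=
  (Function.ExtendByZero.linearMap ℂ (idxMap e)).map_sub u v

theorem liftField_gen (α : ℝ) (g : Gen m) :
    liftField e (gen (freq m α) g) = gen (freq n α) (g.map e) := by
  funext y
  cases g with
  | plus => exact extend_single e _ _
  | minus => exact extend_single e _ _
  | tr i => exact (extend_add e _ _).trans (congrArg₂ _ (extend_single e _ _) (extend_single e _ _))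
  | star i => exact (extend_add e _ _).trans (congrArg₂ _ (extend_single e _ _) (extend_single e _ _))
  | rot i j =>
    exact (extend_sub e _ _).trans (congrArg₂ _ (extend_single e _ _) (extend_single e _ _))

theorem restrictField_gen_map (α : ℝ) (g : Gen m) :
    restrictField e (gen (freq n α) (g.map e)) = gen (freq m α) g := by
  rw [← liftField_gen, restrictField_liftField]

theorem inclPt_tr_of_notMem (x : Pt m) {j : Fin n} (hj : j ∉ Set.range e) : inclPt e x (it j) = 0 :=
  inclPt_of_notMem e x fun ⟨b, hb⟩ => ne_idxMap e hj b hb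

/-- On the subspace the erased coordinates vanish, so an erased translation becomes normal, and an
erased rotation normal or zero. -/
theorem restrictField_gen_erased (lam : Fin n → ℂ) {g : Gen n} (hg : ¬ g.Within (Set.range e)) :
    restrictField e (gen lam g) = 0 := by
  funext x k
  rw [restrictField_apply]
  cases g with
  | plus => exact absurd trivial hg
  | minus => exact absurd trivial hg
  | tr i => simp [gen, Pi.single_eq_of_ne (ne_idxMap e hg k), inclPt_tr_of_notMem e x hg]
  | star i => simp [gen, Pi.single_eq_of_ne (ne_idxMap e hg k), inclPt_tr_of_notMem e x hg]
  | rot i j =>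
    rcases not_and_or.mp hg with h | h <;>
      simp [gen, Pi.single_eq_of_ne (ne_idxMap e h k), inclPt_tr_of_notMem e x h]

theorem Gen.exists_map {g : Gen n} (hg : g.Within (Set.range e)) : ∃ g' : Gen m, g'.map e = g := by
  cases g with
  | plus => exact ⟨Gen.plus, rfl⟩
  | minus => exact ⟨Gen.minus, rfl⟩
  | tr i => obtain ⟨k, rfl⟩ := hg; exact ⟨Gen.tr k, rfl⟩
  | star i => obtain ⟨k, rfl⟩ := hg; exact ⟨Gen.star k, rfl⟩
  | rot i j => obtain ⟨⟨k, rfl⟩, ⟨l, rfl⟩⟩ := hg; exact ⟨Gen.rot k l, rfl⟩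

theorem Gen.within_map (g : Gen m) : (g.map e).Within (Set.range e) := by
  cases g <;> simp [Gen.map, Gen.Within]

theorem Gen.admits_map {r : Fin n → Fin n → Prop} {r' : Fin m → Fin m → Prop}
    (hr : ∀ i j, r' i j ↔ r (e i) (e j)) (g : Gen m) : (g.map e).Admits r ↔ g.Admits r' := by
  cases g <;> simp [Gen.map, Gen.Admits, hr]

theorem image_gen_map {r : Fin n → Fin n → Prop} {r' : Fin m → Fin m → Prop}
    (hr : ∀ i j, r' i j ↔ r (e i) (e j)) (α : ℝ) :
    gen (freq n α) '' {g | g.Admits r ∧ g.Within (Set.range e)}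
      = liftField e '' (gen (freq m α) '' {g | g.Admits r'}) := by
  ext X
  constructor
  · rintro ⟨g, ⟨hg, hw⟩, rfl⟩
    obtain ⟨g', rfl⟩ := Gen.exists_map e hw
    exact ⟨_, ⟨g', (Gen.admits_map e hr g').mp hg, rfl⟩, liftField_gen e α g'⟩
  · rintro ⟨_, ⟨g', hg, rfl⟩, rfl⟩
    exact ⟨g'.map e, ⟨(Gen.admits_map e hr g').mpr hg, Gen.within_map e g'⟩,
      (liftField_gen e α g').symm⟩

end LiftField

/-! ### Splitting the even part -/

section Split

variable {m n : ℕ} {ι ι' : Type} [Fintype ι] [DecidableEq ι] [Fintype ι'] [DecidableEq ι']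
  {e : Fin m ↪ Fin n} {D : SuperData n ι} {D' : SuperData m ι'} {α : ℝ}

theorem remaining_eq_map (hD : D.lam = freq n α) (hD' : D'.lam = freq m α)
    (hr : ∀ i j, D'.rot i j ↔ D.rot (e i) (e j)) :
    D.remaining (Set.range e) = D'.K0.map (liftField e) := by
  rw [SuperData.remaining, SuperData.K0, hD, hD', image_gen_map e hr, Submodule.map_span]

theorem restrictField_of_mem_erased {Y : VF n} (hY : Y ∈ D.erased (Set.range e)) :
    restrictField e Y = 0 := by
  have : D.erased (Set.range e) ≤ LinearMap.ker (restrictField e) := by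
    refine Submodule.span_le.mpr ?_
    rintro _ ⟨g, hg, rfl⟩
    exact restrictField_gen_erased e _ hg.2
  exact this hY

theorem remaining_sup_erased (s : Set (Fin n)) : D.remaining s ⊔ D.erased s = D.K0 := by
  rw [SuperData.remaining, SuperData.erased, ← Submodule.span_union, ← Set.image_union, SuperData.K0]
  congr 2
  ext g
  simp only [Set.mem_union, Set.mem_ofPred_eq, ← and_or_left, em, and_true]

variable (hR : D.remaining (Set.range e) = D'.K0.map (liftField e))
include hR

theorem liftField_restrictField {X : VF n} (hX : X ∈ D.remaining (Set.range e)) :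
    liftField e (restrictField e X) = X := by
  rw [hR] at hX
  obtain ⟨X', -, rfl⟩ := hX
  rw [restrictField_liftField]

/-- `K0` is the sum of the lifts, on which restriction is injective, and of the erased fields, which
it kills. Membership in the erased span thus becomes a vanishing condition, which serves for
stability as well as for the truncated bracket. -/
theorem mem_erased_iff {Z : VF n} (hZ : Z ∈ D.K0) :
    Z ∈ D.erased (Set.range e) ↔ restrictField e Z = 0 := by
  refine ⟨restrictField_of_mem_erased, fun h0 => ?_⟩
  rw [← remaining_sup_erased (Set.range e)] at hZ
  obtain ⟨X, hX, Y, hY, rfl⟩ := Submodule.mem_sup.mp hZ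
  rw [map_add, restrictField_of_mem_erased hY, add_zero] at h0
  rw [← liftField_restrictField hR hX, h0, map_zero, zero_add]
  exact hY

theorem disjoint_remaining_erased :
    Disjoint (D.remaining (Set.range e)) (D.erased (Set.range e)) := by
  refine Submodule.disjoint_def.mpr fun X hX hX' => ?_
  rw [← liftField_restrictField hR hX, restrictField_of_mem_erased hX', map_zero]

end Split

/-! ### The bracket along a subspace -/

/-- Restriction discards the erased components, so comparing the truncated bracket with the smaller
one amounts to comparing functionals on the bracket operators in the kept directions. -/
theorem restrictField_field {m n : ℕ} (e : Fin m ↪ Fin n) {ι ι' : Type} [Fintype ι] [DecidableEq ι]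
    [Fintype ι'] [DecidableEq ι'] {Γ : Idx n → Matrix ι ι ℂ} {c : Matrix ι ι ℂ} {α : ℝ}
    {p : Fin n → Prop} [DecidablePred p] {φ : Matrix ι ι ℂ →ₗ[ℂ] ℂ}
    {Γ' : Idx m → Matrix ι' ι' ℂ} {c' : Matrix ι' ι' ℂ} {p' : Fin m → Prop} [DecidablePred p']
    {ψ : Matrix ι' ι' ℂ →ₗ[ℂ] ℂ} (hm : φ (Γ im) = ψ (Γ' im)) (hp : φ (Γ ip) = ψ (Γ' ip))
    (ht : ∀ k, φ (Γ (it (e k))) = ψ (Γ' (it k)))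
    (hs : ∀ k, φ (starOp Γ c α p (e k)) = ψ (starOp Γ' c' α p' k))
    (hr : ∀ k l, φ (rotOp Γ c p (e k) (e l)) = ψ (rotOp Γ' c' p' k l)) :
    restrictField e (field Γ c α p φ) = field Γ' c' α p' ψ := by
  have er : ∀ g : Gen n, ¬ g.Within (Set.range e) → restrictField e (gen (freq n α) g) = 0 :=
    fun g hg => restrictField_gen_erased e _ hg
  simp only [field, map_add, map_smul, map_sum]
  congr 1
  · congr 1
    · congr 1
      · congr 1
        · rw [hm]
          exact congrArg _ (restrictField_gen_map e α Gen.plus)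
        · rw [hp]
          exact congrArg _ (restrictField_gen_map e α Gen.minus)
      · refine (Fintype.sum_of_injective e e.injective _ _ (fun i hi => ?_) fun k => ?_).symm
        · rw [er (Gen.tr i) hi, smul_zero]
        · rw [ht]
          exact congrArg _ (restrictField_gen_map e α (Gen.tr k)).symm
    · refine (Fintype.sum_of_injective e e.injective _ _ (fun i hi => ?_) fun k => ?_).symm
      · rw [er (Gen.star i) hi, smul_zero]
      · rw [hs]
        exact congrArg _ (restrictField_gen_map e α (Gen.star k)).symm
  · congr 1
    refine (Fintype.sum_of_injective e e.injective _ _ (fun i hi => ?_) fun k => ?_).symm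
    · refine Finset.sum_eq_zero fun j _ => ?_
      rw [er (Gen.rot i j) fun h => hi h.1, smul_zero]
    · refine Fintype.sum_of_injective e e.injective _ _ (fun j hj => ?_) fun l => ?_
      · rw [er (Gen.rot (e k) j) fun h => hj h.2, smul_zero]
      · rw [hr]
        exact congrArg _ (restrictField_gen_map e α (Gen.rot k l)).symm

/-! ### The intertwiner of the spinor spaces -/

/-- For unit vectors `t` and `e_0` with sum `s`, both `s t` and `e_0 s` equal `-1 + e_0 t` in the
Clifford algebra, so Clifford multiplication by `s` intertwines them. Division by `‖s‖` and a factor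
`i` make it an involution. If `t = -e_0` the sum vanishes, and a vector orthogonal to `e_0` serves
instead. -/
theorem exists_twist {t : EuclideanSpace ℝ (Fin 5)} (ht : ‖t‖ = 1) :
    ∃ g : Matrix I5 I5 ℂ, g * g = 1 ∧ IsAdj C5 g g ∧ g * vec5 t = T5 0 * g := by
  have hT := vec5_sq ht
  have hadd : ∀ s u, vec5 (s + u) = vec5 s + vec5 u := by
    intro s u
    simp [vec5, add_smul, Finset.sum_add_distrib]
  have h0 : vec5 (EuclideanSpace.single 0 1) = T5 0 := by
    simp [vec5]
  set s := t + EuclideanSpace.single 0 1 with hs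
  have hvs : vec5 s = vec5 t + T5 0 := by rw [hs, hadd, h0]
  by_cases h : s = 0
  · have ht0 : vec5 t = -T5 0 := by
      rw [h] at hvs
      refine eq_neg_of_add_eq_zero_left (hvs.symm.trans ?_)
      simp [vec5]
    refine ⟨Complex.I • T5 1, ?_, (adj_T5 1).smul _, ?_⟩
    · rw [smul_mul_smul_comm, T5_sq, Complex.I_mul_I, neg_one_smul, neg_neg]
    · rw [ht0, smul_mul_assoc, mul_smul_comm, mul_neg, T5_anticomm (by decide : (1 : Fin 5) ≠ 0),
        neg_neg]
  · have hn : (‖s‖ : ℂ) ≠ 0 := by exact_mod_cast norm_ne_zero_iff.mpr h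
    refine ⟨(Complex.I / ‖s‖) • vec5 s, ?_, (adj_vec5 s).smul _, ?_⟩
    · rw [smul_mul_smul_comm, vec5_mul_self, smul_smul]
      have : Complex.I / ‖s‖ * (Complex.I / ‖s‖) * -(‖s‖ : ℂ) ^ 2 = 1 := by
        field_simp
        linear_combination -Complex.I_sq
      rw [this, one_smul]
    · rw [smul_mul_assoc, mul_smul_comm, hvs, add_mul, mul_add, hT, T5_sq, add_comm]

theorem one_kronecker_comm (A : Matrix I6 I6 ℂ) (B : Matrix I5 I5 ℂ) :
    Commute (1 ⊗ₖ B : Matrix I32 I32 ℂ) (A ⊗ₖ 1) := by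
  show (1 ⊗ₖ B) * (A ⊗ₖ 1) = (A ⊗ₖ 1) * (1 ⊗ₖ B)
  rw [← Matrix.mul_kronecker_mul, ← Matrix.mul_kronecker_mul, one_mul, mul_one, one_mul, mul_one]

/-- Multiplication by `Γ_1234` exchanges the pairs 12 and 34. On chiral spinors the
eleven-dimensional square root therefore looks like the six-dimensional one, up to a sign on `S_+`.
-/
theorem pair_mul_chiral : Gam6 (it 2) * Gam6 (it 3) * chiral
    = Gam6 (it 0) * Gam6 (it 1) * (sigM Gam6 - sigP Gam6) := by
  have h := isClifford_Gam6
  have e : Gam6 (it 2) * Gam6 (it 3) * (Gam6 (it 0) * Gam6 (it 1) * Gam6 (it 2) * Gam6 (it 3))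
      = -(Gam6 (it 0) * Gam6 (it 1)) := by
    have h1 : Commute (Gam6 (it 2) * Gam6 (it 3)) (Gam6 (it 0) * Gam6 (it 1)) := by
      have := fun k (hk : k = (0 : Fin 4) ∨ k = 1) =>
        h.tr_mul_pair (i := 2) (j := 3) (k := k) (by decide)
      have h2 : Commute (Gam6 (it 0)) (Gam6 (it 2) * Gam6 (it 3)) := by
        show _ = _
        simpa using this 0 (Or.inl rfl)
      have h3 : Commute (Gam6 (it 1)) (Gam6 (it 2) * Gam6 (it 3)) := by
        show _ = _
        simpa using this 1 (Or.inr rfl)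
      exact (h2.mul_left h3).symm
    rw [mul_assoc (Gam6 (it 0) * _), ← mul_assoc, h1.eq, mul_assoc,
      h.quad_sq (by decide : (2 : Fin 4) ≠ 3), mul_neg, mul_one]
  have hc : Commute (Gam6 (it 0) * Gam6 (it 1) * Gam6 (it 2) * Gam6 (it 3))
      (sigP Gam6 - sigM Gam6) := commute_quad_sigP.sub_right commute_quad_sigM
  rw [chiral_eq, ← hc.eq, ← mul_assoc, e, neg_mul, ← mul_neg, neg_sub]

/-- An involution that intertwines the gamma matrices and the square roots, the latter up to
chirality. -/
structure IsTwist (G c c' : Matrix I32 I32 ℂ) : Prop where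
  mul_self : G * G = 1
  adj : IsAdj Cmat G G
  comm : ∀ a, Commute G (Gam6 a)
  comm_chiral : Commute G chiral
  root : c' * G * chiral = G * c * (sigM Gam6 - sigP Gam6)

theorem exists_isTwist (α : ℝ) {t : EuclideanSpace ℝ (Fin 5)} (ht : ‖t‖ = 1) :
    ∃ G, IsTwist G (c6 α t) (c11 α) := by
  obtain ⟨g, g1, g2, g3⟩ := exists_twist ht
  refine ⟨1 ⊗ₖ g, ?_, ?_, fun a => one_kronecker_comm _ _, one_kronecker_comm _ _, ?_⟩
  · rw [← Matrix.mul_kronecker_mul, g1, mul_one, Matrix.one_kronecker_one]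
  · exact (IsAdj.one).kronecker g2
  · have e1 : ∀ (i j : Fin 4) (M : Matrix I5 I5 ℂ),
        (gam6 (it i) * gam6 (it j)) ⊗ₖ M = (1 ⊗ₖ M) * (Gam6 (it i) * Gam6 (it j)) := by
      intro i j M
      rw [Gam6, Gam6, ← Matrix.mul_kronecker_mul, ← Matrix.mul_kronecker_mul, one_mul, mul_one,
        mul_one]
    have e2 : Commute (1 ⊗ₖ g : Matrix I32 I32 ℂ) (Gam6 (it 2) * Gam6 (it 3)) :=
      (one_kronecker_comm _ _).mul_right (one_kronecker_comm _ _)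
    have e3 : (1 ⊗ₖ T5 0 : Matrix I32 I32 ℂ) * (1 ⊗ₖ g) = (1 ⊗ₖ g) * (1 ⊗ₖ vec5 t) := by
      rw [← Matrix.mul_kronecker_mul, ← Matrix.mul_kronecker_mul, g3]
    rw [c11_eq, c6, e1, e1, smul_mul_assoc, smul_mul_assoc, mul_smul_comm, smul_mul_assoc,
      mul_assoc (1 ⊗ₖ T5 0), ← e2.eq, mul_assoc _ _ chiral, mul_assoc _ _ chiral, pair_mul_chiral]
    simp only [← mul_assoc, e3]

/-! ### Compatibility of the intertwiner with action and bracket -/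

theorem Gam11_emb (k : Fin 4) : Gam11 (it (emb k)) = Gam6 (it k) := by
  rw [Gam11_tr, slot_emb]
  rfl

theorem commute_spinAct_eleven_chiral {α : ℝ} (hα : α ≠ 0) (g : Gen 4) :
    Commute (spinAct Gam11 (c11 α) α (g.map emb)) chiral := by
  have hc : Commute (c11 α) chiral := by
    rw [c11_eq]
    exact commute_pair_chiral _ _ _ _
  cases g with
  | plus => exact Commute.zero_left _
  | minus => exact (hc.mul_left commute_sigM_chiral).neg_left
  | tr i =>
    rw [Gen.map, spinAct, (isSquareRoot_c11 hα).tilt_eq, Gam11_emb]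
    exact (hc.mul_left (commute_chiral_mul _ _)).smul_left _
  | star i =>
    rw [Gen.map, spinAct, Gam11_emb]
    exact (commute_chiral_mul _ _).smul_left _
  | rot i j =>
    rw [Gen.map, spinAct, Gam11_emb, Gam11_emb]
    exact ((commute_chiral_mul _ _).sub_left (commute_chiral_mul _ _)).smul_left _

/-- The square roots use complementary pairs of the four directions, so their commutation signs are
opposite. This compensates the opposite sign of the two roots on `S_+`. -/
theorem sgn_emb (k : Fin 4) : sgn (fun i : Fin 9 => (i : ℕ) < 3) (emb k)
    = -sgn (fun i : Fin 4 => ¬ (i : ℕ) < 2) k := by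
  fin_cases k <;> simp [sgn, emb]

theorem rot_emb (k l : Fin 4) : (((emb k : Fin 9) : ℕ) < 3 ↔ ((emb l : Fin 9) : ℕ) < 3)
    ↔ ((k : ℕ) < 2 ↔ (l : ℕ) < 2) := by
  revert k l
  decide

section Twist

variable {α : ℝ} {t : EuclideanSpace ℝ (Fin 5)}
  {G : Matrix I32 I32 ℂ} (hG : IsTwist G (c6 α t) (c11 α))
include hG

/-- In the action `c` is always applied to vectors of `S_-`, where the two square roots agree on
chiral spinors without a sign. -/
theorem IsTwist.root_mul {M : Matrix I32 I32 ℂ} (h1 : Commute G M) (h2 : Commute M chiral)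
    (h3 : sigM Gam6 * M = M) : c11 α * M * G * chiral = G * (c6 α t * M) := by
  have h4 : sigP Gam6 * M = 0 := by
    rw [← h3, ← mul_assoc, isClifford_Gam6.sigP_sigM, zero_mul]
  rw [mul_assoc (c11 α), ← h1.eq, mul_assoc, mul_assoc G, h2.eq, ← mul_assoc, ← mul_assoc, hG.root,
    mul_assoc, sub_mul, h3, h4, sub_zero, mul_assoc]

theorem IsTwist.spinAct_mulVec (hα : α ≠ 0) (ht : ‖t‖ = 1) (g : Gen 4) {v : I32 → ℂ} (hv : chiral *ᵥ v = v) :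
    spinAct Gam11 (c11 α) α (g.map emb) *ᵥ (G *ᵥ v) = G *ᵥ (spinAct Gam6 (c6 α t) α g *ᵥ v) := by
  have h6 := isSquareRoot_c6 hα ht
  have hp : ∀ a b, Commute G (Gam6 a * Gam6 b) := fun a b => (hG.comm a).mul_right (hG.comm b)
  have e : ∀ A B : Matrix I32 I32 ℂ, A * G * chiral = G * B → A *ᵥ (G *ᵥ v) = G *ᵥ (B *ᵥ v) := by
    intro A B hAB
    rw [Matrix.mulVec_mulVec, Matrix.mulVec_mulVec, ← hAB, ← Matrix.mulVec_mulVec _ (A * G), hv]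
  have e' : ∀ A : Matrix I32 I32 ℂ, Commute G A → A *ᵥ (G *ᵥ v) = G *ᵥ (A *ᵥ v) := by
    intro A hA
    rw [Matrix.mulVec_mulVec, Matrix.mulVec_mulVec, hA.eq]
  cases g with
  | plus => exact e' 0 (Commute.zero_right _)
  | minus =>
    refine e _ _ ?_
    show -(c11 α * sigM Gam6) * G * chiral = G * -(c6 α t * sigM Gam6)
    have hS : Commute G (sigM Gam6) := (hp _ _).smul_right _
    rw [neg_mul, neg_mul, hG.root_mul hS commute_sigM_chiral
      isClifford_Gam6.sigM_sigM, mul_neg]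
  | tr i =>
    refine e _ _ ?_
    rw [Gen.map, spinAct, spinAct, (isSquareRoot_c11 hα).tilt_eq, h6.tilt_eq, Gam11_emb, smul_mul_assoc,
      smul_mul_assoc, mul_smul_comm]
    exact congrArg _ (hG.root_mul (hp _ _) (commute_chiral_mul _ _) (h6.sigM_plus_tr i))
  | star i =>
    rw [Gen.map, spinAct, spinAct, Gam11_emb]
    exact e' _ ((hp _ _).smul_right _)
  | rot i j =>
    rw [Gen.map, spinAct, spinAct, Gam11_emb, Gam11_emb]
    exact e' _ (((hp _ _).sub_right (hp _ _)).smul_right _)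

theorem IsTwist.pairing_eq {A B : Matrix I32 I32 ℂ} (hAB : A * G * chiral = G * B) (v : I32 → ℂ)
    {w : I32 → ℂ} (hw : chiral *ᵥ w = w) :
    pairing Cmat (G *ᵥ v) (G *ᵥ w) A = pairing Cmat v w B := by
  rw [hG.adj.pairing_mulVec_left, pairing_mulVec_right]
  conv_lhs => rw [← hw, pairing_mulVec_right]
  rw [mul_assoc, mul_assoc, ← mul_assoc A, hAB, ← mul_assoc, hG.mul_self, one_mul]

/-- Operators without `c` commute with the intertwiner, which preserves the form. In `starOp` and
`rotOp` the chirality operator, taken from the spinor `w`, converts one square root into the other,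
and the signs picked up on the way are those of `sgn_emb`. -/
theorem IsTwist.restrictField_field (v : I32 → ℂ) {w : I32 → ℂ} (hw : chiral *ᵥ w = w) :
    restrictField emb (field Gam11 (c11 α) α (fun i : Fin 9 => (i : ℕ) < 3)
      (pairing Cmat (G *ᵥ v) (G *ᵥ w)))
      = field Gam6 (c6 α t) α (fun i : Fin 4 => ¬ (i : ℕ) < 2) (pairing Cmat v w) := by
  have h := isClifford_Gam6
  have hA : ∀ A, Commute G A → pairing Cmat (G *ᵥ v) (G *ᵥ w) A = pairing Cmat v w A := by
    intro A hA
    rw [hG.adj.pairing_mulVec_left, pairing_mulVec_right, hA.eq, mul_assoc, hG.mul_self,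
      mul_one]
  refine CW.restrictField_field emb (hA _ (hG.comm im)) (hA _ (hG.comm ip)) (fun k => ?_) (fun k => ?_)
    fun k l => ?_
  · rw [Gam11_emb]
    exact hA _ (hG.comm _)
  · refine hG.pairing_eq ?_ v hw
    have hσ : ∀ x : ℂ, Commute G (sigP Gam6 - x • sigM Gam6) := fun x =>
      (((hG.comm _).mul_right (hG.comm _)).smul_right _).sub_right
        ((((hG.comm _).mul_right (hG.comm _)).smul_right _).smul_right _)
    have hχ : ∀ x : ℂ, Commute (sigP Gam6 - x • sigM Gam6) chiral := fun x =>
      ((commute_chiral_mul _ _).smul_left _).sub_left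
        (((commute_chiral_mul _ _).smul_left _).smul_left _)
    rw [starOp, starOp, sgn_emb, Gam11_emb, smul_mul_assoc, smul_mul_assoc, mul_smul_comm]
    congr 1
    show c11 α * Gam6 (it k) * (sigP Gam6 - -sgn _ k • sigM Gam6) * G * chiral = _
    set x := sgn (fun i : Fin 4 => ¬ (i : ℕ) < 2) k
    calc c11 α * Gam6 (it k) * (sigP Gam6 - -x • sigM Gam6) * G * chiral
        = c11 α * (Gam6 (it k) * (G * (chiral * (sigP Gam6 - -x • sigM Gam6)))) := by
          rw [← (hχ _).eq, ← mul_assoc G, (hσ _).eq]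
          simp only [mul_assoc]
      _ = -(c11 α * G * chiral * (Gam6 (it k) * (sigP Gam6 - -x • sigM Gam6))) := by
          rw [← mul_assoc (Gam6 (it k)), ← (hG.comm _).eq, mul_assoc G, ← mul_assoc (Gam6 (it k)),
            anticomm_chiral]
          simp only [mul_assoc, neg_mul, mul_neg]
      _ = G * (c6 α t * Gam6 (it k) * (sigP Gam6 - x • sigM Gam6)) := by
          rw [hG.root]
          -- The difference of projections reverses the relative sign between `σ_+` and `σ_-`, as
          -- the opposite sign of the direction in the two dimensions requires.
          have : (sigM Gam6 - sigP Gam6) * (Gam6 (it k) * (sigP Gam6 - -x • sigM Gam6))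
              = -(Gam6 (it k) * (sigP Gam6 - x • sigM Gam6)) := by
            rw [← mul_assoc, sub_mul, ← (h.commute_tr_sigM k).eq, ← (h.commute_tr_sigP k).eq, ← mul_sub,
              mul_assoc, ← mul_neg]
            congr 1
            simp only [sub_mul, mul_sub, mul_smul_comm, h.sigM_sigP, h.sigM_sigM, h.sigP_sigP,
              h.sigP_sigM]
            module
          rw [mul_assoc (G * _), this]
          simp only [mul_assoc, mul_neg, neg_neg]
  · rw [rotOp, rotOp]
    by_cases hkl : (k : ℕ) < 2 ↔ (l : ℕ) < 2
    · rw [if_pos ((rot_emb k l).mpr hkl), if_pos (not_congr hkl)]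
      refine hG.pairing_eq ?_ v hw
      rw [sgn_emb, Gam11_emb, Gam11_emb, smul_mul_assoc, smul_mul_assoc, mul_smul_comm, neg_neg,
        neg_smul, ← smul_neg]
      congr 1
      show c11 α * (Gam6 (it k) * Gam6 (it l)) * Gam6 ip * G * chiral = _
      calc c11 α * (Gam6 (it k) * Gam6 (it l)) * Gam6 ip * G * chiral
          = c11 α * (Gam6 (it k) * Gam6 (it l) * (G * (Gam6 ip * chiral))) := by
            rw [← mul_assoc G, (hG.comm _).eq]
            simp only [mul_assoc]
        _ = -(c11 α * G * (Gam6 (it k) * Gam6 (it l) * chiral * Gam6 ip)) := by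
            rw [← mul_assoc _ G, ← ((hG.comm (it k)).mul_right (hG.comm (it l))).eq, anticomm_chiral]
            simp only [mul_assoc, mul_neg]
        _ = -(c11 α * G * chiral * (Gam6 (it k) * Gam6 (it l) * Gam6 ip)) := by
            rw [(commute_chiral_mul _ _).eq]
            simp only [mul_assoc]
        _ = -(G * (c6 α t * (Gam6 (it k) * Gam6 (it l)) * Gam6 ip)) := by
            have : (sigM Gam6 - sigP Gam6) * (Gam6 (it k) * Gam6 (it l) * Gam6 ip)
                = Gam6 (it k) * Gam6 (it l) * Gam6 ip := by
              have hc : Commute (sigM Gam6 - sigP Gam6) (Gam6 (it k) * Gam6 (it l)) :=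
                (((h.commute_tr_sigM k).mul_left (h.commute_tr_sigM l)).symm).sub_left
                  (((h.commute_tr_sigP k).mul_left (h.commute_tr_sigP l)).symm)
              rw [← mul_assoc, hc.eq, mul_assoc, sub_mul, h.sigM_plus, h.sigP_plus, sub_zero]
            rw [hG.root, mul_assoc (G * _), this]
            simp only [mul_assoc]
    · rw [if_neg fun h => hkl ((rot_emb k l).mp h), if_neg fun h => hkl (not_iff_not.mp h),
        map_zero, map_zero]

end Twist

/-! ### The reduction -/

theorem mem_six {α : ℝ} {t : EuclideanSpace ℝ (Fin 5)} {ξ : SF 4 I32} : ξ ∈ (six α t).K1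
    ↔ ξ ∈ parallel (fun _ => -α ^ 2) Gam6 (c6 α t) 0 ∧ chiral *ᵥ ξ 0 = ξ 0 :=
  mem_restricted_iff

theorem mem_restr11 {α : ℝ} {ξ : SF 9 I32} : ξ ∈ restr11 α
    ↔ ξ ∈ parallel (fun _ => -α ^ 2) Gam11 (c11 α) 0 ∧ chiral *ᵥ ξ 0 = ξ 0 := by
  rw [← parallel_eleven]
  exact mem_restricted_iff

theorem remaining_eleven (α : ℝ) (t : EuclideanSpace ℝ (Fin 5)) :
    (eleven α 0).remaining (Set.range emb) = (six α t).K0.map (liftField emb) :=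
  remaining_eq_map (lam11_zero α) rfl fun k l => (rot_emb k l).symm

section Equivalence

variable {α : ℝ} (hα : α ≠ 0) {t : EuclideanSpace ℝ (Fin 5)} (ht : ‖t‖ = 1) {G : Matrix I32 I32 ℂ}

/-- The even part of six dimensions and what remains of the even part of eleven dimensions. -/
def evenEquiv (α : ℝ) (t : EuclideanSpace ℝ (Fin 5)) :
    (six α t).K0 ≃ₗ[ℂ] (eleven α 0).remaining (Set.range emb) :=
  ((six α t).K0.equivMapOfInjective (liftField emb) (liftField_injective emb)).trans
    (LinearEquiv.ofEq _ _ (remaining_eleven α t).symm)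

theorem coe_evenEquiv (X : (six α t).K0) :
    (evenEquiv α t X : VF 9) = liftField emb (X : VF 4) := rfl

theorem IsTwist.chiral_mulVec (hG : IsTwist G (c6 α t) (c11 α)) {v : I32 → ℂ}
    (hv : chiral *ᵥ v = v) : chiral *ᵥ (G *ᵥ v) = G *ᵥ v := by
  rw [Matrix.mulVec_mulVec, ← hG.comm_chiral.eq, ← Matrix.mulVec_mulVec, hv]

theorem IsTwist.mulVec_mulVec (hG : IsTwist G (c6 α t) (c11 α)) (v : I32 → ℂ) :
    G *ᵥ (G *ᵥ v) = v := by
  rw [Matrix.mulVec_mulVec, hG.mul_self, Matrix.one_mulVec]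

/-- The odd part of six dimensions and the restricted odd part of eleven dimensions. -/
def oddEquiv (hG : IsTwist G (c6 α t) (c11 α)) : (six α t).K1 ≃ₗ[ℂ] restr11 α where
  toFun ξ := ⟨par Gam11 (c11 α) α (G *ᵥ (ξ : SF 4 I32) 0), mem_restr11.mpr
    ⟨(isSquareRoot_c11 hα).par_mem _, by
      rw [(isSquareRoot_c11 hα).par_zero]
      exact hG.chiral_mulVec (mem_six.mp ξ.2).2⟩⟩
  map_add' ξ η := Subtype.ext (by
    show par Gam11 (c11 α) α (G *ᵥ ((ξ : SF 4 I32) 0 + (η : SF 4 I32) 0)) = _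
    rw [Matrix.mulVec_add, HasSymbol.par_add]
    rfl)
  map_smul' k ξ := Subtype.ext (by
    show par Gam11 (c11 α) α (G *ᵥ (k • (ξ : SF 4 I32) 0)) = _
    rw [Matrix.mulVec_smul, HasSymbol.par_smul]
    rfl)
  invFun ζ := ⟨par Gam6 (c6 α t) α (G *ᵥ (ζ : SF 9 I32) 0), mem_six.mpr
    ⟨(isSquareRoot_c6 hα ht).par_mem _, by
      rw [(isSquareRoot_c6 hα ht).par_zero]
      exact hG.chiral_mulVec (mem_restr11.mp ζ.2).2⟩⟩
  left_inv ξ := Subtype.ext (by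
    show par Gam6 (c6 α t) α (G *ᵥ par Gam11 (c11 α) α (G *ᵥ (ξ : SF 4 I32) 0) 0) = _
    rw [(isSquareRoot_c11 hα).par_zero, hG.mulVec_mulVec]
    exact ((isSquareRoot_c6 hα ht).eq_par (mem_six.mp ξ.2).1).symm)
  right_inv ζ := Subtype.ext (by
    show par Gam11 (c11 α) α (G *ᵥ par Gam6 (c6 α t) α (G *ᵥ (ζ : SF 9 I32) 0) 0) = _
    rw [(isSquareRoot_c6 hα ht).par_zero, hG.mulVec_mulVec]
    exact ((isSquareRoot_c11 hα).eq_par (mem_restr11.mp ζ.2).1).symm)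

theorem coe_oddEquiv (hG : IsTwist G (c6 α t) (c11 α)) (ξ : (six α t).K1) :
    (oddEquiv hα ht hG ξ : SF 9 I32) = par Gam11 (c11 α) α (G *ᵥ (ξ : SF 4 I32) 0) := rfl

include hα ht

/-- A field of six dimensions and its lift act compatibly on chiral spinors. -/
theorem IsTwist.exists_hasSymbol (hG : IsTwist G (c6 α t) (c11 α)) {X : VF 4}
    (hX : X ∈ (six α t).K0) : ∃ M M', HasSymbol Gam6 (c6 α t) α X M
      ∧ HasSymbol Gam11 (c11 α) α (liftField emb X) M'
      ∧ ∀ v, chiral *ᵥ v = v → M' *ᵥ (G *ᵥ v) = G *ᵥ (M *ᵥ v) := by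
  have h6 := isHyperbolic_six hα ht
  have h11 := isHyperbolic_eleven hα
  rw [SuperData.K0] at hX
  induction hX using Submodule.span_induction with
  | mem X hX =>
    obtain ⟨g, hg, rfl⟩ := hX
    have hg6 : g.Admits fun i j : Fin 4 => (¬ (i : ℕ) < 2 ↔ ¬ (j : ℕ) < 2) := by
      have := hg
      rwa [Set.mem_ofPred_eq, h6.rot_eq] at this
    refine ⟨_, _, h6.root.hasSymbol_gen h6.commute_rot hg6, ?_,
      fun v hv => hG.spinAct_mulVec hα ht g hv⟩
    have := h11.root.hasSymbol_gen h11.commute_rot (g := g.map emb)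
      ((Gen.admits_map emb (fun k l => (rot_emb k l).symm) g).mpr hg)
    rwa [← liftField_gen] at this
  | zero =>
    refine ⟨0, 0, HasSymbol.zero, ?_, fun v _ => ?_⟩
    · rw [map_zero]
      exact HasSymbol.zero
    · rw [Matrix.zero_mulVec, Matrix.zero_mulVec, Matrix.mulVec_zero]
  | add X Y _ _ hX hY =>
    obtain ⟨M, M', h1, h2, h3⟩ := hX
    obtain ⟨N, N', k1, k2, k3⟩ := hY
    refine ⟨M + N, M' + N', h1.add k1, ?_, fun v hv => ?_⟩
    · rw [map_add]
      exact h2.add k2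
    · rw [Matrix.add_mulVec, Matrix.add_mulVec, Matrix.mulVec_add, h3 v hv, k3 v hv]
  | smul k X _ hX =>
    obtain ⟨M, M', h1, h2, h3⟩ := hX
    refine ⟨k • M, k • M', h1.smul k, ?_, fun v hv => ?_⟩
    · rw [map_smul]
      exact h2.smul k
    · rw [Matrix.smul_mulVec, Matrix.smul_mulVec, Matrix.mulVec_smul, h3 v hv]

/-- The even isomorphism is the lift of vector fields, and the odd one is the intertwiner applied to
values at the origin. Erased fields are recognized by their vanishing restriction. -/
theorem isReduction : (six α t).IsReduction (eleven α 0) emb (restr11 α) := by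
  have h6 := isHyperbolic_six hα ht
  have h11 := isHyperbolic_eleven hα
  have hR := remaining_eleven α t
  have hle : (eleven α 0).remaining (Set.range emb) ≤ (eleven α 0).K0 :=
    le_sup_left.trans (remaining_sup_erased _).le
  have hle' : (eleven α 0).erased (Set.range emb) ≤ (eleven α 0).K0 :=
    le_sup_right.trans (remaining_sup_erased _).le
  obtain ⟨G, hG⟩ := exists_isTwist α ht
  refine ⟨h6.isGeometric, h11.isGeometric, by norm_num, rfl, fun i => ?_, ?_, ?_,
    disjoint_remaining_erased hR, ?_, ?_, evenEquiv α t, oddEquiv hα ht hG, ?_, ?_, ?_⟩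
  · rw [h6.B_eq, h11.B_eq]
  · rw [hR]
    rintro _ ⟨X, hX, rfl⟩ _ ⟨Y, hY, rfl⟩
    rw [lieBr_liftField emb (h6.contDiff_of_mem_K0 hX) (h6.contDiff_of_mem_K0 hY)]
    exact ⟨_, h6.isGeometric.lie_mem X hX Y hY, rfl⟩
  · intro X hX Y hY
    refine (mem_erased_iff hR (h11.isGeometric.lie_mem X (hle hX) Y (hle' hY))).mpr ?_
    rw [hR] at hX
    obtain ⟨X, hX, rfl⟩ := hX
    rw [restrictField_lieBr emb (h6.contDiff_of_mem_K0 hX) (h11.contDiff_of_mem_K0 (hle' hY)),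
      restrictField_of_mem_erased hY, lieBr_zero_right]
  · intro ξ hξ
    exact (parallel_eleven α).ge (mem_restr11.mp hξ).1
  · intro X hX ξ hξ
    refine h11.L_mem_of_span (K := restr11 α) ?_ (fun ξ hξ => (parallel_eleven α).ge
      (mem_restr11.mp hξ).1) (fun g hg => hg.1) hX hξ
    rintro g ⟨-, hg⟩ ξ hξ
    -- A remaining generator comes from a six-dimensional one, so it acts by an operator that
    -- commutes with chirality.
    obtain ⟨g, rfl⟩ := Gen.exists_map emb hg
    refine mem_restr11.mpr ⟨h11.root.par_mem _, ?_⟩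
    rw [h11.root.par_zero, Matrix.mulVec_mulVec]
    refine (congrArg (· *ᵥ ξ 0) (commute_spinAct_eleven_chiral hα g).eq.symm).trans ?_
    rw [← Matrix.mulVec_mulVec, (mem_restr11.mp hξ).2]
    rfl
  · intro X Y Z hZ
    rw [coe_evenEquiv, coe_evenEquiv, coe_evenEquiv, hZ,
      lieBr_liftField emb (h6.contDiff_of_mem_K0 X.2) (h6.contDiff_of_mem_K0 Y.2)]
  · intro X ξ ζ hζ
    obtain ⟨M, M', h1, h2, h3⟩ := hG.exists_hasSymbol hα ht X.2
    obtain ⟨hξ, hχ⟩ := mem_six.mp ξ.2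
    have e1 : (ζ : SF 4 I32) = par Gam6 (c6 α t) α (M *ᵥ (ξ : SF 4 I32) 0) := by
      rw [hζ, ← h1.2, ← (isSquareRoot_c6 hα ht).eq_par hξ]
      rfl
    rw [coe_oddEquiv, coe_oddEquiv, coe_evenEquiv, e1, SuperData.L, h11.B_eq, (isSquareRoot_c6 hα ht).par_zero,
      ← h3 _ hχ]
    exact (h2.2 _).symm
  · intro ξ η Z hZ
    have m1 := (parallel_eleven α).ge (mem_restr11.mp (oddEquiv hα ht hG ξ).2).1
    have m2 := (parallel_eleven α).ge (mem_restr11.mp (oddEquiv hα ht hG η).2).1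
    -- The difference lies in `K0`, so it is erased as soon as its restriction vanishes; the
    -- restriction of the lifted six-dimensional bracket is that bracket itself.
    refine (mem_erased_iff hR ((eleven α 0).K0.sub_mem (h11.isGeometric.br_mem _ m1 _ m2)
      (hle (evenEquiv α t Z).2))).mpr ?_
    rw [map_sub, coe_evenEquiv, restrictField_liftField, h11.br_eq _ m1 _ m2, coe_oddEquiv, coe_oddEquiv,
      (isSquareRoot_c11 hα).par_zero, (isSquareRoot_c11 hα).par_zero]
    refine sub_eq_zero.mpr ((hG.restrictField_field _ (mem_six.mp η.2).2).trans ?_)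
    rw [hZ, h6.br_eq _ ξ.2 _ η.2]
    rfl

end Equivalence

end CW

end

theorem proposition5 (α : ℝ) (hα : α ≠ 0) (t : EuclideanSpace ℝ (Fin 5)) (ht : ‖t‖ = 1) :
    -- the connection in dimension six is flat
    CW.IsFlat (CW.six α t).B (CW.six α t).Γ (CW.six α t).c (CW.six α t).d ∧
    -- the six-dimensional data are a restricted 4-extended supersymmetry algebra with `ν = 1/2`
    (CW.six α t).N = 4 ∧ (CW.six α t).IsSupersymmetry ∧
    ¬ (CW.six α t).NonRestricted ∧ (CW.six α t).nu = 1 / 2 ∧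
    -- the eleven-dimensional data are a non-restricted geometric superalgebra with `N = 1`
    (CW.eleven α 0).N = 1 ∧ (CW.eleven α 0).IsGeometric ∧
    (CW.eleven α 0).NonRestricted ∧ (CW.eleven α 0).nu = 1 ∧
    -- which is not a supersymmetry algebra
    ¬ (CW.eleven α 0).IsSupersymmetry ∧
    -- and of which the former are a reduction
    (CW.six α t).IsReduction (CW.eleven α 0) CW.emb (CW.restr11 α) := by
  have h6 := CW.isHyperbolic_six hα ht
  exact ⟨h6.root.isFlat, rfl, CW.isSupersymmetry_six hα ht, CW.not_nonRestricted_six hα ht,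
    CW.nu_six hα ht, rfl, (CW.isHyperbolic_eleven hα).isGeometric, CW.nonRestricted_eleven α,
    CW.nu_eleven hα, CW.not_isSupersymmetry_eleven hα, CW.isReduction hα ht⟩
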